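/- **Setting.** Let $\mathbb L_\bullet=\mathbb Z^2$ with nearest-neighbour edges $\mathbb E^\bullet$, and let $\mathbb L_\circ=(\frac12,\frac12)+\mathbb Z^2$ be the dual lattice. Each edge $e$ crosses a unique dual edge $e^*$; the convex hull $t$ of the endpoints of $e$ and $e^*$ is a tile, and $e_t:=e$. Write $\mathbb L_\diamond$ for the set of tiles and $\mathbb H^+=\{y\ge 0\}$, $\mathbb H^-=\{y<0\}$. Fix $q>4$ and let $\lambda>0$ be given by $\sqrt q=e^\lambda+e^{-\lambda}$; put $p_c=\frac{\sqrt q}{1+\sqrt q}$, $\mathbf c=e^{\lambda/2}+e^{-\lambda/2}$, $\mathbf c_{\mathrm b}=e^{\lambda/2}$. For integers $n,m\ge 0$ let $\mathsf B=\{-n,\dots,n\}\times\{-m,\dots,m\}$, $\mathsf B'=\{-n-\frac12,\dots,n+\frac12\}\times\{-m-\frac12,\dots,m+\frac12\}$, $\mathsf D=\mathsf B\cup\mathsf B'$. Let $\mathsf V$ be the union of $\mathsf B$ and its exterior boundary $\partial^{\mathrm{ex}}\mathsf B$, $\mathsf E$ the set of edges with at least one endpoint in $\mathsf B$, $\mathsf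 G=(\mathsf V,\mathsf E)$, and $\partial^\pm=\partial^{\mathrm{ex}}\mathsf B\cap\mathbb H^\pm$. Let $\mathsf A$ be the set of tiles with at least one corner in $\mathsf D$, $\partial\mathsf A$ the set of tiles with exactly one corner in $\mathsf D$, $\mathsf A^{\mathrm i}=\mathsf A\setminus\partial\mathsf A$, $\mathsf E_{\mathrm b}=\{e_t:t\in\partial\mathsf A\}$, $\bar{\mathsf E}=\mathsf E\cup\mathsf E_{\mathrm b}$, $\bar{\mathsf V}$ the set of endpoints of edges in $\bar{\mathsf E}$, and $\mathsf K=(\bar{\mathsf V},\bar{\mathsf E})$. Let $\mathsf K^1$ be obtained from $\mathsf K$ by identifying all vertices of the interior boundary of $\bar{\mathsf V}$ in $\mathbb H^+$ with each other, and all those in $\mathbb H^-$ with each other. Let $v_L=(-n-1,0)$, $v_R=(n+1,0)$, $v'_L=(-n-\frac32,-\frac12)$, $v'_R=(n+\frac32,-\frac12)$. *FK measure.* Let $\xi(e)=1$ if $e\subset\mathbb H^+$ or $e\subset\mathbb H^-$, and $\xi(e)=0$ otherwise. $\mathtt{FK}$ is the probability measure on $\{0,1\}^{\mathbb E^\bullet}$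 with $\mathtt{FK}(\omega)\propto p_c^{|\omega\cap\mathsf E|}(1-p_c)^{|\mathsf E\setminus\omega|}q^{\kappa_{\mathsf V}(\omega)}\mathbf 1\{\omega=\xi\text{ off }\mathsf E\}$, where $\kappa_{\mathsf V}(\omega)$ is the number of clusters of $\omega$ that intersect $\mathsf V$. *Loops.* The loop configuration of $\omega$ consists, in each tile $t$, of the two arcs joining mid-points of sides of $t$ that do not cross $e_t$ if $\omega(e_t)=1$, and of the two that do not cross $e_t^*$ if $\omega(e_t)=0$. These arcs form loops and bi-infinite paths. Let $\mathcal L$ be the set of all loops that occur in the loop configuration of some $\omega$. *Spins.* Let $(\omega,U,U')$ be distributed according to $\mathtt{FK}(\,\cdot\,|\,\partial^+\nleftrightarrow\partial^-)\otimes Q\otimes Q'$, where $Q,Q'$ are the laws of i.i.d. uniform $[0,1]$ variables indexed by $\mathcal L$ and by $\mathbb L_\diamond$, respectively. Orient every loop of $\omega$ that surrounds a vertex of $\mathbb L_\circ\setminus\mathsf B'$ clockwise; orient the bi-infinite paths from right to left; and orient every loop $l$ of $\omega$ that surrounds a vertex of $\mathsf B\cup\mathsf B'$ clockwise if $U_l<e^\lambda/\sqrt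 q$ and counter-clockwise otherwise. This orients all sides of tiles (each side is traversed by the arcs). Let $(\sigma_\bullet,\sigma_\circ)\in\{\pm1\}^{\mathbb L_\bullet}\times\{\pm1\}^{\mathbb L_\circ}$ be the spin configuration with $\sigma_\bullet((n+1,0))=+1$ such that, for each oriented side, separating $i\in\mathbb L_\bullet$ from $u\in\mathbb L_\circ$, $\sigma_\bullet(i)=\sigma_\circ(u)$ if $i$ is to its left and $\sigma_\bullet(i)=-\sigma_\circ(u)$ if $i$ is to its right. *Local sampling rule.* For each $t\in\mathsf A$ with $e_t=ij$, $e_t^*=uv$, define $(\omega_\tau(e_t),\omega_{\tau\tau'}(e_t))$ as follows. If $\sigma_\circ(u)\ne\sigma_\circ(v)$, it is $(1,1)$. If $\sigma_\bullet(i)\neq\sigma_\bullet(j)$, it is $(0,0)$. If $\sigma_\circ(u)=\sigma_\circ(v)$ and $\sigma_\bullet(i)=\sigma_\bullet(j)$: for $t\in\mathsf A^{\mathrm i}$ it is $(1,1)$, $(0,0)$ or $(0,1)$ according to whether $U'_t\in[0,\frac1{\mathbf c})$, $[\frac1{\mathbf c},\frac2{\mathbf c})$ or $[\frac2{\mathbf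 c},1]$; for $t\in\partial\mathsf A$ it is $(1,1)$ or $(0,0)$ according to whether $U'_t\in[0,\frac1{\mathbf c_{\mathrm b}})$ or $[\frac1{\mathbf c_{\mathrm b}},1]$. *Modified ATRC measure.* $\mathtt{mATRC}_{\mathsf K}$ is the probability measure on $\{0,1\}^{\bar{\mathsf E}}\times\{0,1\}^{\bar{\mathsf E}}$ with $$\mathtt{mATRC}_{\mathsf K}(\omega_\tau,\omega_{\tau\tau'})\propto\mathbf 1_{\omega_\tau\subseteq\omega_{\tau\tau'}}\mathbf 1_{\omega_{\tau\tau'}\setminus\omega_\tau\subseteq\mathsf E}\,2^{|\omega_\tau\cap\mathsf E|}\Big(\frac{2}{\mathbf c_{\mathrm b}-1}\Big)^{|\omega_\tau\cap\mathsf E_{\mathrm b}|}(\mathbf c-2)^{|\omega_{\tau\tau'}\setminus\omega_\tau|}\,2^{\kappa_{\mathsf K}(\omega_\tau)+\kappa_{\mathsf K^1}(\omega_{\tau\tau'})},$$ where $\kappa_{\mathsf K}$, $\kappa_{\mathsf K^1}$ count the clusters in the spanning subgraphs of $\mathsf K$, $\mathsf K^1$. For $\omega\in\{0,1\}^{\bar{\mathsf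 E}}$, $\omega^*$ denotes the dual configuration, $\omega^*(e^*)=1-\omega(e)$ for $e\in\bar{\mathsf E}$. **Lemma.** Almost surely, $(\sigma_\bullet,\sigma_\circ)$ is well defined (it exists and is unique), and the law of $(\omega_\tau,\omega_{\tau\tau'})$ is $$\mathtt{mATRC}_{\mathsf K}\big(\,\cdot\,\big|\,v_L\xleftrightarrow{\omega_\tau}v_R,\ v'_L\xleftrightarrow{\omega^*_{\tau\tau'}}v'_R\big).$$ In particular, almost surely, $\omega_\tau\subseteq\omega_{\tau\tau'}$ and $\omega_{\tau\tau'}\setminus\omega_\tau\subseteq\{e_t:t\in\mathsf A^{\mathrm i}\}=\mathsf E$; moreover $\sigma_\bullet$ is constant along each edge of $\omega_{\tau\tau'}$, and $\sigma_\circ$ is constant along each edge of $\omega_\tau^*$. -/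

import Mathlib

/-!
The square lattice `ℤ²`, its dual, the FK-percolation / loop / six-vertex-spin coupling under double
Dobrushin conditions on a rectangle, and the modified Ashkin--Teller random-cluster measure.

All points of the plane are given in DOUBLED coordinates, i.e. the pair `(a, b) : ℤ × ℤ` stands
for the point `(a/2, b/2)`.
-/

open MeasureTheory ProbabilityTheory
open scoped ENNReal

noncomputable section

namespace BKW

/-- The points of `(1/2)ℤ²`, in doubled coordinates. -/
abbrev Pt : Type := ℤ × ℤ

/-- The primal lattice `𝕃_• = ℤ²`. -/
abbrev Primal : Type := {p : Pt // Even p.1 ∧ Even p.2}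

/-- The dual lattice `𝕃_∘ = (1/2,1/2) + ℤ²`. -/
abbrev Dual : Type := {p : Pt // Odd p.1 ∧ Odd p.2}

/-- The tiles `𝕃_⋄`, identified with their centres, which are the mid-points of the primal edges.
A primal edge `e`, its dual edge `e*` and the tile `t` with `e_t = e` are identified. -/
abbrev Tile : Type := {p : Pt // Odd (p.1 + p.2)}

/-- The four corners of a tile: two primal ones (the endpoints of `e_t`) and two dual ones (the
endpoints of `e_t*`). -/
def IsCorner (t : Tile) (z : Pt) : Prop := |z.1 - t.1.1| + |z.2 - t.1.2| = 1

/-- The set of endpoints of the primal edge `e_t`. -/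
def edgeEnds (t : Tile) : Set Primal := {i | IsCorner t i.1}

/-- The set of endpoints of the dual edge `e_t*`. -/
def dualEnds (t : Tile) : Set Dual := {u | IsCorner t u.1}

/-- A percolation configuration `ω ∈ {0,1}^{𝔼^•}`. -/
abbrev Config : Type := Tile → Bool

/-- The graph with vertex set `𝕃_•` and edge set `{e_t : t ∈ F}`. -/
def primalGraph (F : Set Tile) : SimpleGraph Primal :=
  SimpleGraph.fromRel fun i j => ∃ t ∈ F, i ∈ edgeEnds t ∧ j ∈ edgeEnds t

/-- The graph with vertex set `𝕃_∘` and edge set `{e_t* : t ∈ F}`. -/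
def dualGraph (F : Set Tile) : SimpleGraph Dual :=
  SimpleGraph.fromRel fun u v => ∃ t ∈ F, u ∈ dualEnds t ∧ v ∈ dualEnds t

/-- The open edges of a percolation configuration. -/
def openEdges (ω : Config) : Set Tile := {t | ω t = true}

/-! ### Rectangular domains -/

/-- The closed upper half plane `ℍ⁺`; its complement is `ℍ⁻`. -/
def Upper (p : Pt) : Prop := 0 ≤ p.2

/-- `B_{n,m} = {-n,…,n} × {-m,…,m}`. -/
def B (n m : ℕ) : Set Primal := {i | |i.1.1| ≤ 2 * n ∧ |i.1.2| ≤ 2 * m}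

/-- `B'_{n,m} = {-n-1/2,…,n+1/2} × {-m-1/2,…,m+1/2}`. -/
def B' (n m : ℕ) : Set Dual := {u | |u.1.1| ≤ 2 * n + 1 ∧ |u.1.2| ≤ 2 * m + 1}

/-- `D_{n,m} = B_{n,m} ∪ B'_{n,m}`, as a set of points. -/
def D (n m : ℕ) : Set Pt := (Subtype.val '' B n m) ∪ (Subtype.val '' B' n m)

/-- The exterior boundary of `Λ ⊂ ℤ²`. -/
def exBoundary (Λ : Set Primal) : Set Primal :=
  {j | j ∉ Λ ∧ ∃ i ∈ Λ, (primalGraph Set.univ).Adj i j}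

/-- The interior boundary of `Λ ⊂ ℤ²`. -/
def inBoundary (Λ : Set Primal) : Set Primal :=
  {i | i ∈ Λ ∧ ∃ j, j ∉ Λ ∧ (primalGraph Set.univ).Adj i j}

/-- The vertex set `V_{n,m} = B_{n,m} ∪ ∂^ex B_{n,m}` of `G_{n,m}`. -/
def V (n m : ℕ) : Set Primal := B n m ∪ exBoundary (B n m)

/-- The edge set `E_{n,m}` of `G_{n,m}`: the edges inside `B_{n,m}` and the edges between
`B_{n,m}` and its complement, i.e. all edges with at least one endpoint in `B_{n,m}`. -/
def E (n m : ℕ) : Set Tile := {t | ∃ i ∈ edgeEnds t, i ∈ B n m}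

/-- The tiles with at least one corner in `D_{n,m}`. -/
def A (n m : ℕ) : Set Tile := {t | ∃ z ∈ D n m, IsCorner t z}

/-- The boundary tiles `∂A_{n,m}`: the tiles with precisely one corner in `D_{n,m}`. -/
def bdryA (n m : ℕ) : Set Tile := {t | ∃! z, z ∈ D n m ∧ IsCorner t z}

/-- The inner tiles `A^i_{n,m}`. -/
def innerA (n m : ℕ) : Set Tile := A n m \ bdryA n m

/-- The boundary edges `E_b = {e_t : t ∈ ∂A}`. -/
def Eb (n m : ℕ) : Set Tile := bdryA n m

/-- The augmented edge set `Ē = E ∪ E_b`. -/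
def Ebar (n m : ℕ) : Set Tile := E n m ∪ Eb n m

/-- The augmented vertex set, i.e. the set of endpoints of the edges in `Ē`. -/
def Vbar (n m : ℕ) : Set Primal := {i | ∃ t ∈ Ebar n m, i ∈ edgeEnds t}

/-- `v_L = (-n-1, 0)`. -/
def vL (n : ℕ) : Primal := ⟨(-2 * n - 2, 0), ⟨-n - 1, by ring⟩, ⟨0, by ring⟩⟩

/-- `v_R = (n+1, 0)`. -/
def vR (n : ℕ) : Primal := ⟨(2 * n + 2, 0), ⟨n + 1, by ring⟩, ⟨0, by ring⟩⟩

/-- `v'_L = (-n-3/2, -1/2)`. -/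
def vL' (n : ℕ) : Dual := ⟨(-2 * n - 3, -1), ⟨-n - 2, by ring⟩, ⟨-1, by ring⟩⟩

/-- `v'_R = (n+3/2, -1/2)`. -/
def vR' (n : ℕ) : Dual := ⟨(2 * n + 3, -1), ⟨n + 1, by ring⟩, ⟨-1, by ring⟩⟩

/-! ### The probability measure proportional to a weight -/

/-- The discrete probability measure `μ(a) ∝ w(a)`. -/
def gibbs {α : Type*} [MeasurableSpace α] (w : α → ℝ≥0∞) : Measure α :=
  (∑' a, w a)⁻¹ • Measure.sum fun a => w a • Measure.dirac a

/-! ### FK-percolation with wired-wired Dobrushin boundary conditions -/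

/-- `ξ_{1/1}(e) = 1` iff `e ⊂ ℍ⁺` or `e ⊂ ℍ⁻`. -/
def xi (t : Tile) : Prop :=
  (∀ i ∈ edgeEnds t, Upper i.1) ∨ (∀ i ∈ edgeEnds t, ¬ Upper i.1)

/-- `κ_V(ω)`: the number of clusters of `(ℤ², ω)` that intersect `V_{n,m}`. -/
def kappaV (n m : ℕ) (ω : Config) : ℕ :=
  {C : (primalGraph (openEdges ω)).ConnectedComponent | ∃ i ∈ V n m,
    (primalGraph (openEdges ω)).connectedComponentMk i = C}.ncard

open Classical in
/-- The weight of `ω` in the FK-percolation model on `G_{n,m}` under the boundary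
conditions `ξ_{1/1}`. -/
def fkWeight (n m : ℕ) (p q : ℝ) (ω : Config) : ℝ≥0∞ :=
  if ∀ t, t ∉ E n m → (ω t = true ↔ xi t) then
    ENNReal.ofReal (p ^ {t ∈ E n m | ω t = true}.ncard *
      (1 - p) ^ {t ∈ E n m | ω t = false}.ncard * q ^ kappaV n m ω)
  else 0

/-- `FK_{G;p,q}^{1/1}`. -/
def fk (n m : ℕ) (p q : ℝ) : Measure Config := gibbs (fkWeight n m p q)

/-- The event that `∂⁺` and `∂⁻` are not connected, where `∂^± = (∂^ex B_{n,m}) ∩ ℍ^±`. -/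
def NotCrossed (n m : ℕ) : Set Config :=
  {ω | ∀ i ∈ exBoundary (B n m), ∀ j ∈ exBoundary (B n m), Upper i.1 → ¬ Upper j.1 →
    ¬ (primalGraph (openEdges ω)).Reachable i j}

/-- The self-dual point `p_c(q) = √q / (1 + √q)`. -/
def pc (q : ℝ) : ℝ := Real.sqrt q / (1 + Real.sqrt q)

/-! ### Loops -/

/-- A loop arc: in the tile `t`, the arc `(t, z)` cuts off the corner `z`, i.e. it joins the
mid-points of the two sides of `t` that meet in `z`. -/
abbrev Arc : Type := {a : Tile × Pt // IsCorner a.1 a.2}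

namespace Arc

/-- The tile of an arc. -/
def tile (a : Arc) : Tile := a.1.1

/-- The corner that an arc cuts off. -/
def corner (a : Arc) : Pt := a.1.2

/-- The corner of the tile that precedes `a.corner` in the clockwise order. -/
def next (a : Arc) : Pt :=
  (a.tile.1.1 - (a.corner.2 - a.tile.1.2), a.tile.1.2 + (a.corner.1 - a.tile.1.1))

/-- The corner of the tile that follows `a.corner` in the clockwise order. -/
def prev (a : Arc) : Pt :=
  (a.tile.1.1 + (a.corner.2 - a.tile.1.2), a.tile.1.2 - (a.corner.1 - a.tile.1.1))

/-- The two sides of the tile joined by the arc. A side (an edge of `𝔼^⋄`) is encoded by the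
unordered pair of the primal and the dual vertex which it separates, i.e. by its endpoints as
a side of the tile. -/
def sides (a : Arc) : Set (Sym2 Pt) := {s(a.corner, a.next), s(a.corner, a.prev)}

/-- A directed edge of `𝔼^⋄` is encoded by the ordered pair
`(vertex to its left, vertex to its right)`. This is the directed edge along which the arc
enters the tile, if it is oriented such that the cut-off corner is to its right (`right = true`, a
right turn) or to its left (`right = false`, a left turn). -/
def source (right : Bool) (a : Arc) : Pt × Pt :=
  if right then (a.prev, a.corner) else (a.corner, a.next)

/-- The directed edge of `𝔼^⋄` along which the oriented arc leaves the tile. -/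
def target (right : Bool) (a : Arc) : Pt × Pt :=
  if right then (a.next, a.corner) else (a.corner, a.prev)

end Arc

/-- The arcs drawn for `ω`: if `e_t` is open, the two arcs along `e_t` (cutting off the two dual
corners), otherwise the two arcs along `e_t*` (cutting off the two primal corners). -/
def arcs (ω : Config) : Set Arc :=
  {a | ω a.tile = true ↔ (Odd a.corner.1 ∧ Odd a.corner.2)}

/-- Arcs of `ω` are neighbours if they have a side in common. -/
def arcGraph (ω : Config) : SimpleGraph Arc :=
  SimpleGraph.fromRel fun a b => a ∈ arcs ω ∧ b ∈ arcs ω ∧ (a.sides ∩ b.sides).Nonempty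

/-- `l` is the set of arcs of a loop or of a bi-infinite path of the loop configuration of `ω`. -/
def IsCurve (ω : Config) (l : Set Arc) : Prop :=
  ∃ a ∈ arcs ω, l = {b | (arcGraph ω).Reachable a b}

/-- `l` is a loop of the loop configuration of `ω`. -/
def IsLoop (ω : Config) (l : Set Arc) : Prop := IsCurve ω l ∧ l.Finite

/-- `l` is a bi-infinite path of the loop configuration of `ω`. -/
def IsPath (ω : Config) (l : Set Arc) : Prop := IsCurve ω l ∧ l.Infinite

/-- The set `𝓛` of all unoriented loops drawn on the tiles. -/
abbrev Loop : Type := {l : Set Arc // ∃ ω, IsLoop ω l}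

/-- The loop `l` surrounds the vertex `z` (even-odd rule): the horizontal ray from `z` to the right
crosses the loop an odd number of times. The arcs that cross the horizontal line through `z`
are those whose tile centre and cut-off corner both lie on that line. -/
def Surrounds (l : Set Arc) (z : Pt) : Prop :=
  Odd {a ∈ l | a.tile.1.2 = z.2 ∧ a.corner.2 = z.2 ∧ z.1 < a.tile.1.1}.ncard

/-- An orientation of the arcs: `o a = true` iff the arc `a` is oriented such that the corner
which it cuts off is to its right. -/
abbrev ArcOrientation : Type := Arc → Bool

/-- The loop `l` is oriented clockwise: what it surrounds is to its right. -/
def Clockwise (o : ArcOrientation) (l : Set Arc) : Prop :=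
  ∀ a ∈ l, (o a = true ↔ Surrounds l a.corner)

/-- The loop `l` is oriented counter-clockwise: what it surrounds is to its left. -/
def CounterClockwise (o : ArcOrientation) (l : Set Arc) : Prop :=
  ∀ a ∈ l, (o a = true ↔ ¬ Surrounds l a.corner)

/-- The bi-infinite path `l` is oriented from right to left. -/
def RightToLeft (o : ArcOrientation) (l : Set Arc) : Prop :=
  ∃ γ : ℤ → Arc, Set.range γ = l ∧
    (∀ k, (γ k).target (o (γ k)) = (γ (k + 1)).source (o (γ (k + 1)))) ∧
    Filter.Tendsto (fun k => (γ k).tile.1.1) Filter.atTop Filter.atBot ∧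
    Filter.Tendsto (fun k => (γ k).tile.1.1) Filter.atBot Filter.atTop

/-! ### The coupling measure and the six-vertex spins -/

/-- The probability space `{0,1}^{𝔼^•} × [0,1]^𝓛 × [0,1]^{𝕃_⋄}`. -/
abbrev CouplingSpace : Type := Config × (Loop → unitInterval) × (Tile → unitInterval)

/-- The coupling measure: `FK_G^{1/1}( · | ∂⁺ ↮ ∂⁻)` at `p = p_c(q)`, with independent uniform
random variables on `[0,1]` attached to all loops and to all tiles. -/
def coupling (n m : ℕ) (q : ℝ) : Measure CouplingSpace :=
  (ProbabilityTheory.cond (fk n m (pc q) q) (NotCrossed n m)).prod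
    ((Measure.infinitePi fun _ : Loop => (volume : Measure unitInterval)).prod
      (Measure.infinitePi fun _ : Tile => (volume : Measure unitInterval)))

/-- The rule for orienting the loops of `ω` by means of the uniform random variables `U`. -/
structure IsLoopOrientation (n m : ℕ) (q lam : ℝ) (ω : Config) (U : Loop → unitInterval)
    (o : ArcOrientation) : Prop where
  outside : ∀ l, IsLoop ω l → (∃ u : Dual, u ∉ B' n m ∧ Surrounds l u.1) → Clockwise o l
  paths : ∀ l, IsPath ω l → RightToLeft o l
  inside_cw : ∀ l (hl : IsLoop ω l), (∃ z ∈ D n m, Surrounds l z) →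
    (U ⟨l, ω, hl⟩ : ℝ) < Real.exp lam / Real.sqrt q → Clockwise o l
  inside_ccw : ∀ l (hl : IsLoop ω l), (∃ z ∈ D n m, Surrounds l z) →
    ¬ (U ⟨l, ω, hl⟩ : ℝ) < Real.exp lam / Real.sqrt q → CounterClockwise o l

/-- The six-vertex edge orientation given by an oriented loop configuration, as the set of
directed edges of `𝔼^⋄`. -/
def edgeOrientation (ω : Config) (o : ArcOrientation) : Set (Pt × Pt) :=
  {e | ∃ a ∈ arcs ω, e = a.source (o a) ∨ e = a.target (o a)}

/-- Pairs `(σ_•, σ_∘)` of spin configurations. -/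
abbrev Spins : Type := (Primal → ℤˣ) × (Dual → ℤˣ)

/-- `σ` is a spin representation of the six-vertex edge orientation `R`: for each directed edge
which separates `i ∈ 𝕃_•` from `u ∈ 𝕃_∘`, `σ_•(i) = σ_∘(u)` if `i` is to its left and
`σ_•(i) = -σ_∘(u)` if `i` is to its right. -/
def IsSpinRep (R : Set (Pt × Pt)) (σ : Spins) : Prop :=
  ∀ (i : Primal) (u : Dual),
    ((i.1, u.1) ∈ R → σ.1 i = σ.2 u) ∧ ((u.1, i.1) ∈ R → σ.1 i = -σ.2 u)

/-- `σ` is the six-vertex spin configuration with `σ_•((n+1,0)) = +1` associated to the oriented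
loops obtained from `(ω, U)`. -/
def IsBKWSpins (n m : ℕ) (q lam : ℝ) (ω : Config) (U : Loop → unitInterval) (σ : Spins) : Prop :=
  ∃ o, IsLoopOrientation n m q lam ω U o ∧ IsSpinRep (edgeOrientation ω o) σ ∧ σ.1 (vR n) = 1

/-- The six-vertex spin configuration associated to `(ω, U)`. (Almost surely, there is exactly one.) -/
def bkwSpins (n m : ℕ) (q lam : ℝ) (ω : Config) (U : Loop → unitInterval) : Spins :=
  Classical.epsilon (IsBKWSpins n m q lam ω U)

/-! ### The modified ATRC measure -/

/-- The parameter `c = e^{λ/2} + e^{-λ/2}`. -/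
def cBulk (lam : ℝ) : ℝ := Real.exp (lam / 2) + Real.exp (-lam / 2)

/-- The parameter `c_b = e^{λ/2}`. -/
def cBdry (lam : ℝ) : ℝ := Real.exp (lam / 2)

/-- Percolation configurations in `{0,1}^{Ē}`. -/
abbrev BoxConfig (n m : ℕ) : Type := Ebar n m → Bool

/-- The open edges of a configuration in `{0,1}^{Ē}`. -/
def openSet {n m : ℕ} (a : BoxConfig n m) : Set Tile := {t | ∃ h : t ∈ Ebar n m, a ⟨t, h⟩ = true}

/-- The edges `e ∈ Ē` which are closed, i.e. for which `e*` is open in the dual configuration. -/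
def closedSet {n m : ℕ} (a : BoxConfig n m) : Set Tile :=
  {t | ∃ h : t ∈ Ebar n m, a ⟨t, h⟩ = false}

/-- The spanning subgraph of `K = (V̄, Ē)` given by the open edges of `a`. -/
def graphK {n m : ℕ} (a : BoxConfig n m) : SimpleGraph (Vbar n m) :=
  (primalGraph (openSet a)).induce (Vbar n m)

/-- The identification of vertices leading from `K` to `K¹`: all vertices of `∂^in V̄ ∩ ℍ⁺` are
identified, and all vertices of `∂^in V̄ ∩ ℍ⁻` are identified. -/
def Identified (n m : ℕ) (i j : Vbar n m) : Prop :=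
  i.1 ∈ inBoundary (Vbar n m) ∧ j.1 ∈ inBoundary (Vbar n m) ∧ (Upper i.1.1 ↔ Upper j.1.1)

/-- The spanning subgraph of `K¹` given by the open edges of `a`. -/
def graphK1 {n m : ℕ} (a : BoxConfig n m) : SimpleGraph (Quot (Identified n m)) :=
  (graphK a).map (Quot.mk (Identified n m))

open Classical in
/-- The weight of `(ω_τ, ω_{ττ'}) = (a, b)` in the modified ATRC measure. -/
def mATRCWeight (n m : ℕ) (lam : ℝ) (w : BoxConfig n m × BoxConfig n m) : ℝ≥0∞ :=
  if openSet w.1 ⊆ openSet w.2 ∧ openSet w.2 \ openSet w.1 ⊆ E n m then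
    ENNReal.ofReal (2 ^ (openSet w.1 ∩ E n m).ncard *
      (2 / (cBdry lam - 1)) ^ (openSet w.1 ∩ Eb n m).ncard *
      (cBulk lam - 2) ^ (openSet w.2 \ openSet w.1).ncard *
      2 ^ (Nat.card (graphK w.1).ConnectedComponent + Nat.card (graphK1 w.2).ConnectedComponent))
  else 0

/-- The modified ATRC measure `mATRC_K`. -/
def mATRC (n m : ℕ) (lam : ℝ) : Measure (BoxConfig n m × BoxConfig n m) :=
  gibbs (mATRCWeight n m lam)

/-- The event that `v_L ↔ v_R` in `ω_τ` and `v'_L ↔ v'_R` in `ω_{ττ'}*`. -/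
def Crossings (n m : ℕ) : Set (BoxConfig n m × BoxConfig n m) :=
  {w | (primalGraph (openSet w.1)).Reachable (vL n) (vR n) ∧
    (dualGraph (closedSet w.2)).Reachable (vL' n) (vR' n)}

/-! ### From six-vertex spins to the modified ATRC measure -/

/-- `σ_• ∼ F`: the spins agree along all edges `e_t`, `t ∈ F`. -/
def AgreePrimal (σ : Primal → ℤˣ) (F : Set Tile) : Prop :=
  ∀ t ∈ F, ∀ i ∈ edgeEnds t, ∀ j ∈ edgeEnds t, σ i = σ j

/-- `σ_∘ ∼ *F`: the spins agree along all dual edges `e_t*`, `t ∈ F`. -/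
def AgreeDual (σ : Dual → ℤˣ) (F : Set Tile) : Prop :=
  ∀ t ∈ F, ∀ u ∈ dualEnds t, ∀ v ∈ dualEnds t, σ u = σ v

open Classical in
/-- The local sampling rule: the value of `(ω_τ(e_t), ω_{ττ'}(e_t))` given the spins and the
value `x` of the uniform random variable attached to the tile `t`. -/
def localRule (n m : ℕ) (lam : ℝ) (σ : Spins) (t : Tile) (x : unitInterval) : Bool × Bool :=
  if ¬ AgreeDual σ.2 {t} then (true, true)
  else if ¬ AgreePrimal σ.1 {t} then (false, false)
  else if t ∈ innerA n m then
    if (x : ℝ) < 1 / cBulk lam then (true, true)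
    else if (x : ℝ) < 2 / cBulk lam then (false, false)
    else (false, true)
  else
    if (x : ℝ) < 1 / cBdry lam then (true, true) else (false, false)

/-- The pair `(ω_τ, ω_{ττ'})` obtained from the spins `σ` and the tile variables `U'` by applying
the local sampling rule at each tile. -/
def sampleATRC (n m : ℕ) (lam : ℝ) (σ : Spins) (U' : Tile → unitInterval) :
    BoxConfig n m × BoxConfig n m :=
  (fun t => (localRule n m lam σ t.1 (U' t.1)).1, fun t => (localRule n m lam σ t.1 (U' t.1)).2)

end BKW

end

noncomputable section

namespace BKW


/-! ### Coordinates -/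

/-! The proof is a double resummation of a weight that factorises over the tiles (the
Baxter–Kelland–Wu coupling).

From FK weights to turns. At `pc` an open edge of E weighs √q times as much as a closed one, and by
Euler's formula (`Dob.kappaV_eq`) the weight of a configuration without crossing is a constant times
√q to the number of inner loops. An inner loop is clockwise with probability e^λ/√q and
counter-clockwise with probability e^{-λ}/√q. So the joint weight of ω and the orientations is a
constant times the product of e^{±λ} over the inner loops. A clockwise loop makes four more right
turns than left turns (`IsCurve.turnSum_eq`, again Euler's formula, for the interior of the loop),
hence e^{±λ} is the product of e^{±λ/4} over the turns of the loop.

The boundary. The bi-infinite paths turn inside the box as well. If all edges outside the box are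
closed, the paths become parts of two closed rings, around the upper and the lower boundary cluster,
with opposite orientations; their turns add up to 4 - 4 = 0 (`Dob.exists_ring`). The arcs added
around the box are oriented in a fixed way, so they contribute a constant (`Dob.sum_turn`).

Spins. The pairs of spins with the ± boundary values that are constant on the clusters and dual
clusters of ω correspond bijectively to the orientations of the inner loops (`Dob.exists_comp`,
`Dob.comp_ext`). One such pair exists because the two boundary arcs are not connected
(`Dob.exists_base`). This makes the spins well defined (`Dob.bkwSpins`), and the joint weight of ω
and the spins becomes a product over tiles (`Dob.prod_factors`).

Summing out ω and sampling. For fixed spins, the two states of an inner edge add up to `cBulk` if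
both pairs of spins agree, to 1 if exactly one does, and to 0 otherwise. The local rule splits
`cBulk` into 1 + 1 + (`cBulk` - 2); at the boundary the weights are in the ratio 1 : (`cBdry` - 1).
So spins and sample have as joint weight the local ATRC factors times the indicator that σ_• is
constant along ω_{ττ'} and σ_∘ along the dual of ω_τ (`bulk_mul_ruleProb`, `bdry_mul_ruleProb`).

Summing out the spins. There remains the number of admissible σ_• times the number of admissible σ_∘
(`sum_joint_weight`). These are nonzero exactly if the two crossings occur, because the interface
forced by the boundary values has to run through the permitted edges (`spinsD_nonempty_iff`,
`spinsP_nonempty_iff`). If so, the first number is 2^{κ_{K¹}(ω_{ττ'})} / 4, and by Euler's formula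
the second one is 2^{κ_K(ω_τ) + |ω_τ|} up to a constant (`pow_card_graphK1`, `pow_card_graphK_mul`).
This is the modified ATRC weight (`indicator_mATRCWeight`). The two probability measures are
multiples of one measure and therefore equal.

All planar topology is done modulo two. Insides of loops are parities of ray crossings, connections
are chains with prescribed boundary, clusters are counted through locally constant functions with
values in ℤ/2, and Euler's formula is the equality of row and column rank of an incidence matrix. -/

theorem isCorner_iff (t : Tile) (z : Pt) : IsCorner t z ↔
    (z.1 = t.1.1 + 1 ∧ z.2 = t.1.2) ∨ (z.1 = t.1.1 - 1 ∧ z.2 = t.1.2) ∨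
    (z.1 = t.1.1 ∧ z.2 = t.1.2 + 1) ∨ (z.1 = t.1.1 ∧ z.2 = t.1.2 - 1) := by
  unfold IsCorner
  rcases abs_cases (z.1 - t.1.1) with h | h <;> rcases abs_cases (z.2 - t.1.2) with h' | h' <;> omega

theorem Primal.mod (i : Primal) : i.1.1 % 2 = 0 ∧ i.1.2 % 2 = 0 :=
  ⟨Int.even_iff.1 i.2.1, Int.even_iff.1 i.2.2⟩

theorem Dual.mod (i : Dual) : i.1.1 % 2 = 1 ∧ i.1.2 % 2 = 1 :=
  ⟨Int.odd_iff.1 i.2.1, Int.odd_iff.1 i.2.2⟩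

theorem Tile.mod (t : Tile) : (t.1.1 + t.1.2) % 2 = 1 := Int.odd_iff.1 t.2

/-- The primal vertex with given coordinates. -/
def mkP (x y : ℤ) (hx : x % 2 = 0) (hy : y % 2 = 0) : Primal :=
  ⟨(x, y), Int.even_iff.2 hx, Int.even_iff.2 hy⟩

/-- The dual vertex with given coordinates. -/
def mkD (x y : ℤ) (hx : x % 2 = 1) (hy : y % 2 = 1) : Dual :=
  ⟨(x, y), Int.odd_iff.2 hx, Int.odd_iff.2 hy⟩

/-- The tile with given centre. -/
def mkT (x y : ℤ) (h : (x + y) % 2 = 1) : Tile := ⟨(x, y), Int.odd_iff.2 h⟩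

@[simp] theorem mkP_fst (x y : ℤ) (hx hy) : (mkP x y hx hy).1.1 = x := rfl
@[simp] theorem mkP_snd (x y : ℤ) (hx hy) : (mkP x y hx hy).1.2 = y := rfl
@[simp] theorem mkD_fst (x y : ℤ) (hx hy) : (mkD x y hx hy).1.1 = x := rfl
@[simp] theorem mkD_snd (x y : ℤ) (hx hy) : (mkD x y hx hy).1.2 = y := rfl
@[simp] theorem mkT_fst (x y : ℤ) (h) : (mkT x y h).1.1 = x := rfl
@[simp] theorem mkT_snd (x y : ℤ) (h) : (mkT x y h).1.2 = y := rfl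

theorem Primal.ext' {i j : Primal} (h1 : i.1.1 = j.1.1) (h2 : i.1.2 = j.1.2) : i = j :=
  Subtype.ext (Prod.ext h1 h2)

theorem Dual.ext' {i j : Dual} (h1 : i.1.1 = j.1.1) (h2 : i.1.2 = j.1.2) : i = j :=
  Subtype.ext (Prod.ext h1 h2)

theorem Tile.ext' {i j : Tile} (h1 : i.1.1 = j.1.1) (h2 : i.1.2 = j.1.2) : i = j :=
  Subtype.ext (Prod.ext h1 h2)

theorem mem_edgeEnds (t : Tile) (i : Primal) : i ∈ edgeEnds t ↔ IsCorner t i.1 := Iff.rfl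

theorem mem_dualEnds (t : Tile) (u : Dual) : u ∈ dualEnds t ↔ IsCorner t u.1 := Iff.rfl

theorem mem_B (n m : ℕ) (i : Primal) :
    i ∈ B n m ↔ -(2 * n : ℤ) ≤ i.1.1 ∧ i.1.1 ≤ 2 * n ∧ -(2 * m : ℤ) ≤ i.1.2 ∧ i.1.2 ≤ 2 * m := by
  simp only [B, Set.mem_ofPred_eq, abs_le]; tauto

theorem mem_B' (n m : ℕ) (u : Dual) :
    u ∈ B' n m ↔ -(2 * n + 1 : ℤ) ≤ u.1.1 ∧ u.1.1 ≤ 2 * n + 1 ∧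
      -(2 * m + 1 : ℤ) ≤ u.1.2 ∧ u.1.2 ≤ 2 * m + 1 := by
  simp only [B', Set.mem_ofPred_eq, abs_le]; tauto

/-- The vertices of both lattices together are the points of even coordinate sum, so the box and its
dual box merge into one system of linear inequalities. -/
theorem mem_D (n m : ℕ) (z : Pt) : z ∈ D n m ↔ (z.1 + z.2) % 2 = 0 ∧
    -(2 * n + 1 : ℤ) ≤ z.1 ∧ z.1 ≤ 2 * n + 1 ∧ -(2 * m + 1 : ℤ) ≤ z.2 ∧ z.2 ≤ 2 * m + 1 := by
  constructor
  · rintro (⟨i, hi, rfl⟩ | ⟨i, hi, rfl⟩)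
    · have := Primal.mod i; rw [mem_B] at hi; omega
    · have := Dual.mod i; rw [mem_B'] at hi; omega
  · rintro ⟨h, h'⟩
    by_cases hz : z.1 % 2 = 0
    · left
      refine ⟨mkP z.1 z.2 hz (by omega), ?_, rfl⟩
      rw [mem_B]; simp; omega
    · right
      refine ⟨mkD z.1 z.2 (by omega) (by omega), ?_, rfl⟩
      rw [mem_B']; simp; omega

theorem corner_parity {t : Tile} {z : Pt} (h : IsCorner t z) : (z.1 + z.2) % 2 = 0 := by
  rw [isCorner_iff] at h; have := t.mod; omega

/-- The two endpoints of a primal edge. -/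
theorem exists_edgeEnds (t : Tile) : ∃ i j : Primal, i ∈ edgeEnds t ∧ j ∈ edgeEnds t ∧ i ≠ j ∧
    (∀ k ∈ edgeEnds t, k = i ∨ k = j) ∧
    ((t.1.1 % 2 = 1 ∧ i.1.1 = t.1.1 - 1 ∧ i.1.2 = t.1.2 ∧ j.1.1 = t.1.1 + 1 ∧ j.1.2 = t.1.2) ∨
     (t.1.1 % 2 = 0 ∧ i.1.1 = t.1.1 ∧ i.1.2 = t.1.2 - 1 ∧ j.1.1 = t.1.1 ∧ j.1.2 = t.1.2 + 1)) := by
  have ht := t.mod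
  by_cases h : t.1.1 % 2 = 1
  · refine ⟨mkP (t.1.1 - 1) t.1.2 (by omega) (by omega), mkP (t.1.1 + 1) t.1.2 (by omega) (by omega),
      ?_, ?_, ?_, ?_, ?_⟩
    · rw [mem_edgeEnds, isCorner_iff]; simp
    · rw [mem_edgeEnds, isCorner_iff]; simp
    · intro h'; have := congrArg (fun i : Primal => i.1.1) h'; simp at this; omega
    · intro k hk
      rw [mem_edgeEnds, isCorner_iff] at hk
      have := k.mod
      rcases hk with hk | hk | hk | hk
      · right; apply Primal.ext' <;> simp <;> omega
      · left; apply Primal.ext' <;> simp <;> omega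
      · omega
      · omega
    · simp; omega
  · refine ⟨mkP t.1.1 (t.1.2 - 1) (by omega) (by omega), mkP t.1.1 (t.1.2 + 1) (by omega) (by omega),
      ?_, ?_, ?_, ?_, ?_⟩
    · rw [mem_edgeEnds, isCorner_iff]; simp
    · rw [mem_edgeEnds, isCorner_iff]; simp
    · intro h'; have := congrArg (fun i : Primal => i.1.2) h'; simp at this; omega
    · intro k hk
      rw [mem_edgeEnds, isCorner_iff] at hk
      have := k.mod
      rcases hk with hk | hk | hk | hk
      · omega
      · omega
      · right; apply Primal.ext' <;> simp <;> omega
      · left; apply Primal.ext' <;> simp <;> omega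
    · simp; omega

/-- The two endpoints of a dual edge. -/
theorem exists_dualEnds (t : Tile) : ∃ i j : Dual, i ∈ dualEnds t ∧ j ∈ dualEnds t ∧ i ≠ j ∧
    (∀ k ∈ dualEnds t, k = i ∨ k = j) ∧
    ((t.1.1 % 2 = 0 ∧ i.1.1 = t.1.1 - 1 ∧ i.1.2 = t.1.2 ∧ j.1.1 = t.1.1 + 1 ∧ j.1.2 = t.1.2) ∨
     (t.1.1 % 2 = 1 ∧ i.1.1 = t.1.1 ∧ i.1.2 = t.1.2 - 1 ∧ j.1.1 = t.1.1 ∧ j.1.2 = t.1.2 + 1)) := by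
  have ht := t.mod
  by_cases h : t.1.1 % 2 = 0
  · refine ⟨mkD (t.1.1 - 1) t.1.2 (by omega) (by omega), mkD (t.1.1 + 1) t.1.2 (by omega) (by omega),
      ?_, ?_, ?_, ?_, ?_⟩
    · rw [mem_dualEnds, isCorner_iff]; simp
    · rw [mem_dualEnds, isCorner_iff]; simp
    · intro h'; have := congrArg (fun i : Dual => i.1.1) h'; simp at this; omega
    · intro k hk
      rw [mem_dualEnds, isCorner_iff] at hk
      have := k.mod
      rcases hk with hk | hk | hk | hk
      · right; apply Dual.ext' <;> simp <;> omega
      · left; apply Dual.ext' <;> simp <;> omega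
      · omega
      · omega
    · simp; omega
  · refine ⟨mkD t.1.1 (t.1.2 - 1) (by omega) (by omega), mkD t.1.1 (t.1.2 + 1) (by omega) (by omega),
      ?_, ?_, ?_, ?_, ?_⟩
    · rw [mem_dualEnds, isCorner_iff]; simp
    · rw [mem_dualEnds, isCorner_iff]; simp
    · intro h'; have := congrArg (fun i : Dual => i.1.2) h'; simp at this; omega
    · intro k hk
      rw [mem_dualEnds, isCorner_iff] at hk
      have := k.mod
      rcases hk with hk | hk | hk | hk
      · omega
      · omega
      · right; apply Dual.ext' <;> simp <;> omega
      · left; apply Dual.ext' <;> simp <;> omega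
    · simp; omega

/-- E, A and the augmented vertex set are all rectangles in doubled coordinates, which reduces later
geometric claims to linear arithmetic. -/
theorem mem_E (n m : ℕ) (t : Tile) : t ∈ E n m ↔ -(2 * n + 1 : ℤ) ≤ t.1.1 ∧ t.1.1 ≤ 2 * n + 1 ∧
    -(2 * m + 1 : ℤ) ≤ t.1.2 ∧ t.1.2 ≤ 2 * m + 1 := by
  have ht := t.mod
  constructor
  · rintro ⟨i, hi, hB⟩
    rw [mem_edgeEnds, isCorner_iff] at hi
    rw [mem_B] at hB; omega
  · intro h
    obtain ⟨i, j, hi, hj, -, -, hc⟩ := exists_edgeEnds t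
    by_cases hB : i ∈ B n m
    · exact ⟨i, hi, hB⟩
    · refine ⟨j, hj, ?_⟩
      rw [mem_B] at hB ⊢
      have := i.mod; have := j.mod
      omega

theorem mem_A (n m : ℕ) (t : Tile) : t ∈ A n m ↔ -(2 * n + 2 : ℤ) ≤ t.1.1 ∧ t.1.1 ≤ 2 * n + 2 ∧
    -(2 * m + 2 : ℤ) ≤ t.1.2 ∧ t.1.2 ≤ 2 * m + 2 := by
  have ht := t.mod
  constructor
  · rintro ⟨z, hz, hc⟩
    rw [isCorner_iff] at hc
    rw [mem_D] at hz; omega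
  · intro h
    by_contra hcon
    have key : ∀ z : Pt, IsCorner t z → z ∉ D n m := fun z hz hD => hcon ⟨z, hD, hz⟩
    have h1 := key (t.1.1 + 1, t.1.2) (by rw [isCorner_iff]; simp)
    have h2 := key (t.1.1 - 1, t.1.2) (by rw [isCorner_iff]; simp)
    have h3 := key (t.1.1, t.1.2 + 1) (by rw [isCorner_iff]; simp)
    have h4 := key (t.1.1, t.1.2 - 1) (by rw [isCorner_iff]; simp)
    rw [mem_D] at h1 h2 h3 h4
    simp only at h1 h2 h3 h4
    omega

/-- The boundary tiles are the outermost layer of the rectangle A. Its four corner positions have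
even coordinate sum and are no tiles, so each tile of the layer faces the domain with a single
corner. -/
theorem mem_bdryA (n m : ℕ) (t : Tile) : t ∈ bdryA n m ↔ t ∈ A n m ∧ t ∉ E n m := by
  have ht := t.mod
  rw [mem_A, mem_E]
  constructor
  · rintro ⟨z, ⟨hz, hc⟩, hu⟩
    have h1 := fun h => hu (t.1.1 + 1, t.1.2) ⟨h, by rw [isCorner_iff]; simp⟩
    have h2 := fun h => hu (t.1.1 - 1, t.1.2) ⟨h, by rw [isCorner_iff]; simp⟩
    have h3 := fun h => hu (t.1.1, t.1.2 + 1) ⟨h, by rw [isCorner_iff]; simp⟩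
    have h4 := fun h => hu (t.1.1, t.1.2 - 1) ⟨h, by rw [isCorner_iff]; simp⟩
    rw [isCorner_iff] at hc
    rw [mem_D] at hz h1 h2 h3 h4
    simp only [Prod.ext_iff] at h1 h2 h3 h4
    omega
  · intro h
    obtain ⟨z, hz, hc⟩ := (mem_A n m t).2 h.1
    refine ⟨z, ⟨hz, hc⟩, ?_⟩
    rintro y ⟨hy, hcy⟩
    rw [isCorner_iff] at hc hcy
    rw [mem_D] at hz hy
    ext <;> omega

theorem Eb_eq (n m : ℕ) : Eb n m = A n m \ E n m := by
  ext t; exact mem_bdryA n m t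

theorem E_subset_A (n m : ℕ) : E n m ⊆ A n m := by
  intro t; rw [mem_A, mem_E]; omega

theorem Ebar_eq (n m : ℕ) : Ebar n m = A n m := by
  rw [Ebar, Eb_eq, Set.union_sdiff_cancel (E_subset_A n m)]

theorem innerA_eq (n m : ℕ) : innerA n m = E n m := by
  ext t
  have := @E_subset_A n m t
  simp only [innerA, Set.mem_sdiff, mem_bdryA]
  tauto

theorem mem_Ebar (n m : ℕ) (t : Tile) : t ∈ Ebar n m ↔
    -(2 * n + 2 : ℤ) ≤ t.1.1 ∧ t.1.1 ≤ 2 * n + 2 ∧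
    -(2 * m + 2 : ℤ) ≤ t.1.2 ∧ t.1.2 ≤ 2 * m + 2 := by
  rw [Ebar_eq, mem_A]

theorem mem_Eb (n m : ℕ) (t : Tile) : t ∈ Eb n m ↔ t ∈ Ebar n m ∧ t ∉ E n m := by
  rw [Eb_eq, Ebar_eq, Set.mem_sdiff]

theorem mem_Vbar (n m : ℕ) (i : Primal) : i ∈ Vbar n m ↔
    -(2 * n + 2 : ℤ) ≤ i.1.1 ∧ i.1.1 ≤ 2 * n + 2 ∧
    -(2 * m + 2 : ℤ) ≤ i.1.2 ∧ i.1.2 ≤ 2 * m + 2 := by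
  have hi := i.mod
  constructor
  · rintro ⟨t, ht, hc⟩
    have := t.mod
    rw [mem_edgeEnds, isCorner_iff] at hc
    rw [mem_Ebar] at ht
    omega
  · intro h
    by_cases h' : i.1.1 ≤ 2 * n
    · refine ⟨mkT (i.1.1 + 1) i.1.2 (by omega), ?_, ?_⟩
      · rw [mem_Ebar]; simp; omega
      · rw [mem_edgeEnds, isCorner_iff]; simp
    · refine ⟨mkT (i.1.1 - 1) i.1.2 (by omega), ?_, ?_⟩
      · rw [mem_Ebar]; simp; omega
      · rw [mem_edgeEnds, isCorner_iff]; simp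

theorem exists_tile_of_adj {F : Set Tile} {i j : Primal} :
    (primalGraph F).Adj i j ↔ i ≠ j ∧ ∃ t ∈ F, i ∈ edgeEnds t ∧ j ∈ edgeEnds t := by
  simp only [primalGraph, SimpleGraph.fromRel_adj]
  constructor
  · rintro ⟨h, ⟨t, h1, h2, h3⟩ | ⟨t, h1, h2, h3⟩⟩
    exacts [⟨h, t, h1, h2, h3⟩, ⟨h, t, h1, h3, h2⟩]
  · rintro ⟨h, h'⟩; exact ⟨h, Or.inl h'⟩

theorem mem_inBoundary_Vbar (n m : ℕ) (i : Primal) : i ∈ inBoundary (Vbar n m) ↔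
    i ∈ Vbar n m ∧ (i.1.1 = -(2 * n + 2 : ℤ) ∨ i.1.1 = 2 * n + 2 ∨
      i.1.2 = -(2 * m + 2 : ℤ) ∨ i.1.2 = 2 * m + 2) := by
  have hi := i.mod
  constructor
  · rintro ⟨h, j, hj, hadj⟩
    refine ⟨h, ?_⟩
    obtain ⟨-, t, -, h1, h2⟩ := exists_tile_of_adj.1 hadj
    rw [mem_Vbar] at h hj
    have := j.mod
    have := t.mod
    rw [mem_edgeEnds, isCorner_iff] at h1 h2
    omega
  · rintro ⟨h, h'⟩
    refine ⟨h, ?_⟩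
    have aux : ∀ (j : Primal) (t : Tile), j ∉ Vbar n m → i ∈ edgeEnds t → j ∈ edgeEnds t →
        ∃ j, j ∉ Vbar n m ∧ (primalGraph Set.univ).Adj i j := fun j t h1 h2 h3 =>
      ⟨j, h1, exists_tile_of_adj.2 ⟨fun h4 => h1 (h4 ▸ h), t, trivial, h2, h3⟩⟩
    rcases h' with h' | h' | h' | h'
    · refine aux (mkP (i.1.1 - 2) i.1.2 (by omega) (by omega)) (mkT (i.1.1 - 1) i.1.2 (by omega)) ?_ ?_ ?_
      · rw [mem_Vbar]; simp; omega
      · rw [mem_edgeEnds, isCorner_iff]; simp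
      · rw [mem_edgeEnds, isCorner_iff]; simp; omega
    · refine aux (mkP (i.1.1 + 2) i.1.2 (by omega) (by omega)) (mkT (i.1.1 + 1) i.1.2 (by omega)) ?_ ?_ ?_
      · rw [mem_Vbar]; simp; omega
      · rw [mem_edgeEnds, isCorner_iff]; simp
      · rw [mem_edgeEnds, isCorner_iff]; simp; omega
    · refine aux (mkP i.1.1 (i.1.2 - 2) (by omega) (by omega)) (mkT i.1.1 (i.1.2 - 1) (by omega)) ?_ ?_ ?_
      · rw [mem_Vbar]; simp; omega
      · rw [mem_edgeEnds, isCorner_iff]; simp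
      · rw [mem_edgeEnds, isCorner_iff]; simp; omega
    · refine aux (mkP i.1.1 (i.1.2 + 2) (by omega) (by omega)) (mkT i.1.1 (i.1.2 + 1) (by omega)) ?_ ?_ ?_
      · rw [mem_Vbar]; simp; omega
      · rw [mem_edgeEnds, isCorner_iff]; simp
      · rw [mem_edgeEnds, isCorner_iff]; simp; omega

/-- The four diagonal corners (±(2n+2), ±(2m+2)) are missing here, although they belong to `Vbar`.
-/
theorem mem_exBoundary_B (n m : ℕ) (j : Primal) : j ∈ exBoundary (B n m) ↔
    ((j.1.1 = -(2 * n + 2 : ℤ) ∨ j.1.1 = 2 * n + 2) ∧ -(2 * m : ℤ) ≤ j.1.2 ∧ j.1.2 ≤ 2 * m) ∨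
    ((j.1.2 = -(2 * m + 2 : ℤ) ∨ j.1.2 = 2 * m + 2) ∧ -(2 * n : ℤ) ≤ j.1.1 ∧ j.1.1 ≤ 2 * n) := by
  have hj := j.mod
  constructor
  · rintro ⟨h, i, hi, hadj⟩
    obtain ⟨-, t, -, h1, h2⟩ := exists_tile_of_adj.1 hadj
    rw [mem_B] at h hi
    have := i.mod
    have := t.mod
    rw [mem_edgeEnds, isCorner_iff] at h1 h2
    omega
  · intro h'
    have h : j ∉ B n m := by rw [mem_B]; omega
    refine ⟨h, ?_⟩
    have aux : ∀ (i : Primal) (t : Tile), i ∈ B n m → i ∈ edgeEnds t → j ∈ edgeEnds t →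
        ∃ i ∈ B n m, (primalGraph Set.univ).Adj i j := fun i t h1 h2 h3 =>
      ⟨i, h1, exists_tile_of_adj.2 ⟨fun h4 => h (h4 ▸ h1), t, trivial, h2, h3⟩⟩
    rcases h' with ⟨h' | h', h''⟩ | ⟨h' | h', h''⟩
    · refine aux (mkP (j.1.1 + 2) j.1.2 (by omega) (by omega)) (mkT (j.1.1 + 1) j.1.2 (by omega)) ?_ ?_ ?_
      · rw [mem_B]; simp; omega
      · rw [mem_edgeEnds, isCorner_iff]; simp; omega
      · rw [mem_edgeEnds, isCorner_iff]; simp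
    · refine aux (mkP (j.1.1 - 2) j.1.2 (by omega) (by omega)) (mkT (j.1.1 - 1) j.1.2 (by omega)) ?_ ?_ ?_
      · rw [mem_B]; simp; omega
      · rw [mem_edgeEnds, isCorner_iff]; simp; omega
      · rw [mem_edgeEnds, isCorner_iff]; simp
    · refine aux (mkP j.1.1 (j.1.2 + 2) (by omega) (by omega)) (mkT j.1.1 (j.1.2 + 1) (by omega)) ?_ ?_ ?_
      · rw [mem_B]; simp; omega
      · rw [mem_edgeEnds, isCorner_iff]; simp; omega
      · rw [mem_edgeEnds, isCorner_iff]; simp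
    · refine aux (mkP j.1.1 (j.1.2 - 2) (by omega) (by omega)) (mkT j.1.1 (j.1.2 - 1) (by omega)) ?_ ?_ ?_
      · rw [mem_B]; simp; omega
      · rw [mem_edgeEnds, isCorner_iff]; simp; omega
      · rw [mem_edgeEnds, isCorner_iff]; simp

/-- Only the vertical edges between the heights 0 and -1 meet both half planes, and their mid-points
have doubled height -1. This row plays a special role throughout. -/
theorem xi_iff (t : Tile) : xi t ↔ t.1.2 ≠ -1 := by
  obtain ⟨i, j, hi, hj, -, hall, hc⟩ := exists_edgeEnds t
  have := i.mod
  have := t.mod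
  unfold xi Upper
  constructor
  · rintro (h | h)
    · have := h i hi; have := h j hj; omega
    · have := h i hi; have := h j hj; omega
  · intro h
    by_cases h0 : 0 ≤ i.1.2
    · left; intro k hk; rcases hall k hk with rfl | rfl <;> omega
    · right; intro k hk; rcases hall k hk with rfl | rfl <;> omega

/-- Points of bounded coordinates form a finite set. -/
theorem finite_box (a b : ℤ) : {z : Pt | -a ≤ z.1 ∧ z.1 ≤ a ∧ -b ≤ z.2 ∧ z.2 ≤ b}.Finite := by
  apply ((Set.finite_Icc (-a) a).prod (Set.finite_Icc (-b) b)).subset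
  rintro ⟨x, y⟩ h
  simp only [Set.mem_ofPred_eq] at h
  simp only [Set.mem_prod, Set.mem_Icc]; omega

theorem finite_tiles {S : Set Tile} (a b : ℤ)
    (h : ∀ t ∈ S, -a ≤ t.1.1 ∧ t.1.1 ≤ a ∧ -b ≤ t.1.2 ∧ t.1.2 ≤ b) : S.Finite :=
  ((finite_box a b).preimage Subtype.val_injective.injOn).subset h

theorem finite_primal {S : Set Primal} (a b : ℤ)
    (h : ∀ t ∈ S, -a ≤ t.1.1 ∧ t.1.1 ≤ a ∧ -b ≤ t.1.2 ∧ t.1.2 ≤ b) : S.Finite :=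
  ((finite_box a b).preimage Subtype.val_injective.injOn).subset h

theorem finite_dual {S : Set Dual} (a b : ℤ)
    (h : ∀ t ∈ S, -a ≤ t.1.1 ∧ t.1.1 ≤ a ∧ -b ≤ t.1.2 ∧ t.1.2 ≤ b) : S.Finite :=
  ((finite_box a b).preimage Subtype.val_injective.injOn).subset h

theorem finite_Ebar (n m : ℕ) : (Ebar n m).Finite :=
  finite_tiles (2 * n + 2) (2 * m + 2) fun t ht => (mem_Ebar n m t).1 ht

theorem finite_E (n m : ℕ) : (E n m).Finite :=
  (finite_Ebar n m).subset Set.subset_union_left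

theorem finite_Vbar (n m : ℕ) : (Vbar n m).Finite :=
  finite_primal (2 * n + 2) (2 * m + 2) fun t ht => (mem_Vbar n m t).1 ht

theorem finite_B (n m : ℕ) : (B n m).Finite :=
  finite_primal (2 * n) (2 * m) fun t ht => (mem_B n m t).1 ht

theorem finite_B' (n m : ℕ) : (B' n m).Finite :=
  finite_dual (2 * n + 1) (2 * m + 1) fun t ht => (mem_B' n m t).1 ht

theorem finite_arcs {S : Set Arc} {T : Set Tile} (hT : T.Finite) (h : ∀ a ∈ S, a.tile ∈ T) :
    S.Finite := by
  have : ∀ t : Tile, {z : Pt | IsCorner t z}.Finite := by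
    intro t
    apply ((Set.finite_Icc (t.1.1 - 1) (t.1.1 + 1)).prod
      (Set.finite_Icc (t.1.2 - 1) (t.1.2 + 1))).subset
    intro z hz
    rw [Set.mem_ofPred_eq, isCorner_iff] at hz
    simp only [Set.mem_prod, Set.mem_Icc]; omega
  have h2 : (⋃ t ∈ T, (fun z => (t, z)) '' {z : Pt | IsCorner t z}).Finite :=
    hT.biUnion fun t _ => (this t).image _
  refine (h2.preimage (f := fun a : Arc => a.1) Subtype.val_injective.injOn).subset ?_
  intro a ha
  simp only [Set.mem_preimage, Set.mem_iUnion]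
  exact ⟨a.tile, h a ha, a.1.2, a.2, rfl⟩


/-! ### Sides of tiles and curves -/

/-- The arc `a` crosses the side of its tile that separates `i` from `u`. -/
def Crosses (a : Arc) (i : Primal) (u : Dual) : Prop :=
  IsCorner a.tile i.1 ∧ IsCorner a.tile u.1 ∧ (a.corner = i.1 ∨ a.corner = u.1)

/-- `i` and `u` are the endpoints of a side of a tile. -/
def Beside (i : Primal) (u : Dual) : Prop :=
  (u.1.1 = i.1.1 + 1 ∨ u.1.1 = i.1.1 - 1) ∧ (u.1.2 = i.1.2 + 1 ∨ u.1.2 = i.1.2 - 1)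

/-- The first of the two tiles with a given side. -/
def tile₁ (i : Primal) (u : Dual) : Tile :=
  mkT i.1.1 u.1.2 (by have := i.mod; have := u.mod; omega)

/-- The second of the two tiles with a given side. -/
def tile₂ (i : Primal) (u : Dual) : Tile :=
  mkT u.1.1 i.1.2 (by have := i.mod; have := u.mod; omega)

/-- The centre of a tile shares one coordinate with each endpoint of a side, and there are two ways
to distribute them. A side thus lies in two tiles. -/
theorem beside_of_corners {t : Tile} {i : Primal} {u : Dual} (hi : IsCorner t i.1)
    (hu : IsCorner t u.1) : Beside i u ∧ (t = tile₁ i u ∨ t = tile₂ i u) := by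
  rw [isCorner_iff] at hi hu
  have := i.mod; have := u.mod; have := t.mod
  refine ⟨by unfold Beside; omega, ?_⟩
  by_cases h : t.1.1 = i.1.1
  · left; apply Tile.ext' <;> simp [tile₁] <;> omega
  · right; apply Tile.ext' <;> simp [tile₂] <;> omega

theorem Beside.corner₁ {i : Primal} {u : Dual} (h : Beside i u) :
    IsCorner (tile₁ i u) i.1 ∧ IsCorner (tile₁ i u) u.1 := by
  unfold Beside at h
  rw [isCorner_iff, isCorner_iff]; simp [tile₁]; omega

theorem Beside.corner₂ {i : Primal} {u : Dual} (h : Beside i u) :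
    IsCorner (tile₂ i u) i.1 ∧ IsCorner (tile₂ i u) u.1 := by
  unfold Beside at h
  rw [isCorner_iff, isCorner_iff]; simp [tile₂]; omega

theorem tile₁_ne_tile₂ (i : Primal) (u : Dual) : tile₁ i u ≠ tile₂ i u := by
  intro h
  have := congrArg (fun t : Tile => t.1.1) h
  have h1 := i.mod; have h2 := u.mod
  simp [tile₁, tile₂] at this; omega

theorem Crosses.beside {a : Arc} {i : Primal} {u : Dual} (h : Crosses a i u) : Beside i u :=
  (beside_of_corners h.1 h.2.1).1

theorem Arc.ext' {a b : Arc} (h1 : a.tile = b.tile) (h2 : a.corner = b.corner) : a = b :=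
  Subtype.ext (Prod.ext h1 h2)

theorem Arc.isCorner (a : Arc) : IsCorner a.tile a.corner := a.2

/-- The corner cut off by an arc is primal or dual. -/
theorem Arc.corner_cases (a : Arc) :
    (∃ i : Primal, a.corner = i.1) ∨ (∃ u : Dual, a.corner = u.1) := by
  have := corner_parity a.isCorner
  by_cases h : a.corner.1 % 2 = 0
  · left; exact ⟨mkP a.corner.1 a.corner.2 h (by omega), rfl⟩
  · right; exact ⟨mkD a.corner.1 a.corner.2 (by omega) (by omega), rfl⟩

theorem Primal.ne_dual (i : Primal) (u : Dual) : i.1 ≠ u.1 := by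
  intro h; have h1 := i.mod; have h2 := u.mod; rw [h] at h1; omega

theorem Arc.next_isCorner (a : Arc) : IsCorner a.tile a.next := by
  have h := a.isCorner
  rw [isCorner_iff] at h ⊢; simp only [Arc.next]; omega

theorem Arc.prev_isCorner (a : Arc) : IsCorner a.tile a.prev := by
  have h := a.isCorner
  rw [isCorner_iff] at h ⊢; simp only [Arc.prev]; omega

/-- If an arc cuts off a primal corner, the neighbouring corners are dual. -/
theorem Arc.next_of_primal {a : Arc} {i : Primal} (h : a.corner = i.1) :
    ∃ u v : Dual, a.next = u.1 ∧ a.prev = v.1 := by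
  have hc := a.isCorner
  have := i.mod
  rw [isCorner_iff, h] at hc
  refine ⟨mkD a.next.1 a.next.2 ?_ ?_, mkD a.prev.1 a.prev.2 ?_ ?_, rfl, rfl⟩ <;>
    simp only [Arc.next, Arc.prev, h] <;> omega

theorem Arc.next_of_dual {a : Arc} {u : Dual} (h : a.corner = u.1) :
    ∃ i j : Primal, a.next = i.1 ∧ a.prev = j.1 := by
  have hc := a.isCorner
  have := u.mod
  rw [isCorner_iff, h] at hc
  refine ⟨mkP a.next.1 a.next.2 ?_ ?_, mkP a.prev.1 a.prev.2 ?_ ?_, rfl, rfl⟩ <;>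
    simp only [Arc.next, Arc.prev, h] <;> omega

theorem exists_crosses_of_mem_sides {a : Arc} {e : Sym2 Pt} (h : e ∈ a.sides) :
    ∃ i u, e = s(i.1, u.1) ∧ Crosses a i u := by
  rcases a.corner_cases with ⟨i, hi⟩ | ⟨u, hu⟩
  · obtain ⟨u, v, hu, hv⟩ := Arc.next_of_primal hi
    rcases h with h | h
    · exact ⟨i, u, by rw [h, hi, hu], hi ▸ a.isCorner, hu ▸ a.next_isCorner, Or.inl hi⟩
    · rw [Set.mem_singleton_iff] at h
      exact ⟨i, v, by rw [h, hi, hv], hi ▸ a.isCorner, hv ▸ a.prev_isCorner, Or.inl hi⟩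
  · obtain ⟨i, j, hi, hj⟩ := Arc.next_of_dual hu
    rcases h with h | h
    · exact ⟨i, u, by rw [h, hi, hu, Sym2.eq_swap], hi ▸ a.next_isCorner, hu ▸ a.isCorner, Or.inr hu⟩
    · rw [Set.mem_singleton_iff] at h
      exact ⟨j, u, by rw [h, hj, hu, Sym2.eq_swap], hj ▸ a.prev_isCorner, hu ▸ a.isCorner, Or.inr hu⟩

theorem Crosses.next_or_prev {a : Arc} {i : Primal} {u : Dual} (h : Crosses a i u) :
    (a.corner = i.1 ∧ (a.next = u.1 ∨ a.prev = u.1)) ∨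
    (a.corner = u.1 ∧ (a.next = i.1 ∨ a.prev = i.1)) := by
  obtain ⟨h1, h2, h3⟩ := h
  rw [isCorner_iff] at h1 h2
  have := i.mod; have := u.mod; have := a.tile.mod
  rcases h3 with h | h
  · left
    refine ⟨h, ?_⟩
    simp only [Arc.next, Arc.prev, h, Prod.ext_iff]
    omega
  · right
    refine ⟨h, ?_⟩
    simp only [Arc.next, Arc.prev, h, Prod.ext_iff]
    omega

theorem Crosses.mem_sides {a : Arc} {i : Primal} {u : Dual} (h : Crosses a i u) :
    s(i.1, u.1) ∈ a.sides := by
  rcases h.next_or_prev with ⟨h, h' | h'⟩ | ⟨h, h' | h'⟩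
  · left; rw [h, h']
  · right; rw [Set.mem_singleton_iff, h, h']
  · left; rw [h, h', Sym2.eq_swap]
  · right; rw [Set.mem_singleton_iff, h, h', Sym2.eq_swap]

theorem sides_inter_nonempty {a b : Arc} :
    (a.sides ∩ b.sides).Nonempty ↔ ∃ i u, Crosses a i u ∧ Crosses b i u := by
  constructor
  · rintro ⟨e, ha, hb⟩
    obtain ⟨i, u, rfl, h⟩ := exists_crosses_of_mem_sides ha
    obtain ⟨j, v, he, h'⟩ := exists_crosses_of_mem_sides hb
    rw [Sym2.eq_iff] at he
    rcases he with ⟨h1, h2⟩ | ⟨h1, h2⟩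
    · obtain rfl := Subtype.ext h1
      obtain rfl := Subtype.ext h2
      exact ⟨i, u, h, h'⟩
    · exact absurd h1 (Primal.ne_dual _ _)
  · rintro ⟨i, u, h, h'⟩
    exact ⟨_, h.mem_sides, h'.mem_sides⟩

theorem mem_arcs_primal {ω : Config} {a : Arc} {i : Primal} (h : a.corner = i.1) :
    a ∈ arcs ω ↔ ω a.tile = false := by
  have := i.mod
  have h' : ¬ (Odd a.corner.1 ∧ Odd a.corner.2) := by
    rw [h, Int.odd_iff]; omega
  simp [arcs, h']

theorem mem_arcs_dual {ω : Config} {a : Arc} {u : Dual} (h : a.corner = u.1) :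
    a ∈ arcs ω ↔ ω a.tile = true := by
  have h' : (Odd a.corner.1 ∧ Odd a.corner.2) := by
    rw [h]; exact u.2
  simp [arcs, h']

theorem Arc.exists_crosses (a : Arc) : ∃ i u, Crosses a i u := by
  obtain ⟨i, u, -, h⟩ := exists_crosses_of_mem_sides (a := a) (e := s(a.corner, a.next)) (Or.inl rfl)
  exact ⟨i, u, h⟩

/-- The two arcs of `ω` in a tile cut off corners of the same kind, and a side has one endpoint of
each kind, so it is met by only one of them. -/
theorem arc_eq_of_crosses {ω : Config} {a b : Arc} (ha : a ∈ arcs ω) (hb : b ∈ arcs ω)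
    (hab : a.tile = b.tile) {i : Primal} {u : Dual} (h1 : Crosses a i u) (h2 : Crosses b i u) :
    a = b := by
  apply Arc.ext' hab
  rcases h1.2.2 with h | h <;> rcases h2.2.2 with h' | h'
  · rw [h, h']
  · rw [mem_arcs_primal h] at ha; rw [mem_arcs_dual h', ← hab, ha] at hb; simp at hb
  · rw [mem_arcs_dual h] at ha; rw [mem_arcs_primal h', ← hab, ha] at hb; simp at hb
  · rw [h, h']

theorem exists_arc_crossing (ω : Config) {t : Tile} {i : Primal} {u : Dual} (hi : IsCorner t i.1)
    (hu : IsCorner t u.1) : ∃ a ∈ arcs ω, a.tile = t ∧ Crosses a i u := by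
  cases h : ω t
  · refine ⟨⟨(t, i.1), hi⟩, ?_, rfl, hi, hu, Or.inl rfl⟩
    rw [mem_arcs_primal (i := i) rfl]; exact h
  · refine ⟨⟨(t, u.1), hu⟩, ?_, rfl, hi, hu, Or.inr rfl⟩
    rw [mem_arcs_dual (u := u) rfl]; exact h

theorem arcGraph_adj {ω : Config} {a b : Arc} : (arcGraph ω).Adj a b ↔
    a ≠ b ∧ a ∈ arcs ω ∧ b ∈ arcs ω ∧ ∃ i u, Crosses a i u ∧ Crosses b i u := by
  simp only [arcGraph, SimpleGraph.fromRel_adj, sides_inter_nonempty]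
  constructor
  · rintro ⟨h, ⟨h1, h2, i, u, h3, h4⟩ | ⟨h1, h2, i, u, h3, h4⟩⟩
    exacts [⟨h, h1, h2, i, u, h3, h4⟩, ⟨h, h2, h1, i, u, h4, h3⟩]
  · rintro ⟨h, h'⟩; exact ⟨h, Or.inl h'⟩

/-! ### Curves of a configuration and propagation along them -/

/-- The curve through a given arc. -/
def curveOf (ω : Config) (a : Arc) : Set Arc := {b | (arcGraph ω).Reachable a b}

theorem isCurve_curveOf {ω : Config} {a : Arc} (ha : a ∈ arcs ω) : IsCurve ω (curveOf ω a) :=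
  ⟨a, ha, rfl⟩

theorem mem_curveOf (ω : Config) (a : Arc) : a ∈ curveOf ω a := SimpleGraph.Reachable.refl _

theorem reachable_induction {V : Type*} {G : SimpleGraph V} {P : V → Prop} {a b : V}
    (h : G.Reachable a b) (ha : P a) (hstep : ∀ x y, G.Adj x y → P x → P y) : P b := by
  obtain ⟨p⟩ := h
  induction p with
  | nil => exact ha
  | cons hadj _ ih => exact ih (hstep _ _ hadj ha)

theorem IsCurve.subset {ω : Config} {l : Set Arc} (h : IsCurve ω l) : l ⊆ arcs ω := by
  obtain ⟨a, ha, rfl⟩ := h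
  intro b hb
  exact reachable_induction hb ha fun x y hxy _ => (arcGraph_adj.1 hxy).2.2.1

theorem IsCurve.nonempty {ω : Config} {l : Set Arc} (h : IsCurve ω l) : l.Nonempty := by
  obtain ⟨a, ha, rfl⟩ := h
  exact ⟨a, SimpleGraph.Reachable.refl _⟩

theorem IsCurve.eq_curveOf {ω : Config} {l : Set Arc} (h : IsCurve ω l) {a : Arc} (ha : a ∈ l) :
    l = curveOf ω a := by
  obtain ⟨b, hb, rfl⟩ := h
  ext c
  exact ⟨fun hc => SimpleGraph.Reachable.trans (SimpleGraph.Reachable.symm ha) hc,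
    fun hc => SimpleGraph.Reachable.trans ha hc⟩

theorem IsCurve.eq_of_mem {ω : Config} {l l' : Set Arc} (h : IsCurve ω l) (h' : IsCurve ω l')
    {a : Arc} (ha : a ∈ l) (ha' : a ∈ l') : l = l' := by
  rw [h.eq_curveOf ha, h'.eq_curveOf ha']

theorem IsCurve.mem_of_crosses {ω : Config} {l : Set Arc} (h : IsCurve ω l) {a b : Arc}
    (ha : a ∈ l) (hb : b ∈ arcs ω) {i : Primal} {u : Dual} (h1 : Crosses a i u)
    (h2 : Crosses b i u) : b ∈ l := by
  by_cases hab : a = b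
  · exact hab ▸ ha
  · have : (arcGraph ω).Adj a b := arcGraph_adj.2 ⟨hab, h.subset ha, hb, i, u, h1, h2⟩
    rw [h.eq_curveOf ha]
    exact this.reachable

/-- Connectivity of a curve is used in this form: a property that passes across every common side of
two arcs of the curve holds along all of it. -/
theorem IsCurve.induction {ω : Config} {l : Set Arc} (h : IsCurve ω l) {P : Arc → Prop} {a b : Arc}
    (ha : a ∈ l) (hb : b ∈ l) (hP : P a)
    (hstep : ∀ x ∈ l, ∀ y ∈ l, ∀ i u, Crosses x i u → Crosses y i u → P x → P y) : P b := by
  rw [h.eq_curveOf ha] at hb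
  have : b ∈ l ∧ P b := by
    refine reachable_induction (P := fun c => c ∈ l ∧ P c) hb ⟨ha, hP⟩ ?_
    rintro x y hxy ⟨hx, hPx⟩
    obtain ⟨-, -, hy, i, u, h1, h2⟩ := arcGraph_adj.1 hxy
    have hy' := h.mem_of_crosses hx hy h1 h2
    exact ⟨hy', hstep x hx y hy' i u h1 h2 hPx⟩
  exact this.2

/-- A function that is constant along the open edges which a curve follows is constant on the
primal side of the curve. -/
theorem IsCurve.const_primal {ω : Config} {l : Set Arc} (h : IsCurve ω l) {X : Type*}
    (φ : Primal → X)
    (hφ : ∀ a ∈ l, ω a.tile = true → ∀ i ∈ edgeEnds a.tile, ∀ j ∈ edgeEnds a.tile, φ i = φ j)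
    {a b : Arc} (ha : a ∈ l) (hb : b ∈ l) {i j : Primal} {u v : Dual} (h1 : Crosses a i u)
    (h2 : Crosses b j v) : φ i = φ j := by
  -- Within one arc: in a closed tile both crossed sides have the cut-off primal corner as endpoint;
  -- in an open tile the two primal corners are joined by the open edge.
  have key : ∀ c ∈ l, ∀ i j u v, Crosses c i u → Crosses c j v → φ i = φ j := by
    intro c hc i j u v h1 h2
    cases hω : ω c.tile
    · have : ∀ i u, Crosses c i u → c.corner = i.1 := by
        intro i u hx
        rcases hx.2.2 with h' | h'
        · exact h'
        · have := (mem_arcs_dual h').1 (h.subset hc)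
          simp [hω] at this
      rw [Subtype.ext ((this i u h1).symm.trans (this j v h2))]
    · exact hφ c hc hω i h1.1 j h2.1
  refine h.induction (P := fun c => ∀ j v, Crosses c j v → φ i = φ j) ha hb
    (fun j v h => key a ha i j u v h1 h) ?_ j v h2
  intro x hx y hy k w hxk hyk hP j v hyj
  rw [hP k w hxk, key y hy k j w v hyk hyj]

theorem IsCurve.const_dual {ω : Config} {l : Set Arc} (h : IsCurve ω l) {X : Type*}
    (φ : Dual → X)
    (hφ : ∀ a ∈ l, ω a.tile = false → ∀ i ∈ dualEnds a.tile, ∀ j ∈ dualEnds a.tile, φ i = φ j)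
    {a b : Arc} (ha : a ∈ l) (hb : b ∈ l) {i j : Primal} {u v : Dual} (h1 : Crosses a i u)
    (h2 : Crosses b j v) : φ u = φ v := by
  have key : ∀ c ∈ l, ∀ i j u v, Crosses c i u → Crosses c j v → φ u = φ v := by
    intro c hc i j u v h1 h2
    cases hω : ω c.tile
    · exact hφ c hc hω u h1.2.1 v h2.2.1
    · have : ∀ i u, Crosses c i u → c.corner = u.1 := by
        intro i u hx
        rcases hx.2.2 with h' | h'
        · have := (mem_arcs_primal h').1 (h.subset hc)
          simp [hω] at this
        · exact h'
      rw [Subtype.ext ((this i u h1).symm.trans (this j v h2))]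
  refine h.induction (P := fun c => ∀ j v, Crosses c j v → φ u = φ v) ha hb
    (fun j v h => key a ha i j u v h1 h) ?_ j v h2
  intro x hx y hy k w hxk hyk hP j v hyj
  rw [hP k w hxk, key y hy k j w v hyk hyj]

/-- A curve only depends on the configuration in the tiles which it visits. -/
theorem IsCurve.congr {ω ω' : Config} {l : Set Arc} (h : IsCurve ω l)
    (hω : ∀ a ∈ l, ω a.tile = ω' a.tile) : IsCurve ω' l := by
  have harcs : ∀ a : Arc, ω a.tile = ω' a.tile → (a ∈ arcs ω ↔ a ∈ arcs ω') := by
    intro a h; simp [arcs, h]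
  obtain ⟨a, ha⟩ := h.nonempty
  refine ⟨a, (harcs a (hω a ha)).1 (h.subset ha), ?_⟩
  apply Set.Subset.antisymm
  · intro b hb
    refine h.induction (P := fun b => (arcGraph ω').Reachable a b) ha hb
      (SimpleGraph.Reachable.refl _) ?_
    intro x hx y hy i u hxi hyi hP
    by_cases hxy : x = y
    · exact hxy ▸ hP
    · refine hP.trans (SimpleGraph.Adj.reachable (arcGraph_adj.2 ⟨hxy, ?_, ?_, i, u, hxi, hyi⟩))
      · exact (harcs x (hω x hx)).1 (h.subset hx)
      · exact (harcs y (hω y hy)).1 (h.subset hy)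
  · intro b hb
    refine reachable_induction (P := fun b => b ∈ l) hb ha ?_
    intro x y hxy hx
    obtain ⟨-, -, hy, i, u, hxi, hyi⟩ := arcGraph_adj.1 hxy
    -- The arc of `ω` in the tile of `y` that continues `x` belongs to `l`; hence the two
    -- configurations agree in that tile, and this arc is `y`.
    obtain ⟨c, hc, hct, hci⟩ := exists_arc_crossing ω hyi.1 hyi.2.1
    have hcl := h.mem_of_crosses hx hc hxi hci
    have : c = y := by
      refine arc_eq_of_crosses (ω := ω') ?_ hy hct hci hyi
      exact (harcs c (hω c hcl)).1 hc
    exact this ▸ hcl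

/-! ### The parity rule -/

/-- The set `l` contains an arc that crosses the side between `i` and `u`. -/
def CrossedBy (l : Set Arc) (i : Primal) (u : Dual) : Prop := ∃ a ∈ l, Crosses a i u

open Classical in
/-- The indicator function of a set of arcs. -/
def arcInd (l : Set Arc) (t z : Pt) : ZMod 2 :=
  if ∃ a ∈ l, a.tile.1 = t ∧ a.corner = z then 1 else 0

/-- The set of arcs that the horizontal ray from `z` crosses. -/
def raySet (l : Set Arc) (z : Pt) : Set Arc :=
  {a ∈ l | a.tile.1.2 = z.2 ∧ a.corner.2 = z.2 ∧ z.1 < a.tile.1.1}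

/-- The parity of the number of arcs that the horizontal ray from `z` crosses. -/
def sur (l : Set Arc) (z : Pt) : ZMod 2 := ((raySet l z).ncard : ZMod 2)

theorem sur_eq_one {l : Set Arc} {z : Pt} : sur l z = 1 ↔ Surrounds l z := by
  rw [sur, ZMod.natCast_eq_one_iff_odd]; rfl

theorem sur_eq_zero {l : Set Arc} {z : Pt} : sur l z = 0 ↔ ¬ Surrounds l z := by
  rw [← sur_eq_one]; generalize sur l z = x; revert x; decide

open Classical in
theorem arcInd_eq_ncard (l : Set Arc) (t z : Pt) :
    arcInd l t z = ({a ∈ l | a.tile.1 = t ∧ a.corner = z}.ncard : ZMod 2) := by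
  unfold arcInd
  split_ifs with h
  · obtain ⟨a, ha, h1, h2⟩ := h
    have : {a ∈ l | a.tile.1 = t ∧ a.corner = z} = {a} := by
      ext b
      simp only [Set.mem_ofPred_eq, Set.mem_singleton_iff]
      constructor
      · rintro ⟨-, h3, h4⟩; exact Arc.ext' (Subtype.ext (h3.trans h1.symm)) (h4.trans h2.symm)
      · rintro rfl; exact ⟨ha, h1, h2⟩
    rw [this]; simp
  · have : {a ∈ l | a.tile.1 = t ∧ a.corner = z} = ∅ := by
      ext b
      simp only [Set.mem_ofPred_eq, Set.mem_empty_iff_false, iff_false]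
      rintro ⟨h1, h2⟩; exact h ⟨b, h1, h2⟩
    rw [this]; simp

/-- Between `z` and `z + (2, 0)` there is exactly one tile, and the arcs of it that meet the
horizontal line are those around its left and right corners. -/
theorem sur_step {l : Set Arc} (hl : l.Finite) (z : Pt) (hz : (z.1 + z.2) % 2 = 0) :
    sur l z = arcInd l (z.1 + 1, z.2) z + arcInd l (z.1 + 1, z.2) (z.1 + 2, z.2) +
      sur l (z.1 + 2, z.2) := by
  have hsplit : raySet l z = ({a ∈ l | a.tile.1 = (z.1 + 1, z.2) ∧ a.corner = z} ∪
      {a ∈ l | a.tile.1 = (z.1 + 1, z.2) ∧ a.corner = (z.1 + 2, z.2)}) ∪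
      raySet l (z.1 + 2, z.2) := by
    ext a
    have h1 := a.isCorner
    have h2 := a.tile.mod
    rw [isCorner_iff] at h1
    simp only [raySet, Set.mem_union, Set.mem_ofPred_eq, Prod.ext_iff]
    by_cases ha : a ∈ l
    · simp only [ha, true_and]; omega
    · simp [ha]
  have hf : ∀ P : Arc → Prop, {a ∈ l | P a}.Finite := fun P => hl.subset fun a ha => ha.1
  have hr : (raySet l (z.1 + 2, z.2)).Finite := hl.subset fun a ha => ha.1
  rw [sur, hsplit, Set.ncard_union_eq _ ((hf _).union (hf _)) hr, Set.ncard_union_eq _ (hf _) (hf _)]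
  · rw [arcInd_eq_ncard, arcInd_eq_ncard, sur]; push_cast; rfl
  · rw [Set.disjoint_left]
    rintro a ⟨-, -, h⟩ ⟨-, -, h'⟩
    rw [h, Prod.ext_iff] at h'; simp at h'
  · rw [Set.disjoint_left]
    rintro a (⟨-, h, -⟩ | ⟨-, h, -⟩) ⟨-, -, -, h'⟩ <;> rw [h] at h' <;> simp at h'

theorem sur_of_forall_lt {l : Set Arc} {z : Pt} (h : ∀ a ∈ l, a.tile.1.1 ≤ z.1) : sur l z = 0 := by
  have : raySet l z = ∅ := by
    ext a; simp only [raySet, Set.mem_ofPred_eq, Set.mem_empty_iff_false, iff_false]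
    rintro ⟨ha, -, -, h'⟩; have := h a ha; omega
  simp [sur, this]

theorem sur_of_row {l : Set Arc} {z : Pt} (h : ∀ a ∈ l, a.tile.1.2 ≠ z.2) : sur l z = 0 := by
  have : raySet l z = ∅ := by
    ext a; simp only [raySet, Set.mem_ofPred_eq, Set.mem_empty_iff_false, iff_false]
    rintro ⟨ha, h', -⟩; exact h a ha h'
  simp [sur, this]

open Classical in
-- The only arc of `ω` in `t` that meets this side cuts off exactly one of the two endpoints, and it
-- is in `l` as soon as `l` meets the side from either tile.
theorem IsCurve.arcInd_add {ω : Config} {l : Set Arc} (h : IsCurve ω l) {i : Primal} {u : Dual}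
    {t : Tile} (hi : IsCorner t i.1) (hu : IsCorner t u.1) :
    arcInd l t.1 i.1 + arcInd l t.1 u.1 = if CrossedBy l i u then 1 else 0 := by
  obtain ⟨a, ha, hat, hac⟩ := exists_arc_crossing ω hi hu
  have hmem : CrossedBy l i u ↔ a ∈ l :=
    ⟨fun ⟨b, hb, hbc⟩ => h.mem_of_crosses hb ha hbc hac, fun hal => ⟨a, hal, hac⟩⟩
  have key : ∀ z : Pt, (∃ b ∈ l, b.tile.1 = t.1 ∧ b.corner = z) → (z = i.1 ∨ z = u.1) →
      a ∈ l ∧ a.corner = z := by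
    rintro z ⟨b, hb, hbt, hbz⟩ hz
    have hbt' : b.tile = t := Subtype.ext hbt
    have hbc : Crosses b i u := ⟨hbt' ▸ hi, hbt' ▸ hu, by rw [hbz]; exact hz⟩
    have : b = a := arc_eq_of_crosses (h.subset hb) ha (hbt'.trans hat.symm) hbc hac
    exact this ▸ ⟨hb, hbz⟩
  by_cases hal : a ∈ l
  · rw [if_pos (hmem.2 hal)]
    rcases hac.2.2 with hc | hc
    · have h1 : arcInd l t.1 i.1 = 1 := if_pos ⟨a, hal, by rw [hat], hc⟩
      have h2 : arcInd l t.1 u.1 = 0 := if_neg fun hex =>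
        Primal.ne_dual i u (hc.symm.trans (key _ hex (Or.inr rfl)).2)
      rw [h1, h2]; rfl
    · have h1 : arcInd l t.1 u.1 = 1 := if_pos ⟨a, hal, by rw [hat], hc⟩
      have h2 : arcInd l t.1 i.1 = 0 := if_neg fun hex =>
        Primal.ne_dual i u ((key _ hex (Or.inl rfl)).2.symm.trans hc)
      rw [h1, h2]; rfl
  · rw [if_neg fun hc => hal (hmem.1 hc)]
    have h1 : arcInd l t.1 i.1 = 0 := if_neg fun hex => hal (key _ hex (Or.inl rfl)).1
    have h2 : arcInd l t.1 u.1 = 0 := if_neg fun hex => hal (key _ hex (Or.inr rfl)).1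
    rw [h1, h2]; rfl

/-- The two tiles at a side see the same arc of a curve. -/
theorem IsCurve.arcInd_closed {ω : Config} {l : Set Arc} (h : IsCurve ω l) (p : Pt) (e : ℤ)
    (he : e = 1 ∨ e = -1) (hp : (p.1 + p.2) % 2 = 0) :
    arcInd l (p.1, p.2 + e) p + arcInd l (p.1, p.2 + e) (p.1 + 1, p.2 + e) =
    arcInd l (p.1 + 1, p.2) p + arcInd l (p.1 + 1, p.2) (p.1 + 1, p.2 + e) := by
  let T₁ : Tile := mkT p.1 (p.2 + e) (by omega)
  let T₂ : Tile := mkT (p.1 + 1) p.2 (by omega)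
  have c1 : IsCorner T₁ p := by rw [isCorner_iff]; simp [T₁]; omega
  have c2 : IsCorner T₂ p := by rw [isCorner_iff]; simp [T₂]
  have c3 : IsCorner T₁ (p.1 + 1, p.2 + e) := by rw [isCorner_iff]; simp [T₁]
  have c4 : IsCorner T₂ (p.1 + 1, p.2 + e) := by rw [isCorner_iff]; simp [T₂]; omega
  by_cases hp1 : p.1 % 2 = 0
  · let i : Primal := mkP p.1 p.2 hp1 (by omega)
    let u : Dual := mkD (p.1 + 1) (p.2 + e) (by omega) (by omega)
    have h1 := h.arcInd_add (i := i) (u := u) (t := T₁) c1 c3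
    have h2 := h.arcInd_add (i := i) (u := u) (t := T₂) c2 c4
    exact h1.trans h2.symm
  · let u : Dual := mkD p.1 p.2 (by omega) (by omega)
    let i : Primal := mkP (p.1 + 1) (p.2 + e) (by omega) (by omega)
    have h1 := h.arcInd_add (i := i) (u := u) (t := T₁) c3 c1
    have h2 := h.arcInd_add (i := i) (u := u) (t := T₂) c4 c2
    rw [add_comm] at h1 h2
    exact h1.trans h2.symm

theorem zmod2_add_self (x : ZMod 2) : x + x = 0 := by revert x; decide

/-- Let `X` be the sum of both sides of the identity. By `sur_step` and `arcInd_closed`, `X` is the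
same after one diagonal step to the right with the vertical direction reversed. Zigzagging beyond
the loop makes every term vanish. -/
theorem IsCurve.sur_diag {ω : Config} {l : Set Arc} (h : IsCurve ω l) (hl : l.Finite) (z : Pt)
    (hz : (z.1 + z.2) % 2 = 0) (e : ℤ) (he : e = 1 ∨ e = -1) :
    sur l z + sur l (z.1 + 1, z.2 + e) =
      arcInd l (z.1 + 1, z.2) z + arcInd l (z.1 + 1, z.2) (z.1 + 1, z.2 + e) := by
  obtain ⟨N, hN⟩ : ∃ N : ℤ, ∀ a ∈ l, a.tile.1.1 ≤ N := by
    obtain ⟨N, hN⟩ := (hl.image fun a : Arc => a.tile.1.1).bddAbove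
    exact ⟨N, fun a ha => hN ⟨a, ha, rfl⟩⟩
  let X : Pt → ℤ → ZMod 2 := fun z e => sur l z + sur l (z.1 + 1, z.2 + e) +
    (arcInd l (z.1 + 1, z.2) z + arcInd l (z.1 + 1, z.2) (z.1 + 1, z.2 + e))
  have hstep : ∀ (z : Pt) (e : ℤ), (z.1 + z.2) % 2 = 0 → (e = 1 ∨ e = -1) →
      X z e = X (z.1 + 1, z.2 + e) (-e) := by
    intro z e hz he
    have h1 := sur_step hl z hz
    have h2 := h.arcInd_closed (z.1 + 1, z.2 + e) (-e) (by omega) (by simp; omega)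
    have e1 : z.1 + 1 + 1 = z.1 + 2 := by ring
    have e2 : z.2 + e + -e = z.2 := by ring
    simp only [X]
    simp only [e1, e2] at h2 ⊢
    rw [h1, ← h2]
    have := zmod2_add_self (arcInd l (z.1 + 1, z.2) z)
    linear_combination this
  have hfar : ∀ (z : Pt) (e : ℤ), N ≤ z.1 → X z e = 0 := by
    intro z e hz
    have h1 : sur l z = 0 := sur_of_forall_lt fun a ha => (hN a ha).trans hz
    have h2 : sur l (z.1 + 1, z.2 + e) = 0 := sur_of_forall_lt fun a ha => by
      have := hN a ha; simp; omega
    have h3 : ∀ w, arcInd l (z.1 + 1, z.2) w = 0 := by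
      intro w
      refine if_neg ?_
      rintro ⟨a, ha, h3, -⟩
      have := hN a ha
      rw [h3] at this; simp at this; omega
    simp [X, h1, h2, h3]
  have hall : ∀ (k : ℕ) (z : Pt) (e : ℤ), (z.1 + z.2) % 2 = 0 → (e = 1 ∨ e = -1) → N ≤ z.1 + k →
      X z e = 0 := by
    intro k
    induction k with
    | zero => intro z e _ _ h; exact hfar z e (by simpa using h)
    | succ k ih =>
      intro z e hz he hk
      rw [hstep z e hz he]
      exact ih _ _ (by simp only; omega) (by omega) (by push_cast at hk; simp only; omega)
  have := hall (N - z.1).toNat z e hz he (by omega)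
  simp only [X] at this
  rwa [CharTwo.add_eq_zero] at this

open Classical in
/-- Two adjacent vertices are on different sides of a loop iff the loop crosses the side
between them. -/
theorem IsCurve.sur_add {ω : Config} {l : Set Arc} (h : IsCurve ω l) (hl : l.Finite)
    {i : Primal} {u : Dual} (hiu : Beside i u) :
    sur l i.1 + sur l u.1 = if CrossedBy l i u then 1 else 0 := by
  have hi := i.mod
  have hu := u.mod
  obtain ⟨h1, h2⟩ := hiu
  obtain ⟨e, he, hy⟩ : ∃ e : ℤ, (e = 1 ∨ e = -1) ∧ u.1.2 = i.1.2 + e := by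
    rcases h2 with h2 | h2
    · exact ⟨1, Or.inl rfl, h2⟩
    · exact ⟨-1, Or.inr rfl, h2⟩
  -- `sur_diag` only treats steps to the right; if the dual vertex is to the left of the primal one,
  -- it is taken as the starting point.
  rcases h1 with h1 | h1
  · have h3 := h.sur_diag hl i.1 (by omega) e he
    have h4 : u.1 = (i.1.1 + 1, i.1.2 + e) := Prod.ext h1 hy
    have hT : (tile₂ i u).1 = (i.1.1 + 1, i.1.2) := Prod.ext h1 rfl
    have c := Beside.corner₂ (i := i) (u := u) ⟨Or.inl h1, h2⟩
    have h5 := h.arcInd_add c.1 c.2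
    rw [← h5, hT, h4]; exact h3
  · have h3 := h.sur_diag hl u.1 (by omega) (-e) (by omega)
    have h4 : i.1 = (u.1.1 + 1, u.1.2 + -e) := Prod.ext (by omega) (by simp only; omega)
    have hT : (tile₁ i u).1 = (u.1.1 + 1, u.1.2) := Prod.ext (by simp [tile₁]; omega) rfl
    have c := Beside.corner₁ (i := i) (u := u) ⟨Or.inr h1, h2⟩
    have h5 := h.arcInd_add c.1 c.2
    rw [← h5, hT, add_comm (sur l i.1), add_comm (arcInd l _ i.1), h4]; exact h3

theorem IsCurve.surrounds_iff {ω : Config} {l : Set Arc} (h : IsCurve ω l) (hl : l.Finite)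
    {i : Primal} {u : Dual} (hiu : Beside i u) :
    CrossedBy l i u ↔ ¬ (Surrounds l i.1 ↔ Surrounds l u.1) := by
  have := h.sur_add hl hiu
  rw [← sur_eq_one, ← sur_eq_one]
  by_cases hc : CrossedBy l i u
  · simp only [hc, if_true, true_iff] at this ⊢
    generalize sur l i.1 = x at *; generalize sur l u.1 = y at *
    revert x y; decide
  · simp only [hc, if_false, false_iff, not_not] at this ⊢
    generalize sur l i.1 = x at *; generalize sur l u.1 = y at *
    revert x y; decide


/-! ### Chains modulo two -/

/-- The value of a function on tiles at the tile with given coordinates. -/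
def tv (h : Tile → ZMod 2) (x y : ℤ) : ZMod 2 :=
  if hp : (x + y) % 2 = 1 then h (mkT x y hp) else 0

theorem tv_tile (h : Tile → ZMod 2) (t : Tile) : tv h t.1.1 t.1.2 = h t := by
  rw [tv, dif_pos t.mod]; rfl

theorem tv_eq (h : Tile → ZMod 2) (t : Tile) {x y : ℤ} (hx : t.1.1 = x) (hy : t.1.2 = y) :
    tv h x y = h t := by
  rw [← hx, ← hy, tv_tile]

/-- The number modulo two of elements of `h` on the horizontal ray from `z`. -/
def ray (S : Finset Tile) (h : Tile → ZMod 2) (z : Pt) : ZMod 2 :=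
  ∑ t ∈ S, if t.1.2 = z.2 ∧ z.1 < t.1.1 then h t else 0

/-- The sum of `h` over the tiles at `z`. -/
def bdry (h : Tile → ZMod 2) (z : Pt) : ZMod 2 :=
  tv h (z.1 + 1) z.2 + tv h (z.1 - 1) z.2 + tv h z.1 (z.2 + 1) + tv h z.1 (z.2 - 1)

theorem ray_step {S : Finset Tile} {h : Tile → ZMod 2} (hS : ∀ t, t ∉ S → h t = 0) (z : Pt)
    (hz : (z.1 + z.2) % 2 = 0) :
    ray S h z = tv h (z.1 + 1) z.2 + ray S h (z.1 + 2, z.2) := by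
  have hp : (z.1 + 1 + z.2) % 2 = 1 := by omega
  have h1 : tv h (z.1 + 1) z.2 = ∑ t ∈ S, if t = mkT (z.1 + 1) z.2 hp then h t else 0 := by
    rw [Finset.sum_ite_eq', tv, dif_pos hp]
    split_ifs with h'
    · rfl
    · exact hS _ h'
  rw [h1, ray, ray, ← Finset.sum_add_distrib]
  refine Finset.sum_congr rfl fun t _ => ?_
  have ht := t.mod
  have : t = mkT (z.1 + 1) z.2 hp ↔ t.1.1 = z.1 + 1 ∧ t.1.2 = z.2 :=
    ⟨fun h => by rw [h]; simp, fun h => Tile.ext' h.1 h.2⟩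
  simp only [this]
  by_cases a1 : t.1.2 = z.2
  · by_cases a2 : t.1.1 = z.1 + 1
    · rw [if_pos (by omega), if_pos (by omega), if_neg (by omega), add_zero]
    · rw [if_neg (c := t.1.1 = z.1 + 1 ∧ t.1.2 = z.2) (by omega), zero_add]
      congr 1
      simp only [eq_iff_iff]; omega
  · rw [if_neg (by omega), if_neg (by omega), if_neg (by omega), add_zero]

theorem ray_far {S : Finset Tile} (h : Tile → ZMod 2) {z : Pt} (hz : ∀ t ∈ S, t.1.1 ≤ z.1) :
    ray S h z = 0 :=
  Finset.sum_eq_zero fun t ht => if_neg fun h' => by have := hz t ht; omega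

/-- Adding up the evenness conditions at the points of the intermediate row to the right of `z`
cancels all tiles of that row except the first. The induction runs from beyond the support back to
`z`, and evenness is needed only at points of the other lattice. -/
theorem ray_up {S : Finset Tile} {h : Tile → ZMod 2} (hS : ∀ t, t ∉ S → h t = 0) (z : Pt)
    (hz : (z.1 + z.2) % 2 = 0)
    (hev : ∀ w : Pt, w.1 % 2 ≠ z.1 % 2 → w.2 % 2 ≠ z.2 % 2 → bdry h w = 0) :
    ray S h z + ray S h (z.1, z.2 + 2) = tv h z.1 (z.2 + 1) := by
  obtain ⟨N, hN⟩ : ∃ N : ℤ, ∀ a ∈ S, a.1.1 < N := by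
    obtain ⟨N, hN⟩ := (S.finite_toSet.image fun a : Tile => a.1.1).bddAbove
    exact ⟨N + 1, fun a ha => Int.lt_add_one_iff.2 (hN ⟨a, ha, rfl⟩)⟩
  have hall : ∀ (k : ℕ) (z : Pt), (z.1 + z.2) % 2 = 0 →
      (∀ w : Pt, w.1 % 2 ≠ z.1 % 2 → w.2 % 2 ≠ z.2 % 2 → bdry h w = 0) → N ≤ z.1 + k →
      ray S h z + ray S h (z.1, z.2 + 2) + tv h z.1 (z.2 + 1) = 0 := by
    intro k
    induction k with
    | zero =>
      intro z hz _ hk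
      rw [ray_far h, ray_far h, tv]
      · split_ifs with hp
        · rw [hS, add_zero, add_zero]
          intro hmem; have := hN _ hmem; simp at this; omega
        · simp
      · intro t ht; have := hN t ht; simp at hk; simp; omega
      · intro t ht; have := hN t ht; simp at hk; omega
    | succ k ih =>
      intro z hz hev hk
      have h1 := ray_step hS z hz
      have h2 := ray_step hS (z.1, z.2 + 2) (by simp; omega)
      have h3 := ih (z.1 + 2, z.2) (by simp; omega)
        (fun w h1 h2 => hev w (by simp at h1; omega) h2) (by push_cast at hk; simp; omega)
      have h4 := hev (z.1 + 1, z.2 + 1) (by simp; omega) (by simp; omega)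
      simp only [bdry] at h4
      have e1 : z.1 + 1 + 1 = z.1 + 2 := by ring
      have e2 : z.1 + 1 - 1 = z.1 := by ring
      have e3 : z.2 + 1 + 1 = z.2 + 2 := by ring
      have e4 : z.2 + 1 - 1 = z.2 := by ring
      rw [e1, e2, e3, e4] at h4
      simp only at h1 h2 h3
      rw [h1, h2]
      have h5 := zmod2_add_self (tv h (z.1 + 2) (z.2 + 1))
      linear_combination h3 + h4 - h5
  have := hall (N - z.1).toNat z hz hev (by omega)
  rwa [CharTwo.add_eq_zero] at this

/-! ### Coboundaries of functions on the two lattices -/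

/-- The disagreement of a function on primal vertices along an edge. -/
def cobP (φ : Primal → ZMod 2) (t : Tile) : ZMod 2 :=
  φ (exists_edgeEnds t).choose + φ (exists_edgeEnds t).choose_spec.choose

/-- The disagreement of a function on dual vertices along a dual edge. -/
def cobD (φ : Dual → ZMod 2) (t : Tile) : ZMod 2 :=
  φ (exists_dualEnds t).choose + φ (exists_dualEnds t).choose_spec.choose

theorem cobP_eq (φ : Primal → ZMod 2) {t : Tile} {i j : Primal} (hi : i ∈ edgeEnds t)
    (hj : j ∈ edgeEnds t) (hij : i ≠ j) : cobP φ t = φ i + φ j := by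
  obtain ⟨-, -, -, h, -⟩ := (exists_edgeEnds t).choose_spec.choose_spec
  rw [cobP]
  rcases h i hi with h1 | h1 <;> rcases h j hj with h2 | h2
  · exact absurd (h1.trans h2.symm) hij
  · exact congrArg₂ (fun x y => φ x + φ y) h1.symm h2.symm
  · rw [add_comm (φ i)]; exact congrArg₂ (fun x y => φ x + φ y) h2.symm h1.symm
  · exact absurd (h1.trans h2.symm) hij

theorem cobD_eq (φ : Dual → ZMod 2) {t : Tile} {i j : Dual} (hi : i ∈ dualEnds t)
    (hj : j ∈ dualEnds t) (hij : i ≠ j) : cobD φ t = φ i + φ j := by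
  obtain ⟨-, -, -, h, -⟩ := (exists_dualEnds t).choose_spec.choose_spec
  rw [cobD]
  rcases h i hi with h1 | h1 <;> rcases h j hj with h2 | h2
  · exact absurd (h1.trans h2.symm) hij
  · exact congrArg₂ (fun x y => φ x + φ y) h1.symm h2.symm
  · rw [add_comm (φ i)]; exact congrArg₂ (fun x y => φ x + φ y) h2.symm h1.symm
  · exact absurd (h1.trans h2.symm) hij

theorem cobP_eq_zero (φ : Primal → ZMod 2) (t : Tile) :
    cobP φ t = 0 ↔ ∀ i ∈ edgeEnds t, ∀ j ∈ edgeEnds t, φ i = φ j := by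
  obtain ⟨i, j, hi, hj, hij, hall, -⟩ := exists_edgeEnds t
  rw [cobP_eq φ hi hj hij, CharTwo.add_eq_zero]
  constructor
  · intro h k hk l hl
    rcases hall k hk with rfl | rfl <;> rcases hall l hl with rfl | rfl <;> simp [h]
  · intro h; exact h i hi j hj

theorem cobD_eq_zero (φ : Dual → ZMod 2) (t : Tile) :
    cobD φ t = 0 ↔ ∀ i ∈ dualEnds t, ∀ j ∈ dualEnds t, φ i = φ j := by
  obtain ⟨i, j, hi, hj, hij, hall, -⟩ := exists_dualEnds t
  rw [cobD_eq φ hi hj hij, CharTwo.add_eq_zero]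
  constructor
  · intro h k hk l hl
    rcases hall k hk with rfl | rfl <;> rcases hall l hl with rfl | rfl <;> simp [h]
  · intro h; exact h i hi j hj

/-- A function that agrees along two coordinate steps is constant on a half line. -/
theorem int_const_up {X : Type*} (f : ℤ → X) (a b : ℤ) (hab : a ≤ b)
    (h : ∀ x, a ≤ x → x < b → f (x + 1) = f x) : f b = f a := by
  obtain ⟨k, rfl⟩ : ∃ k : ℕ, b = a + k := ⟨(b - a).toNat, by omega⟩
  clear hab
  induction k with
  | zero => simp
  | succ k ih =>
    have h1 := h (a + k) (by omega) (by push_cast; omega)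
    push_cast
    rw [← add_assoc, h1]
    exact ih fun x hx hx' => h x hx (by push_cast; omega)

theorem primal_row_const {X : Type*} (φ : Primal → X) {i j : Primal} (hy : i.1.2 = j.1.2)
    (hx : i.1.1 ≤ j.1.1)
    (h : ∀ t : Tile, t.1.2 = i.1.2 → i.1.1 < t.1.1 → t.1.1 < j.1.1 →
      ∀ k ∈ edgeEnds t, ∀ l ∈ edgeEnds t, φ k = φ l) : φ i = φ j := by
  have hi := i.mod; have hj := j.mod
  have := int_const_up (fun x => φ (mkP (2 * x) i.1.2 (by omega) hi.2)) (i.1.1 / 2) (j.1.1 / 2)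
    (by omega) ?_
  · have e1 : mkP (2 * (i.1.1 / 2)) i.1.2 (by omega) hi.2 = i := Primal.ext' (by simp; omega) rfl
    have e2 : mkP (2 * (j.1.1 / 2)) i.1.2 (by omega) hi.2 = j := Primal.ext' (by simp; omega) hy
    simp only [e1, e2] at this
    exact this.symm
  · intro x h1 h2
    refine h (mkT (2 * x + 1) i.1.2 (by omega)) rfl ?_ ?_ _ ?_ _ ?_
    · simp; omega
    · simp; omega
    · rw [mem_edgeEnds, isCorner_iff]; simp; omega
    · rw [mem_edgeEnds, isCorner_iff]; simp

theorem primal_col_const {X : Type*} (φ : Primal → X) {i j : Primal} (hx : i.1.1 = j.1.1)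
    (hy : i.1.2 ≤ j.1.2)
    (h : ∀ t : Tile, t.1.1 = i.1.1 → i.1.2 < t.1.2 → t.1.2 < j.1.2 →
      ∀ k ∈ edgeEnds t, ∀ l ∈ edgeEnds t, φ k = φ l) : φ i = φ j := by
  have hi := i.mod; have hj := j.mod
  have := int_const_up (fun x => φ (mkP i.1.1 (2 * x) hi.1 (by omega))) (i.1.2 / 2) (j.1.2 / 2)
    (by omega) ?_
  · have e1 : mkP i.1.1 (2 * (i.1.2 / 2)) hi.1 (by omega) = i := Primal.ext' rfl (by simp; omega)
    have e2 : mkP i.1.1 (2 * (j.1.2 / 2)) hi.1 (by omega) = j := Primal.ext' hx (by simp; omega)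
    simp only [e1, e2] at this
    exact this.symm
  · intro x h1 h2
    refine h (mkT i.1.1 (2 * x + 1) (by omega)) rfl ?_ ?_ _ ?_ _ ?_
    · simp; omega
    · simp; omega
    · rw [mem_edgeEnds, isCorner_iff]; simp; omega
    · rw [mem_edgeEnds, isCorner_iff]; simp

theorem dual_row_const {X : Type*} (φ : Dual → X) {i j : Dual} (hy : i.1.2 = j.1.2)
    (hx : i.1.1 ≤ j.1.1)
    (h : ∀ t : Tile, t.1.2 = i.1.2 → i.1.1 < t.1.1 → t.1.1 < j.1.1 →
      ∀ k ∈ dualEnds t, ∀ l ∈ dualEnds t, φ k = φ l) : φ i = φ j := by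
  have hi := i.mod; have hj := j.mod
  have := int_const_up (fun x => φ (mkD (2 * x + 1) i.1.2 (by omega) hi.2)) (i.1.1 / 2) (j.1.1 / 2)
    (by omega) ?_
  · have e1 : mkD (2 * (i.1.1 / 2) + 1) i.1.2 (by omega) hi.2 = i := Dual.ext' (by simp; omega) rfl
    have e2 : mkD (2 * (j.1.1 / 2) + 1) i.1.2 (by omega) hi.2 = j := Dual.ext' (by simp; omega) hy
    simp only [e1, e2] at this
    exact this.symm
  · intro x h1 h2
    refine h (mkT (2 * x + 2) i.1.2 (by omega)) rfl ?_ ?_ _ ?_ _ ?_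
    · simp; omega
    · simp; omega
    · rw [mem_dualEnds, isCorner_iff]; simp; omega
    · rw [mem_dualEnds, isCorner_iff]; simp; omega

theorem dual_col_const {X : Type*} (φ : Dual → X) {i j : Dual} (hx : i.1.1 = j.1.1)
    (hy : i.1.2 ≤ j.1.2)
    (h : ∀ t : Tile, t.1.1 = i.1.1 → i.1.2 < t.1.2 → t.1.2 < j.1.2 →
      ∀ k ∈ dualEnds t, ∀ l ∈ dualEnds t, φ k = φ l) : φ i = φ j := by
  have hi := i.mod; have hj := j.mod
  have := int_const_up (fun x => φ (mkD i.1.1 (2 * x + 1) hi.1 (by omega))) (i.1.2 / 2) (j.1.2 / 2)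
    (by omega) ?_
  · have e1 : mkD i.1.1 (2 * (i.1.2 / 2) + 1) hi.1 (by omega) = i := Dual.ext' rfl (by simp; omega)
    have e2 : mkD i.1.1 (2 * (j.1.2 / 2) + 1) hi.1 (by omega) = j := Dual.ext' hx (by simp; omega)
    simp only [e1, e2] at this
    exact this.symm
  · intro x h1 h2
    refine h (mkT i.1.1 (2 * x + 2) (by omega)) rfl ?_ ?_ _ ?_ _ ?_
    · simp; omega
    · simp; omega
    · rw [mem_dualEnds, isCorner_iff]; simp; omega
    · rw [mem_dualEnds, isCorner_iff]; simp; omega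

theorem primal_const {X : Type*} (φ : Primal → X)
    (h : ∀ t, ∀ k ∈ edgeEnds t, ∀ l ∈ edgeEnds t, φ k = φ l) (i j : Primal) : φ i = φ j := by
  have hi := i.mod; have hj := j.mod
  have h1 : φ i = φ (mkP j.1.1 i.1.2 hj.1 hi.2) := by
    rcases le_total i.1.1 j.1.1 with h' | h'
    · exact primal_row_const φ rfl h' fun t _ _ _ => h t
    · exact (primal_row_const φ (i := mkP j.1.1 i.1.2 hj.1 hi.2) (j := i) rfl h' fun t _ _ _ => h t).symm
  rw [h1]
  rcases le_total i.1.2 j.1.2 with h' | h'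
  · exact primal_col_const φ rfl h' fun t _ _ _ => h t
  · exact (primal_col_const φ (j := mkP j.1.1 i.1.2 hj.1 hi.2) (i := j) rfl h' fun t _ _ _ => h t).symm

theorem dual_const {X : Type*} (φ : Dual → X)
    (h : ∀ t, ∀ k ∈ dualEnds t, ∀ l ∈ dualEnds t, φ k = φ l) (i j : Dual) : φ i = φ j := by
  have hi := i.mod; have hj := j.mod
  have h1 : φ i = φ (mkD j.1.1 i.1.2 hj.1 hi.2) := by
    rcases le_total i.1.1 j.1.1 with h' | h'
    · exact dual_row_const φ rfl h' fun t _ _ _ => h t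
    · exact (dual_row_const φ (i := mkD j.1.1 i.1.2 hj.1 hi.2) (j := i) rfl h' fun t _ _ _ => h t).symm
  rw [h1]
  rcases le_total i.1.2 j.1.2 with h' | h'
  · exact dual_col_const φ rfl h' fun t _ _ _ => h t
  · exact (dual_col_const φ (j := mkD j.1.1 i.1.2 hj.1 hi.2) (i := j) rfl h' fun t _ _ _ => h t).symm

/-- Coboundaries of functions on dual vertices are even at primal vertices. -/
theorem bdry_cobD (φ : Dual → ZMod 2) (i : Primal) : bdry (cobD φ) i.1 = 0 := by
  have hi := i.mod
  let a : Dual := mkD (i.1.1 + 1) (i.1.2 + 1) (by omega) (by omega)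
  let b : Dual := mkD (i.1.1 - 1) (i.1.2 + 1) (by omega) (by omega)
  let c : Dual := mkD (i.1.1 - 1) (i.1.2 - 1) (by omega) (by omega)
  let d : Dual := mkD (i.1.1 + 1) (i.1.2 - 1) (by omega) (by omega)
  have key : ∀ (x y : ℤ) (hp : (x + y) % 2 = 1) (u v : Dual), u ≠ v → IsCorner (mkT x y hp) u.1 →
      IsCorner (mkT x y hp) v.1 → tv (cobD φ) x y = φ u + φ v := by
    intro x y hp u v huv hu hv
    rw [tv, dif_pos hp, cobD_eq φ hu hv huv]
  rw [bdry, key (i.1.1 + 1) i.1.2 (by omega) a d, key (i.1.1 - 1) i.1.2 (by omega) b c,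
    key i.1.1 (i.1.2 + 1) (by omega) a b, key i.1.1 (i.1.2 - 1) (by omega) c d]
  · generalize φ a = x; generalize φ b = y; generalize φ c = z; generalize φ d = w
    revert x y z w; decide
  all_goals first
    | (rw [isCorner_iff]; simp [a, b, c, d])
    | (intro h; have h1 := congrArg (fun u : Dual => u.1.1) h
       have h2 := congrArg (fun u : Dual => u.1.2) h
       simp [a, b, c, d] at h1 h2; try omega)

/-- Coboundaries of functions on primal vertices are even at dual vertices. -/
theorem bdry_cobP (φ : Primal → ZMod 2) (i : Dual) : bdry (cobP φ) i.1 = 0 := by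
  have hi := i.mod
  let a : Primal := mkP (i.1.1 + 1) (i.1.2 + 1) (by omega) (by omega)
  let b : Primal := mkP (i.1.1 - 1) (i.1.2 + 1) (by omega) (by omega)
  let c : Primal := mkP (i.1.1 - 1) (i.1.2 - 1) (by omega) (by omega)
  let d : Primal := mkP (i.1.1 + 1) (i.1.2 - 1) (by omega) (by omega)
  have key : ∀ (x y : ℤ) (hp : (x + y) % 2 = 1) (u v : Primal), u ≠ v →
      IsCorner (mkT x y hp) u.1 →
      IsCorner (mkT x y hp) v.1 → tv (cobP φ) x y = φ u + φ v := by
    intro x y hp u v huv hu hv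
    rw [tv, dif_pos hp, cobP_eq φ hu hv huv]
  rw [bdry, key (i.1.1 + 1) i.1.2 (by omega) a d, key (i.1.1 - 1) i.1.2 (by omega) b c,
    key i.1.1 (i.1.2 + 1) (by omega) a b, key i.1.1 (i.1.2 - 1) (by omega) c d]
  · generalize φ a = x; generalize φ b = y; generalize φ c = z; generalize φ d = w
    revert x y z w; decide
  all_goals first
    | (rw [isCorner_iff]; simp [a, b, c, d])
    | (intro h; have h1 := congrArg (fun u : Primal => u.1.1) h
       have h2 := congrArg (fun u : Primal => u.1.2) h
       simp [a, b, c, d] at h1 h2; try omega)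

/-- Every finite set of edges that is even at all primal vertices bounds a set of faces. -/
theorem cobD_ray {S : Finset Tile} {h : Tile → ZMod 2} (hS : ∀ t, t ∉ S → h t = 0)
    (hev : ∀ i : Primal, bdry h i.1 = 0) (t : Tile) :
    cobD (fun u => ray S h u.1) t = h t := by
  obtain ⟨u, v, hu, hv, huv, -, hc⟩ := exists_dualEnds t
  rw [cobD_eq _ hu hv huv]
  have hu' := u.mod
  -- For a horizontal dual edge the two rays differ by just this tile; for a vertical one the
  -- difference is computed by `ray_up`, which is where evenness enters.
  rcases hc with ⟨h1, h2, h3, h4, h5⟩ | ⟨h1, h2, h3, h4, h5⟩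
  · rw [ray_step hS u.1 (by omega), tv_eq h t (by omega) (by omega)]
    have : v.1 = (u.1.1 + 2, u.1.2) := Prod.ext (by simp; omega) (by simp; omega)
    rw [this, add_assoc, zmod2_add_self, add_zero]
  · have : v.1 = (u.1.1, u.1.2 + 2) := Prod.ext (by simp; omega) (by simp; omega)
    rw [this, ray_up hS u.1 (by omega), tv_eq h t (by omega) (by omega)]
    intro w hw1 hw2
    exact hev (mkP w.1 w.2 (by omega) (by omega))

theorem cobP_ray {S : Finset Tile} {h : Tile → ZMod 2} (hS : ∀ t, t ∉ S → h t = 0)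
    (hev : ∀ i : Dual, bdry h i.1 = 0) (t : Tile) :
    cobP (fun u => ray S h u.1) t = h t := by
  obtain ⟨u, v, hu, hv, huv, -, hc⟩ := exists_edgeEnds t
  rw [cobP_eq _ hu hv huv]
  have hu' := u.mod
  rcases hc with ⟨h1, h2, h3, h4, h5⟩ | ⟨h1, h2, h3, h4, h5⟩
  · rw [ray_step hS u.1 (by omega), tv_eq h t (by omega) (by omega)]
    have : v.1 = (u.1.1 + 2, u.1.2) := Prod.ext (by simp; omega) (by simp; omega)
    rw [this, add_assoc, zmod2_add_self, add_zero]
  · have : v.1 = (u.1.1, u.1.2 + 2) := Prod.ext (by simp; omega) (by simp; omega)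
    rw [this, ray_up hS u.1 (by omega), tv_eq h t (by omega) (by omega)]
    intro w hw1 hw2
    exact hev (mkD w.1 w.2 (by omega) (by omega))

/-! ### Euler's formula -/

open Classical in
/-- The vertex-edge incidence matrix modulo two. -/
def incMat (P : Finset Primal) (F : Finset Tile) : Matrix P F (ZMod 2) :=
  fun i t => if i.1 ∈ edgeEnds t.1 then 1 else 0

/-- Functions on `P` that are constant along the edges in `F`. -/
abbrev PrimalFns (P : Finset Primal) (F : Finset Tile) : Type :=
  {φ : P → ZMod 2 // ∀ t ∈ F, ∀ i j : P, i.1 ∈ edgeEnds t → j.1 ∈ edgeEnds t → φ i = φ j}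

/-- Functions on the dual vertices that are constant along all dual edges except those of `F`. -/
abbrev DualFns (F : Finset Tile) : Type :=
  {g : Dual → ZMod 2 // ∀ t, t ∉ F → ∀ u ∈ dualEnds t, ∀ v ∈ dualEnds t, g u = g v}

/-- The transpose adds the values at the two ends of an edge, and modulo two this is their
difference. -/
theorem incMat_transpose_mulVec {P : Finset Primal} {F : Finset Tile}
    (hP : ∀ t ∈ F, ∀ i ∈ edgeEnds t, i ∈ P) (φ : P → ZMod 2) :
    (incMat P F).transpose.mulVec φ = 0 ↔
      ∀ t ∈ F, ∀ i j : P, i.1 ∈ edgeEnds t → j.1 ∈ edgeEnds t → φ i = φ j := by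
  classical
  have key : ∀ t : F, ∀ i j : P, i.1 ∈ edgeEnds t.1 → j.1 ∈ edgeEnds t.1 → i ≠ j →
      (incMat P F).transpose.mulVec φ t = φ i + φ j := by
    intro t i j hi hj hij
    obtain ⟨a, b, -, -, -, hall, -⟩ := exists_edgeEnds t.1
    have : ∀ k : P, (k.1 ∈ edgeEnds t.1) ↔ (k = i ∨ k = j) := by
      intro k
      constructor
      · intro hk
        have h1 := hall _ hi; have h2 := hall _ hj; have h3 := hall _ hk
        have h4 : i.1 ≠ j.1 := fun h => hij (Subtype.ext h)
        suffices h5 : k.1 = i.1 ∨ k.1 = j.1 from h5.imp Subtype.ext Subtype.ext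
        clear hall hP
        rcases h1 with h1 | h1 <;> rcases h2 with h2 | h2 <;> rcases h3 with h3 | h3 <;>
          rw [h1, h2] at h4 <;> rw [h1, h2, h3] <;> simp at h4 ⊢
      · rintro (rfl | rfl) <;> assumption
    rw [Matrix.mulVec, dotProduct, ← Finset.sum_subset (Finset.subset_univ {i, j})]
    · rw [Finset.sum_pair hij]
      simp [incMat, hi, hj]
    · intro k _ hk
      have : k.1 ∉ edgeEnds t.1 := by rw [this]; simpa using hk
      simp [incMat, this]
  constructor
  · intro h t ht i j hi hj
    by_cases hij : i = j
    · rw [hij]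
    · have := key ⟨t, ht⟩ i j hi hj hij
      rw [h] at this
      exact (CharTwo.add_eq_zero.1 this.symm)
  · intro h
    ext t
    obtain ⟨a, b, ha, hb, hab, hall, -⟩ := exists_edgeEnds t.1
    have ha' := hP t.1 t.2 a ha
    have hb' := hP t.1 t.2 b hb
    rw [key t ⟨a, ha'⟩ ⟨b, hb'⟩ ha hb (fun h => hab (congrArg Subtype.val h)),
      h t.1 t.2 ⟨a, ha'⟩ ⟨b, hb'⟩ ha hb, zmod2_add_self]; rfl

open Classical in
/-- Extension by zero of a function on a finite set of tiles. -/
def extZero {F : Finset Tile} (h : F → ZMod 2) (t : Tile) : ZMod 2 :=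
  if ht : t ∈ F then h ⟨t, ht⟩ else 0

theorem bdry_eq_sum {F : Finset Tile} (h : F → ZMod 2) (i : Primal) [DecidablePred fun t : F => i ∈ edgeEnds t.1] :
    bdry (extZero h) i.1 = ∑ t : F, if i ∈ edgeEnds t.1 then h t else 0 := by
  classical
  have hi := i.mod
  have hsum : ∀ (x y : ℤ) (hp : (x + y) % 2 = 1), tv (extZero h) x y =
      ∑ t : F, if t.1 = mkT x y hp then h t else 0 := by
    intro x y hp
    rw [tv, dif_pos hp, extZero]
    split_ifs with hm
    · rw [Finset.sum_eq_single ⟨_, hm⟩]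
      · simp
      · intro b _ hb
        rw [if_neg]; exact fun h' => hb (Subtype.ext h')
      · simp
    · rw [Finset.sum_eq_zero]
      intro t _
      exact if_neg fun h' : t.1 = mkT x y hp => hm (h' ▸ t.2)
  rw [bdry, hsum _ _ (by omega), hsum _ _ (by omega), hsum _ _ (by omega), hsum _ _ (by omega),
    ← Finset.sum_add_distrib, ← Finset.sum_add_distrib, ← Finset.sum_add_distrib]
  refine Finset.sum_congr rfl fun t _ => ?_
  have e : ∀ (x y : ℤ) (hp : (x + y) % 2 = 1), t.1 = mkT x y hp ↔ t.1.1.1 = x ∧ t.1.1.2 = y :=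
    fun x y hp => ⟨fun h => by rw [h]; simp, fun h => Tile.ext' h.1 h.2⟩
  simp only [e, mem_edgeEnds, isCorner_iff]
  generalize h t = c
  by_cases h1 : t.1.1.1 = i.1.1 + 1 ∧ t.1.1.2 = i.1.2
  · rw [if_pos h1, if_neg (by omega), if_neg (by omega), if_neg (by omega), if_pos (by omega)]; simp
  by_cases h2 : t.1.1.1 = i.1.1 - 1 ∧ t.1.1.2 = i.1.2
  · rw [if_neg h1, if_pos h2, if_neg (by omega), if_neg (by omega), if_pos (by omega)]; simp
  by_cases h3 : t.1.1.1 = i.1.1 ∧ t.1.1.2 = i.1.2 + 1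
  · rw [if_neg h1, if_neg h2, if_pos h3, if_neg (by omega), if_pos (by omega)]; simp
  by_cases h4 : t.1.1.1 = i.1.1 ∧ t.1.1.2 = i.1.2 - 1
  · rw [if_neg h1, if_neg h2, if_neg h3, if_pos h4, if_pos (by omega)]; simp
  · rw [if_neg h1, if_neg h2, if_neg h3, if_neg h4, if_neg (by omega)]; simp

/-- Evenness at vertices off `P` is automatic because the edges of `F` end in `P`; so the kernel is
the full cycle space of `F`. -/
theorem incMat_mulVec {P : Finset Primal} {F : Finset Tile}
    (hP : ∀ t ∈ F, ∀ i ∈ edgeEnds t, i ∈ P) (h : F → ZMod 2) :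
    (incMat P F).mulVec h = 0 ↔ ∀ i : Primal, bdry (extZero h) i.1 = 0 := by
  classical
  have key : ∀ i : P, (incMat P F).mulVec h i = bdry (extZero h) i.1.1 := by
    intro i
    rw [bdry_eq_sum, Matrix.mulVec, dotProduct]
    exact Finset.sum_congr rfl fun t _ => by simp [incMat]
  constructor
  · intro h0 i
    by_cases hi : i ∈ P
    · rw [← key ⟨i, hi⟩, h0]; rfl
    · rw [bdry_eq_sum]
      exact Finset.sum_eq_zero fun t _ => if_neg fun h' => hi (hP t.1 t.2 i h')
  · intro h0; ext i; rw [key, h0]; rfl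

/-- Functions on dual vertices correspond to cycles. -/
theorem card_dualFns {P : Finset Primal} {F : Finset Tile}
    (hP : ∀ t ∈ F, ∀ i ∈ edgeEnds t, i ∈ P) :
    Nat.card (DualFns F) = Nat.card (LinearMap.ker (incMat P F).mulVecLin) * 2 := by
  classical
  -- A cycle determines the function that it bounds up to a constant. The constant is recorded by
  -- the value at an arbitrary base point and accounts for the factor 2.
  let u₀ : Dual := mkD 1 1 rfl rfl
  have hext : ∀ g : DualFns F, extZero (fun t : F => cobD g.1 t.1) = cobD g.1 := by
    intro g; ext t
    rw [extZero]
    split_ifs with h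
    · rfl
    · exact ((cobD_eq_zero g.1 t).2 (g.2 t h)).symm
  have hker : ∀ g : DualFns F, (fun t : F => cobD g.1 t.1) ∈
      LinearMap.ker (incMat P F).mulVecLin := by
    intro g
    rw [LinearMap.mem_ker, Matrix.mulVecLin_apply, incMat_mulVec hP]
    intro i; rw [hext, bdry_cobD]
  let f : DualFns F → LinearMap.ker (incMat P F).mulVecLin × ZMod 2 := fun g => (⟨_, hker g⟩, g.1 u₀)
  have hf : Function.Bijective f := by
    constructor
    · intro g g' hgg
      have h1 : (fun t : F => cobD g.1 t.1) = fun t : F => cobD g'.1 t.1 :=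
        congrArg (fun x => x.1.1) hgg
      have h2 : g.1 u₀ = g'.1 u₀ := congrArg Prod.snd hgg
      have h3 : cobD g.1 = cobD g'.1 := by rw [← hext g, ← hext g', h1]
      have h4 : ∀ t, cobD (g.1 + g'.1) t = 0 := by
        intro t
        have := congrFun h3 t
        obtain ⟨u, v, hu, hv, huv, -⟩ := exists_dualEnds t
        rw [cobD_eq _ hu hv huv] at this ⊢
        rw [cobD_eq _ hu hv huv] at this
        simp only [Pi.add_apply]
        have h5 := zmod2_add_self (g'.1 u + g'.1 v)
        linear_combination this + h5
      apply Subtype.ext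
      funext u
      have := dual_const (g.1 + g'.1) (fun t => (cobD_eq_zero _ t).1 (h4 t)) u u₀
      simp only [Pi.add_apply, h2, zmod2_add_self] at this
      exact CharTwo.add_eq_zero.1 this
    · rintro ⟨⟨h, hh⟩, c⟩
      rw [LinearMap.mem_ker, Matrix.mulVecLin_apply, incMat_mulVec hP] at hh
      have hS : ∀ t, t ∉ F → extZero h t = 0 := fun t ht => dif_neg ht
      let g₀ : Dual → ZMod 2 := fun u => ray F (extZero h) u.1
      have hg₀ : ∀ t, cobD g₀ t = extZero h t := cobD_ray hS hh
      let g : Dual → ZMod 2 := fun u => g₀ u + (g₀ u₀ + c)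
      have hg : ∀ t, cobD g t = extZero h t := by
        intro t
        rw [← hg₀]
        obtain ⟨u, v, hu, hv, huv, -⟩ := exists_dualEnds t
        rw [cobD_eq _ hu hv huv, cobD_eq _ hu hv huv]
        have h5 := zmod2_add_self (g₀ u₀ + c)
        simp only [g]
        linear_combination h5
      refine ⟨⟨g, fun t ht => (cobD_eq_zero g t).1 ((hg t).trans (hS t ht))⟩, ?_⟩
      apply Prod.ext
      · apply Subtype.ext
        funext t
        change cobD g t.1 = h t
        rw [hg, extZero, dif_pos t.2]
      · change g u₀ = c
        simp only [g]
        have h5 := zmod2_add_self (g₀ u₀)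
        linear_combination h5
  rw [Nat.card_congr (Equiv.ofBijective f hf), Nat.card_prod]
  simp

/-- Euler's formula for a finite planar graph, in terms of the numbers of functions that are
constant on the clusters and on the dual clusters. -/
theorem euler {P : Finset Primal} {F : Finset Tile} (hP : ∀ t ∈ F, ∀ i ∈ edgeEnds t, i ∈ P) :
    Nat.card (PrimalFns P F) * 2 ^ F.card * 2 = Nat.card (DualFns F) * 2 ^ P.card := by
  classical
  have h1 : Nat.card (PrimalFns P F) =
      Nat.card (LinearMap.ker (incMat P F).transpose.mulVecLin) := by
    refine Nat.card_congr (Equiv.subtypeEquivRight fun φ => ?_)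
    rw [LinearMap.mem_ker, Matrix.mulVecLin_apply, incMat_transpose_mulVec hP]
  have h2 : ∀ (V : Type) [AddCommGroup V] [Module (ZMod 2) V] [Finite V],
      Nat.card V = 2 ^ Module.finrank (ZMod 2) V := by
    intro V _ _ _
    rw [Module.natCard_eq_pow_finrank (K := ZMod 2)]; simp
  have h3 := LinearMap.finrank_range_add_finrank_ker (incMat P F).transpose.mulVecLin
  have h4 := LinearMap.finrank_range_add_finrank_ker (incMat P F).mulVecLin
  -- The kernels of the matrix and of its transpose have dimensions |F| - r and |P| - r with the
  -- same rank r; this is the whole content of the formula.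
  have h5 := Matrix.rank_transpose (incMat P F)
  rw [Matrix.rank, Matrix.rank] at h5
  rw [card_dualFns hP, h1, h2, h2]
  simp only [Module.finrank_fintype_fun_eq_card, Fintype.card_coe] at h3 h4
  rw [mul_assoc, mul_assoc, mul_comm 2 (2 ^ P.card), ← mul_assoc, ← mul_assoc, ← pow_add,
    ← pow_add]
  congr 2
  omega


/-! ### The turning number of a loop -/

open Classical in
/-- The number of right turns minus the number of left turns of a set of arcs that is oriented
clockwise. -/
def turnSum (l : Set Arc) : ℤ := ∑ᶠ a ∈ l, if Surrounds l a.corner then 1 else -1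

theorem loop_bounds {l : Set Arc} (hl : l.Finite) : ∃ N : ℤ, ∀ a ∈ l, a.tile.1.1 < N ∧
    -N + 1 < a.tile.1.1 ∧ a.tile.1.2 < N ∧ -N < a.tile.1.2 := by
  obtain ⟨N1, h1⟩ := (hl.image fun a : Arc => |a.tile.1.1|).bddAbove
  obtain ⟨N2, h2⟩ := (hl.image fun a : Arc => |a.tile.1.2|).bddAbove
  refine ⟨max N1 N2 + 2, fun a ha => ?_⟩
  have h3 := abs_le.1 ((h1 ⟨a, ha, rfl⟩).trans (le_max_left N1 N2))
  have h4 := abs_le.1 ((h2 ⟨a, ha, rfl⟩).trans (le_max_right N1 N2))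
  omega

/-- A point to the left of a loop is not surrounded. -/
theorem not_crossed_of_far {l : Set Arc} {i : Primal} {u : Dual} {N : ℤ}
    (hN : ∀ a ∈ l, -N + 1 < a.tile.1.1) (hi : i.1.1 ≤ -N ∨ u.1.1 ≤ -N) :
    ¬ CrossedBy l i u := by
  rintro ⟨a, ha, h1, h2, -⟩
  have := hN a ha
  have := a.tile.mod; have := i.mod; have := u.mod
  rw [isCorner_iff] at h1 h2
  omega

theorem beside_up (i : Primal) : Beside i (mkD (i.1.1 + 1) (i.1.2 + 1)
    (by have := i.mod; omega) (by have := i.mod; omega)) := by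
  unfold Beside; simp

/-- Points with a large coordinate are not surrounded by a given loop. -/
theorem IsCurve.sur_bounds {ω : Config} {l : Set Arc} (h : IsCurve ω l) (hl : l.Finite) :
    ∃ N : ℤ, 0 < N ∧ (∀ a ∈ l, a.tile.1.1 < N ∧ -N < a.tile.1.1 ∧ a.tile.1.2 < N ∧ -N < a.tile.1.2) ∧
      ∀ z : Pt, (z.1 + z.2) % 2 = 0 → Surrounds l z → -N < z.1 ∧ z.1 < N ∧ -N < z.2 ∧ z.2 < N := by
  obtain ⟨N, hN⟩ := loop_bounds hl
  obtain ⟨a0, ha0⟩ := h.nonempty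
  refine ⟨N, by have := hN a0 ha0; omega, fun a ha => by have := hN a ha; omega, fun z hz hs => ?_⟩
  rw [← sur_eq_one] at hs
  have h1 : z.1 < N := by
    by_contra hcon
    rw [sur_of_forall_lt fun a ha => by have := hN a ha; omega] at hs
    exact zero_ne_one hs
  have h2 : z.2 < N := by
    by_contra hcon
    rw [sur_of_row fun a ha => by have := hN a ha; omega] at hs
    exact zero_ne_one hs
  have h3 : -N < z.2 := by
    by_contra hcon
    rw [sur_of_row fun a ha => by have := hN a ha; omega] at hs
    exact zero_ne_one hs
  refine ⟨?_, h1, h3, h2⟩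
  by_contra hcon
  -- A ray from a point far to the left does meet the loop, so this side needs an argument: the
  -- diagonal walk up and to the left crosses no arc and ends above the loop, where the ray is
  -- empty.
  have key : ∀ (k : ℕ) (w : Pt), (w.1 + w.2) % 2 = 0 → w.1 ≤ -N → N ≤ w.2 + k → sur l w = 0 := by
    intro k
    induction k with
    | zero =>
      intro w _ _ hk
      exact sur_of_row fun a ha => by have := hN a ha; push_cast at hk; omega
    | succ k ih =>
      intro w hw hw1 hk
      have h4 := ih (w.1 - 1, w.2 + 1) (by simp; omega) (by simp; omega)
        (by push_cast at hk; simp; omega)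
      by_cases hp : w.1 % 2 = 0
      · let i : Primal := mkP w.1 w.2 hp (by omega)
        let u : Dual := mkD (w.1 - 1) (w.2 + 1) (by omega) (by omega)
        have h5 := h.sur_add hl (i := i) (u := u) ⟨Or.inr rfl, Or.inl rfl⟩
        rw [if_neg (not_crossed_of_far (fun a ha => (hN a ha).2.1) (Or.inl hw1))] at h5
        have h6 : sur l w + sur l (w.1 - 1, w.2 + 1) = 0 := h5
        rwa [h4, add_zero] at h6
      · let u : Dual := mkD w.1 w.2 (by omega) (by omega)
        let i : Primal := mkP (w.1 - 1) (w.2 + 1) (by omega) (by omega)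
        have h5 := h.sur_add hl (i := i) (u := u)
          ⟨Or.inl (by simp [i, u]), Or.inr (by simp [i, u])⟩
        rw [if_neg (not_crossed_of_far (fun a ha => (hN a ha).2.1) (Or.inr hw1))] at h5
        have h6 : sur l (w.1 - 1, w.2 + 1) + sur l w = 0 := h5
        rwa [h4, zero_add] at h6
  rw [key (N - z.2).toNat z hz (by omega) (by omega)] at hs
  exact zero_ne_one hs

/-- The loop `l` has primal vertices at its inner side. -/
def PrimalInside (l : Set Arc) : Prop :=
  ∀ i u, CrossedBy l i u → Surrounds l i.1 ∧ ¬ Surrounds l u.1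

/-- The loop `l` has dual vertices at its inner side. -/
def DualInside (l : Set Arc) : Prop :=
  ∀ i u, CrossedBy l i u → ¬ Surrounds l i.1 ∧ Surrounds l u.1

/-- Being surrounded is constant along the primal side of the loop: in an open tile both primal
corners are separated by the loop from the same dual corner, so they have the same status. -/
theorem IsCurve.inside_cases {ω : Config} {l : Set Arc} (h : IsCurve ω l) (hl : l.Finite) :
    PrimalInside l ∨ DualInside l := by
  obtain ⟨a, ha⟩ := h.nonempty
  obtain ⟨i, u, hiu⟩ := a.exists_crosses
  have key : ∀ j v, CrossedBy l j v → (Surrounds l i.1 ↔ Surrounds l j.1) := by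
    rintro j v ⟨b, hb, hjv⟩
    rw [← eq_iff_iff]
    refine h.const_primal (fun k : Primal => Surrounds l k.1) ?_ ha hb hiu hjv
    intro c hc hω k hk k' hk'
    rcases c.corner_cases with ⟨w, hw⟩ | ⟨w, hw⟩
    · have := (mem_arcs_primal hw).1 (h.subset hc)
      simp [hω] at this
    · have hcw : IsCorner c.tile w.1 := hw ▸ c.isCorner
      have h1 : CrossedBy l k w := ⟨c, hc, hk, hcw, Or.inr hw⟩
      have h2 : CrossedBy l k' w := ⟨c, hc, hk', hcw, Or.inr hw⟩
      rw [h.surrounds_iff hl (beside_of_corners hk hcw).1] at h1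
      rw [h.surrounds_iff hl (beside_of_corners hk' hcw).1] at h2
      simp only [eq_iff_iff]; tauto
  by_cases hs : Surrounds l i.1
  · left
    intro j v hjv
    have h1 := (key j v hjv).1 hs
    have hb : Beside j v := by obtain ⟨b, -, hb⟩ := hjv; exact hb.beside
    have := (h.surrounds_iff hl hb).1 hjv
    tauto
  · right
    intro j v hjv
    have h1 := mt (key j v hjv).2 hs
    have hb : Beside j v := by obtain ⟨b, -, hb⟩ := hjv; exact hb.beside
    have := (h.surrounds_iff hl hb).1 hjv
    tauto

/-- The arc of the tile `t` that cuts off `z`. -/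
def mkArc (t : Tile) (z : Pt) (h : IsCorner t z) : Arc := ⟨(t, z), h⟩

open Classical in
theorem sum_arcs_of_tile {L : Finset Arc} (f : Arc → ℤ) {t : Tile} {i j : Primal} {u v : Dual}
    (hi : i ∈ edgeEnds t) (hj : j ∈ edgeEnds t) (hij : i ≠ j) (hu : u ∈ dualEnds t)
    (hv : v ∈ dualEnds t) (huv : u ≠ v) (hall : ∀ k ∈ edgeEnds t, k = i ∨ k = j)
    (hall' : ∀ k ∈ dualEnds t, k = u ∨ k = v) :
    ∑ a ∈ L with a.tile = t, f a =
      (if mkArc t i.1 hi ∈ L then f (mkArc t i.1 hi) else 0) +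
      (if mkArc t j.1 hj ∈ L then f (mkArc t j.1 hj) else 0) +
      (if mkArc t u.1 hu ∈ L then f (mkArc t u.1 hu) else 0) +
      (if mkArc t v.1 hv ∈ L then f (mkArc t v.1 hv) else 0) := by
  have hne : ∀ {z w : Pt} (hz : IsCorner t z) (hw : IsCorner t w), z ≠ w →
      mkArc t z hz ≠ mkArc t w hw := by
    intro z w hz hw h h'
    exact h (congrArg Arc.corner h')
  have h1 : (L.filter fun a => a.tile = t) =
      ({mkArc t i.1 hi, mkArc t j.1 hj, mkArc t u.1 hu, mkArc t v.1 hv} : Finset Arc).filter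
        fun a => a ∈ L := by
    ext a
    simp only [Finset.mem_filter, Finset.mem_insert, Finset.mem_singleton]
    constructor
    · rintro ⟨ha, rfl⟩
      refine ⟨?_, ha⟩
      rcases a.corner_cases with ⟨k, hk⟩ | ⟨k, hk⟩
      · rcases hall k (by rw [mem_edgeEnds, ← hk]; exact a.isCorner) with rfl | rfl
        · left; exact Arc.ext' rfl hk
        · right; left; exact Arc.ext' rfl hk
      · rcases hall' k (by rw [mem_dualEnds, ← hk]; exact a.isCorner) with rfl | rfl
        · right; right; left; exact Arc.ext' rfl hk
        · right; right; right; exact Arc.ext' rfl hk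
    · rintro ⟨rfl | rfl | rfl | rfl, ha⟩ <;> exact ⟨ha, rfl⟩
  rw [h1, Finset.sum_filter, Finset.sum_insert, Finset.sum_insert, Finset.sum_insert,
    Finset.sum_singleton]
  · ring
  · simp only [Finset.mem_singleton]
    exact hne _ _ fun h => huv (Subtype.ext h)
  · simp only [Finset.mem_insert, Finset.mem_singleton]
    rintro (h | h)
    · exact hne hj hu (Primal.ne_dual _ _) h
    · exact hne hj hv (Primal.ne_dual _ _) h
  · simp only [Finset.mem_insert, Finset.mem_singleton]
    rintro (h | h | h)
    · exact hne hi hj (fun h => hij (Subtype.ext h)) h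
    · exact hne hi hu (Primal.ne_dual _ _) h
    · exact hne hi hv (Primal.ne_dual _ _) h

open Classical in
theorem sum_corner_primal (S : Finset Primal) {t : Tile} {i j : Primal}
    (hi : i ∈ edgeEnds t) (hj : j ∈ edgeEnds t) (hij : i ≠ j)
    (hall : ∀ k ∈ edgeEnds t, k = i ∨ k = j) :
    ∑ k ∈ S, (if k ∈ edgeEnds t then (1 : ℤ) else 0) =
      (if i ∈ S then 1 else 0) + if j ∈ S then 1 else 0 := by
  have : ∀ k, (if k ∈ edgeEnds t then (1 : ℤ) else 0) =
      (if k = i then 1 else 0) + if k = j then 1 else 0 := by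
    intro k
    by_cases h : k ∈ edgeEnds t
    · rcases hall k h with rfl | rfl
      · simp [hi, hij]
      · simp [hj, hij.symm]
    · rw [if_neg h, if_neg (by rintro rfl; exact h hi), if_neg (by rintro rfl; exact h hj), add_zero]
  simp only [this, Finset.sum_add_distrib, Finset.sum_ite_eq']

open Classical in
theorem sum_corner_dual (S : Finset Dual) {t : Tile} {i j : Dual}
    (hi : i ∈ dualEnds t) (hj : j ∈ dualEnds t) (hij : i ≠ j)
    (hall : ∀ k ∈ dualEnds t, k = i ∨ k = j) :
    ∑ k ∈ S, (if k ∈ dualEnds t then (1 : ℤ) else 0) =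
      (if i ∈ S then 1 else 0) + if j ∈ S then 1 else 0 := by
  have : ∀ k, (if k ∈ dualEnds t then (1 : ℤ) else 0) =
      (if k = i then 1 else 0) + if k = j then 1 else 0 := by
    intro k
    by_cases h : k ∈ dualEnds t
    · rcases hall k h with rfl | rfl
      · simp [hi, hij]
      · simp [hj, hij.symm]
    · rw [if_neg h, if_neg (by rintro rfl; exact h hi), if_neg (by rintro rfl; exact h hj), add_zero]
  simp only [this, Finset.sum_add_distrib, Finset.sum_ite_eq']

open Classical in
/-- Each vertex is a corner of four tiles. -/
theorem sum_tiles_at (T : Finset Tile) (z : Pt) (hz : (z.1 + z.2) % 2 = 0)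
    (hT : ∀ t, IsCorner t z → t ∈ T) : ∑ t ∈ T, (if IsCorner t z then (1 : ℤ) else 0) = 4 := by
  rw [← Finset.sum_filter, Finset.sum_const, nsmul_eq_mul, mul_one]
  have : T.filter (fun t => IsCorner t z) =
      {mkT (z.1 + 1) z.2 (by omega), mkT (z.1 - 1) z.2 (by omega), mkT z.1 (z.2 + 1) (by omega),
        mkT z.1 (z.2 - 1) (by omega)} := by
    ext t
    simp only [Finset.mem_filter, Finset.mem_insert, Finset.mem_singleton]
    constructor
    · rintro ⟨-, h⟩
      rw [isCorner_iff] at h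
      rcases h with h | h | h | h
      · right; left; exact Tile.ext' (by simp; omega) (by simp; omega)
      · left; exact Tile.ext' (by simp; omega) (by simp; omega)
      · right; right; right; exact Tile.ext' (by simp; omega) (by simp; omega)
      · right; right; left; exact Tile.ext' (by simp; omega) (by simp; omega)
    · intro h
      have hc : IsCorner t z := by
        rw [isCorner_iff]
        rcases h with rfl | rfl | rfl | rfl <;> simp
      exact ⟨hT t hc, hc⟩
  have hne : ∀ (x y x' y' : ℤ) (h h'), (x ≠ x' ∨ y ≠ y') → mkT x y h ≠ mkT x' y' h' := by
    intro x y x' y' h h' hxy heq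
    have h1 := congrArg (fun t : Tile => t.1.1) heq
    have h2 := congrArg (fun t : Tile => t.1.2) heq
    simp at h1 h2; omega
  rw [this, Finset.card_insert_of_notMem, Finset.card_insert_of_notMem,
    Finset.card_insert_of_notMem, Finset.card_singleton]; rfl
  · rw [Finset.mem_singleton]; exact hne _ _ _ _ _ _ (by omega)
  · simp only [Finset.mem_insert, Finset.mem_singleton, not_or]
    exact ⟨hne _ _ _ _ _ _ (by omega), hne _ _ _ _ _ _ (by omega)⟩
  · simp only [Finset.mem_insert, Finset.mem_singleton, not_or]
    exact ⟨hne _ _ _ _ _ _ (by omega), hne _ _ _ _ _ _ (by omega), hne _ _ _ _ _ _ (by omega)⟩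

/-- The edges that fill the inside of a loop. -/
def filling (ω : Config) (l : Set Arc) : Set Tile :=
  {t | (∀ i ∈ edgeEnds t, Surrounds l i.1) ∧
    (ω t = true ∨ ∃ u ∈ dualEnds t, Surrounds l u.1)}

/-- A side with only its dual end surrounded would be crossed by the loop, contrary to the
assumption on its inner side. -/
theorem PrimalInside.of_dual {ω : Config} {l : Set Arc} (h : IsCurve ω l) (hl : l.Finite)
    (hp : PrimalInside l) {i : Primal} {u : Dual} (hiu : Beside i u) (hu : Surrounds l u.1) :
    Surrounds l i.1 := by
  by_contra hi
  have := (h.surrounds_iff hl hiu).2 (by tauto)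
  exact hi (hp i u this).1

open Classical in
-- The local form of the turning number: per tile, right minus left turns equal the number of
-- surrounded corners minus four times the indicator of the filling. Summed over tiles, this
-- compares vertices and faces with edges. The proof is a finite check of the state and the corners.
theorem turn_tile {ω : Config} {l : Set Arc} (h : IsCurve ω l) (hl : l.Finite)
    (hp : PrimalInside l) {t : Tile} {i j : Primal} {u v : Dual}
    (hi : i ∈ edgeEnds t) (hj : j ∈ edgeEnds t) (hu : u ∈ dualEnds t)
    (hv : v ∈ dualEnds t) (hall : ∀ k ∈ edgeEnds t, k = i ∨ k = j)
    (hall' : ∀ k ∈ dualEnds t, k = u ∨ k = v) (f : Arc → ℤ)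
    (hf : ∀ a, f a = if Surrounds l a.corner then 1 else -1) :
    (if mkArc t i.1 hi ∈ l then f (mkArc t i.1 hi) else 0) +
      (if mkArc t j.1 hj ∈ l then f (mkArc t j.1 hj) else 0) +
      (if mkArc t u.1 hu ∈ l then f (mkArc t u.1 hu) else 0) +
      (if mkArc t v.1 hv ∈ l then f (mkArc t v.1 hv) else 0) =
    (((if Surrounds l i.1 then 1 else 0) + if Surrounds l j.1 then 1 else 0) +
     ((if Surrounds l u.1 then 1 else 0) + if Surrounds l v.1 then 1 else 0)) -
     4 * (if t ∈ filling ω l then (1 : ℤ) else 0) := by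
  have hb : ∀ k ∈ edgeEnds t, ∀ w ∈ dualEnds t, Beside k w := fun k hk w hw =>
    (beside_of_corners hk hw).1
  have hfill : t ∈ filling ω l ↔ (Surrounds l i.1 ∧ Surrounds l j.1) ∧
      (ω t = true ∨ Surrounds l u.1 ∨ Surrounds l v.1) := by
    constructor
    · rintro ⟨h1, h2⟩
      refine ⟨⟨h1 i hi, h1 j hj⟩, h2.imp_right ?_⟩
      rintro ⟨w, hw, hs⟩
      rcases hall' w hw with rfl | rfl
      exacts [Or.inl hs, Or.inr hs]
    · rintro ⟨h1, h2⟩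
      refine ⟨fun k hk => ?_, h2.imp_right ?_⟩
      · rcases hall k hk with rfl | rfl
        exacts [h1.1, h1.2]
      · rintro (h3 | h3)
        exacts [⟨u, hu, h3⟩, ⟨v, hv, h3⟩]
  have arcP : ∀ (k : Primal) (hk : k ∈ edgeEnds t) (w : Dual) (hw : w ∈ dualEnds t),
      ω t = false → (mkArc t k.1 hk ∈ l ↔ ¬ (Surrounds l k.1 ↔ Surrounds l w.1)) := by
    intro k hk w hw hω
    rw [← h.surrounds_iff hl (hb k hk w hw)]
    have ha : mkArc t k.1 hk ∈ arcs ω := (mem_arcs_primal (i := k) rfl).2 hω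
    have hc : Crosses (mkArc t k.1 hk) k w := ⟨hk, hw, Or.inl rfl⟩
    exact ⟨fun h' => ⟨_, h', hc⟩, fun ⟨b, hb, hbc⟩ => h.mem_of_crosses hb ha hbc hc⟩
  have arcD : ∀ (k : Primal) (hk : k ∈ edgeEnds t) (w : Dual) (hw : w ∈ dualEnds t),
      ω t = true → (mkArc t w.1 hw ∈ l ↔ ¬ (Surrounds l k.1 ↔ Surrounds l w.1)) := by
    intro k hk w hw hω
    rw [← h.surrounds_iff hl (hb k hk w hw)]
    have ha : mkArc t w.1 hw ∈ arcs ω := (mem_arcs_dual (u := w) rfl).2 hω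
    have hc : Crosses (mkArc t w.1 hw) k w := ⟨hk, hw, Or.inr rfl⟩
    exact ⟨fun h' => ⟨_, h', hc⟩, fun ⟨b, hb, hbc⟩ => h.mem_of_crosses hb ha hbc hc⟩
  have t1 := hp.of_dual h hl (hb i hi u hu)
  have t2 := hp.of_dual h hl (hb i hi v hv)
  have t3 := hp.of_dual h hl (hb j hj u hu)
  have t4 := hp.of_dual h hl (hb j hj v hv)
  have fi : ∀ z hz, f (mkArc t z hz) = if Surrounds l z then 1 else -1 := fun z hz => hf _
  rw [fi i.1 hi, fi j.1 hj, fi u.1 hu, fi v.1 hv]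
  simp only [hfill]
  cases hω : ω t
  · have nu : mkArc t u.1 hu ∉ l := fun h' => by
      have := (mem_arcs_dual (u := u) rfl).1 (h.subset h')
      rw [show (mkArc t u.1 hu).tile = t from rfl, hω] at this; simp at this
    have nv : mkArc t v.1 hv ∉ l := fun h' => by
      have := (mem_arcs_dual (u := v) rfl).1 (h.subset h')
      rw [show (mkArc t v.1 hv).tile = t from rfl, hω] at this; simp at this
    have e1 := arcP i hi u hu hω
    have e2 := arcP i hi v hv hω
    have e3 := arcP j hj u hu hω
    have e4 := arcP j hj v hv hω
    rw [e1] at e2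
    rw [e3] at e4
    simp only [nu, nv, e1, e3, if_false]
    by_cases si : Surrounds l i.1 <;> by_cases sj : Surrounds l j.1 <;>
      by_cases su : Surrounds l u.1 <;> by_cases sv : Surrounds l v.1 <;>
      simp only [si, sj, su, sv] at t1 t2 t3 t4 e2 e4 ⊢ <;> simp at t1 t2 t3 t4 e2 e4 ⊢
  · have nu : mkArc t i.1 hi ∉ l := fun h' => by
      have := (mem_arcs_primal (i := i) rfl).1 (h.subset h')
      rw [show (mkArc t i.1 hi).tile = t from rfl, hω] at this; simp at this
    have nv : mkArc t j.1 hj ∉ l := fun h' => by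
      have := (mem_arcs_primal (i := j) rfl).1 (h.subset h')
      rw [show (mkArc t j.1 hj).tile = t from rfl, hω] at this; simp at this
    have e1 := arcD i hi u hu hω
    have e2 := arcD i hi v hv hω
    have e3 := arcD j hj u hu hω
    have e4 := arcD j hj v hv hω
    rw [e1] at e3
    rw [e2] at e4
    simp only [nu, nv, e1, e2, if_false]
    by_cases si : Surrounds l i.1 <;> by_cases sj : Surrounds l j.1 <;>
      by_cases su : Surrounds l u.1 <;> by_cases sv : Surrounds l v.1 <;>
      simp only [si, sj, su, sv] at t1 t2 t3 t4 e3 e4 ⊢ <;> simp at t1 t2 t3 t4 e3 e4 ⊢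


theorem filling_primal {ω : Config} {l : Set Arc} {t : Tile} (ht : t ∈ filling ω l) {i : Primal}
    (hi : i ∈ edgeEnds t) : Surrounds l i.1 := ht.1 i hi

/-- All four tiles around a surrounded dual vertex are in the filling, so this vertex is isolated in
the dual of the filling. -/
theorem PrimalInside.mem_filling {ω : Config} {l : Set Arc} (h : IsCurve ω l) (hl : l.Finite)
    (hp : PrimalInside l) {t : Tile} {u : Dual} (hu : u ∈ dualEnds t) (hs : Surrounds l u.1) :
    t ∈ filling ω l :=
  ⟨fun _ hi => hp.of_dual h hl (beside_of_corners hi hu).1 hs, Or.inr ⟨u, hu, hs⟩⟩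

/-- In the filled configuration, the primal vertices inside the loop form one cluster. -/
theorem PrimalInside.primal_const {ω : Config} {l : Set Arc} (h : IsCurve ω l) (hl : l.Finite)
    (hp : PrimalInside l) {X : Type*} (φ : Primal → X)
    (hφ : ∀ t ∈ filling ω l, ∀ i ∈ edgeEnds t, ∀ j ∈ edgeEnds t, φ i = φ j)
    {i j : Primal} (hi : Surrounds l i.1) (hj : Surrounds l j.1) : φ i = φ j := by
  obtain ⟨N, -, -, hN⟩ := h.sur_bounds hl
  obtain ⟨a, ha⟩ := h.nonempty
  obtain ⟨k, w, hkw⟩ := a.exists_crosses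
  suffices key : ∀ (n : ℕ) (i : Primal), Surrounds l i.1 → N ≤ i.1.1 + n → φ i = φ k by
    rw [key (N - i.1.1).toNat i hi (by omega), key (N - j.1.1).toNat j hj (by omega)]
  intro n
  induction n with
  | zero =>
    intro i hi hn
    have := i.mod
    have := hN i.1 (by omega) hi
    omega
  | succ n ih =>
    intro i hi hn
    have hm := i.mod
    let u : Dual := mkD (i.1.1 + 1) (i.1.2 + 1) (by omega) (by omega)
    have hiu : Beside i u := beside_up i
    -- If the diagonal neighbour is surrounded, the edge to the right is in the filling and the walk
    -- continues. Otherwise the loop passes between `i` and `u`, and its primal side leads to `k`.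
    by_cases hu : Surrounds l u.1
    · let t : Tile := mkT (i.1.1 + 1) i.1.2 (by omega)
      let i' : Primal := mkP (i.1.1 + 2) i.1.2 (by omega) (by omega)
      have hut : u ∈ dualEnds t := by rw [mem_dualEnds, isCorner_iff]; simp [u, t]
      have hit : i ∈ edgeEnds t := by rw [mem_edgeEnds, isCorner_iff]; simp [t]
      have hit' : i' ∈ edgeEnds t := by rw [mem_edgeEnds, isCorner_iff]; simp [t, i']; omega
      have ht := hp.mem_filling h hl hut hu
      rw [hφ t ht i hit i' hit']
      exact ih i' (filling_primal ht hit') (by push_cast at hn; simp [i']; omega)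
    · obtain ⟨b, hb, hbc⟩ := (h.surrounds_iff hl hiu).2 (by tauto)
      refine h.const_primal φ ?_ hb ha hbc hkw
      intro c hc hω i₁ hi₁ i₂ hi₂
      refine hφ c.tile ⟨?_, Or.inl hω⟩ i₁ hi₁ i₂ hi₂
      intro i₃ hi₃
      rcases c.corner_cases with ⟨w, hw⟩ | ⟨w, hw⟩
      · have := (mem_arcs_primal hw).1 (h.subset hc)
        simp [hω] at this
      · exact (hp i₃ w ⟨c, hc, hi₃, hw ▸ c.isCorner, Or.inr hw⟩).1

/-- In the filled configuration, the dual vertices outside the loop form one dual cluster. -/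
theorem PrimalInside.dual_const {ω : Config} {l : Set Arc} (h : IsCurve ω l) (hl : l.Finite)
    (hp : PrimalInside l) {X : Type*} (g : Dual → X)
    (hg : ∀ t, t ∉ filling ω l → ∀ i ∈ dualEnds t, ∀ j ∈ dualEnds t, g i = g j)
    {u v : Dual} (hu : ¬ Surrounds l u.1) (hv : ¬ Surrounds l v.1) : g u = g v := by
  obtain ⟨N, hN0, -, hN⟩ := h.sur_bounds hl
  obtain ⟨a, ha⟩ := h.nonempty
  obtain ⟨k, w, hkw⟩ := a.exists_crosses
  have hfar : ∀ t : Tile, N ≤ t.1.1 → t ∉ filling ω l := by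
    intro t ht hf
    obtain ⟨i, j, hi, hj, -, -, hc⟩ := exists_edgeEnds t
    have := hN j.1 (by have := j.mod; omega) (hf.1 j hj)
    omega
  -- The dual edges along which the loop runs are not filled: their tiles are closed and their dual
  -- ends are not surrounded.
  have hgl : ∀ i u, CrossedBy l i u → g u = g w := by
    rintro i u ⟨b, hb, hbc⟩
    refine h.const_dual g ?_ hb ha hbc hkw
    intro c hc hω i₁ hi₁ i₂ hi₂
    refine hg c.tile ?_ i₁ hi₁ i₂ hi₂
    rintro ⟨-, hf⟩
    rw [hω] at hf
    obtain ⟨i₃, hi₃, hs⟩ := hf.resolve_left (by simp)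
    rcases c.corner_cases with ⟨j, hj⟩ | ⟨j, hj⟩
    · exact (hp j i₃ ⟨c, hc, hj ▸ c.isCorner, hi₃, Or.inl hj⟩).2 hs
    · have := (mem_arcs_dual hj).1 (h.subset hc)
      simp [hω] at this
  -- the far right
  have hrr : ∀ u v : Dual, N ≤ u.1.1 → N ≤ v.1.1 → g u = g v := by
    intro u v hu hv
    have hum := u.mod; have hvm := v.mod
    have h1 : g u = g (mkD v.1.1 u.1.2 hvm.1 hum.2) := by
      rcases le_total u.1.1 v.1.1 with h' | h'
      · exact dual_row_const g (i := u) (j := mkD v.1.1 u.1.2 hvm.1 hum.2) rfl h'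
          fun t _ h2 _ => hg t (hfar t (by omega))
      · exact (dual_row_const g (j := u) (i := mkD v.1.1 u.1.2 hvm.1 hum.2) rfl h'
          fun t _ h2 _ => hg t (hfar t (by simp only [mkD_fst] at h2; omega))).symm
    rw [h1]
    rcases le_total u.1.2 v.1.2 with h' | h'
    · exact dual_col_const g (j := v) (i := mkD v.1.1 u.1.2 hvm.1 hum.2) rfl h'
        fun t h2 _ _ => hg t (hfar t (by simp only [mkD_fst] at h2; omega))
    · exact (dual_col_const g (i := v) (j := mkD v.1.1 u.1.2 hvm.1 hum.2) rfl h'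
        fun t h2 _ _ => hg t (hfar t (by omega))).symm
  let v₀ : Dual := mkD (2 * N + 1) 1 (by omega) rfl
  have hv₀ : N ≤ v₀.1.1 := by simp [v₀]; omega
  -- To the right of the rightmost surrounded primal vertex there is no filled edge, so the dual
  -- vertex beside it is joined to the far right; it also lies along the loop.
  have hright : g w = g v₀ := by
    have hfin : {i : Primal | Surrounds l i.1}.Finite :=
      finite_primal N N fun i hi => by have := i.mod; have := hN i.1 (by omega) hi; omega
    obtain ⟨i, hi, hmax⟩ := hfin.toFinset.exists_max_image (fun i : Primal => i.1.1)
      ⟨k, by rw [Set.Finite.mem_toFinset]; exact (hp k w ⟨a, ha, hkw⟩).1⟩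
    rw [Set.Finite.mem_toFinset] at hi
    have hm := i.mod
    have hmax' : ∀ j : Primal, Surrounds l j.1 → j.1.1 ≤ i.1.1 := fun j hj =>
      hmax j (by rw [Set.Finite.mem_toFinset]; exact hj)
    let u : Dual := mkD (i.1.1 + 1) (i.1.2 + 1) (by omega) (by omega)
    have hus : ¬ Surrounds l u.1 := by
      intro hus
      let i' : Primal := mkP (i.1.1 + 2) i.1.2 (by omega) (by omega)
      have := hmax' i' (hp.of_dual h hl (i := i') (u := u) ⟨by simp [u, i']; omega, by simp [u, i']⟩ hus)
      simp [i'] at this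
    rw [← hgl i u ((h.surrounds_iff hl (beside_up i)).2 (by tauto))]
    have hu1 : u.1.1 = i.1.1 + 1 := rfl
    have h1 := hN i.1 (by omega) hi
    let u' : Dual := mkD (2 * N + 1) u.1.2 (by omega) u.mod.2
    rw [dual_row_const g (i := u) (j := u') rfl (by simp [u, u']; omega)]
    · exact hrr _ _ (by simp [u']; omega) hv₀
    · intro t _ h2 _
      refine hg t ?_
      intro hf
      obtain ⟨j₁, j₂, -, hj, -, -, hc⟩ := exists_edgeEnds t
      have := hmax' j₂ (hf.1 j₂ hj)
      omega
  suffices key : ∀ (n : ℕ) (u : Dual), ¬ Surrounds l u.1 → N ≤ u.1.1 + n → g u = g v₀ by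
    rw [key (N - u.1.1).toNat u hu (by omega), key (N - v.1.1).toNat v hv (by omega)]
  intro n
  induction n with
  | zero => intro u _ hn; exact hrr _ _ (by simpa using hn) hv₀
  | succ n ih =>
    intro u hu hn
    have hm := u.mod
    let t : Tile := mkT (u.1.1 + 1) u.1.2 (by omega)
    have hut : u ∈ dualEnds t := by rw [mem_dualEnds, isCorner_iff]; simp [t]
    -- Walk to the right until a filled edge blocks the way. Its ends are surrounded, so the loop
    -- passes there and connects the walk to the far right.
    by_cases ht : t ∈ filling ω l
    · let i : Primal := mkP (u.1.1 + 1) (u.1.2 + 1) (by omega) (by omega)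
      have hi : i ∈ edgeEnds t := by rw [mem_edgeEnds, isCorner_iff]; simp [t, i]
      have hs := filling_primal ht hi
      rw [hgl i u ((h.surrounds_iff hl (beside_of_corners hi hut).1).2 (by tauto)), hright]
    · let u' : Dual := mkD (u.1.1 + 2) u.1.2 (by omega) (by omega)
      have hut' : u' ∈ dualEnds t := by rw [mem_dualEnds, isCorner_iff]; simp [t, u']; omega
      rw [hg t ht u hut u' hut']
      exact ih u' (fun hs => ht (hp.mem_filling h hl hut' hs)) (by push_cast at hn; simp [u']; omega)

/-- Each vertex is a corner of four tiles, so `turn_tile` adds up to 4 (|IP| + |ID| - |F|), with IP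
and ID the surrounded vertices of the two lattices and F the filling. The filling connects IP, and
its faces are the points of ID and the outside. Euler's formula makes the bracket equal to 1. -/
theorem PrimalInside.turnSum_eq {ω : Config} {l : Set Arc} (h : IsCurve ω l) (hl : l.Finite)
    (hp : PrimalInside l) : turnSum l = 4 := by
  classical
  obtain ⟨N, hN0, hNl, hN⟩ := h.sur_bounds hl
  obtain ⟨a₀, ha₀⟩ := h.nonempty
  obtain ⟨k₀, w₀, hkw⟩ := a₀.exists_crosses
  have hfP : {i : Primal | Surrounds l i.1}.Finite :=
    finite_primal N N fun i hi => by have := i.mod; have := hN i.1 (by omega) hi; omega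
  have hfD : {i : Dual | Surrounds l i.1}.Finite :=
    finite_dual N N fun i hi => by have := i.mod; have := hN i.1 (by omega) hi; omega
  have hfT : {t : Tile | -(N + 1) ≤ t.1.1 ∧ t.1.1 ≤ N + 1 ∧ -(N + 1) ≤ t.1.2 ∧ t.1.2 ≤ N + 1}.Finite :=
    finite_tiles (N + 1) (N + 1) fun t ht => ht
  set IP := hfP.toFinset with hIP
  set ID := hfD.toFinset with hID
  set T := hfT.toFinset with hT
  have mP : ∀ i, i ∈ IP ↔ Surrounds l i.1 := fun i => by rw [hIP, Set.Finite.mem_toFinset]; rfl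
  have mD : ∀ i, i ∈ ID ↔ Surrounds l i.1 := fun i => by rw [hID, Set.Finite.mem_toFinset]; rfl
  have mT : ∀ t, t ∈ T ↔ -(N + 1) ≤ t.1.1 ∧ t.1.1 ≤ N + 1 ∧ -(N + 1) ≤ t.1.2 ∧ t.1.2 ≤ N + 1 :=
    fun t => by rw [hT, Set.Finite.mem_toFinset]; rfl
  have hTc : ∀ z : Pt, (z.1 + z.2) % 2 = 0 → Surrounds l z → ∀ t, IsCorner t z → t ∈ T := by
    intro z hz hs t ht
    have := hN z hz hs
    rw [isCorner_iff] at ht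
    rw [mT]; omega
  let F : Finset Tile := T.filter fun t => t ∈ filling ω l
  have mF : ∀ t, t ∈ F ↔ t ∈ filling ω l := by
    intro t
    rw [Finset.mem_filter]
    refine ⟨fun h => h.2, fun hf => ⟨?_, hf⟩⟩
    obtain ⟨i, -, hi, -⟩ := exists_edgeEnds t
    exact hTc i.1 (by have := i.mod; omega) (hf.1 i hi) t hi
  let f : Arc → ℤ := fun a => if Surrounds l a.corner then 1 else -1
  have hsum : turnSum l = ∑ t ∈ T, ∑ a ∈ hl.toFinset with a.tile = t, f a := by
    rw [turnSum, finsum_mem_eq_finite_toFinset_sum _ hl]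
    refine (Finset.sum_fiberwise_of_maps_to (fun a ha => ?_) _).symm
    rw [Set.Finite.mem_toFinset] at ha
    have := hNl a ha
    rw [mT]; omega
  have htile : ∀ t ∈ T, ∑ a ∈ hl.toFinset with a.tile = t, f a =
      (∑ k ∈ IP, if k ∈ edgeEnds t then (1 : ℤ) else 0) +
      (∑ k ∈ ID, if k ∈ dualEnds t then (1 : ℤ) else 0) - 4 * (if t ∈ F then (1 : ℤ) else 0) := by
    intro t _
    obtain ⟨i, j, hi, hj, hij, hall, -⟩ := exists_edgeEnds t
    obtain ⟨u, v, hu, hv, huv, hall', -⟩ := exists_dualEnds t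
    rw [sum_arcs_of_tile f hi hj hij hu hv huv hall hall', sum_corner_primal IP hi hj hij hall,
      sum_corner_dual ID hu hv huv hall']
    simp only [mF, mP, mD, Set.Finite.mem_toFinset]
    exact turn_tile h hl hp hi hj hu hv hall hall' f fun a => rfl
  rw [hsum, Finset.sum_congr rfl htile, Finset.sum_sub_distrib, Finset.sum_add_distrib,
    Finset.sum_comm, Finset.sum_comm (s := T) (t := ID), ← Finset.mul_sum]
  have e1 : ∑ y ∈ IP, ∑ x ∈ T, (if y ∈ edgeEnds x then (1 : ℤ) else 0) = IP.card * 4 := by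
    have e0 : ∀ i ∈ IP, ∑ x ∈ T, (if i ∈ edgeEnds x then (1 : ℤ) else 0) = 4 := fun i hi =>
      sum_tiles_at T i.1 (by have := i.mod; omega)
        (hTc i.1 (by have := i.mod; omega) ((mP i).1 hi))
    rw [Finset.sum_congr rfl e0, Finset.sum_const, nsmul_eq_mul]
  have e2 : ∑ y ∈ ID, ∑ x ∈ T, (if y ∈ dualEnds x then (1 : ℤ) else 0) = ID.card * 4 := by
    have e0 : ∀ i ∈ ID, ∑ x ∈ T, (if i ∈ dualEnds x then (1 : ℤ) else 0) = 4 := fun i hi =>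
      sum_tiles_at T i.1 (by have := i.mod; omega)
        (hTc i.1 (by have := i.mod; omega) ((mD i).1 hi))
    rw [Finset.sum_congr rfl e0, Finset.sum_const, nsmul_eq_mul]
  have e3 : ∑ t ∈ T, (if t ∈ F then (1 : ℤ) else 0) = F.card := by
    rw [Finset.sum_ite_mem, Finset.inter_eq_right.2 (Finset.filter_subset _ _)]; simp [F]
  rw [e1, e2, e3]
  -- Euler's formula
  have hPF : ∀ t ∈ F, ∀ i ∈ edgeEnds t, i ∈ IP := fun t ht i hi =>
    (mP i).2 (filling_primal ((mF t).1 ht) hi)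
  have c1 : Nat.card (PrimalFns IP F) = 2 := by
    have hk₀ : k₀ ∈ IP := (mP k₀).2 (hp k₀ w₀ ⟨a₀, ha₀, hkw⟩).1
    let e : PrimalFns IP F → ZMod 2 := fun φ => φ.1 ⟨k₀, hk₀⟩
    have he : Function.Bijective e := by
      constructor
      · intro φ φ' hφ
        apply Subtype.ext; funext i
        have key : ∀ φ : PrimalFns IP F, φ.1 i = φ.1 ⟨k₀, hk₀⟩ := by
          intro φ
          have h1 := hp.primal_const h hl (fun j => if hj : j ∈ IP then φ.1 ⟨j, hj⟩ else 0) (by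
            intro t ht i hi j hj
            have hi' := hPF t ((mF t).2 ht) i hi
            have hj' := hPF t ((mF t).2 ht) j hj
            simp only [dif_pos hi', dif_pos hj']
            exact φ.2 t ((mF t).2 ht) _ _ hi hj) ((mP i.1).1 i.2) ((mP k₀).1 hk₀)
          simpa [hk₀] using h1
        rw [key, key]; exact hφ
      · intro c; exact ⟨⟨fun _ => c, fun _ _ _ _ _ _ => rfl⟩, rfl⟩
    rw [Nat.card_congr (Equiv.ofBijective e he)]; simp
  have c2 : Nat.card (DualFns F) = 2 ^ ID.card * 2 := by
    have hw₀ : ¬ Surrounds l w₀.1 := (hp k₀ w₀ ⟨a₀, ha₀, hkw⟩).2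
    let e : DualFns F → (ID → ZMod 2) × ZMod 2 := fun g => (fun u => g.1 u.1, g.1 w₀)
    have he : Function.Bijective e := by
      constructor
      · intro g g' hgg
        apply Subtype.ext; funext u
        by_cases hu : Surrounds l u.1
        · exact congrFun (congrArg Prod.fst hgg) ⟨u, (mD u).2 hu⟩
        · have key : ∀ g : DualFns F, g.1 u = g.1 w₀ := fun g =>
            hp.dual_const h hl g.1 (fun t ht => g.2 t (mt (mF t).1 ht)) hu hw₀
          rw [key, key]; exact congrArg Prod.snd hgg
      · rintro ⟨f, c⟩
        refine ⟨⟨fun u => if hu : u ∈ ID then f ⟨u, hu⟩ else c, ?_⟩, ?_⟩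
        · intro t ht u hu v hv
          have key : ∀ u ∈ dualEnds t, u ∉ ID := fun u hu hs =>
            ht ((mF t).2 (hp.mem_filling h hl hu ((mD u).1 hs)))
          simp only [dif_neg (key u hu), dif_neg (key v hv)]
        · apply Prod.ext
          · funext u; simp [e]
          · simp [e, mD, hw₀]
    rw [Nat.card_congr (Equiv.ofBijective e he), Nat.card_prod]; simp
  have heul := euler hPF
  rw [c1, c2, mul_assoc, mul_comm 2 (2 ^ _ * 2), mul_assoc, mul_assoc, mul_comm 2 (2 ^ IP.card),
    ← mul_assoc] at heul
  have h5 : 2 ^ (F.card + 2) = 2 ^ (ID.card + IP.card + 1) := by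
    rw [pow_add, pow_add, pow_add]; linarith
  have h6 := Nat.pow_right_injective (le_refl 2) h5
  omega

/-! ### Translations that exchange the two lattices -/

/-- Translation by `(c, c)`. -/
def shiftPt (c : ℤ) (z : Pt) : Pt := (z.1 + c, z.2 + c)

/-- Translation of arcs by `(c, c)`. -/
def shiftArc (c : ℤ) (a : Arc) : Arc :=
  ⟨(⟨shiftPt c a.tile.1, by have := a.tile.mod; rw [Int.odd_iff]; simp [shiftPt]; omega⟩,
    shiftPt c a.corner), by
      have h := a.isCorner
      rw [isCorner_iff] at h ⊢
      simp only [shiftPt]; omega⟩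

@[simp] theorem shiftArc_tile (c : ℤ) (a : Arc) : (shiftArc c a).tile.1 = shiftPt c a.tile.1 := rfl

@[simp] theorem shiftArc_corner (c : ℤ) (a : Arc) : (shiftArc c a).corner = shiftPt c a.corner := rfl

theorem shiftArc_neg (c : ℤ) (a : Arc) : shiftArc (-c) (shiftArc c a) = a := by
  apply Arc.ext'
  · apply Tile.ext' <;> simp [shiftPt]
  · simp [shiftPt]

theorem shiftArc_injective (c : ℤ) : Function.Injective (shiftArc c) := fun a b h => by
  rw [← shiftArc_neg c a, h, shiftArc_neg]

theorem shiftPt_injective (c : ℤ) : Function.Injective (shiftPt c) := fun z w h => by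
  simp only [shiftPt, Prod.ext_iff] at h
  exact Prod.ext (by omega) (by omega)

/-- The configuration that is dual to a translated one. -/
def shiftConfig (c : ℤ) (ω : Config) : Config := fun t =>
  !ω ⟨shiftPt (-c) t.1, by have := t.mod; rw [Int.odd_iff]; simp [shiftPt]; omega⟩

/-- An odd translation exchanges the two lattices. An arc around a primal vertex becomes one around
a dual vertex, so open and closed must be exchanged too. -/
theorem shiftArc_mem {c : ℤ} (hc : c % 2 = 1) {ω : Config} {a : Arc} (ha : a ∈ arcs ω) :
    shiftArc c a ∈ arcs (shiftConfig c ω) := by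
  have hω : shiftConfig c ω (shiftArc c a).tile = !ω a.tile := by
    simp only [shiftConfig]
    congr 2
    apply Tile.ext' <;> simp [shiftPt]
  rcases a.corner_cases with ⟨i, hi⟩ | ⟨i, hi⟩
  · have hm := i.mod
    rw [mem_arcs_dual (u := mkD (i.1.1 + c) (i.1.2 + c) (by omega) (by omega)), hω,
      (mem_arcs_primal hi).1 ha]; rfl
    rw [shiftArc_corner, hi]; rfl
  · have hm := i.mod
    rw [mem_arcs_primal (i := mkP (i.1.1 + c) (i.1.2 + c) (by omega) (by omega)), hω,
      (mem_arcs_dual hi).1 ha]; rfl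
    rw [shiftArc_corner, hi]; rfl

theorem shiftArc_sides {c : ℤ} {a b : Arc} (h : (a.sides ∩ b.sides).Nonempty) :
    ((shiftArc c a).sides ∩ (shiftArc c b).sides).Nonempty := by
  have hn : ∀ a : Arc, (shiftArc c a).next = shiftPt c a.next := by
    intro a; simp only [Arc.next, shiftArc_tile, shiftArc_corner, shiftPt]; ext <;> simp <;> ring
  have hp : ∀ a : Arc, (shiftArc c a).prev = shiftPt c a.prev := by
    intro a; simp only [Arc.prev, shiftArc_tile, shiftArc_corner, shiftPt]; ext <;> simp <;> ring
  have key : ∀ (a : Arc) (e : Sym2 Pt), e ∈ a.sides → e.map (shiftPt c) ∈ (shiftArc c a).sides := by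
    intro a e he
    rcases he with rfl | he
    · left; rw [Sym2.map_mk, hn]; rfl
    · right; rw [Set.mem_singleton_iff] at he ⊢; rw [he, Sym2.map_mk, hp]; rfl
  obtain ⟨e, h1, h2⟩ := h
  exact ⟨_, key a e h1, key b e h2⟩

theorem shift_reachable {c : ℤ} (hc : c % 2 = 1) {ω : Config} {a b : Arc}
    (h : (arcGraph ω).Reachable a b) :
    (arcGraph (shiftConfig c ω)).Reachable (shiftArc c a) (shiftArc c b) := by
  refine h.map (⟨shiftArc c, ?_⟩ : arcGraph ω →g arcGraph (shiftConfig c ω))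
  intro a b hab
  simp only [arcGraph, SimpleGraph.fromRel_adj] at hab ⊢
  refine ⟨fun h => hab.1 (shiftArc_injective c h), ?_⟩
  rcases hab.2 with ⟨h1, h2, h3⟩ | ⟨h1, h2, h3⟩
  · exact Or.inl ⟨shiftArc_mem hc h1, shiftArc_mem hc h2, shiftArc_sides h3⟩
  · exact Or.inr ⟨shiftArc_mem hc h1, shiftArc_mem hc h2, shiftArc_sides h3⟩

theorem shiftConfig_neg (c : ℤ) (ω : Config) : shiftConfig (-c) (shiftConfig c ω) = ω := by
  funext t
  simp only [shiftConfig, Bool.not_not]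
  congr 1
  apply Tile.ext' <;> simp [shiftPt]

theorem IsCurve.shift {c : ℤ} (hc : c % 2 = 1) {ω : Config} {l : Set Arc} (h : IsCurve ω l) :
    IsCurve (shiftConfig c ω) (shiftArc c '' l) := by
  obtain ⟨a, ha, rfl⟩ := h
  refine ⟨shiftArc c a, shiftArc_mem hc ha, ?_⟩
  apply Set.Subset.antisymm
  · rintro _ ⟨b, hb, rfl⟩; exact shift_reachable hc hb
  · intro b hb
    have h1 := shift_reachable (c := -c) (by omega) hb
    rw [shiftConfig_neg, shiftArc_neg] at h1
    refine ⟨_, h1, ?_⟩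
    have := shiftArc_neg (-c) b
    rwa [neg_neg] at this

theorem surrounds_shift (c : ℤ) (l : Set Arc) (z : Pt) :
    Surrounds (shiftArc c '' l) (shiftPt c z) ↔ Surrounds l z := by
  have : raySet (shiftArc c '' l) (shiftPt c z) = shiftArc c '' raySet l z := by
    ext b
    constructor
    · rintro ⟨⟨a, ha, rfl⟩, h1, h2, h3⟩
      simp only [shiftArc_tile, shiftArc_corner, shiftPt] at h1 h2 h3
      exact ⟨a, ⟨ha, by omega, by omega, by omega⟩, rfl⟩
    · rintro ⟨a, ⟨ha, h1, h2, h3⟩, rfl⟩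
      refine ⟨⟨a, ha, rfl⟩, ?_, ?_, ?_⟩ <;> simp only [shiftArc_tile, shiftArc_corner, shiftPt] <;>
        omega
  rw [← sur_eq_one, ← sur_eq_one, sur, sur, this, Set.ncard_image_of_injective _ (shiftArc_injective c)]

theorem turnSum_shift (c : ℤ) (l : Set Arc) : turnSum (shiftArc c '' l) = turnSum l := by
  classical
  rw [turnSum, turnSum, finsum_mem_image (shiftArc_injective c).injOn]
  simp only [shiftArc_corner, surrounds_shift]

/-- The turning number of a loop: a loop makes four more turns in one direction than in the
other one. -/
theorem IsCurve.turnSum_eq {ω : Config} {l : Set Arc} (h : IsCurve ω l) (hl : l.Finite) :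
    turnSum l = 4 := by
  rcases h.inside_cases hl with hp | hd
  · exact hp.turnSum_eq h hl
  -- Translating by one doubled unit in each coordinate turns inner dual vertices into inner primal
  -- ones and preserves the turns.
  · rw [← turnSum_shift 1]
    have h' := h.shift (c := 1) rfl
    refine PrimalInside.turnSum_eq h' (hl.image _) ?_
    intro i u hiu
    obtain ⟨_, ⟨a, ha, rfl⟩, hi, hu, hc⟩ := hiu
    have him := i.mod; have hum := u.mod
    let u' : Dual := mkD (i.1.1 - 1) (i.1.2 - 1) (by omega) (by omega)
    let i' : Primal := mkP (u.1.1 - 1) (u.1.2 - 1) (by omega) (by omega)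
    have e1 : i.1 = shiftPt 1 u'.1 := by ext <;> simp [shiftPt, u']
    have e2 : u.1 = shiftPt 1 i'.1 := by ext <;> simp [shiftPt, i']
    rw [e1, e2, surrounds_shift, surrounds_shift]
    have := hd i' u' ⟨a, ha, ?_, ?_, ?_⟩
    · exact this.symm
    · rw [isCorner_iff] at hu ⊢; simp [shiftPt] at hu; simp [i']; omega
    · rw [isCorner_iff] at hi ⊢; simp [shiftPt] at hi; simp [u']; omega
    · rw [e1, e2, shiftArc_corner] at hc
      rcases hc with hc | hc
      · right; exact shiftPt_injective 1 hc
      · left; exact shiftPt_injective 1 hc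


/-! ### Loops and compatible spins under Dobrushin boundary conditions -/

/-- The configuration agrees with the boundary condition off `E`. -/
def Dob (n m : ℕ) (ω : Config) : Prop := ∀ t, t ∉ E n m → (ω t = true ↔ t.1.2 ≠ -1)

/-- The sign of the boundary condition for the spins. -/
def bs (z : Pt) : ℤˣ := if 0 ≤ z.2 then 1 else -1

/-- The spins satisfy the boundary conditions. -/
def BdSpins (n m : ℕ) (σ : Spins) : Prop :=
  (∀ i, i ∉ B n m → σ.1 i = bs i.1) ∧ ∀ u, u ∉ B' n m → σ.2 u = bs u.1

/-- The spins are constant on the clusters and on the dual clusters of `ω`. -/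
def Compat (ω : Config) (σ : Spins) : Prop :=
  (∀ t, ω t = true → ∀ i ∈ edgeEnds t, ∀ j ∈ edgeEnds t, σ.1 i = σ.1 j) ∧
  ∀ t, ω t = false → ∀ u ∈ dualEnds t, ∀ v ∈ dualEnds t, σ.2 u = σ.2 v

/-- The spins that are compatible with `ω` and the boundary conditions. -/
def Comp (n m : ℕ) (ω : Config) (σ : Spins) : Prop := BdSpins n m σ ∧ Compat ω σ

/-- An open tile has no arcs around its primal corners, so both ends of the edge have the same
position relative to one dual corner. -/
theorem IsCurve.surrounds_edge {ω : Config} {l : Set Arc} (h : IsCurve ω l) (hl : l.Finite)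
    {t : Tile} (ht : ω t = true) {i j : Primal} (hi : i ∈ edgeEnds t) (hj : j ∈ edgeEnds t) :
    sur l i.1 = sur l j.1 := by
  classical
  obtain ⟨u, -, hu, -⟩ := exists_dualEnds t
  have h1 := h.arcInd_add hi hu
  have h2 := h.arcInd_add hj hu
  have h3 := h.sur_add hl (beside_of_corners hi hu).1
  have h4 := h.sur_add hl (beside_of_corners hj hu).1
  have hz : ∀ i ∈ edgeEnds t, arcInd l t.1 i.1 = 0 := by
    intro i _
    refine if_neg ?_
    rintro ⟨a, ha, hat, hac⟩
    have := (mem_arcs_primal hac).1 (h.subset ha)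
    rw [Subtype.ext hat, ht] at this; simp at this
  rw [← h1, hz i hi] at h3
  rw [← h2, hz j hj, ← h3] at h4
  linear_combination -h4

theorem IsCurve.surrounds_dualEdge {ω : Config} {l : Set Arc} (h : IsCurve ω l) (hl : l.Finite)
    {t : Tile} (ht : ω t = false) {u v : Dual} (hu : u ∈ dualEnds t) (hv : v ∈ dualEnds t) :
    sur l u.1 = sur l v.1 := by
  classical
  obtain ⟨i, -, hi, -⟩ := exists_edgeEnds t
  have h1 := h.arcInd_add hi hu
  have h2 := h.arcInd_add hi hv
  have h3 := h.sur_add hl (beside_of_corners hi hu).1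
  have h4 := h.sur_add hl (beside_of_corners hi hv).1
  have hz : ∀ i ∈ dualEnds t, arcInd l t.1 i.1 = 0 := by
    intro i _
    refine if_neg ?_
    rintro ⟨a, ha, hat, hac⟩
    have := (mem_arcs_dual hac).1 (h.subset ha)
    rw [Subtype.ext hat, ht] at this; simp at this
  rw [← h1, hz u hu] at h3
  rw [← h2, hz v hv] at h4
  linear_combination h3 - h4

/-- From a vertex outside, the half row to the left or to the right avoids E and is open, because
horizontal edges are never in row -1. It leads to infinity without crossing the loop. -/
theorem Dob.not_surrounds_primal {n m : ℕ} {ω : Config} (hω : Dob n m ω) {l : Set Arc}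
    (h : IsCurve ω l) (hl : l.Finite) {i : Primal} (hi : i ∉ B n m) : ¬ Surrounds l i.1 := by
  obtain ⟨N, hN0, -, hN⟩ := h.sur_bounds hl
  have him := i.mod
  rw [mem_B] at hi
  have hfar : ∀ z : Pt, (z.1 + z.2) % 2 = 0 → (z.1 ≤ -N ∨ N ≤ z.1) → sur l z = 0 := by
    intro z hz h'
    rw [sur_eq_zero]; intro hs; have := hN z hz hs; omega
  rw [← sur_eq_zero]
  have hrow : ∀ t : Tile, t.1.2 = i.1.2 → t ∉ E n m → ∀ k ∈ edgeEnds t, ∀ l' ∈ edgeEnds t,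
      sur l k.1 = sur l l'.1 := fun t ht hE k hk l' hl' =>
    h.surrounds_edge hl ((hω t hE).2 (by omega)) hk hl'
  by_cases hc : i.1.1 < -(2 * n)
  · let j : Primal := mkP (min i.1.1 (-2 * N)) i.1.2 (by omega) him.2
    rw [← primal_row_const (fun k : Primal => sur l k.1) (i := j) (j := i) rfl (by simp [j])
      fun t h1 h2 h3 => hrow t h1 (by rw [mem_E]; omega)]
    exact hfar _ (by simp [j]; omega) (Or.inl (by simp [j]; omega))
  · let j : Primal := mkP (max i.1.1 (2 * N)) i.1.2 (by omega) him.2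
    rw [primal_row_const (fun k : Primal => sur l k.1) (i := i) (j := j) rfl (by simp [j])
      fun t h1 h2 h3 => hrow t h1 (by rw [mem_E]; omega)]
    exact hfar _ (by simp [j]; omega) (Or.inr (by simp [j]; omega))

/-- Dual counterpart for the middle row: outside E the edges of row -1 are closed, so their duals
form an escape route to infinity. -/
theorem Dob.not_surrounds_row {n m : ℕ} {ω : Config} (hω : Dob n m ω) {l : Set Arc}
    (h : IsCurve ω l) (hl : l.Finite) {u : Dual} (hu : u ∉ B' n m) (hrow : u.1.2 = -1) :
    ¬ Surrounds l u.1 := by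
  obtain ⟨N, hN0, -, hN⟩ := h.sur_bounds hl
  have him := u.mod
  rw [mem_B'] at hu
  have hfar : ∀ z : Pt, (z.1 + z.2) % 2 = 0 → (z.1 ≤ -N ∨ N ≤ z.1) → sur l z = 0 := by
    intro z hz h'
    rw [sur_eq_zero]; intro hs; have := hN z hz hs; omega
  rw [← sur_eq_zero]
  have hrow : ∀ t : Tile, t.1.2 = u.1.2 → t ∉ E n m → ∀ k ∈ dualEnds t, ∀ l' ∈ dualEnds t,
      sur l k.1 = sur l l'.1 := by
    intro t ht hE k hk l' hl'
    refine h.surrounds_dualEdge hl ?_ hk hl'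
    have := hω t hE
    cases ho : ω t
    · rfl
    · rw [ho] at this; simp at this; omega
  by_cases hc : u.1.1 < -(2 * n)
  · let j : Dual := mkD (min u.1.1 (-2 * N - 1)) u.1.2 (by omega) him.2
    rw [← dual_row_const (fun k : Dual => sur l k.1) (i := j) (j := u) rfl (by simp [j])
      fun t h1 h2 h3 => hrow t h1 (by rw [mem_E]; omega)]
    exact hfar _ (by simp [j]; omega) (Or.inl (by simp [j]; omega))
  · let j : Dual := mkD (max u.1.1 (2 * N + 1)) u.1.2 (by omega) him.2
    rw [dual_row_const (fun k : Dual => sur l k.1) (i := u) (j := j) rfl (by simp [j])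
      fun t h1 h2 h3 => hrow t h1 (by rw [mem_E]; omega)]
    exact hfar _ (by simp [j]; omega) (Or.inr (by simp [j]; omega))

theorem Dob.open_around {n m : ℕ} {ω : Config} (hω : Dob n m ω) {u : Dual} (hu : u ∉ B' n m)
    (hrow : u.1.2 ≠ -1) {t : Tile} (ht : u ∈ dualEnds t) : ω t = true := by
  rw [mem_B'] at hu
  rw [mem_dualEnds, isCorner_iff] at ht
  have := u.mod; have := t.mod
  rw [hω t (by rw [mem_E]; omega)]; omega

/-- Around a dual vertex outside the domain and off the middle row, there is a trivial loop. -/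
theorem Dob.trivial_curve {n m : ℕ} {ω : Config} (hω : Dob n m ω) {l : Set Arc}
    (h : IsCurve ω l) {u : Dual} (hu : u ∉ B' n m) (hrow : u.1.2 ≠ -1) {a : Arc} (ha : a ∈ l)
    (hau : a.corner = u.1) {b : Arc} (hb : b ∈ l) : b.corner = u.1 := by
  refine h.induction (P := fun b => b.corner = u.1) ha hb hau ?_
  intro x _ y hy i w hxi hyi hx
  have hw : w = u := by
    rcases hxi.2.2 with h' | h'
    · exact absurd (h'.symm.trans hx) (Primal.ne_dual _ _)
    · exact Subtype.ext (h'.symm.trans hx)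
  rw [hw] at hyi
  rcases hyi.2.2 with h' | h'
  · have h1 := hω.open_around hu hrow hyi.2.1
    rw [(mem_arcs_primal h').1 (h.subset hy)] at h1; simp at h1
  · exact h'

/-- A loop that surrounds a dual vertex outside the domain is trivial. -/
theorem Dob.outer_loop {n m : ℕ} {ω : Config} (hω : Dob n m ω) {l : Set Arc}
    (h : IsCurve ω l) (hl : l.Finite) {u : Dual} (hu : u ∉ B' n m) (hs : Surrounds l u.1) :
    (∀ a ∈ l, a.corner = u.1) ∧ ∀ z : Pt, (z.1 + z.2) % 2 = 0 → Surrounds l z → z = u.1 := by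
  have hrow : u.1.2 ≠ -1 := fun h' => hω.not_surrounds_row h hl hu h' hs
  have hum := u.mod
  have hall : ∀ a ∈ l, a.corner = u.1 := by
    let i : Primal := mkP (u.1.1 + 1) (u.1.2 + 1) (by omega) (by omega)
    have hiu : Beside i u := ⟨Or.inr (by simp [i]), Or.inr (by simp [i])⟩
    have hi : i ∉ B n m ∨ u.1.1 < -(2 * n) ∨ u.1.2 < -(2 * m) := by
      rw [mem_B'] at hu; rw [mem_B]; simp [i]; omega
    have key : ∀ i : Primal, Beside i u → ¬ Surrounds l i.1 := by
      intro i hiu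
      refine hω.not_surrounds_primal h hl ?_
      unfold Beside at hiu
      have := i.mod
      rw [mem_B'] at hu; rw [mem_B]; omega
    have := key i hiu
    obtain ⟨a, ha, hac⟩ := (h.surrounds_iff hl hiu).2 (by tauto)
    have hau : a.corner = u.1 := by
      rcases hac.2.2 with h' | h'
      · have h1 := hω.open_around hu hrow hac.2.1
        rw [(mem_arcs_primal h').1 (h.subset ha)] at h1; simp at h1
      · exact h'
    exact fun b hb => hω.trivial_curve h hu hrow ha hau hb
  refine ⟨hall, ?_⟩
  have hcr : ∀ i w, CrossedBy l i w → w = u := by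
    rintro i w ⟨a, ha, hac⟩
    rcases hac.2.2 with h' | h'
    · exact absurd (h'.symm.trans (hall a ha)) (Primal.ne_dual _ _)
    · exact Subtype.ext (h'.symm.trans (hall a ha))
  obtain ⟨N, hN0, -, hN⟩ := h.sur_bounds hl
  suffices key : ∀ (k : ℕ) (z : Pt), (z.1 + z.2) % 2 = 0 → z ≠ u.1 → N ≤ z.1 + k → sur l z = 0 by
    intro z hz hzs
    by_contra hne
    have := key (N - z.1).toNat z hz hne (by omega)
    exact sur_eq_zero.1 this hzs
  intro k
  induction k with
  | zero =>
    intro z hz _ hk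
    rw [sur_eq_zero]; intro hs'; have := hN z hz hs'; push_cast at hk; omega
  | succ k ih =>
    intro z hz hne hk
    -- The loop is crossed only at sides ending in `u`. At least one of the two diagonal steps to
    -- the right avoids `u`, so the walk to infinity never meets the loop.
    obtain ⟨e, he, hw⟩ : ∃ e : ℤ, (e = 1 ∨ e = -1) ∧ (z.1 + 1, z.2 + e) ≠ u.1 := by
      by_cases h1 : (z.1 + 1, z.2 + 1) = u.1
      · refine ⟨-1, Or.inr rfl, fun h2 => ?_⟩
        rw [← h1, Prod.ext_iff] at h2; simp at h2
      · exact ⟨1, Or.inl rfl, h1⟩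
    have h2 := ih (z.1 + 1, z.2 + e) (by simp; omega) hw (by push_cast at hk; simp; omega)
    by_cases hp : z.1 % 2 = 0
    · let i : Primal := mkP z.1 z.2 hp (by omega)
      let w : Dual := mkD (z.1 + 1) (z.2 + e) (by omega) (by omega)
      have hb : Beside i w := ⟨Or.inl rfl, by rcases he with rfl | rfl <;> simp [i, w]; omega⟩
      have h3 := h.sur_add hl hb
      rw [if_neg fun hc => hw (congrArg Subtype.val (hcr _ _ hc))] at h3
      have h4 : sur l z + sur l (z.1 + 1, z.2 + e) = 0 := h3
      rwa [h2, add_zero] at h4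
    · let w : Dual := mkD z.1 z.2 (by omega) (by omega)
      let i : Primal := mkP (z.1 + 1) (z.2 + e) (by omega) (by omega)
      have hb : Beside i w := ⟨Or.inr (by simp [i, w]), by rcases he with rfl | rfl <;> simp [i, w]⟩
      have h3 := h.sur_add hl hb
      rw [if_neg fun hc => hne (congrArg Subtype.val (hcr _ _ hc))] at h3
      have h4 : sur l (z.1 + 1, z.2 + e) + sur l z = 0 := h3
      rwa [h2, zero_add] at h4

/-! ### Inner loops and trivial outer loops -/

/-- The loops of `ω` that surround a point of `D`. -/
def InnerLoop (n m : ℕ) (ω : Config) (l : Set Arc) : Prop :=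
  IsLoop ω l ∧ ∃ z ∈ D n m, Surrounds l z

theorem IsCurve.exists_surrounds {ω : Config} {l : Set Arc} (h : IsCurve ω l) (hl : l.Finite) {a : Arc}
    (ha : a ∈ l) : ∃ z : Pt, (z.1 + z.2) % 2 = 0 ∧ Surrounds l z ∧ IsCorner a.tile z := by
  obtain ⟨i, u, hiu⟩ := a.exists_crosses
  have := (h.surrounds_iff hl hiu.beside).1 ⟨a, ha, hiu⟩
  by_cases hi : Surrounds l i.1
  · exact ⟨i.1, by have := i.mod; omega, hi, hiu.1⟩
  · exact ⟨u.1, by have := u.mod; omega, by tauto, hiu.2.1⟩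

theorem not_mem_D_primal {n m : ℕ} {i : Primal} : i.1 ∈ D n m ↔ i ∈ B n m := by
  have := i.mod
  rw [mem_D, mem_B]; omega

theorem mem_D_dual {n m : ℕ} {u : Dual} : u.1 ∈ D n m ↔ u ∈ B' n m := by
  have := u.mod
  rw [mem_D, mem_B']; omega

theorem pt_cases {z : Pt} (hz : (z.1 + z.2) % 2 = 0) :
    (∃ i : Primal, z = i.1) ∨ ∃ u : Dual, z = u.1 := by
  by_cases h : z.1 % 2 = 0
  · left; exact ⟨mkP z.1 z.2 h (by omega), rfl⟩
  · right; exact ⟨mkD z.1 z.2 (by omega) (by omega), rfl⟩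

/-- Primal vertices outside are never surrounded, and a loop around an outer dual vertex is trivial,
so it could not surround a point of the domain as well. -/
theorem Dob.inner_surrounds {n m : ℕ} {ω : Config} (hω : Dob n m ω) {l : Set Arc}
    (h : InnerLoop n m ω l) {z : Pt} (hz : (z.1 + z.2) % 2 = 0) (hs : Surrounds l z) :
    z ∈ D n m := by
  obtain ⟨⟨hc, hl⟩, w, hw, hws⟩ := h
  rcases pt_cases hz with ⟨i, rfl⟩ | ⟨u, rfl⟩
  · rw [not_mem_D_primal]
    by_contra hi
    exact hω.not_surrounds_primal hc hl hi hs
  · by_contra hu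
    rw [mem_D_dual] at hu
    have := (hω.outer_loop hc hl hu hs).2 w ((mem_D n m w).1 hw).1 hws
    rw [this, mem_D_dual] at hw
    exact hu hw

/-- A loop is either an inner loop or the trivial loop around a dual vertex outside. -/
theorem Dob.loop_cases {n m : ℕ} {ω : Config} (hω : Dob n m ω) {l : Set Arc}
    (h : IsLoop ω l) : InnerLoop n m ω l ∨ ∃ u : Dual, u ∉ B' n m ∧ Surrounds l u.1 ∧
      ∀ a ∈ l, a.corner = u.1 := by
  obtain ⟨a, ha⟩ := h.1.nonempty
  obtain ⟨z, hz, hs, -⟩ := h.1.exists_surrounds h.2 ha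
  by_cases hD : z ∈ D n m
  · exact Or.inl ⟨h, z, hD, hs⟩
  · right
    rcases pt_cases hz with ⟨i, rfl⟩ | ⟨u, rfl⟩
    · rw [not_mem_D_primal] at hD
      exact absurd hs (hω.not_surrounds_primal h.1 h.2 hD)
    · rw [mem_D_dual] at hD
      exact ⟨u, hD, hs, (hω.outer_loop h.1 h.2 hD hs).1⟩

theorem Dob.inner_tile {n m : ℕ} {ω : Config} (hω : Dob n m ω) {l : Set Arc}
    (h : InnerLoop n m ω l) {a : Arc} (ha : a ∈ l) : a.tile ∈ Ebar n m := by
  obtain ⟨z, hz, hs, hc⟩ := h.1.1.exists_surrounds h.1.2 ha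
  rw [Ebar_eq]
  exact ⟨z, hω.inner_surrounds h hz hs, hc⟩

theorem Dob.finite_inner {n m : ℕ} {ω : Config} (hω : Dob n m ω) :
    {l | InnerLoop n m ω l}.Finite := by
  have : {a : Arc | a.tile ∈ Ebar n m}.Finite := finite_arcs (finite_Ebar n m) fun a ha => ha
  exact this.finite_subsets.subset fun l hl a ha => hω.inner_tile hl ha

/-! ### Flipping spins inside loops -/

/-- The sign character of `ℤ/2`. -/
def sgn (x : ZMod 2) : ℤˣ := if x = 0 then 1 else -1

theorem sgn_zero : sgn 0 = 1 := rfl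

/-- Multiply the spins by the signs of a pair of cochains. -/
def twist (σ : Spins) (φ : Primal → ZMod 2) (ψ : Dual → ZMod 2) : Spins :=
  (fun i => σ.1 i * sgn (φ i), fun u => σ.2 u * sgn (ψ u))

theorem Comp.twist {n m : ℕ} {ω : Config} {σ : Spins} (h : Comp n m ω σ) {φ : Primal → ZMod 2}
    {ψ : Dual → ZMod 2} (h1 : ∀ i, i ∉ B n m → φ i = 0) (h2 : ∀ u, u ∉ B' n m → ψ u = 0)
    (h3 : ∀ t, ω t = true → ∀ i ∈ edgeEnds t, ∀ j ∈ edgeEnds t, φ i = φ j)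
    (h4 : ∀ t, ω t = false → ∀ i ∈ dualEnds t, ∀ j ∈ dualEnds t, ψ i = ψ j) :
    Comp n m ω (twist σ φ ψ) := by
  refine ⟨⟨fun i hi => ?_, fun u hu => ?_⟩, fun t ht i hi j hj => ?_, fun t ht i hi j hj => ?_⟩
  · simp only [BKW.twist]; rw [h1 i hi, sgn_zero, mul_one, h.1.1 i hi]
  · simp only [BKW.twist]; rw [h2 u hu, sgn_zero, mul_one, h.1.2 u hu]
  · simp only [BKW.twist]; rw [h3 t ht i hi j hj, h.2.1 t ht i hi j hj]
  · simp only [BKW.twist]; rw [h4 t ht i hi j hj, h.2.2 t ht i hi j hj]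

/-- Flip all spins inside the loop `l`. -/
def flip (l : Set Arc) (σ : Spins) : Spins :=
  twist σ (fun i => sur l i.1) (fun u => sur l u.1)

theorem Comp.flip {n m : ℕ} {ω : Config} (hω : Dob n m ω) {σ : Spins} (h : Comp n m ω σ)
    {l : Set Arc} (hl : InnerLoop n m ω l) : Comp n m ω (flip l σ) := by
  have hc := hl.1.1
  have hf := hl.1.2
  refine h.twist (fun i hi => ?_) (fun u hu => ?_) (fun t ht i hi j hj => ?_) fun t ht i hi j hj => ?_
  · rw [sur_eq_zero]
    exact fun hs => hi (not_mem_D_primal.1 (hω.inner_surrounds hl (by have := i.mod; omega) hs))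
  · rw [sur_eq_zero]
    exact fun hs => hu (mem_D_dual.1 (hω.inner_surrounds hl (by have := u.mod; omega) hs))
  · exact hc.surrounds_edge hf ht hi hj
  · exact hc.surrounds_dualEdge hf ht hi hj

/-- The loop `l` is clockwise in the orientation that corresponds to the spins `σ`. -/
def CwSpins (σ : Spins) (l : Set Arc) : Prop :=
  ∀ i u, CrossedBy l i u → (σ.1 i = σ.2 u ↔ Surrounds l u.1)

/-- The loop `l` is counter-clockwise in the orientation that corresponds to the spins `σ`. -/
def CcwSpins (σ : Spins) (l : Set Arc) : Prop :=
  ∀ i u, CrossedBy l i u → (σ.1 i = σ.2 u ↔ ¬ Surrounds l u.1)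

theorem Compat.curve_const {ω : Config} {σ : Spins} (hσ : Compat ω σ) {l : Set Arc}
    (h : IsCurve ω l) {i j : Primal} {u v : Dual} (h1 : CrossedBy l i u) (h2 : CrossedBy l j v) :
    σ.1 i = σ.1 j ∧ σ.2 u = σ.2 v := by
  obtain ⟨a, ha, hac⟩ := h1
  obtain ⟨b, hb, hbc⟩ := h2
  exact ⟨h.const_primal σ.1 (fun a _ hω => hσ.1 a.tile hω) ha hb hac hbc,
    h.const_dual σ.2 (fun a _ hω => hσ.2 a.tile hω) ha hb hac hbc⟩

theorem IsCurve.side_const {ω : Config} {l : Set Arc} (h : IsCurve ω l) (hl : l.Finite)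
    {i j : Primal} {u v : Dual} (h1 : CrossedBy l i u) (h2 : CrossedBy l j v) :
    (Surrounds l u.1 ↔ Surrounds l v.1) ∧ (Surrounds l i.1 ↔ Surrounds l j.1) := by
  rcases h.inside_cases hl with hp | hp
  · have := hp i u h1; have := hp j v h2; tauto
  · have := hp i u h1; have := hp j v h2; tauto

/-- The spins are constant along each of the two sides of the loop, so the relation at one crossed
side of a tile decides for the whole loop. -/
theorem Compat.cw_or_ccw {ω : Config} {σ : Spins} (hσ : Compat ω σ) {l : Set Arc}
    (h : IsCurve ω l) (hl : l.Finite) : CwSpins σ l ↔ ¬ CcwSpins σ l := by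
  obtain ⟨a, ha⟩ := h.nonempty
  obtain ⟨i, u, hiu⟩ := a.exists_crosses
  have hc : CrossedBy l i u := ⟨a, ha, hiu⟩
  constructor
  · intro h1 h2
    have := h1 i u hc; have := h2 i u hc; tauto
  · intro hn
    by_contra hcw
    apply hn
    intro j v hjv
    have h1 := hσ.curve_const h hc hjv
    have h2 := (h.side_const hl hc hjv).1
    rw [← h1.1, ← h1.2, ← h2]
    by_contra hne
    apply hcw
    intro k w hkw
    have h3 := hσ.curve_const h hc hkw
    have h4 := (h.side_const hl hc hkw).1
    rw [← h3.1, ← h3.2, ← h4]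
    tauto

/-- Exactly one of the two spins is flipped if the loop runs between them, and otherwise both or
none. So the relative sign changes along `l` and nowhere else. -/
theorem flip_eq_iff {ω : Config} {σ : Spins} {l : Set Arc} (h : IsCurve ω l) (hl : l.Finite)
    {i : Primal} {u : Dual} (hiu : Beside i u) :
    ((flip l σ).1 i = (flip l σ).2 u) ↔ ((σ.1 i = σ.2 u) ↔ ¬ CrossedBy l i u) := by
  have h1 := h.sur_add hl hiu
  simp only [flip, twist]
  by_cases hc : CrossedBy l i u
  · rw [if_pos hc] at h1
    simp only [hc, not_true, iff_false]
    generalize σ.1 i = a at *; generalize σ.2 u = b at *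
    generalize sur l i.1 = x at *; generalize sur l u.1 = y at *
    revert a b x y; decide
  · rw [if_neg hc] at h1
    simp only [hc, not_false_eq_true, iff_true]
    generalize σ.1 i = a at *; generalize σ.2 u = b at *
    generalize sur l i.1 = x at *; generalize sur l u.1 = y at *
    revert a b x y; decide

/-- Any choice of orientations of the inner loops is realised by compatible spins. -/
theorem Dob.exists_comp {n m : ℕ} {ω : Config} (hω : Dob n m ω) {σ₀ : Spins}
    (h₀ : Comp n m ω σ₀) (c : Set Arc → Prop) :
    ∃ σ, Comp n m ω σ ∧ ∀ l, InnerLoop n m ω l → (CwSpins σ l ↔ c l) := by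
  suffices key : ∀ S : Finset (Set Arc), (∀ l ∈ S, InnerLoop n m ω l) →
      ∃ σ, Comp n m ω σ ∧ ∀ l ∈ S, (CwSpins σ l ↔ c l) by
    obtain ⟨σ, h1, h2⟩ := key hω.finite_inner.toFinset fun l hl => by simpa using hl
    exact ⟨σ, h1, fun l hl => h2 l (by simpa using hl)⟩
  classical
  intro S
  induction S using Finset.induction_on with
  | empty => exact fun _ => ⟨σ₀, h₀, by simp⟩
  | insert l S hlS ih =>
    intro hS
    obtain ⟨σ, h1, h2⟩ := ih fun l' hl' => hS l' (Finset.mem_insert_of_mem hl')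
    have hl := hS l (Finset.mem_insert_self l S)
    by_cases hcl : CwSpins σ l ↔ c l
    · exact ⟨σ, h1, fun l' hl' => by
        rcases Finset.mem_insert.1 hl' with rfl | hl'
        exacts [hcl, h2 l' hl']⟩
    -- Flipping the inside of `l` reverses `l` alone, since distinct loops of one configuration
    -- cross disjoint sets of sides.
    · have hf := h1.flip hω hl
      refine ⟨flip l σ, hf, fun l' hl' => ?_⟩
      have hbes : ∀ {l i u}, CrossedBy l i u → Beside i u := fun ⟨_, _, hb⟩ => hb.beside
      rcases Finset.mem_insert.1 hl' with rfl | hl'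
      · have h3 : CwSpins (flip l' σ) l' ↔ ¬ CwSpins σ l' := by
          have h4 : CwSpins (flip l' σ) l' ↔ CcwSpins σ l' := by
            refine forall_congr' fun i => forall_congr' fun u => forall_congr' fun hiu => ?_
            rw [flip_eq_iff hl.1.1 hl.1.2 (hbes hiu)]; tauto
          rw [h4, h1.2.cw_or_ccw hl.1.1 hl.1.2, not_not]
        rw [h3]; tauto
      · rw [← h2 l' hl']
        refine forall_congr' fun i => forall_congr' fun u => forall_congr' fun hiu => ?_
        have hn : ¬ CrossedBy l i u := by
          rintro ⟨a, ha, hac⟩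
          obtain ⟨b, hb, hbc⟩ := hiu
          have hl'' := hS l' (Finset.mem_insert_of_mem hl')
          have := hl.1.1.mem_of_crosses ha (hl''.1.1.subset hb) hac hbc
          rw [hl.1.1.eq_of_mem hl''.1.1 this hb] at hlS
          exact hlS hl'
        rw [flip_eq_iff hl.1.1 hl.1.2 (hbes hiu)]; tauto

/-- Spins are determined by the relative signs of adjacent spins and one spin. -/
theorem spins_ext {σ σ' : Spins} (h : ∀ i u, Beside i u → (σ.1 i = σ.2 u ↔ σ'.1 i = σ'.2 u))
    {i₀ : Primal} (h₀ : σ.1 i₀ = σ'.1 i₀) : σ = σ' := by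
  have key : ∀ i u, Beside i u → (σ.1 i = σ'.1 i ↔ σ.2 u = σ'.2 u) := by
    intro i u hiu
    have := h i u hiu
    generalize σ.1 i = a at *; generalize σ.2 u = b at *
    generalize σ'.1 i = c at *; generalize σ'.2 u = d at *
    revert a b c d; decide
  have hP : ∀ i, σ.1 i = σ'.1 i := by
    intro i
    have := primal_const (fun i => (σ.1 i = σ'.1 i)) (by
      intro t i hi j hj
      obtain ⟨u, -, hu, -⟩ := exists_dualEnds t
      rw [eq_iff_iff, key i u (beside_of_corners hi hu).1, key j u (beside_of_corners hj hu).1]) i i₀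
    rw [this]; exact h₀
  refine Prod.ext (funext hP) (funext fun u => ?_)
  have hu := u.mod
  exact (key (mkP (u.1.1 - 1) (u.1.2 - 1) (by omega) (by omega)) u
    ⟨Or.inl (by simp), Or.inl (by simp)⟩).1 (hP _)

theorem not_mem_B_of_tile {n m : ℕ} {t : Tile} (ht : t ∉ Ebar n m) {i : Primal} {u : Dual} :
    (i ∈ edgeEnds t → i ∉ B n m) ∧ (u ∈ dualEnds t → u ∉ B' n m) := by
  rw [Ebar_eq] at ht
  exact ⟨fun hi hB => ht ⟨i.1, not_mem_D_primal.2 hB, hi⟩,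
    fun hu hB => ht ⟨u.1, mem_D_dual.2 hB, hu⟩⟩

/-- Compatible spins are determined by the orientations of the inner loops. -/
theorem Dob.comp_ext {n m : ℕ} {ω : Config} (hω : Dob n m ω) {σ σ' : Spins}
    (h : Comp n m ω σ) (h' : Comp n m ω σ')
    (hcw : ∀ l, InnerLoop n m ω l → (CwSpins σ l ↔ CwSpins σ' l)) : σ = σ' := by
  refine spins_ext (i₀ := vR n) ?_ ?_
  · intro i u hiu
    obtain ⟨a, ha, -, hac⟩ := exists_arc_crossing ω hiu.corner₁.1 hiu.corner₁.2
    have hcurve := isCurve_curveOf ha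
    have hc : CrossedBy (curveOf ω a) i u := ⟨a, mem_curveOf ω a, hac⟩
    by_cases hf : (curveOf ω a).Finite
    · rcases hω.loop_cases ⟨hcurve, hf⟩ with hin | ⟨w, hw, hws, hwc⟩
      · have h1 := hcw _ hin
        by_cases h2 : CwSpins σ (curveOf ω a)
        · rw [h2 i u hc, h1.1 h2 i u hc]
        · have h3 := mt h1.2 h2
          rw [h.2.cw_or_ccw hcurve hf, not_not] at h2
          rw [h'.2.cw_or_ccw hcurve hf, not_not] at h3
          rw [h2 i u hc, h3 i u hc]
      · have hcu := hwc a (mem_curveOf ω a)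
        have hu : u = w := by
          rcases hac.2.2 with h1 | h1
          · exact absurd (h1.symm.trans hcu) (Primal.ne_dual _ _)
          · exact Subtype.ext (h1.symm.trans hcu)
        rw [← hu] at hw
        have hi : i ∉ B n m := by
          unfold Beside at hiu
          have := i.mod
          rw [mem_B'] at hw; rw [mem_B]; omega
        rw [h.1.1 i hi, h.1.2 u hw, h'.1.1 i hi, h'.1.2 u hw]
    -- An infinite curve leaves the finite box; the spins there are given by the boundary condition
    -- and are carried back along the curve.
    · obtain ⟨b, hb, hbt⟩ : ∃ b ∈ curveOf ω a, b.tile ∉ Ebar n m := by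
        by_contra hcon
        push Not at hcon
        exact hf (finite_arcs (finite_Ebar n m) hcon)
      obtain ⟨j, v, hjv⟩ := b.exists_crosses
      have hc' : CrossedBy (curveOf ω a) j v := ⟨b, hb, hjv⟩
      have h1 := h.2.curve_const hcurve hc hc'
      have h2 := h'.2.curve_const hcurve hc hc'
      have h3 := (not_mem_B_of_tile hbt (u := v)).1 hjv.1
      have h4 := (not_mem_B_of_tile hbt (i := j)).2 hjv.2.1
      rw [h1.1, h1.2, h2.1, h2.2, h.1.1 j h3, h.1.2 v h4, h'.1.1 j h3, h'.1.2 v h4]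
  · have : vR n ∉ B n m := by rw [mem_B]; simp [vR]
    rw [h.1.1 _ this, h'.1.1 _ this]

theorem reachable_open {ω : Config} {t : Tile} (ht : ω t = true) {i j : Primal} (hi : i ∈ edgeEnds t)
    (hj : j ∈ edgeEnds t) : (primalGraph (openEdges ω)).Reachable i j := by
  by_cases hij : i = j
  · rw [hij]
  · exact (exists_tile_of_adj.2 ⟨hij, t, ht, hi, hj⟩).reachable

/-- The middle of the top or of the bottom side of the exterior boundary. -/
def midVertex (m : ℕ) (up : Prop) [Decidable up] : Primal :=
  mkP 0 (if up then 2 * m + 2 else -(2 * m + 2)) rfl (by split_ifs <;> omega)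

open Classical in
/-- All vertices outside with the same sign are connected to each other. -/
theorem Dob.reachable_mid {n m : ℕ} {ω : Config} (hω : Dob n m ω) {j : Primal} (hj : j ∉ B n m) :
    (primalGraph (openEdges ω)).Reachable (midVertex m (Upper j.1)) j := by
  have hjm := j.mod
  have hEq : ∀ t : Tile, t ∉ E n m → t.1.2 ≠ -1 → ∀ a ∈ edgeEnds t, ∀ b ∈ edgeEnds t, ∀ k,
      (primalGraph (openEdges ω)).Reachable k a = (primalGraph (openEdges ω)).Reachable k b :=
    fun t h1 h2 a ha b hb k => propext
      ⟨fun h => h.trans (reachable_open ((hω t h1).2 h2) ha hb),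
        fun h => h.trans (reachable_open ((hω t h1).2 h2) hb ha)⟩
  rw [mem_B] at hj
  -- The route runs vertically, within the half plane of `j`, to height ±(2m+2) and then
  -- horizontally to the middle. It avoids E and row -1, so all its edges are open.
  let j' : Primal := mkP j.1.1 (if Upper j.1 then 2 * m + 2 else -(2 * m + 2))
    hjm.1 (by split_ifs <;> omega)
  have hj2 : j'.1.2 = if 0 ≤ j.1.2 then 2 * (m : ℤ) + 2 else -(2 * m + 2) :=
    if_congr Iff.rfl rfl rfl
  have hk2 : (midVertex m (Upper j.1)).1.2 = if 0 ≤ j.1.2 then 2 * (m : ℤ) + 2 else -(2 * m + 2) :=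
    if_congr Iff.rfl rfl rfl
  have hk1 : (midVertex m (Upper j.1)).1.1 = 0 := rfl
  have h1 : (primalGraph (openEdges ω)).Reachable j' j := by
    have : (primalGraph (openEdges ω)).Reachable j' j' = (primalGraph (openEdges ω)).Reachable j' j := by
      rcases le_total j.1.2 j'.1.2 with hle | hle
      · refine (primal_col_const (fun i => (primalGraph (openEdges ω)).Reachable j' i) (i := j) (j := j')
          rfl hle fun t h1 h2 h3 a ha b hb => hEq t ?_ ?_ a ha b hb j').symm
        · rw [mem_E]; split_ifs at hj2 <;> omega
        · split_ifs at hj2 <;> omega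
      · refine primal_col_const (fun i => (primalGraph (openEdges ω)).Reachable j' i) (i := j') (j := j)
          rfl hle fun t h1 h2 h3 a ha b hb => hEq t ?_ ?_ a ha b hb j'
        · rw [mem_E]; have : t.1.1 = j.1.1 := h1; split_ifs at hj2 <;> omega
        · split_ifs at hj2 <;> omega
    rw [← this]
  refine SimpleGraph.Reachable.trans ?_ h1
  generalize hk : midVertex m (Upper j.1) = k at *
  have hrow : j'.1.2 = k.1.2 := hj2.trans hk2.symm
  have : (primalGraph (openEdges ω)).Reachable k k = (primalGraph (openEdges ω)).Reachable k j' := by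
    rcases le_total j'.1.1 k.1.1 with hle | hle
    · refine (primal_row_const (fun i => (primalGraph (openEdges ω)).Reachable k i) (i := j') (j := k)
        hrow hle fun t h1 h2 h3 a ha b hb => hEq t ?_ ?_ a ha b hb k).symm
      · rw [mem_E]; split_ifs at hj2 <;> omega
      · split_ifs at hj2 <;> omega
    · refine primal_row_const (fun i => (primalGraph (openEdges ω)).Reachable k i) (i := k) (j := j')
        hrow.symm hle fun t h1 h2 h3 a ha b hb => hEq t ?_ ?_ a ha b hb k
      · rw [mem_E]; split_ifs at hj2 <;> omega
      · split_ifs at hj2 <;> omega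
  rw [← this]

open Classical in
theorem midVertex_mem (n : ℕ) {m : ℕ} (up : Prop) :
    midVertex m up ∈ exBoundary (B n m) ∧ (Upper (midVertex m up).1 ↔ up) := by
  have h1 : (midVertex m up).1.1 = 0 := rfl
  have h2 : (midVertex m up).1.2 = if up then 2 * (m : ℤ) + 2 else -(2 * m + 2) := rfl
  rw [mem_exBoundary_B, Upper]
  by_cases h : up
  · rw [if_pos h] at h2; exact ⟨by omega, fun _ => h, fun _ => by omega⟩
  · rw [if_neg h] at h2; exact ⟨by omega, fun _ => by omega, fun h' => absurd h' h⟩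

/-- If the two boundary arcs are not connected, there are compatible spins. -/
theorem Dob.exists_base {n m : ℕ} {ω : Config} (hω : Dob n m ω) (hnc : ω ∈ NotCrossed n m) :
    ∃ σ, Comp n m ω σ := by
  classical
  let conn : Primal → Prop := fun i => ∃ j, j ∉ B n m ∧ Upper j.1 ∧
    (primalGraph (openEdges ω)).Reachable j i
  have hbd : ∀ i, i ∉ B n m → (conn i ↔ Upper i.1) := by
    intro i hi
    constructor
    · rintro ⟨j, hj, hju, hr⟩
      by_contra hiu
      exact hnc _ (midVertex_mem n _).1 _ (midVertex_mem n _).1 ((midVertex_mem n _).2.2 hju)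
        (mt (midVertex_mem n _).2.1 hiu)
        (((hω.reachable_mid hj).trans hr).trans (hω.reachable_mid hi).symm)
    · intro hu; exact ⟨i, hi, hu, SimpleGraph.Reachable.refl i⟩
  -- Primal spins: plus on what is connected to the upper outside. Dual spins: minus throughout the
  -- dual box. The latter is consistent because a closed edge off E is in row -1, where the boundary
  -- value of the dual spins is also minus.
  refine ⟨(fun i => if conn i then 1 else -1,
    fun u => if u ∈ B' n m then -1 else bs u.1), ⟨?_, ?_⟩, ?_, ?_⟩
  · intro i hi
    simp only [hbd i hi, bs, Upper]
  · intro u hu; simp [hu]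
  · intro t ht i hi j hj
    have : conn i ↔ conn j := by
      constructor
      · rintro ⟨k, h1, h2, h3⟩; exact ⟨k, h1, h2, h3.trans (reachable_open ht hi hj)⟩
      · rintro ⟨k, h1, h2, h3⟩; exact ⟨k, h1, h2, h3.trans (reachable_open ht hj hi)⟩
    simp only [this]
  · intro t ht u hu v hv
    have key : ∀ u ∈ dualEnds t, u ∈ B' n m ∨ u.1.2 = -1 := by
      intro u hu
      rw [mem_B']
      rw [mem_dualEnds, isCorner_iff] at hu
      have := u.mod; have := t.mod
      by_cases hE : t ∈ E n m
      · rw [mem_E] at hE; omega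
      · have h1 := hω t hE
        rw [ht] at h1; simp at h1; omega
    have key' : ∀ u ∈ dualEnds t, (if u ∈ B' n m then (-1 : ℤˣ) else bs u.1) = -1 := by
      intro u hu
      rcases key u hu with h1 | h1
      · simp [h1]
      · simp [bs, h1]
    simp only [key' u hu, key' v hv]


/-! ### Orientations of the arcs and spins -/

theorem Arc.source_not (r : Bool) (a : Arc) : a.source (!r) = (a.target r).swap := by
  cases r <;> rfl

/-- The centre of the entered tile is the mid-point of the side plus half of the left-to-right
vector rotated counter-clockwise. In particular a directed side determines the tile that it enters.
-/
theorem Arc.source_tile (r : Bool) (a : Arc) :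
    2 * a.tile.1.1 = (a.source r).1.1 + (a.source r).2.1 - (a.source r).2.2 + (a.source r).1.2 ∧
    2 * a.tile.1.2 = (a.source r).1.2 + (a.source r).2.2 + (a.source r).2.1 - (a.source r).1.1 := by
  cases r <;> simp [Arc.source, Arc.next, Arc.prev] <;> constructor <;> ring

/-- The two directed sides of an oriented arc which have a primal vertex to the left. -/
theorem Arc.primal_left (a : Arc) (r : Bool) (i : Primal) (u : Dual) :
    ((i.1, u.1) = a.source r ∨ (i.1, u.1) = a.target r) ↔
      Crosses a i u ∧ (r = true ↔ a.corner = u.1) := by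
  constructor
  · intro h
    cases r
    · simp only [Arc.source, Arc.target, Prod.mk.injEq, Bool.false_eq_true, if_false] at h
      have hi : a.corner = i.1 := by rcases h with h | h <;> exact h.1.symm
      refine ⟨⟨hi ▸ a.isCorner, ?_, Or.inl hi⟩, ?_⟩
      · rcases h with h | h
        · exact h.2 ▸ a.next_isCorner
        · exact h.2 ▸ a.prev_isCorner
      · simp [hi, Primal.ne_dual]
    · simp only [Arc.source, Arc.target, Prod.mk.injEq, if_true] at h
      have hu : a.corner = u.1 := by rcases h with h | h <;> exact h.2.symm
      refine ⟨⟨?_, hu ▸ a.isCorner, Or.inr hu⟩, by simp [hu]⟩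
      rcases h with h | h
      · exact h.1 ▸ a.prev_isCorner
      · exact h.1 ▸ a.next_isCorner
  · rintro ⟨h, hr⟩
    rcases h.next_or_prev with ⟨h1, h2⟩ | ⟨h1, h2⟩
    · have : r = false := by simpa [h1, Primal.ne_dual] using hr
      subst this
      simp only [Arc.source, Arc.target, Prod.mk.injEq, Bool.false_eq_true, if_false, h1, true_and]
      exact h2.imp Eq.symm Eq.symm
    · have : r = true := by simpa [h1] using hr
      subst this
      simp only [Arc.source, Arc.target, Prod.mk.injEq, if_true, h1, and_true]
      exact (h2.imp Eq.symm Eq.symm).symm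

/-- The two directed sides of an oriented arc which have a dual vertex to the left. -/
theorem Arc.dual_left (a : Arc) (r : Bool) (i : Primal) (u : Dual) :
    ((u.1, i.1) = a.source r ∨ (u.1, i.1) = a.target r) ↔
      Crosses a i u ∧ (r = true ↔ a.corner = i.1) := by
  have h := a.primal_left (!r) i u
  have hs : (i.1, u.1) = a.source (!r) ↔ (u.1, i.1) = a.target r := by
    rw [Arc.source_not, eq_comm, Prod.swap_eq_iff_eq_swap, eq_comm]; rfl
  have ht : (i.1, u.1) = a.target (!r) ↔ (u.1, i.1) = a.source r := by
    have := Arc.source_not (!r) a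
    rw [Bool.not_not] at this
    rw [this, ← Prod.swap_eq_iff_eq_swap]; rfl
  rw [hs, ht, or_comm] at h
  rw [h]
  refine and_congr_right fun hc => ?_
  rcases hc.2.2 with h' | h'
  · simp [h', Primal.ne_dual]
  · simp [h', (Primal.ne_dual i u).symm]

theorem Arc.source_crosses (a : Arc) (r : Bool) : ∃ i u, Crosses a i u ∧
    (a.source r = (i.1, u.1) ∨ a.source r = (u.1, i.1)) := by
  rcases a.corner_cases with ⟨i, hi⟩ | ⟨u, hu⟩
  · obtain ⟨u, v, hu, hv⟩ := Arc.next_of_primal hi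
    cases r
    · exact ⟨i, u, ((a.primal_left false i u).1 (Or.inl (by simp [Arc.source, hi, hu]))).1,
        by simp [Arc.source, hi, hu]⟩
    · exact ⟨i, v, ((a.dual_left true i v).1 (Or.inl (by simp [Arc.source, hi, hv]))).1,
        by simp [Arc.source, hi, hv]⟩
  · obtain ⟨i, j, hi, hj⟩ := Arc.next_of_dual hu
    cases r
    · exact ⟨i, u, ((a.dual_left false i u).1 (Or.inl (by simp [Arc.source, hi, hu]))).1,
        by simp [Arc.source, hi, hu]⟩
    · exact ⟨j, u, ((a.primal_left true j u).1 (Or.inl (by simp [Arc.source, hj, hu]))).1,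
        by simp [Arc.source, hj, hu]⟩

/-- A directed side determines the tile that it enters, then the unique arc of `ω` there that meets
it, and then the direction of that arc. -/
theorem Arc.source_inj {ω : Config} {a b : Arc} (ha : a ∈ arcs ω) (hb : b ∈ arcs ω) {r s : Bool}
    (h : a.source r = b.source s) : a = b ∧ r = s := by
  have h1 := a.source_tile r
  have h2 := b.source_tile s
  rw [h] at h1
  have ht : a.tile = b.tile := Tile.ext' (by omega) (by omega)
  obtain ⟨i, u, hc, hiu⟩ := a.source_crosses r
  have hcb : Crosses b i u := by
    rcases hiu with h' | h'
    · exact ((b.primal_left s i u).1 (Or.inl (h'.symm.trans h))).1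
    · exact ((b.dual_left s i u).1 (Or.inl (h'.symm.trans h))).1
  obtain rfl := arc_eq_of_crosses ha hb ht hc hcb
  refine ⟨rfl, ?_⟩
  have hr : (r = true ↔ s = true) := by
    rcases hiu with h' | h'
    · rw [((a.primal_left r i u).1 (Or.inl h'.symm)).2,
        ((a.primal_left s i u).1 (Or.inl (h'.symm.trans h))).2]
    · rw [((a.dual_left r i u).1 (Or.inl h'.symm)).2,
        ((a.dual_left s i u).1 (Or.inl (h'.symm.trans h))).2]
  exact Bool.eq_iff_iff.2 hr

theorem Arc.target_inj {ω : Config} {a b : Arc} (ha : a ∈ arcs ω) (hb : b ∈ arcs ω) {r s : Bool}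
    (h : a.target r = b.target s) : a = b ∧ r = s := by
  have : a.source (!r) = b.source (!s) := by rw [Arc.source_not, Arc.source_not, h]
  obtain ⟨h1, h2⟩ := Arc.source_inj ha hb this
  exact ⟨h1, Bool.not_inj h2⟩

theorem eq_neg_iff_ne (a b : ℤˣ) : a = -b ↔ a ≠ b := by revert a b; decide

/-- An arc around a dual vertex that turns right has its primal side on the left, which means equal
spins; around a primal vertex the roles are reversed. This rewrites the spin condition as a
condition on single arcs. -/
theorem isSpinRep_iff {ω : Config} {o : ArcOrientation} {σ : Spins} :
    IsSpinRep (edgeOrientation ω o) σ ↔ ∀ a ∈ arcs ω, ∀ i u, Crosses a i u →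
      (o a = true ↔ (a.corner = u.1 ↔ σ.1 i = σ.2 u)) := by
  constructor
  · intro h a ha i u hc
    obtain ⟨h1, h2⟩ := h i u
    rw [eq_neg_iff_ne] at h2
    have h1' := fun hx => h1 ⟨a, ha, (a.primal_left (o a) i u).2 ⟨hc, hx⟩⟩
    have h2' := fun hx => h2 ⟨a, ha, (a.dual_left (o a) i u).2 ⟨hc, hx⟩⟩
    rcases hc.2.2 with h' | h'
    · simp only [h', Primal.ne_dual, iff_true, iff_false, false_iff] at h1' h2' ⊢
      exact ⟨h2', fun hx => by by_contra hn; exact hx (h1' hn)⟩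
    · simp only [h', (Primal.ne_dual i u).symm, iff_true, iff_false, true_iff] at h1' h2' ⊢
      exact ⟨h1', fun hx => by by_contra hn; exact h2' hn hx⟩
  · intro h i u
    rw [eq_neg_iff_ne]
    constructor
    · rintro ⟨a, ha, hx⟩
      obtain ⟨hc, hr⟩ := (a.primal_left (o a) i u).1 hx
      have := h a ha i u hc
      tauto
    · rintro ⟨a, ha, hx⟩
      obtain ⟨hc, hr⟩ := (a.dual_left (o a) i u).1 hx
      have := h a ha i u hc
      have h3 : a.corner = i.1 ↔ ¬ a.corner = u.1 := by
        rcases hc.2.2 with h' | h'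
        · simp [h', Primal.ne_dual]
        · simp [h', (Primal.ne_dual i u).symm]
      tauto

open Classical in
/-- The orientation of the arcs that corresponds to compatible spins. -/
def spinOrient (σ : Spins) : ArcOrientation := fun a =>
  decide (∃ i u, Crosses a i u ∧ (a.corner = u.1 ↔ σ.1 i = σ.2 u))

theorem Compat.arc_const {ω : Config} {σ : Spins} (hσ : Compat ω σ) {a : Arc} (ha : a ∈ arcs ω)
    {i j : Primal} {u v : Dual} (h1 : Crosses a i u) (h2 : Crosses a j v) :
    σ.1 i = σ.1 j ∧ σ.2 u = σ.2 v :=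
  hσ.curve_const (isCurve_curveOf ha) ⟨a, mem_curveOf ω a, h1⟩ ⟨a, mem_curveOf ω a, h2⟩

theorem Compat.spinOrient_iff {ω : Config} {σ : Spins} (hσ : Compat ω σ) {a : Arc}
    (ha : a ∈ arcs ω) {i : Primal} {u : Dual} (h : Crosses a i u) :
    spinOrient σ a = true ↔ (a.corner = u.1 ↔ σ.1 i = σ.2 u) := by
  classical
  simp only [spinOrient, decide_eq_true_eq]
  constructor
  · rintro ⟨j, v, h', hx⟩
    have hc := hσ.arc_const ha h h'
    have : a.corner = u.1 ↔ a.corner = v.1 := by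
      rcases a.corner_cases with ⟨k, hk⟩ | ⟨k, hk⟩
      · simp [hk, Primal.ne_dual]
      · have e1 : a.corner = u.1 := h.2.2.resolve_left
          fun hx => Primal.ne_dual i k (hx.symm.trans hk)
        have e2 : a.corner = v.1 := h'.2.2.resolve_left
          fun hx => Primal.ne_dual j k (hx.symm.trans hk)
        simp [e1, ← e2]
    rw [this, hc.1, hc.2]; exact hx
  · exact fun hx => ⟨i, u, h, hx⟩

theorem Compat.isSpinRep {ω : Config} {σ : Spins} (hσ : Compat ω σ) :
    IsSpinRep (edgeOrientation ω (spinOrient σ)) σ :=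
  isSpinRep_iff.2 fun _ ha _ _ hc => hσ.spinOrient_iff ha hc

theorem Compat.spinOrient_surrounds {ω : Config} {σ : Spins} (hσ : Compat ω σ) {l : Set Arc}
    (h : IsCurve ω l) (hl : l.Finite) {a : Arc} (ha : a ∈ l) {i : Primal} {u : Dual}
    (hc : Crosses a i u) :
    (spinOrient σ a = true ↔ Surrounds l a.corner) ↔ (σ.1 i = σ.2 u ↔ Surrounds l u.1) := by
  rw [hσ.spinOrient_iff (h.subset ha) hc]
  have := (h.surrounds_iff hl hc.beside).1 ⟨a, ha, hc⟩
  rcases hc.2.2 with h' | h'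
  · rw [h']; simp only [Primal.ne_dual, false_iff]; tauto
  · rw [h']; simp only [true_iff]

theorem Compat.clockwise_iff {ω : Config} {σ : Spins} (hσ : Compat ω σ) {l : Set Arc}
    (h : IsCurve ω l) (hl : l.Finite) : Clockwise (spinOrient σ) l ↔ CwSpins σ l := by
  constructor
  · rintro hcw i u ⟨a, ha, hc⟩
    exact (hσ.spinOrient_surrounds h hl ha hc).1 (hcw a ha)
  · intro hcw a ha
    obtain ⟨i, u, hc⟩ := a.exists_crosses
    exact (hσ.spinOrient_surrounds h hl ha hc).2 (hcw i u ⟨a, ha, hc⟩)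

theorem Compat.counterClockwise_iff {ω : Config} {σ : Spins} (hσ : Compat ω σ) {l : Set Arc}
    (h : IsCurve ω l) (hl : l.Finite) :
    CounterClockwise (spinOrient σ) l ↔ CcwSpins σ l := by
  constructor
  · rintro hcw i u ⟨a, ha, hc⟩
    have h1 := hσ.spinOrient_surrounds h hl ha hc
    have h2 := hcw a ha
    tauto
  · intro hcw a ha
    obtain ⟨i, u, hc⟩ := a.exists_crosses
    have h1 := hσ.spinOrient_surrounds h hl ha hc
    have h2 := hcw i u ⟨a, ha, hc⟩
    tauto

/-! ### Bi-infinite paths -/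

/-- If the orientations differed at one arc, injectivity of sources would force one parametrisation
to follow the other backwards, and the abscissa would tend to both infinities along the same arcs.
-/
theorem rightToLeft_unique {ω : Config} {l : Set Arc} (hl : l ⊆ arcs ω) {o o' : ArcOrientation}
    (h : RightToLeft o l) (h' : RightToLeft o' l) {a : Arc} (ha : a ∈ l) : o a = o' a := by
  obtain ⟨γ, hγ, hs, -, hr⟩ := h
  obtain ⟨γ', hγ', hs', hr', -⟩ := h'
  by_contra hne
  obtain ⟨k₀, hk₀⟩ : a ∈ Set.range γ := hγ ▸ ha
  obtain ⟨j₀, hj₀⟩ : a ∈ Set.range γ' := hγ' ▸ ha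
  have hm : ∀ k, γ k ∈ arcs ω := fun k => hl (hγ ▸ Set.mem_range_self k)
  have hm' : ∀ k, γ' k ∈ arcs ω := fun k => hl (hγ' ▸ Set.mem_range_self k)
  have key : ∀ k : ℕ, γ' (j₀ + k) = γ (k₀ - k) ∧ o' (γ' (j₀ + k)) = !o (γ (k₀ - k)) := by
    intro k
    induction k with
    | zero =>
      simp only [Nat.cast_zero, add_zero, sub_zero, hk₀, hj₀, true_and]
      cases h1 : o a <;> cases h2 : o' a <;> simp_all
    | succ k ih =>
      have h1 := hs' (j₀ + k)
      have h2 := hs (k₀ - k - 1)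
      rw [sub_add_cancel] at h2
      have h3 : (γ' (j₀ + k + 1)).source (o' (γ' (j₀ + k + 1))) =
          (γ (k₀ - k - 1)).source (!o (γ (k₀ - k - 1))) := by
        rw [Arc.source_not, h2, ← h1, ih.2, ih.1]
        have := Arc.source_not (!o (γ (k₀ - k))) (γ (k₀ - k))
        rw [Bool.not_not] at this
        rw [this, Prod.swap_swap]
      obtain ⟨h4, h5⟩ := Arc.source_inj (hm' _) (hm _) h3
      rw [show j₀ + ((k + 1 : ℕ) : ℤ) = j₀ + k + 1 by push_cast; ring,
        show k₀ - ((k + 1 : ℕ) : ℤ) = k₀ - k - 1 by push_cast; ring]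
      exact ⟨h4, h5⟩
  have t1 : Filter.Tendsto (fun k : ℕ => (γ' (j₀ + k)).tile.1.1) Filter.atTop Filter.atBot :=
    hr'.comp (Filter.tendsto_atTop_add_const_left _ _ tendsto_natCast_atTop_atTop)
  have t2 : Filter.Tendsto (fun k : ℕ => (γ (k₀ - k)).tile.1.1) Filter.atTop Filter.atTop := by
    refine hr.comp ?_
    simp only [sub_eq_add_neg]
    exact Filter.tendsto_atBot_add_const_left _ _
      (Filter.tendsto_neg_atTop_atBot.comp tendsto_natCast_atTop_atTop)
  obtain ⟨k, hk1, hk2⟩ :=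
    ((t1.eventually (Filter.eventually_lt_atBot 0)).and
      (t2.eventually (Filter.eventually_gt_atTop 0))).exists
  rw [(key k).1] at hk1
  omega

/-- The arc that enters through a directed side, for the orientation given by spins. -/
theorem Compat.exists_source {ω : Config} {σ : Spins} (hσ : Compat ω σ) {a : Arc}
    (ha : a ∈ arcs ω) : ∃ b ∈ arcs ω, a.target (spinOrient σ a) = b.source (spinOrient σ b) := by
  obtain ⟨i, u, hc, he⟩ := a.source_crosses (!spinOrient σ a)
  rw [Arc.source_not] at he
  have he' : a.target (spinOrient σ a) = (u.1, i.1) ∨ a.target (spinOrient σ a) = (i.1, u.1) := by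
    rcases he with h | h
    · left; rw [← Prod.swap_swap (a.target _), h]; rfl
    · right; rw [← Prod.swap_swap (a.target _), h]; rfl
  -- The candidate is the arc across the exit side, in the other tile of that side.
  obtain ⟨b, hb, hbt, hbc⟩ : ∃ b ∈ arcs ω, b.tile ≠ a.tile ∧ Crosses b i u := by
    have hs := hc.beside
    obtain ⟨b, hb, hbt, hbc⟩ := exists_arc_crossing ω hs.corner₁.1 hs.corner₁.2
    obtain ⟨b', hb', hbt', hbc'⟩ := exists_arc_crossing ω hs.corner₂.1 hs.corner₂.2
    by_cases h : b.tile = a.tile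
    · refine ⟨b', hb', ?_, hbc'⟩
      rw [← h, hbt, hbt']; exact (tile₁_ne_tile₂ i u).symm
    · exact ⟨b, hb, h, hbc⟩
  refine ⟨b, hb, ?_⟩
  have hoa := hσ.spinOrient_iff ha hc
  have hob := hσ.spinOrient_iff hb hbc
  have hcor : ∀ c : Arc, Crosses c i u → (c.corner = i.1 ↔ ¬ c.corner = u.1) := by
    intro c hc
    rcases hc.2.2 with h' | h'
    · simp [h', Primal.ne_dual]
    · simp [h', (Primal.ne_dual i u).symm]
  have hca := hcor a hc
  have hcb := hcor b hbc
  -- Spins fix the direction of the side, so it is a source or a target of `b`. It cannot be a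
  -- target, because a target determines its arc and `a` is in another tile.
  have hnt : a.target (spinOrient σ a) ≠ b.target (spinOrient σ b) := by
    intro h
    exact hbt (congrArg Arc.tile (Arc.target_inj ha hb h).1).symm
  rcases he' with h | h
  · have h1 := ((a.dual_left _ i u).1 (Or.inr h.symm)).2
    have h2 := (b.dual_left (spinOrient σ b) i u).2 ⟨hbc, by tauto⟩
    rw [h] at hnt ⊢
    exact h2.resolve_right hnt
  · have h1 := ((a.primal_left _ i u).1 (Or.inr h.symm)).2
    have h2 := (b.primal_left (spinOrient σ b) i u).2 ⟨hbc, by tauto⟩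
    rw [h] at hnt ⊢
    exact h2.resolve_right hnt

/-- Negating the dual spins reverses every arc, so predecessors are obtained from successors without
a second geometric argument. -/
theorem spinOrient_neg {ω : Config} {σ : Spins} (hσ : Compat ω σ) {a : Arc} (ha : a ∈ arcs ω) :
    spinOrient (σ.1, fun u => -σ.2 u) a = !spinOrient σ a := by
  have hσ' : Compat ω (σ.1, fun u => -σ.2 u) :=
    ⟨hσ.1, fun t ht u hu v hv => congrArg Neg.neg (hσ.2 t ht u hu v hv)⟩
  obtain ⟨i, u, hc⟩ := a.exists_crosses
  have h1 := hσ.spinOrient_iff ha hc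
  have h2 := hσ'.spinOrient_iff ha hc
  simp only [eq_neg_iff_ne] at h2
  rw [Bool.eq_iff_iff, Bool.not_eq_true', ← Bool.not_eq_true]
  tauto

theorem Compat.exists_target {ω : Config} {σ : Spins} (hσ : Compat ω σ) {a : Arc}
    (ha : a ∈ arcs ω) : ∃ b ∈ arcs ω, b.target (spinOrient σ b) = a.source (spinOrient σ a) := by
  have hσ' : Compat ω (σ.1, fun u => -σ.2 u) :=
    ⟨hσ.1, fun t ht u hu v hv => congrArg Neg.neg (hσ.2 t ht u hu v hv)⟩
  obtain ⟨b, hb, h⟩ := hσ'.exists_source ha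
  refine ⟨b, hb, ?_⟩
  rw [spinOrient_neg hσ ha, spinOrient_neg hσ hb, Arc.source_not] at h
  have := Arc.source_not (!spinOrient σ a) a
  rw [Bool.not_not] at this
  rw [this, h, Prod.swap_swap]

/-- The successor of an arc in the orientation given by spins. -/
theorem Compat.exists_succ {ω : Config} {σ : Spins} (hσ : Compat ω σ) :
    ∃ f : Equiv.Perm (arcs ω), ∀ a : arcs ω,
      a.1.target (spinOrient σ a.1) = (f a).1.source (spinOrient σ (f a).1) := by
  choose s hs hs' using fun a : arcs ω => hσ.exists_source a.2
  choose p hp hp' using fun a : arcs ω => hσ.exists_target a.2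
  refine ⟨⟨fun a => ⟨s a, hs a⟩, fun a => ⟨p a, hp a⟩, ?_, ?_⟩, hs'⟩
  · intro a
    exact Subtype.ext (Arc.target_inj (hp _) a.2 ((hp' ⟨s a, hs a⟩).trans (hs' a).symm)).1
  · intro a
    exact Subtype.ext (Arc.source_inj (hs _) a.2 ((hs' ⟨p a, hp a⟩).symm.trans (hp' a))).1

theorem Arc.source_or_target {a : Arc} {i : Primal} {u : Dual} (h : Crosses a i u) (r : Bool) :
    ((i.1, u.1) = a.source r ∨ (i.1, u.1) = a.target r) ∧ (r = true ↔ a.corner = u.1) ∨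
    ((u.1, i.1) = a.source r ∨ (u.1, i.1) = a.target r) ∧ ¬ (r = true ↔ a.corner = u.1) := by
  by_cases hr : r = true ↔ a.corner = u.1
  · exact Or.inl ⟨(a.primal_left r i u).2 ⟨h, hr⟩, hr⟩
  · refine Or.inr ⟨(a.dual_left r i u).2 ⟨h, ?_⟩, hr⟩
    rcases h.2.2 with h' | h' <;> rw [h'] at hr ⊢
    · simp only [Primal.ne_dual, iff_false, not_not] at hr; simp [hr]
    · simp only [iff_true] at hr; simp [hr, (Primal.ne_dual i u).symm]

theorem iff_of_iff_iff {a b c : Prop} (h : a ↔ (b ↔ c)) : (a ↔ b) ↔ c := by tauto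

/-- A curve is the orbit of the successor map. -/
theorem Compat.range_zpow {ω : Config} {σ : Spins} (hσ : Compat ω σ) {f : Equiv.Perm (arcs ω)}
    (hf : ∀ a : arcs ω, a.1.target (spinOrient σ a.1) = (f a).1.source (spinOrient σ (f a).1))
    {l : Set Arc} (h : IsCurve ω l) (a : arcs ω) (ha : a.1 ∈ l) :
    Set.range (fun k : ℤ => ((f ^ k) a).1) = l := by
  have hcr : ∀ x : arcs ω, ∃ i u, Crosses x.1 i u ∧ Crosses (f x).1 i u := by
    intro x
    obtain ⟨i, u, hc, he⟩ := (f x).1.source_crosses (spinOrient σ (f x).1)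
    rw [← hf x] at he
    refine ⟨i, u, ?_, hc⟩
    rcases he with he | he
    · exact ((x.1.primal_left _ i u).1 (Or.inr he.symm)).1
    · exact ((x.1.dual_left _ i u).1 (Or.inr he.symm)).1
  have hfwd : ∀ x : arcs ω, x.1 ∈ l ↔ (f x).1 ∈ l := by
    intro x
    obtain ⟨i, u, h1, h2⟩ := hcr x
    exact ⟨fun hx => h.mem_of_crosses hx (f x).2 h1 h2, fun hx => h.mem_of_crosses hx x.2 h2 h1⟩
  have hz : ∀ k : ℤ, (f ^ (k + 1)) a = f ((f ^ k) a) := fun k => by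
    rw [add_comm, zpow_add, zpow_one, Equiv.Perm.mul_apply]
  apply Set.Subset.antisymm
  · rintro _ ⟨k, rfl⟩
    induction k with
    | zero => simpa using ha
    | succ k ih => simp only [hz]; exact (hfwd _).1 ih
    | pred k ih =>
      have := hz (-(k : ℤ) - 1)
      rw [sub_add_cancel] at this
      simp only [this] at ih
      exact (hfwd _).2 ih
  · intro b hb
    refine h.induction (P := fun b => b ∈ Set.range (fun k : ℤ => ((f ^ k) a).1)) ha hb
      ⟨0, by simp⟩ ?_
    rintro x hx y hy i u hxi hyi ⟨k, rfl⟩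
    have hy' := h.subset hy
    have hx' := h.subset hx
    have hox := hσ.spinOrient_iff hx' hxi
    have hoy := hσ.spinOrient_iff hy' hyi
    have hpred := hz (k - 1)
    rw [sub_add_cancel] at hpred
    have hts := hf ((f ^ (k - 1)) a)
    rw [← hpred] at hts
    have hts' := hf ((f ^ k) a)
    rw [← hz k] at hts'
    -- Two arcs that share a directed side are equal or consecutive; this covers the four
    -- combinations of source and target.
    have main : ∀ e : Pt × Pt,
        (e = ((f ^ k) a).1.source (spinOrient σ ((f ^ k) a).1) ∨
          e = ((f ^ k) a).1.target (spinOrient σ ((f ^ k) a).1)) →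
        (e = y.source (spinOrient σ y) ∨ e = y.target (spinOrient σ y)) →
        y ∈ Set.range (fun k : ℤ => ((f ^ k) a).1) := by
      rintro e (h1 | h1) (h2 | h2)
      · exact ⟨k, (Arc.source_inj hx' hy' (h1.symm.trans h2)).1⟩
      · exact ⟨k - 1, (Arc.target_inj ((f ^ (k - 1)) a).2 hy' (hts.trans (h1.symm.trans h2))).1⟩
      · exact ⟨k + 1, (Arc.source_inj ((f ^ (k + 1)) a).2 hy' (hts'.symm.trans (h1.symm.trans h2))).1⟩
      · exact ⟨k, (Arc.target_inj hx' hy' (h1.symm.trans h2)).1⟩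
    rcases Arc.source_or_target hxi (spinOrient σ ((f ^ k) a).1) with ⟨h1, h2⟩ | ⟨h1, h2⟩ <;>
      rcases Arc.source_or_target hyi (spinOrient σ y) with ⟨h3, h4⟩ | ⟨h3, h4⟩
    · exact main _ h1 h3
    · exact absurd ((iff_of_iff_iff hoy).2 ((iff_of_iff_iff hox).1 h2)) h4
    · exact absurd ((iff_of_iff_iff hox).2 ((iff_of_iff_iff hoy).1 h4)) h2
    · exact main _ h1 h3

/-- A coincidence gives a period, and a periodic orbit is finite. -/
theorem zpow_injective_of_infinite {X : Type*} (f : Equiv.Perm X) (a : X)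
    (h : (Set.range fun k : ℤ => (f ^ k) a).Infinite) : Function.Injective fun k : ℤ => (f ^ k) a := by
  have key : ∀ d : ℤ, 0 < d → (f ^ d) a ≠ a := by
    intro d hd hfix
    refine h (((Set.finite_Ico (0 : ℤ) d).image fun k : ℤ => (f ^ k) a).subset ?_)
    rintro _ ⟨k, rfl⟩
    refine ⟨k % d, ⟨Int.emod_nonneg _ hd.ne', Int.emod_lt_of_pos _ hd⟩, ?_⟩
    have h1 : ((f ^ d) ^ (k / d)) a = a := Equiv.Perm.zpow_apply_eq_self_of_apply_eq_self hfix _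
    have h2 : k = k % d + d * (k / d) := (Int.emod_add_mul_ediv k d).symm
    change (f ^ (k % d)) a = (f ^ k) a
    conv_rhs => rw [h2, zpow_add, zpow_mul, Equiv.Perm.mul_apply, h1]
  have key' : ∀ j k : ℤ, j < k → (f ^ j) a ≠ (f ^ k) a := by
    intro j k hjk heq
    apply key (k - j) (by omega)
    apply (f ^ j).injective
    rw [← Equiv.Perm.mul_apply, ← zpow_add, heq]
    congr 2; ring
  intro j k hjk
  rcases lt_trichotomy j k with h1 | h1 | h1
  · exact absurd hjk (key' j k h1)
  · exact h1
  · exact absurd hjk.symm (key' k j h1)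

/-- Far out, the paths run in the strip around the middle row from right to left. -/
theorem Dob.path_step {n m : ℕ} {ω : Config} (hω : Dob n m ω) {σ : Spins} (hσ : Comp n m ω σ)
    {l : Set Arc} (h : IsPath ω l) {a : Arc} (ha : a ∈ l) (ht : a.tile ∉ Ebar n m) {b : Arc}
    (hab : a.target (spinOrient σ a) = b.source (spinOrient σ b)) :
    b.tile.1.1 = a.tile.1.1 - 1 := by
  have hs := (b.source_tile (spinOrient σ b)).1
  rw [← hab] at hs
  have haω := h.1.subset ha
  have hE : a.tile ∉ E n m := fun hE => ht (Or.inl hE)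
  obtain ⟨i, u, hc⟩ := a.exists_crosses
  have ho := hσ.2.spinOrient_iff haω hc
  have hi := hσ.1.1 i ((not_mem_B_of_tile ht (u := u)).1 hc.1)
  have hu := hσ.1.2 u ((not_mem_B_of_tile ht (i := i)).2 hc.2.1)
  have him := i.mod
  have hum := u.mod
  have htm := a.tile.mod
  have hci := (isCorner_iff _ _).1 hc.1
  have hcu := (isCorner_iff _ _).1 hc.2.1
  have hpm : (1 : ℤˣ) ≠ -1 := by decide
  rw [hi, hu] at ho
  simp only [bs] at ho
  rcases hc.2.2 with h' | h'
  · have hcl := (mem_arcs_primal h').1 haω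
    have h2 := hω _ hE
    rw [hcl] at h2
    simp only [Bool.false_eq_true, ne_eq, false_iff, not_not] at h2
    rw [if_neg (by omega : ¬ (0 ≤ u.1.2)), h'] at ho
    simp only [Primal.ne_dual, false_iff] at ho
    by_cases h0 : 0 ≤ i.1.2
    · rw [if_pos h0] at ho
      have : spinOrient σ a = true := ho.2 hpm
      rw [this] at hs
      simp only [Arc.target, Arc.next, h', if_true] at hs
      omega
    · rw [if_neg h0] at ho
      have : spinOrient σ a = false := by simpa using ho
      rw [this] at hs
      simp only [Arc.target, Arc.prev, h', Bool.false_eq_true, if_false] at hs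
      omega
  · have hcl := (mem_arcs_dual h').1 haω
    have h2 := hω _ hE
    rw [hcl] at h2
    simp only [ne_eq, true_iff] at h2
    -- An outer dual vertex off the middle row carries a trivial loop, which is finite, so the path
    -- can only run around dual vertices of the middle row.
    have hrow : u.1.2 = -1 := by
      by_contra hrow
      have hu' : u ∉ B' n m := (not_mem_B_of_tile ht (i := i)).2 hc.2.1
      have hall := fun b hb => hω.trivial_curve h.1 hu' hrow ha h' (b := b) hb
      refine h.2 (finite_arcs (T := {t | -(|u.1.1| + 1) ≤ t.1.1 ∧ t.1.1 ≤ |u.1.1| + 1 ∧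
        -(|u.1.2| + 1) ≤ t.1.2 ∧ t.1.2 ≤ |u.1.2| + 1}) (finite_tiles _ _ fun t ht => ht) ?_)
      intro b hb
      have := b.isCorner
      rw [hall b hb, isCorner_iff] at this
      have e1 := le_abs_self u.1.1
      have e2 := neg_abs_le u.1.1
      have e3 := le_abs_self u.1.2
      have e4 := neg_abs_le u.1.2
      exact ⟨by omega, by omega, by omega, by omega⟩
    rw [if_neg (by omega : ¬ (0 ≤ u.1.2)), h'] at ho
    simp only [true_iff] at ho
    by_cases h0 : 0 ≤ i.1.2
    · rw [if_pos h0] at ho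
      have : spinOrient σ a = false := by
        rw [← Bool.not_eq_true, ho]; exact hpm
      rw [this] at hs
      simp only [Arc.target, Arc.prev, h', Bool.false_eq_true, if_false] at hs
      omega
    · rw [if_neg h0] at ho
      have : spinOrient σ a = true := by simpa using ho
      rw [this] at hs
      simp only [Arc.target, Arc.next, h', if_true] at hs
      omega

/-- The successor map parametrises the path injectively, so the box is visited finitely often.
Before and after that, `path_step` moves one unit to the left at each step, which gives both limits.
-/
theorem Dob.rightToLeft {n m : ℕ} {ω : Config} (hω : Dob n m ω) {σ : Spins} (hσ : Comp n m ω σ)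
    {l : Set Arc} (h : IsPath ω l) : RightToLeft (spinOrient σ) l := by
  obtain ⟨f, hf⟩ := hσ.2.exists_succ
  obtain ⟨a₀, ha₀⟩ := h.1.nonempty
  let a : arcs ω := ⟨a₀, h.1.subset ha₀⟩
  have hr := hσ.2.range_zpow hf h.1 a ha₀
  have hz : ∀ k : ℤ, (f ^ (k + 1)) a = f ((f ^ k) a) := fun k => by
    rw [add_comm, zpow_add, zpow_one, Equiv.Perm.mul_apply]
  have hstep : ∀ k : ℤ, ((f ^ k) a).1.target (spinOrient σ ((f ^ k) a).1) =
      ((f ^ (k + 1)) a).1.source (spinOrient σ ((f ^ (k + 1)) a).1) := fun k => by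
    rw [hz]; exact hf _
  have hinf : (Set.range fun k : ℤ => (f ^ k) a).Infinite := by
    intro hfin
    refine h.2 ?_
    rw [← hr]
    convert hfin.image Subtype.val using 1
    ext x; simp [Set.mem_image, Set.mem_range]
  have hinj := zpow_injective_of_infinite f a hinf
  have hfin : {k : ℤ | ((f ^ k) a).1.tile ∈ Ebar n m}.Finite := by
    have : {x : Arc | x.tile ∈ Ebar n m}.Finite := finite_arcs (finite_Ebar n m) fun _ hx => hx
    exact this.preimage (f := fun k : ℤ => ((f ^ k) a).1)
      (Subtype.val_injective.comp hinj).injOn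
  obtain ⟨N, hN⟩ := (hfin.image fun k => |k|).bddAbove
  have hdec : ∀ k : ℤ, N < |k| →
      ((f ^ (k + 1)) a).1.tile.1.1 = ((f ^ k) a).1.tile.1.1 - 1 := by
    intro k hk
    refine hω.path_step hσ h (hr ▸ Set.mem_range_self k) ?_ (hstep k)
    intro hE
    exact absurd (hN ⟨k, hE, rfl⟩) (by simpa using hk)
  have hNN : 0 ≤ |N| := abs_nonneg N
  have hNa : N ≤ |N| := le_abs_self N
  refine ⟨fun k => ((f ^ k) a).1, hr, hstep, ?_, ?_⟩
  · have h1 : ∀ k : ℕ, ((f ^ ((|N| + 1) + (k : ℤ))) a).1.tile.1.1 =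
        ((f ^ (|N| + 1)) a).1.tile.1.1 - k := by
      intro k
      induction k with
      | zero => simp
      | succ k ih =>
        have := hdec (|N| + 1 + k) (by rw [abs_of_nonneg] <;> omega)
        rw [ih, add_assoc] at this
        push_cast; rw [this]; ring
    rw [Filter.tendsto_atBot]
    intro C
    filter_upwards [Filter.eventually_ge_atTop
      (|N| + 1 + |((f ^ (|N| + 1)) a).1.tile.1.1 - C|)] with k hk
    have h2 := h1 (k - (|N| + 1)).toNat
    have h3 := le_abs_self (((f ^ (|N| + 1)) a).1.tile.1.1 - C)
    have h4 := abs_nonneg (((f ^ (|N| + 1)) a).1.tile.1.1 - C)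
    rw [Int.toNat_of_nonneg (by omega), add_sub_cancel] at h2
    rw [h2]; omega
  · have h1 : ∀ k : ℕ, ((f ^ (-(|N| + 1) - (k : ℤ))) a).1.tile.1.1 =
        ((f ^ (-(|N| + 1))) a).1.tile.1.1 + k := by
      intro k
      induction k with
      | zero => simp
      | succ k ih =>
        have := hdec (-(|N| + 1) - (k + 1)) (by rw [abs_of_neg] <;> omega)
        rw [show -(|N| + 1) - ((k : ℤ) + 1) + 1 = -(|N| + 1) - k by ring, ih] at this
        push_cast; linarith
    rw [Filter.tendsto_atTop]
    intro C
    filter_upwards [Filter.eventually_le_atBot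
      (-(|N| + 1) - |C - ((f ^ (-(|N| + 1))) a).1.tile.1.1|)] with k hk
    have h2 := h1 (-(|N| + 1) - k).toNat
    have h3 := le_abs_self (C - ((f ^ (-(|N| + 1))) a).1.tile.1.1)
    have h4 := abs_nonneg (C - ((f ^ (-(|N| + 1))) a).1.tile.1.1)
    rw [Int.toNat_of_nonneg (by omega), sub_sub_cancel] at h2
    rw [h2]; omega

/-- Around an outer dual vertex off the middle row all boundary signs agree, and this is what makes
the trivial outer loops clockwise. -/
theorem BdSpins.bs_eq {n m : ℕ} {σ : Spins} (hσ : BdSpins n m σ) {i : Primal} {u : Dual}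
    (hiu : Beside i u) (hu : u ∉ B' n m) (hrow : u.1.2 ≠ -1) : σ.1 i = σ.2 u := by
  have him := i.mod
  have hum := u.mod
  unfold Beside at hiu
  rw [hσ.2 u hu, hσ.1 i (by rw [mem_B'] at hu; rw [mem_B]; omega), bs, bs]
  congr 1
  rw [eq_iff_iff]; omega

/-- The spins that are associated to `(ω, U)`. -/
theorem Dob.bkwSpins {n m : ℕ} {ω : Config} (hω : Dob n m ω) (hnc : ω ∈ NotCrossed n m) (q lam : ℝ)
    (U : Loop → unitInterval) :
    ∃ σ, Comp n m ω σ ∧ (∀ l (hl : InnerLoop n m ω l),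
      ((U ⟨l, ω, hl.1⟩ : ℝ) < Real.exp lam / Real.sqrt q ↔ CwSpins σ l)) ∧
      ∀ σ', IsBKWSpins n m q lam ω U σ' ↔ σ' = σ := by
  obtain ⟨σ₀, h₀⟩ := hω.exists_base hnc
  obtain ⟨σ, hσ, hcw⟩ := hω.exists_comp h₀
    (fun l => ∃ h : ∃ ω, IsLoop ω l, (U ⟨l, h⟩ : ℝ) < Real.exp lam / Real.sqrt q)
  have hU : ∀ l (hl : InnerLoop n m ω l),
      ((U ⟨l, ω, hl.1⟩ : ℝ) < Real.exp lam / Real.sqrt q ↔ CwSpins σ l) := by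
    intro l hl
    rw [hcw l hl]
    exact ⟨fun h => ⟨⟨ω, hl.1⟩, h⟩, fun ⟨_, h⟩ => h⟩
  have hor : IsLoopOrientation n m q lam ω U (spinOrient σ) := by
    refine ⟨?_, fun l hl => hω.rightToLeft hσ hl, ?_, ?_⟩
    · rintro l hl ⟨u, hu, hs⟩
      rw [hσ.2.clockwise_iff hl.1 hl.2]
      rintro i v ⟨a, ha, hc⟩
      have hall := (hω.outer_loop hl.1 hl.2 hu hs).1 a ha
      have hrow : u.1.2 ≠ -1 := fun h' => hω.not_surrounds_row hl.1 hl.2 hu h' hs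
      have hv : v = u := by
        rcases hc.2.2 with h | h
        · exact absurd (h.symm.trans hall) (Primal.ne_dual _ _)
        · exact Subtype.ext (h.symm.trans hall)
      subst hv
      simp only [hs, iff_true]
      exact hσ.1.bs_eq hc.beside hu hrow
    · intro l hl hz hlt
      rw [hσ.2.clockwise_iff hl.1 hl.2]
      exact (hU l ⟨hl, hz⟩).1 hlt
    · intro l hl hz hlt
      rw [hσ.2.counterClockwise_iff hl.1 hl.2]
      have := mt (hU l ⟨hl, hz⟩).2 hlt
      rwa [hσ.2.cw_or_ccw hl.1 hl.2, not_not] at this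
  have hvR : σ.1 (vR n) = 1 := by
    have : vR n ∉ B n m := by rw [mem_B]; simp [vR]
    rw [hσ.1.1 _ this]; simp [bs, vR]
  refine ⟨σ, hσ, hU, fun σ' => ⟨?_, ?_⟩⟩
  · rintro ⟨o, ho, hrep, h1⟩
    -- Uniqueness: every arc lies on an inner loop, an outer loop or a path, and in each case the
    -- rule leaves one orientation.
    have hag : ∀ a ∈ arcs ω, o a = spinOrient σ a := by
      intro a ha
      have hcurve := isCurve_curveOf ha
      have hal := mem_curveOf ω a
      by_cases hf : (curveOf ω a).Finite
      · rcases hω.loop_cases ⟨hcurve, hf⟩ with hin | ⟨w, hw, hws, -⟩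
        · by_cases hlt : (U ⟨curveOf ω a, ω, hin.1⟩ : ℝ) < Real.exp lam / Real.sqrt q
          · rw [Bool.eq_iff_iff, ho.inside_cw _ hin.1 hin.2 hlt a hal,
              hor.inside_cw _ hin.1 hin.2 hlt a hal]
          · rw [Bool.eq_iff_iff, ho.inside_ccw _ hin.1 hin.2 hlt a hal,
              hor.inside_ccw _ hin.1 hin.2 hlt a hal]
        · rw [Bool.eq_iff_iff, ho.outside _ ⟨hcurve, hf⟩ ⟨w, hw, hws⟩ a hal,
            hor.outside _ ⟨hcurve, hf⟩ ⟨w, hw, hws⟩ a hal]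
      · exact rightToLeft_unique hcurve.subset (ho.paths _ ⟨hcurve, hf⟩) (hor.paths _ ⟨hcurve, hf⟩) hal
    refine spins_ext (i₀ := vR n) ?_ (h1.trans hvR.symm)
    intro i u hiu
    obtain ⟨a, ha, -, hac⟩ := exists_arc_crossing ω hiu.corner₁.1 hiu.corner₁.2
    have e1 := isSpinRep_iff.1 hrep a ha i u hac
    have e2 := isSpinRep_iff.1 hσ.2.isSpinRep a ha i u hac
    rw [hag a ha] at e1
    tauto
  · rintro rfl
    exact ⟨_, hor, hσ.2.isSpinRep, hvR⟩


/-! ### The sum of all turns -/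

/-- `+1` for a right turn and `-1` for a left turn, in the orientation given by the spins. -/
def turn (σ : Spins) (a : Arc) : ℤ := if spinOrient σ a = true then 1 else -1

open Classical in
theorem Compat.sum_turn {ω : Config} {σ : Spins} (hσ : Compat ω σ) {l : Set Arc} (h : IsCurve ω l)
    (hl : l.Finite) :
    ∑ᶠ a ∈ l, turn σ a = if CwSpins σ l then 4 else -4 := by
  rw [← h.turnSum_eq hl]
  by_cases hc : CwSpins σ l
  · rw [if_pos hc]
    refine finsum_mem_congr rfl fun a ha => ?_
    rw [turn, if_congr (((hσ.clockwise_iff h hl).2 hc) a ha) rfl rfl]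
  · rw [if_neg hc]
    rw [hσ.cw_or_ccw h hl, not_not] at hc
    rw [turnSum, ← finsum_mem_neg_distrib _ hl]
    refine finsum_mem_congr rfl fun a ha => ?_
    have := ((hσ.counterClockwise_iff h hl).2 hc) a ha
    rw [turn]
    by_cases h1 : Surrounds l a.corner
    · rw [if_neg (by tauto), if_pos h1]
    · rw [if_pos (by tauto), if_neg h1, neg_neg]

/-- The arcs of `ω` in the tiles of the box, except for those which belong to the trivial loops
around dual vertices outside. -/
def boxArcs (n m : ℕ) (ω : Config) : Set Arc :=
  {a | a ∈ arcs ω ∧ a.tile ∈ Ebar n m ∧ ∀ u : Dual, a.corner = u.1 → u ∈ B' n m}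

/-- The arcs around the box. -/
def fringe (n m : ℕ) : Set Arc :=
  {a | (a.tile ∉ Ebar n m ∧ ∃ i ∈ Vbar n m, a.corner = i.1) ∨
    (a.tile ∈ Ebar n m ∧ a.tile.1.2 ≠ -1 ∧ ∃ u : Dual, u ∉ B' n m ∧ a.corner = u.1)}

open Classical in
/-- The configuration that is closed outside the box. -/
def cut (n m : ℕ) (ω : Config) : Config := fun t => if t ∈ Ebar n m then ω t else false

open Classical in
/-- The spins, with all dual spins outside set to `-1`. -/
def cutSpins (n m : ℕ) (σ : Spins) : Spins := (σ.1, fun u => if u ∈ B' n m then σ.2 u else -1)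

theorem cut_of_mem {n m : ℕ} {ω : Config} {t : Tile} (h : t ∈ Ebar n m) : cut n m ω t = ω t :=
  if_pos h

theorem cut_of_not_mem {n m : ℕ} {ω : Config} {t : Tile} (h : t ∉ Ebar n m) :
    cut n m ω t = false := if_neg h

theorem mem_B'_of_E {n m : ℕ} {t : Tile} (ht : t ∈ E n m) {u : Dual} (hu : u ∈ dualEnds t) :
    u ∈ B' n m := by
  rw [mem_E] at ht; rw [mem_B']
  rw [mem_dualEnds, isCorner_iff] at hu
  have := u.mod; have := t.mod
  omega

theorem Dob.closed_dual {n m : ℕ} {ω : Config} (hω : Dob n m ω) {t : Tile} (ht : t ∈ Ebar n m)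
    (hc : ω t = false) {u : Dual} (hu : u ∈ dualEnds t) : u ∈ B' n m ∨ u.1.2 = -1 := by
  by_cases hE : t ∈ E n m
  · exact Or.inl (mem_B'_of_E hE hu)
  · have h1 := hω t hE
    rw [hc] at h1
    simp only [Bool.false_eq_true, ne_eq, false_iff, not_not] at h1
    rw [mem_E] at hE; rw [mem_Ebar] at ht; rw [mem_B']
    rw [mem_dualEnds, isCorner_iff] at hu
    have := u.mod; have := t.mod
    omega

/-- The outer dual vertices that a closed tile of the box can touch lie in row -1, where the
boundary value already is -1. So setting all outer dual spins to -1 changes nothing there. -/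
theorem cutSpins_closed {n m : ℕ} {ω : Config} (hω : Dob n m ω) {σ : Spins} (hσ : Comp n m ω σ)
    {t : Tile} (ht : t ∈ Ebar n m) (hc : ω t = false) {u : Dual} (hu : u ∈ dualEnds t) :
    (cutSpins n m σ).2 u = σ.2 u := by
  by_cases hB : u ∈ B' n m
  · exact if_pos hB
  · have h1 := (hω.closed_dual ht hc hu).resolve_left hB
    rw [hσ.1.2 u hB, bs, h1]
    exact if_neg hB

theorem Dob.cut_compat {n m : ℕ} {ω : Config} (hω : Dob n m ω) {σ : Spins} (hσ : Comp n m ω σ) :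
    Compat (cut n m ω) (cutSpins n m σ) := by
  constructor
  · intro t ht i hi j hj
    by_cases hE : t ∈ Ebar n m
    · rw [cut_of_mem hE] at ht
      exact hσ.2.1 t ht i hi j hj
    · rw [cut_of_not_mem hE] at ht; simp at ht
  · intro t ht u hu v hv
    by_cases hE : t ∈ Ebar n m
    · rw [cut_of_mem hE] at ht
      rw [cutSpins_closed hω hσ hE ht hu, cutSpins_closed hω hσ hE ht hv]
      exact hσ.2.2 t ht u hu v hv
    · have h1 : ∀ u ∈ dualEnds t, u ∉ B' n m := fun u hu =>
        (not_mem_B_of_tile hE (i := mkP 0 0 rfl rfl)).2 hu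
      simp only [cutSpins, if_neg (h1 u hu), if_neg (h1 v hv)]

theorem spinOrient_congr {σ σ' : Spins} {a : Arc}
    (h : ∀ i u, Crosses a i u → σ.1 i = σ'.1 i ∧ σ.2 u = σ'.2 u) :
    spinOrient σ a = spinOrient σ' a := by
  unfold spinOrient
  congr 1
  refine propext (exists_congr fun i => exists_congr fun u => and_congr_right fun hc => ?_)
  rw [(h i u hc).1, (h i u hc).2]

theorem Dob.turn_boxArcs {n m : ℕ} {ω : Config} (hω : Dob n m ω) {σ : Spins} (hσ : Comp n m ω σ)
    {a : Arc} (ha : a ∈ boxArcs n m ω) : turn (cutSpins n m σ) a = turn σ a := by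
  obtain ⟨h1, h2, h3⟩ := ha
  have : spinOrient (cutSpins n m σ) a = spinOrient σ a := by
    refine spinOrient_congr fun i u hc => ⟨rfl, ?_⟩
    rcases hc.2.2 with h | h
    · exact cutSpins_closed hω hσ h2 ((mem_arcs_primal h).1 h1) hc.2.1
    · exact if_pos (h3 u h)
  rw [turn, turn, this]

theorem fringe_crosses {n m : ℕ} {a : Arc} (ha : a ∈ fringe n m) {i : Primal} {u : Dual}
    (hc : Crosses a i u) : i ∉ B n m ∧ i ∈ Vbar n m ∧ u ∉ B' n m ∧
    ((u.1.1 = 2 * n + 3 ∨ u.1.1 = -(2 * n + 3)) ∧ (i.1.1 = 2 * n + 2 ∨ i.1.1 = -(2 * n + 2)) ∨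
    (u.1.2 = 2 * m + 3 ∨ u.1.2 = -(2 * m + 3)) ∧ (i.1.2 = 2 * m + 2 ∨ i.1.2 = -(2 * m + 2))) := by
  have hi := (isCorner_iff _ _).1 hc.1
  have hu := (isCorner_iff _ _).1 hc.2.1
  have him := i.mod; have hum := u.mod; have := a.tile.mod
  rcases ha with ⟨h1, j, hj, hja⟩ | ⟨h1, h2, v, hv, hva⟩
  · have hij : i = j := by
      rcases hc.2.2 with h | h
      · exact Subtype.ext (h.symm.trans hja)
      · exact absurd (hja.symm.trans h) (Primal.ne_dual _ _)
    subst hij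
    refine ⟨(not_mem_B_of_tile h1 (u := u)).1 hc.1, hj, (not_mem_B_of_tile h1 (i := i)).2 hc.2.1, ?_⟩
    rw [mem_Ebar] at h1; rw [mem_Vbar] at hj
    omega
  · have huv : u = v := by
      rcases hc.2.2 with h | h
      · exact absurd (h.symm.trans hva) (Primal.ne_dual _ _)
      · exact Subtype.ext (h.symm.trans hva)
    subst huv
    rw [mem_Ebar] at h1; rw [mem_B'] at hv
    refine ⟨?_, ⟨a.tile, by rwa [mem_Ebar], hc.1⟩, by rwa [mem_B'], ?_⟩
    · rw [mem_B]; omega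
    · omega

/-- The spins outside with the convention of `cutSpins`. -/
def outSpins : Spins := (fun i => bs i.1, fun _ => -1)

theorem turn_fringe {n m : ℕ} {σ : Spins} (hσ : BdSpins n m σ) {a : Arc}
    (ha : a ∈ fringe n m) : turn (cutSpins n m σ) a = turn outSpins a := by
  have : spinOrient (cutSpins n m σ) a = spinOrient outSpins a := by
    refine spinOrient_congr fun i u hc => ?_
    obtain ⟨h1, -, h2, -⟩ := fringe_crosses ha hc
    exact ⟨hσ.1 i h1, if_neg h2⟩
  rw [turn, turn, this]

theorem Dob.fringe_subset {n m : ℕ} {ω : Config} (hω : Dob n m ω) :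
    fringe n m ⊆ arcs (cut n m ω) := by
  rintro a (⟨h1, i, hi, hc⟩ | ⟨h1, h2, u, hu, hc⟩)
  · rw [mem_arcs_primal hc, cut_of_not_mem h1]
  · rw [mem_arcs_dual hc, cut_of_mem h1]
    refine (hω _ fun hE => hu (mem_B'_of_E hE ?_)).2 h2
    rw [mem_dualEnds, ← hc]; exact a.isCorner

theorem boxArcs_subset {n m : ℕ} {ω : Config} : boxArcs n m ω ⊆ arcs (cut n m ω) := by
  rintro a ⟨h1, h2, -⟩
  rw [arcs, Set.mem_ofPred_eq, cut_of_mem h2]; exact h1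

/-- With everything closed outside, the remaining arcs are those of small circles around isolated
primal vertices off `Vbar`. -/
theorem Dob.cut_arc_cases {n m : ℕ} {ω : Config} (hω : Dob n m ω) {a : Arc}
    (ha : a ∈ arcs (cut n m ω)) : a ∈ boxArcs n m ω ∪ fringe n m ∨
      ∃ i : Primal, i ∉ Vbar n m ∧ a.corner = i.1 := by
  by_cases hE : a.tile ∈ Ebar n m
  · left
    have ha' : a ∈ arcs ω := by rwa [arcs, Set.mem_ofPred_eq, cut_of_mem hE] at ha
    by_cases h : ∀ u : Dual, a.corner = u.1 → u ∈ B' n m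
    · exact Or.inl ⟨ha', hE, h⟩
    · push Not at h
      obtain ⟨u, hu, huB⟩ := h
      have hua : u ∈ dualEnds a.tile := by rw [mem_dualEnds, ← hu]; exact a.isCorner
      exact Or.inr (Or.inr ⟨hE, (hω _ fun hE => huB (mem_B'_of_E hE hua)).1
        ((mem_arcs_dual hu).1 ha'), u, huB, hu⟩)
  · rcases a.corner_cases with ⟨i, hi⟩ | ⟨u, hu⟩
    · by_cases hV : i ∈ Vbar n m
      · exact Or.inl (Or.inr (Or.inl ⟨hE, i, hV, hi⟩))
      · exact Or.inr ⟨i, hV, hi⟩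
    · rw [mem_arcs_dual hu, cut_of_not_mem hE] at ha; simp at ha

theorem not_outer_primal {n m : ℕ} {ω : Config} {a : Arc} (ha : a ∈ boxArcs n m ω ∪ fringe n m)
    {i : Primal} (hi : i ∉ Vbar n m) : a.corner ≠ i.1 := by
  intro hc
  rcases ha with ⟨-, h, -⟩ | ⟨-, j, hj, h⟩ | ⟨h, -⟩
  · exact hi ⟨a.tile, h, by rw [mem_edgeEnds, ← hc]; exact a.isCorner⟩
  · rw [Subtype.ext (hc.symm.trans h)] at hi; exact hi hj
  · exact hi ⟨a.tile, h, by rw [mem_edgeEnds, ← hc]; exact a.isCorner⟩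

/-- A curve that contains an arc around an isolated vertex off `Vbar` is the small circle around it,
so it has no arc in the box or in the fringe. -/
theorem Dob.cut_curve_subset {n m : ℕ} {ω : Config} (hω : Dob n m ω) {l : Set Arc}
    (h : IsCurve (cut n m ω) l) {a : Arc} (ha : a ∈ l) (ha' : a ∈ boxArcs n m ω ∪ fringe n m) :
    l ⊆ boxArcs n m ω ∪ fringe n m := by
  intro b hb
  refine (hω.cut_arc_cases (h.subset hb)).resolve_right ?_
  rintro ⟨i, hi, hc⟩
  refine not_outer_primal ha' hi (h.induction (P := fun x => x.corner = i.1) hb ha hc ?_)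
  intro x _ y hy j u hx hy' hxc
  have hij : j = i := by
    rcases hx.2.2 with h' | h'
    · exact Subtype.ext (h'.symm.trans hxc)
    · exact absurd (hxc.symm.trans h') (Primal.ne_dual _ _)
  subst hij
  have hE : y.tile ∉ Ebar n m := fun hE => hi ⟨y.tile, hE, hy'.1⟩
  rcases hy'.2.2 with h' | h'
  · exact h'
  · have := (mem_arcs_dual h').1 (h.subset hy)
    rw [cut_of_not_mem hE] at this; simp at this

theorem finite_fringe (n m : ℕ) : (fringe n m).Finite := by
  refine finite_arcs (T := {t | -(2 * n + 4 : ℤ) ≤ t.1.1 ∧ t.1.1 ≤ 2 * n + 4 ∧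
    -(2 * m + 4 : ℤ) ≤ t.1.2 ∧ t.1.2 ≤ 2 * m + 4}) (finite_tiles _ _ fun t ht => ht) ?_
  rintro a (⟨-, i, hi, h⟩ | ⟨h, -⟩)
  · have := a.isCorner
    rw [h, isCorner_iff] at this
    rw [mem_Vbar] at hi
    exact ⟨by omega, by omega, by omega, by omega⟩
  · rw [mem_Ebar] at h
    exact ⟨by omega, by omega, by omega, by omega⟩

theorem finite_boxArcs (n m : ℕ) (ω : Config) : (boxArcs n m ω).Finite :=
  finite_arcs (finite_Ebar n m) fun _ h => h.2.1

/-! ### The curves around the box -/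

/-- The arc of a closed tile around `i` meets both sides at `i`. Together with the open case below,
this lets one follow a curve along straight stretches of the boundary. -/
theorem IsCurve.crossed_closed {ω : Config} {l : Set Arc} (h : IsCurve ω l) {t : Tile}
    (ht : ω t = false) {i : Primal} {u v : Dual} (hi : i ∈ edgeEnds t) (hu : u ∈ dualEnds t)
    (hv : v ∈ dualEnds t) : CrossedBy l i u ↔ CrossedBy l i v := by
  suffices key : ∀ u ∈ dualEnds t, ∀ v ∈ dualEnds t, CrossedBy l i u → CrossedBy l i v from
    ⟨key u hu v hv, key v hv u hu⟩
  rintro u hu v hv ⟨a, ha, hc⟩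
  have hb : mkArc t i.1 hi ∈ arcs ω := (mem_arcs_primal rfl).2 ht
  exact ⟨_, h.mem_of_crosses ha hb hc ⟨hi, hu, Or.inl rfl⟩, hi, hv, Or.inl rfl⟩

theorem IsCurve.crossed_open {ω : Config} {l : Set Arc} (h : IsCurve ω l) {t : Tile}
    (ht : ω t = true) {i j : Primal} {u : Dual} (hi : i ∈ edgeEnds t) (hj : j ∈ edgeEnds t)
    (hu : u ∈ dualEnds t) : CrossedBy l i u ↔ CrossedBy l j u := by
  suffices key : ∀ i ∈ edgeEnds t, ∀ j ∈ edgeEnds t, CrossedBy l i u → CrossedBy l j u from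
    ⟨key i hi j hj, key j hj i hi⟩
  rintro i hi j hj ⟨a, ha, hc⟩
  have hb : mkArc t u.1 hu ∈ arcs ω := (mem_arcs_dual rfl).2 ht
  exact ⟨_, h.mem_of_crosses ha hb hc ⟨hi, hu, Or.inr rfl⟩, hj, hu, Or.inr rfl⟩

/-- The side that follows a straight column at distance `f = ±1`. -/
theorem IsCurve.crossed_col {ω : Config} {l : Set Arc} (h : IsCurve ω l) {f : ℤ} (hf : f = 1 ∨ f = -1)
    {i j : Primal} {u v : Dual} (hij : i.1.1 = j.1.1) (hle : i.1.2 ≤ j.1.2)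
    (hu : u.1.1 = i.1.1 + f ∧ u.1.2 = i.1.2 + 1) (hv : v.1.1 = j.1.1 + f ∧ v.1.2 = j.1.2 + 1)
    (hopen : ∀ t : Tile, t.1.1 = i.1.1 → i.1.2 < t.1.2 → t.1.2 < j.1.2 → ω t = true)
    (hclosed : ∀ t : Tile, t.1.1 = i.1.1 + f → i.1.2 ≤ t.1.2 → t.1.2 ≤ j.1.2 → ω t = false) :
    CrossedBy l i u ↔ CrossedBy l j v := by
  let nb : Primal → Dual := fun k => mkD (k.1.1 + f) (k.1.2 + 1) (by have := k.mod; omega)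
    (by have := k.mod; omega)
  have hu' : u = nb i := Dual.ext' hu.1 hu.2
  have hv' : v = nb j := Dual.ext' hv.1 hv.2
  rw [hu', hv', ← eq_iff_iff]
  refine primal_col_const (fun k => CrossedBy l k (nb k)) hij hle fun t h1 h2 h3 => ?_
  have him := i.mod; have hjm := j.mod; have htm := t.mod
  suffices key : ∀ k ∈ edgeEnds t,
      (CrossedBy l k (nb k) ↔ CrossedBy l (mkP t.1.1 (t.1.2 + 1) (by omega) (by omega))
        (mkD (t.1.1 + f) t.1.2 (by omega) (by omega))) by
    intro k hk k' hk'
    rw [eq_iff_iff, key k hk, key k' hk']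
  intro k hk
  have hkm := k.mod
  have hkc := (isCorner_iff _ _).1 hk
  refine Iff.trans ?_ (h.crossed_open (i := k) (hopen t h1 h2 h3) hk
    (by rw [mem_edgeEnds, isCorner_iff]; simp) (by rw [mem_dualEnds, isCorner_iff]; simp; omega))
  by_cases hup : k.1.2 = t.1.2 + 1
  · refine h.crossed_closed (t := mkT (k.1.1 + f) k.1.2 (by omega)) (hclosed _ ?_ ?_ ?_) ?_ ?_ ?_
    · simp; omega
    · simp; omega
    · simp; omega
    · rw [mem_edgeEnds, isCorner_iff]; simp; omega
    · rw [mem_dualEnds, isCorner_iff]; simp [nb]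
    · rw [mem_dualEnds, isCorner_iff]; simp; omega
  · have : nb k = mkD (t.1.1 + f) t.1.2 (by omega) (by omega) :=
      Dual.ext' (by simp [nb]; omega) (by simp [nb]; omega)
    rw [this]

/-- The side that follows a straight row at distance `f = ±1`. -/
theorem IsCurve.crossed_row {ω : Config} {l : Set Arc} (h : IsCurve ω l) {f : ℤ} (hf : f = 1 ∨ f = -1)
    {i j : Primal} {u v : Dual} (hij : i.1.2 = j.1.2) (hle : i.1.1 ≤ j.1.1)
    (hu : u.1.1 = i.1.1 + 1 ∧ u.1.2 = i.1.2 + f) (hv : v.1.1 = j.1.1 + 1 ∧ v.1.2 = j.1.2 + f)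
    (hopen : ∀ t : Tile, t.1.2 = i.1.2 → i.1.1 < t.1.1 → t.1.1 < j.1.1 → ω t = true)
    (hclosed : ∀ t : Tile, t.1.2 = i.1.2 + f → i.1.1 ≤ t.1.1 → t.1.1 ≤ j.1.1 → ω t = false) :
    CrossedBy l i u ↔ CrossedBy l j v := by
  let nb : Primal → Dual := fun k => mkD (k.1.1 + 1) (k.1.2 + f) (by have := k.mod; omega)
    (by have := k.mod; omega)
  have hu' : u = nb i := Dual.ext' hu.1 hu.2
  have hv' : v = nb j := Dual.ext' hv.1 hv.2
  rw [hu', hv', ← eq_iff_iff]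
  refine primal_row_const (fun k => CrossedBy l k (nb k)) hij hle fun t h1 h2 h3 => ?_
  have him := i.mod; have hjm := j.mod; have htm := t.mod
  suffices key : ∀ k ∈ edgeEnds t,
      (CrossedBy l k (nb k) ↔ CrossedBy l (mkP (t.1.1 + 1) t.1.2 (by omega) (by omega))
        (mkD t.1.1 (t.1.2 + f) (by omega) (by omega))) by
    intro k hk k' hk'
    rw [eq_iff_iff, key k hk, key k' hk']
  intro k hk
  have hkm := k.mod
  have hkc := (isCorner_iff _ _).1 hk
  refine Iff.trans ?_ (h.crossed_open (i := k) (hopen t h1 h2 h3) hk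
    (by rw [mem_edgeEnds, isCorner_iff]; simp) (by rw [mem_dualEnds, isCorner_iff]; simp; omega))
  by_cases hup : k.1.1 = t.1.1 + 1
  · refine h.crossed_closed (t := mkT k.1.1 (k.1.2 + f) (by omega)) (hclosed _ ?_ ?_ ?_) ?_ ?_ ?_
    · simp; omega
    · simp; omega
    · simp; omega
    · rw [mem_edgeEnds, isCorner_iff]; simp; omega
    · rw [mem_dualEnds, isCorner_iff]; simp [nb]
    · rw [mem_dualEnds, isCorner_iff]; simp; omega
  · have : nb k = mkD t.1.1 (t.1.2 + f) (by omega) (by omega) :=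
      Dual.ext' (by simp [nb]; omega) (by simp [nb]; omega)
    rw [this]

/-- Along the top (`g = 1`) or the bottom (`g = -1`), the curve runs between the open outermost row
of the box and the closed tiles beyond it. -/
theorem Dob.crossed_top {n m : ℕ} {ω : Config} (hω : Dob n m ω) {l : Set Arc}
    (h : IsCurve (cut n m ω) l) {g : ℤ} (hg : g = 1 ∨ g = -1) {i j : Primal} {u v : Dual}
    (hiV : i ∈ Vbar n m) (hjV : j ∈ Vbar n m) (hiu : Beside i u) (hjv : Beside j v)
    (hi : i.1.2 = g * (2 * m + 2)) (hj : j.1.2 = g * (2 * m + 2))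
    (hu : u.1.2 = g * (2 * m + 3)) (hv : v.1.2 = g * (2 * m + 3)) :
    CrossedBy l i u ↔ CrossedBy l j v := by
  have hcl : ∀ t : Tile, t.1.2 = g * (2 * m + 3) → cut n m ω t = false := by
    intro t ht
    refine cut_of_not_mem ?_
    rw [mem_Ebar]
    rcases hg with rfl | rfl <;> omega
  have hop : ∀ t : Tile, t.1.2 = g * (2 * m + 2) → -(2 * n + 2 : ℤ) < t.1.1 → t.1.1 < 2 * n + 2 →
      cut n m ω t = true := by
    intro t ht h1 h2
    rw [cut_of_mem (by rw [mem_Ebar]; rcases hg with rfl | rfl <;> omega), hω]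
    · rcases hg with rfl | rfl <;> omega
    · rw [mem_E]; rcases hg with rfl | rfl <;> omega
  rw [mem_Vbar] at hiV hjV
  have hsw : ∀ i : Primal, ∀ u : Dual, Beside i u → i.1.2 = g * (2 * m + 2) → u.1.2 = g * (2 * m + 3) →
      ∃ u' : Dual, (u'.1.1 = i.1.1 + 1 ∧ u'.1.2 = i.1.2 + g) ∧ (CrossedBy l i u ↔ CrossedBy l i u') := by
    intro i u hiu hi hu
    have him := i.mod; have hum := u.mod
    unfold Beside at hiu
    have hgi : i.1.2 + g = u.1.2 := by rw [hi, hu]; ring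
    refine ⟨mkD (i.1.1 + 1) u.1.2 (by omega) hum.2, ⟨rfl, hgi.symm⟩, ?_⟩
    refine h.crossed_closed (hcl (mkT i.1.1 u.1.2 (by omega)) (by simpa using hu)) ?_ ?_ ?_
    · rw [mem_edgeEnds, isCorner_iff]; simp; omega
    · rw [mem_dualEnds, isCorner_iff]; simp; omega
    · rw [mem_dualEnds, isCorner_iff]; simp
  obtain ⟨u', hu', hiu'⟩ := hsw i u hiu hi hu
  obtain ⟨v', hv', hjv'⟩ := hsw j v hjv hj hv
  rw [hiu', hjv']
  rcases le_total i.1.1 j.1.1 with hle | hle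
  · exact h.crossed_row hg (hi.trans hj.symm) hle hu' hv'
      (fun t h1 h2 h3 => hop t (h1.trans hi) (by omega) (by omega))
      (fun t h1 _ _ => hcl t (by rw [h1, hi]; ring))
  · exact (h.crossed_row hg (hj.trans hi.symm) hle hv' hu'
      (fun t h1 h2 h3 => hop t (h1.trans hj) (by omega) (by omega))
      (fun t h1 _ _ => hcl t (by rw [h1, hj]; ring))).symm

/-- A side at the left or right flank is followed along the open column to the corner of the box and
then along the top or bottom. Staying on one side of the middle row avoids the closed edge in row
-1. -/
theorem Dob.crossed_ring {n m : ℕ} {ω : Config} (hω : Dob n m ω) {l : Set Arc}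
    (h : IsCurve (cut n m ω) l) {g : ℤ} {i j : Primal} {u v : Dual}
    (hg : (0 ≤ i.1.2 ∧ g = 1) ∨ (i.1.2 < 0 ∧ g = -1))
    (hiV : i ∈ Vbar n m) (hiu : Beside i u) (hjV : j ∈ Vbar n m) (hjv : Beside j v)
    (hj : j.1.2 = g * (2 * m + 2)) (hv : v.1.2 = g * (2 * m + 3))
    (hside : (u.1.1 = 2 * n + 3 ∨ u.1.1 = -(2 * n + 3)) ∧ (i.1.1 = 2 * n + 2 ∨ i.1.1 = -(2 * n + 2)) ∨
      (u.1.2 = 2 * m + 3 ∨ u.1.2 = -(2 * m + 3)) ∧ (i.1.2 = 2 * m + 2 ∨ i.1.2 = -(2 * m + 2))) :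
    CrossedBy l i u ↔ CrossedBy l j v := by
  have hg' : g = 1 ∨ g = -1 := by omega
  have him := i.mod; have hum := u.mod
  have hiu' := hiu
  unfold Beside at hiu'
  have hiV' := hiV
  rw [mem_Vbar] at hiV'
  by_cases htop : (u.1.2 = 2 * m + 3 ∨ u.1.2 = -(2 * m + 3)) ∧
      (i.1.2 = 2 * m + 2 ∨ i.1.2 = -(2 * m + 2))
  · refine hω.crossed_top h hg' hiV hjV hiu hjv ?_ hj ?_ hv
    · rcases hg with ⟨h0, rfl⟩ | ⟨h0, rfl⟩ <;> omega
    · rcases hg with ⟨h0, rfl⟩ | ⟨h0, rfl⟩ <;> omega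
  · have hs := hside.resolve_right htop
    obtain ⟨f, hf, hfu⟩ : ∃ f : ℤ, (f = 1 ∨ f = -1) ∧ u.1.1 = i.1.1 + f :=
      ⟨u.1.1 - i.1.1, by omega, by ring⟩
    have hcl : ∀ t : Tile, t.1.1 = i.1.1 + f → cut n m ω t = false := by
      intro t ht
      refine cut_of_not_mem ?_
      rw [mem_Ebar]; omega
    have hop : ∀ t : Tile, t.1.1 = i.1.1 → -(2 * m + 2 : ℤ) < t.1.2 → t.1.2 < 2 * m + 2 →
        t.1.2 ≠ -1 → cut n m ω t = true := by
      intro t ht h1 h2 h3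
      rw [cut_of_mem (by rw [mem_Ebar]; omega), hω]
      · exact h3
      · rw [mem_E]; omega
    have hsw : ∀ (k : Primal) (w w' : Dual), k.1.1 = i.1.1 → w.1.1 = i.1.1 + f → w'.1.1 = i.1.1 + f →
        Beside k w → Beside k w' → (CrossedBy l k w ↔ CrossedBy l k w') := by
      intro k w w' hk hw hw' hkw hkw'
      have hkm := k.mod
      unfold Beside at hkw hkw'
      refine h.crossed_closed (hcl (mkT (i.1.1 + f) k.1.2 (by omega)) rfl) ?_ ?_ ?_
      · rw [mem_edgeEnds, isCorner_iff]; simp; omega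
      · rw [mem_dualEnds, isCorner_iff]; simp; omega
      · rw [mem_dualEnds, isCorner_iff]; simp; omega
    let k : Primal := mkP i.1.1 (g * (2 * m + 2)) him.1 (by rcases hg' with rfl | rfl <;> omega)
    have hk1 : k.1.1 = i.1.1 := rfl
    have hk2 : k.1.2 = g * (2 * m + 2) := rfl
    have hkV : k ∈ Vbar n m := by
      rw [mem_Vbar, hk1, hk2]; rcases hg' with rfl | rfl <;> omega
    let w : Dual := mkD (i.1.1 + f) (g * (2 * m + 3)) (by omega) (by rcases hg' with rfl | rfl <;> omega)
    have hw1 : w.1.1 = i.1.1 + f := rfl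
    have hw2 : w.1.2 = g * (2 * m + 3) := rfl
    let w' : Dual := mkD (i.1.1 + f) (k.1.2 + 1) (by omega) (by have := k.mod; omega)
    let u' : Dual := mkD (i.1.1 + f) (i.1.2 + 1) (by omega) (by omega)
    have hkw : Beside k w := by
      unfold Beside; rw [hk1, hk2, hw1, hw2]; rcases hg' with rfl | rfl <;> omega
    have hkw' : Beside k w' := by
      unfold Beside; rw [hk1]; simp [w']; omega
    have hiu2 : Beside i u' := by
      unfold Beside; simp [u']; omega
    rw [hsw i u u' rfl hfu rfl hiu hiu2, ← hω.crossed_top h hg' hkV hjV hkw hjv hk2 hj hw2 hv,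
      hsw k w w' rfl rfl rfl hkw hkw']
    rcases hg with ⟨h0, rfl⟩ | ⟨h0, rfl⟩
    · refine h.crossed_col hf hk1.symm (by omega) ⟨rfl, rfl⟩ ⟨rfl, rfl⟩
        (fun t h1 h2 h3 => hop t h1 (by omega) (by omega) (by omega)) (fun t h1 _ _ => hcl t h1)
    · refine (h.crossed_col hf hk1 (by omega) ⟨rfl, rfl⟩ ⟨rfl, rfl⟩
        (fun t h1 h2 h3 => hop t h1 (by omega) (by omega) (by omega)) (fun t h1 _ _ => hcl t h1)).symm


/-- The two curves around the box which contain the bi-infinite paths. -/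
theorem Dob.exists_ring {n m : ℕ} {ω : Config} (hω : Dob n m ω) {σ : Spins} (hσ : Comp n m ω σ)
    {g : ℤ} (hg : g = 1 ∨ g = -1) : ∃ l, IsCurve (cut n m ω) l ∧ l ⊆ boxArcs n m ω ∪ fringe n m ∧
      (∃ a ∈ l, a.tile ∉ Ebar n m) ∧
      (∀ a ∈ fringe n m, ∀ i u, Crosses a i u →
        ((0 ≤ i.1.2 ∧ g = 1) ∨ (i.1.2 < 0 ∧ g = -1)) → a ∈ l) ∧
      (∀ i u, CrossedBy l i u → (σ.1 i = 1 ↔ g = 1)) ∧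
      ∑ᶠ a ∈ l, turn (cutSpins n m σ) a = 4 * g := by
  classical
  have hodd : (g * (2 * (m : ℤ) + 3)) % 2 = 1 := by rcases hg with rfl | rfl <;> omega
  have heven : (g * (2 * (m : ℤ) + 2)) % 2 = 0 := by rcases hg with rfl | rfl <;> omega
  -- The ring is started at the middle of the top or of the bottom side of the box.
  let i₀ : Primal := mkP 0 (g * (2 * m + 2)) rfl heven
  let u₀ : Dual := mkD 1 (g * (2 * m + 3)) rfl hodd
  let t₀ : Tile := mkT 0 (g * (2 * m + 3)) (by omega)
  have hi₀ : i₀.1.1 = 0 ∧ i₀.1.2 = g * (2 * m + 2) := ⟨rfl, rfl⟩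
  have hu₀ : u₀.1.1 = 1 ∧ u₀.1.2 = g * (2 * m + 3) := ⟨rfl, rfl⟩
  have ht₀ : t₀.1.1 = 0 ∧ t₀.1.2 = g * (2 * m + 3) := ⟨rfl, rfl⟩
  have hci : IsCorner t₀ i₀.1 := by
    rw [isCorner_iff, ht₀.1, ht₀.2, hi₀.1, hi₀.2]; rcases hg with rfl | rfl <;> omega
  have hcu : IsCorner t₀ u₀.1 := by
    rw [isCorner_iff, ht₀.1, ht₀.2, hu₀.1, hu₀.2]; rcases hg with rfl | rfl <;> omega
  have hbes : Beside i₀ u₀ := (beside_of_corners hci hcu).1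
  have htE : t₀ ∉ Ebar n m := by
    rw [mem_Ebar, ht₀.1, ht₀.2]; rcases hg with rfl | rfl <;> omega
  have hiV : i₀ ∈ Vbar n m := by
    rw [mem_Vbar, hi₀.1, hi₀.2]; rcases hg with rfl | rfl <;> omega
  have hiB : i₀ ∉ B n m := (not_mem_B_of_tile htE (u := u₀)).1 hci
  have huB : u₀ ∉ B' n m := (not_mem_B_of_tile htE (i := i₀)).2 hcu
  have hbs : bs i₀.1 = 1 ↔ g = 1 := by
    rw [bs, hi₀.2]
    rcases hg with rfl | rfl
    · rw [if_pos (by omega)]; simp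
    · rw [if_neg (by omega)]; decide
  obtain ⟨a₀, ha₀, hat, hac⟩ := exists_arc_crossing (cut n m ω) hci hcu
  have hcomp := hω.cut_compat hσ
  have hcurve := isCurve_curveOf ha₀
  have hmem := mem_curveOf (cut n m ω) a₀
  have hcr : CrossedBy (curveOf (cut n m ω) a₀) i₀ u₀ := ⟨a₀, hmem, hac⟩
  have ha₀' : a₀ ∈ boxArcs n m ω ∪ fringe n m := by
    refine (hω.cut_arc_cases ha₀).resolve_right ?_
    rintro ⟨j, hj, hc⟩
    rcases hac.2.2 with h' | h'
    · rw [← Subtype.ext (h'.symm.trans hc)] at hj; exact hj hiV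
    · exact Primal.ne_dual _ _ (hc.symm.trans h')
  have hsub := hω.cut_curve_subset hcurve hmem ha₀'
  have hfin : (curveOf (cut n m ω) a₀).Finite :=
    ((finite_boxArcs n m ω).union (finite_fringe n m)).subset hsub
  -- In the row just beyond the box the only fringe arcs cut off primal corners, which have even
  -- height, so the ray from `u₀` meets no arc of the curve at all.
  have hsur : ¬ Surrounds (curveOf (cut n m ω) a₀) u₀.1 := by
    have hne : raySet (curveOf (cut n m ω) a₀) u₀.1 = ∅ := by
      ext a
      simp only [raySet, Set.mem_ofPred_eq, Set.mem_empty_iff_false, iff_false]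
      rintro ⟨ha, h1, h2, -⟩
      have htm : a.tile ∉ Ebar n m := by
        rw [mem_Ebar, h1, hu₀.2]; rcases hg with rfl | rfl <;> omega
      rcases hsub ha with ⟨-, h, -⟩ | ⟨-, j, -, hj⟩ | ⟨h, -⟩
      · exact htm h
      · have := j.mod
        rw [← hj, h2, hu₀.2] at this; omega
      · exact htm h
    rw [← sur_eq_zero, sur, hne, Set.ncard_empty, Nat.cast_zero]
  refine ⟨_, hcurve, hsub, ⟨a₀, hmem, hat ▸ htE⟩, ?_, ?_, ?_⟩
  · intro a ha i u hc hgi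
    obtain ⟨-, hV, -, hside⟩ := fringe_crosses ha hc
    obtain ⟨b, hb, hbc⟩ := (hω.crossed_ring hcurve hgi hV hc.beside hiV hbes hi₀.2 hu₀.2 hside).2 hcr
    exact hcurve.mem_of_crosses hb (hω.fringe_subset ha) hbc hc
  · intro i u hiu
    have h1 := (hcomp.curve_const hcurve hcr hiu).1
    change σ.1 i₀ = σ.1 i at h1
    rw [← h1, hσ.1.1 i₀ hiB, hbs]
  · rw [hcomp.sum_turn hcurve hfin]
    have h1 : (cutSpins n m σ).1 i₀ = bs i₀.1 := hσ.1.1 i₀ hiB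
    have h2 : (cutSpins n m σ).2 u₀ = -1 := if_neg huB
    have key : CwSpins (cutSpins n m σ) (curveOf (cut n m ω) a₀) ↔ g = 1 := by
      constructor
      · intro h
        have := h i₀ u₀ hcr
        rw [h1, h2] at this
        rw [← hbs]
        have h3 := mt this.1 hsur
        generalize bs i₀.1 = x at h3; revert x; decide
      · intro hg1
        by_contra hn
        rw [hcomp.cw_or_ccw hcurve hfin, not_not] at hn
        have := hn i₀ u₀ hcr
        rw [h1, h2, hbs.2 hg1] at this
        exact absurd (this.2 hsur) (by decide)
    rcases hg with rfl | rfl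
    · rw [if_pos (key.2 rfl)]; rfl
    · rw [if_neg (fun h => by have := key.1 h; omega)]; rfl

theorem Dob.inner_subset {n m : ℕ} {ω : Config} (hω : Dob n m ω) {l : Set Arc}
    (h : InnerLoop n m ω l) : l ⊆ boxArcs n m ω := by
  intro a ha
  refine ⟨h.1.1.subset ha, hω.inner_tile h ha, fun u hu => ?_⟩
  by_contra hB
  obtain ⟨i, w, hc⟩ := a.exists_crosses
  have hwu : w = u := by
    rcases hc.2.2 with h' | h'
    · exact absurd (h'.symm.trans hu) (Primal.ne_dual _ _)
    · exact Subtype.ext (h'.symm.trans hu)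
  subst hwu
  have hs := (h.1.1.surrounds_iff h.1.2 hc.beside).1 ⟨a, ha, hc⟩
  have hi : i ∉ B n m := by
    have hb := hc.beside
    unfold Beside at hb
    have := i.mod
    rw [mem_B'] at hB; rw [mem_B]; omega
  have h1 := hω.not_surrounds_primal h.1.1 h.1.2 hi
  have h2 : Surrounds l w.1 := by tauto
  exact hB (mem_D_dual.1 (hω.inner_surrounds h (by have := w.mod; omega) h2))

open Classical in
/-- The orientations of the inner loops are encoded by the number of turns in the box. -/
theorem Dob.sum_turn {n m : ℕ} {ω : Config} (hω : Dob n m ω) {σ : Spins} (hσ : Comp n m ω σ) :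
    ∑ᶠ a ∈ boxArcs n m ω, turn σ a + ∑ᶠ a ∈ fringe n m, turn outSpins a =
      ∑ᶠ l ∈ {l | InnerLoop n m ω l}, (if CwSpins σ l then 4 else -4) := by
  obtain ⟨l₁, hc₁, hs₁, ⟨a₁, ha₁, ht₁⟩, hf₁, hσ₁, hsum₁⟩ := hω.exists_ring hσ (Or.inl rfl)
  obtain ⟨l₂, hc₂, hs₂, ⟨a₂, ha₂, ht₂⟩, hf₂, hσ₂, hsum₂⟩ := hω.exists_ring hσ (Or.inr rfl)
  have hdis : Disjoint (boxArcs n m ω) (fringe n m) := by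
    rw [Set.disjoint_left]
    rintro a ⟨-, h1, h2⟩ (⟨h3, -⟩ | ⟨-, -, u, hu, hc⟩)
    · exact h3 h1
    · exact hu (h2 u hc)
  have hin : ∀ l, InnerLoop n m ω l → IsCurve (cut n m ω) l := fun l hl =>
    hl.1.1.congr fun a ha => (cut_of_mem (hω.inner_tile hl ha)).symm
  have hne : l₁ ≠ l₂ := by
    rintro rfl
    obtain ⟨i, u, hc⟩ := a₁.exists_crosses
    have h1 := hσ₁ i u ⟨a₁, ha₁, hc⟩
    have h2 := hσ₂ i u ⟨a₁, ha₁, hc⟩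
    rw [h1] at h2; revert h2; decide
  have hfin : (boxArcs n m ω ∪ fringe n m).Finite := (finite_boxArcs n m ω).union (finite_fringe n m)
  -- The box arcs and the fringe are partitioned by the inner loops, which are unaffected by the
  -- cut, and the two rings: a curve that meets the fringe is a ring, any other one is a loop of
  -- `ω`.
  set T : Set (Set Arc) := {l | InnerLoop n m ω l} ∪ {l₁, l₂} with hT
  have hTc : ∀ l ∈ T, IsCurve (cut n m ω) l ∧ l ⊆ boxArcs n m ω ∪ fringe n m := by
    rintro l (hl | rfl | rfl)
    · exact ⟨hin l hl, (hω.inner_subset hl).trans Set.subset_union_left⟩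
    · exact ⟨hc₁, hs₁⟩
    · exact ⟨hc₂, hs₂⟩
  have hU : ⋃₀ T = boxArcs n m ω ∪ fringe n m := by
    apply Set.Subset.antisymm
    · exact Set.sUnion_subset fun l hl => (hTc l hl).2
    · intro a ha
      have haω : a ∈ arcs (cut n m ω) := ha.elim (fun h => boxArcs_subset h) fun h => hω.fringe_subset h
      have hcurve := isCurve_curveOf haω
      have hmem := mem_curveOf (cut n m ω) a
      have hsub := hω.cut_curve_subset hcurve hmem ha
      by_cases hfr : ∃ b ∈ curveOf (cut n m ω) a, b ∈ fringe n m
      · obtain ⟨b, hb, hbf⟩ := hfr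
        obtain ⟨i, u, hc⟩ := b.exists_crosses
        by_cases h0 : 0 ≤ i.1.2
        · have := hf₁ b hbf i u hc (Or.inl ⟨h0, rfl⟩)
          exact ⟨l₁, Or.inr (Or.inl rfl), hc₁.eq_of_mem hcurve this hb ▸ hmem⟩
        · have := hf₂ b hbf i u hc (Or.inr ⟨by omega, rfl⟩)
          exact ⟨l₂, Or.inr (Or.inr rfl), hc₂.eq_of_mem hcurve this hb ▸ hmem⟩
      · push Not at hfr
        have hbox : ∀ b ∈ curveOf (cut n m ω) a, b ∈ boxArcs n m ω := fun b hb =>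
          (hsub hb).resolve_right (hfr b hb)
        have hcω : IsCurve ω (curveOf (cut n m ω) a) :=
          hcurve.congr fun b hb => cut_of_mem (hbox b hb).2.1
        refine ⟨_, Or.inl ?_, hmem⟩
        refine (hω.loop_cases ⟨hcω, hfin.subset hsub⟩).resolve_right ?_
        rintro ⟨u, hu, -, hall⟩
        exact hu ((hbox a hmem).2.2 u (hall a hmem))
  have hpd : T.PairwiseDisjoint id := by
    intro l hl l' hl' hll
    rw [Function.onFun, Set.disjoint_left]
    exact fun a ha ha' => hll ((hTc l hl).1.eq_of_mem (hTc l' hl').1 ha ha')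
  have hTfin : T.Finite := hω.finite_inner.union (by simp)
  have h1 := finsum_mem_sUnion (f := turn (cutSpins n m σ)) hpd hTfin
    fun l hl => hfin.subset (hTc l hl).2
  rw [hU, finsum_mem_union hdis (finite_boxArcs n m ω) (finite_fringe n m),
    finsum_mem_congr rfl fun a ha => hω.turn_boxArcs hσ ha,
    finsum_mem_congr rfl fun a ha => turn_fringe hσ.1 ha] at h1
  -- The two rings contribute 4 and -4, so only the inner loops remain.
  rw [h1, hT, finsum_mem_union _ hω.finite_inner (by simp), finsum_mem_pair hne, hsum₁, hsum₂]
  · have : ∀ l ∈ {l | InnerLoop n m ω l}, ∑ᶠ a ∈ l, turn (cutSpins n m σ) a =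
        if CwSpins σ l then 4 else -4 := by
      intro l hl
      rw [← hσ.2.sum_turn hl.1.1 hl.1.2]
      exact finsum_mem_congr rfl fun a ha => hω.turn_boxArcs hσ (hω.inner_subset hl ha)
    rw [finsum_mem_congr rfl this]; ring
  · rw [Set.disjoint_left]
    rintro l hl (rfl | rfl)
    · exact ht₁ (hω.inner_tile hl ha₁)
    · exact ht₂ (hω.inner_tile hl ha₂)


/-! ### Connectivity and chains modulo two -/

theorem tv_add (h h' : Tile → ZMod 2) (x y : ℤ) : tv (h + h') x y = tv h x y + tv h' x y := by
  unfold tv; split_ifs <;> simp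

theorem bdry_add (h h' : Tile → ZMod 2) (z : Pt) : bdry (h + h') z = bdry h z + bdry h' z := by
  simp only [bdry, tv_add]; ring

open Classical in
theorem bdry_eq {F : Finset Tile} {h : Tile → ZMod 2} (hF : ∀ t, t ∉ F → h t = 0) {z : Pt}
    (hz : (z.1 + z.2) % 2 = 0) : bdry h z = ∑ t ∈ F, if IsCorner t z then h t else 0 := by
  have hsum : ∀ (x y : ℤ) (hp : (x + y) % 2 = 1), tv h x y =
      ∑ t ∈ F, if t = mkT x y hp then h t else 0 := by
    intro x y hp
    rw [Finset.sum_ite_eq', tv, dif_pos hp]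
    split_ifs with h'
    · rfl
    · exact hF _ h'
  rw [bdry, hsum _ _ (by omega), hsum _ _ (by omega), hsum _ _ (by omega), hsum _ _ (by omega),
    ← Finset.sum_add_distrib, ← Finset.sum_add_distrib, ← Finset.sum_add_distrib]
  refine Finset.sum_congr rfl fun t _ => ?_
  have key : ∀ (x y : ℤ) (hp : (x + y) % 2 = 1), t = mkT x y hp ↔ t.1.1 = x ∧ t.1.2 = y :=
    fun x y hp => ⟨fun h => by rw [h]; simp, fun h => Tile.ext' h.1 h.2⟩
  simp only [key, isCorner_iff]
  split_ifs <;> first | omega | simp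

/-- The graph whose vertices are the lattice points with a given property and whose edges are
given by tiles. -/
def cornerGraph (p : Pt → Prop) (F : Set Tile) : SimpleGraph (Subtype p) :=
  SimpleGraph.fromRel fun i j => ∃ t ∈ F, IsCorner t i.1 ∧ IsCorner t j.1

/-- Each tile joins exactly two points with the given property. -/
def TwoCorners (p : Pt → Prop) : Prop := ∀ t, ∃ i j : Subtype p, IsCorner t i.1 ∧ IsCorner t j.1 ∧
  i ≠ j ∧ ∀ k : Subtype p, IsCorner t k.1 → k = i ∨ k = j

open Classical in
-- Add up the edges of a path; modulo two, everything but the endpoints cancels in the boundary.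
theorem TwoCorners.exists_chain {p : Pt → Prop} (hp : TwoCorners p) {F : Finset Tile}
    {x y : Subtype p} (h : (cornerGraph p F).Reachable x y) : ∃ c : Tile → ZMod 2,
      (∀ t, t ∉ F → c t = 0) ∧
      ∀ i : Subtype p, bdry c i.1 = (if i = x then 1 else 0) + if i = y then 1 else 0 := by
  refine reachable_induction (P := fun y => ∃ c : Tile → ZMod 2, (∀ t, t ∉ F → c t = 0) ∧
    ∀ i : Subtype p, bdry c i.1 = (if i = x then 1 else 0) + if i = y then 1 else 0) h
    ⟨0, fun _ _ => rfl, fun i => ?_⟩ ?_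
  · rw [zmod2_add_self]; simp [bdry, tv]
  · rintro y z hyz ⟨c, hc, hb⟩
    obtain ⟨hne, t, ht, hty, htz⟩ : y ≠ z ∧ ∃ t ∈ F, IsCorner t y.1 ∧ IsCorner t z.1 := by
      simp only [cornerGraph, SimpleGraph.fromRel_adj] at hyz
      rcases hyz with ⟨hne, ⟨t, h1, h2, h3⟩ | ⟨t, h1, h2, h3⟩⟩
      exacts [⟨hne, t, h1, h2, h3⟩, ⟨hne, t, h1, h3, h2⟩]
    have hsing : ∀ s, s ∉ ({t} : Finset Tile) → (Pi.single t 1 : Tile → ZMod 2) s = 0 := fun s hs =>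
      Pi.single_eq_of_ne (by simpa using hs) _
    refine ⟨c + Pi.single t 1, fun s hs => ?_, fun i => ?_⟩
    · rw [Pi.add_apply, hc s hs, Pi.single_eq_of_ne (by rintro rfl; exact hs ht), add_zero]
    · have : ∀ i : Subtype p, (i.1.1 + i.1.2) % 2 = 0 → bdry (Pi.single t 1) i.1 =
          (if i = y then 1 else 0) + if i = z then 1 else 0 := by
        intro i hi
        rw [bdry_eq hsing hi, Finset.sum_singleton, Pi.single_eq_same]
        obtain ⟨a, b, ha, hb', hab, hall⟩ := hp t
        have hiff : IsCorner t i.1 ↔ i = y ∨ i = z := by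
          constructor
          · intro hi
            rcases hall i hi with rfl | rfl <;> rcases hall y hty with rfl | rfl <;>
              rcases hall z htz with rfl | rfl <;> simp_all
          · rintro (rfl | rfl) <;> assumption
        by_cases h1 : i = y
        · rw [if_pos (hiff.2 (Or.inl h1)), if_pos h1, if_neg (h1 ▸ hne), add_zero]
        · rw [if_congr hiff rfl rfl, if_neg h1, zero_add]
          simp only [h1, false_or]
      by_cases hi : (i.1.1 + i.1.2) % 2 = 0
      · rw [bdry_add, hb, this i hi]
        have := zmod2_add_self (if i = y then 1 else 0)
        linear_combination this
      · obtain ⟨a, b, ha, hb', hab, hall⟩ := hp t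
        have hbz : bdry (Pi.single t 1) i.1 = 0 := by
          have key : ∀ x y : ℤ, (x + y) % 2 = 0 → tv (Pi.single t 1) x y = 0 := fun x y h => by
            rw [tv, dif_neg (by omega)]
          simp only [bdry]
          rw [key, key, key, key] <;> first | omega | simp
        rw [bdry_add, hb, hbz, add_zero]
        have hy : i ≠ y := fun h => hi (by rw [h]; exact corner_parity hty)
        have hz : i ≠ z := fun h => hi (by rw [h]; exact corner_parity htz)
        rw [if_neg hy, if_neg hz]

open Classical in
-- If `y` were not in the cluster of `x`, pair the boundary of the chain with the indicator of this
-- cluster: computed at vertices the result is 1, but each edge has both or no ends in the cluster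
-- and contributes 0.
theorem TwoCorners.reachable {p : Pt → Prop} (hp : TwoCorners p) {F : Finset Tile}
    {x y : Subtype p} {c : Tile → ZMod 2} (hc : ∀ t, t ∉ F → c t = 0)
    (hx : (x.1.1 + x.1.2) % 2 = 0)
    (hb : ∀ i : Subtype p, bdry c i.1 = (if i = x then 1 else 0) + if i = y then 1 else 0) :
    (cornerGraph p F).Reachable x y := by
  by_contra hn
  choose e f he hf hef hall using hp
  let P : Finset (Subtype p) := insert x (F.image e ∪ F.image f)
  let φ : Subtype p → ZMod 2 := fun i => if (cornerGraph p F).Reachable x i then 1 else 0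
  have hpar : ∀ i ∈ P, (i.1.1 + i.1.2) % 2 = 0 := by
    intro i hi
    rw [Finset.mem_insert, Finset.mem_union, Finset.mem_image, Finset.mem_image] at hi
    rcases hi with rfl | ⟨t, -, rfl⟩ | ⟨t, -, rfl⟩
    exacts [hx, corner_parity (he t), corner_parity (hf t)]
  have h1 : ∑ i ∈ P, φ i * bdry c i.1 = 1 := by
    rw [Finset.sum_eq_single x]
    · have hxy : x ≠ y := fun h => hn (h ▸ SimpleGraph.Reachable.refl x)
      rw [hb, if_pos rfl, if_neg hxy]
      simp only [φ, if_pos (SimpleGraph.Reachable.refl x)]; rfl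
    · intro i _ hix
      rw [hb, if_neg hix, zero_add]
      by_cases hiy : i = y
      · simp only [φ, hiy, if_neg hn, zero_mul]
      · rw [if_neg hiy, mul_zero]
    · intro h; exact absurd (Finset.mem_insert_self _ _) h
  have h2 : ∑ i ∈ P, φ i * bdry c i.1 = 0 := by
    have : ∀ i ∈ P, φ i * bdry c i.1 = ∑ t ∈ F, if IsCorner t i.1 then φ i * c t else 0 := by
      intro i hi
      rw [bdry_eq hc (hpar i hi), Finset.mul_sum]
      exact Finset.sum_congr rfl fun t _ => by rw [mul_ite, mul_zero]
    rw [Finset.sum_congr rfl this, Finset.sum_comm]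
    refine Finset.sum_eq_zero fun t ht => ?_
    rw [← Finset.sum_filter]
    have hset : P.filter (fun i => IsCorner t i.1) = {e t, f t} := by
      ext i
      have hpair : i ∈ ({e t, f t} : Finset (Subtype p)) ↔ i = e t ∨ i = f t := by simp
      rw [Finset.mem_filter, hpair]
      constructor
      · exact fun h => hall t i h.2
      · have hP : e t ∈ P ∧ f t ∈ P := by
          constructor <;> refine Finset.mem_insert_of_mem (Finset.mem_union.2 ?_)
          · exact Or.inl (Finset.mem_image_of_mem _ ht)
          · exact Or.inr (Finset.mem_image_of_mem _ ht)
        rintro (rfl | rfl)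
        exacts [⟨hP.1, he t⟩, ⟨hP.2, hf t⟩]
    have hφ : φ (e t) = φ (f t) := by
      have hadj : (cornerGraph p F).Adj (e t) (f t) :=
        (SimpleGraph.fromRel_adj _ _ _).2 ⟨hef t, Or.inl ⟨t, ht, he t, hf t⟩⟩
      have : (cornerGraph p F).Reachable x (e t) ↔ (cornerGraph p F).Reachable x (f t) :=
        ⟨fun h => h.trans hadj.reachable, fun h => h.trans hadj.symm.reachable⟩
      simp only [φ, this]
    rw [hset, Finset.sum_pair (hef t), hφ, zmod2_add_self]
  rw [h1] at h2
  exact one_ne_zero h2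

theorem twoCorners_primal : TwoCorners fun p => Even p.1 ∧ Even p.2 := fun t => by
  obtain ⟨i, j, hi, hj, hij, hall, -⟩ := exists_edgeEnds t
  exact ⟨i, j, hi, hj, hij, hall⟩

theorem twoCorners_dual : TwoCorners fun p => Odd p.1 ∧ Odd p.2 := fun t => by
  obtain ⟨i, j, hi, hj, hij, hall, -⟩ := exists_dualEnds t
  exact ⟨i, j, hi, hj, hij, hall⟩

open Classical in
/-- Two vertices are connected if and only if they bound a chain. -/
theorem primal_reachable_iff {F : Set Tile} (hF : F.Finite) {x y : Primal} :
    (primalGraph F).Reachable x y ↔ ∃ c : Tile → ZMod 2, (∀ t, t ∉ F → c t = 0) ∧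
      ∀ i : Primal, bdry c i.1 = (if i = x then 1 else 0) + if i = y then 1 else 0 := by
  lift F to Finset Tile using hF
  exact ⟨fun h => twoCorners_primal.exists_chain h, fun ⟨c, hc, hb⟩ =>
    twoCorners_primal.reachable hc (by have := x.mod; omega) hb⟩

open Classical in
theorem dual_reachable_iff {F : Set Tile} (hF : F.Finite) {x y : Dual} :
    (dualGraph F).Reachable x y ↔ ∃ c : Tile → ZMod 2, (∀ t, t ∉ F → c t = 0) ∧
      ∀ i : Dual, bdry c i.1 = (if i = x then 1 else 0) + if i = y then 1 else 0 := by
  lift F to Finset Tile using hF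
  exact ⟨fun h => twoCorners_dual.exists_chain h, fun ⟨c, hc, hb⟩ =>
    twoCorners_dual.reachable hc (by have := x.mod; omega) hb⟩

open Classical in
/-- The chain of tiles on a segment of a row. -/
def rowChain (r c : ℤ) (t : Tile) : ZMod 2 := if t.1.2 = r ∧ -c < t.1.1 ∧ t.1.1 < c then 1 else 0

open Classical in
theorem bdry_rowChain {r c : ℤ} (hc : 0 < c) (hrc : (r + c) % 2 = 0) {z : Pt} (h1 : z.1 % 2 = c % 2)
    (h2 : z.2 % 2 = r % 2) :
    bdry (rowChain r c) z = (if z = (-c, r) then 1 else 0) + if z = (c, r) then 1 else 0 := by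
  have key : ∀ x y : ℤ, tv (rowChain r c) x y =
      if (x + y) % 2 = 1 ∧ y = r ∧ -c < x ∧ x < c then 1 else 0 := by
    intro x y
    rw [tv]
    by_cases hp : (x + y) % 2 = 1
    · rw [dif_pos hp, rowChain]
      exact if_congr (by rw [mkT_fst, mkT_snd]; tauto) rfl rfl
    · rw [dif_neg hp, if_neg (by tauto)]
  simp only [bdry, key, Prod.ext_iff]
  rw [if_neg (c := (z.1 + (z.2 + 1)) % 2 = 1 ∧ z.2 + 1 = r ∧ -c < z.1 ∧ z.1 < c) (by omega),
    if_neg (c := (z.1 + (z.2 - 1)) % 2 = 1 ∧ z.2 - 1 = r ∧ -c < z.1 ∧ z.1 < c) (by omega)]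
  split_ifs <;> first | omega | rfl

/-! ### Crossings and spins -/

/-- The primal spins with the boundary condition which are constant along the edges in `F`. -/
def SpinsP (n m : ℕ) (F : Set Tile) : Set (Primal → ℤˣ) :=
  {σ | (∀ i, i ∉ B n m → σ i = bs i.1) ∧ AgreePrimal σ F}

/-- The dual spins with the boundary condition which are constant along the dual edges in `F`. -/
def SpinsD (n m : ℕ) (F : Set Tile) : Set (Dual → ℤˣ) :=
  {σ | (∀ u, u ∉ B' n m → σ u = bs u.1) ∧ AgreeDual σ F}

theorem dual_const_outside {n m : ℕ} {X : Type*} (g : Dual → X)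
    (hg : ∀ t, t ∉ Ebar n m → ∀ u ∈ dualEnds t, ∀ v ∈ dualEnds t, g u = g v) {u v : Dual}
    (hu : u ∉ B' n m) (hv : v ∉ B' n m) : g u = g v := by
  have hcol : ∀ u v : Dual, u.1.1 = v.1.1 → (2 * n + 3 ≤ u.1.1 ∨ u.1.1 ≤ -(2 * n + 3)) → g u = g v := by
    intro u v h1 h2
    rcases le_total u.1.2 v.1.2 with h | h
    · exact dual_col_const g h1 h fun t h3 _ _ => hg t (by rw [mem_Ebar]; omega)
    · exact (dual_col_const g h1.symm h fun t h3 _ _ => hg t (by rw [mem_Ebar]; omega)).symm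
  have hrow : ∀ u v : Dual, u.1.2 = v.1.2 → (2 * m + 3 ≤ u.1.2 ∨ u.1.2 ≤ -(2 * m + 3)) → g u = g v := by
    intro u v h1 h2
    rcases le_total u.1.1 v.1.1 with h | h
    · exact dual_row_const g h1 h fun t h3 _ _ => hg t (by rw [mem_Ebar]; omega)
    · exact (dual_row_const g h1.symm h fun t h3 _ _ => hg t (by rw [mem_Ebar]; omega)).symm
  let c : Dual := mkD (2 * n + 3) (2 * m + 3) (by omega) (by omega)
  suffices key : ∀ u, u ∉ B' n m → g u = g c by rw [key u hu, key v hv]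
  intro u hu
  have hum := u.mod
  rw [mem_B'] at hu
  by_cases h : 2 * n + 3 ≤ u.1.1 ∨ u.1.1 ≤ -(2 * n + 3)
  · rw [hcol u (mkD u.1.1 (2 * m + 3) hum.1 (by omega)) rfl h]
    exact hrow _ _ rfl (Or.inl (by simp))
  · rw [hrow u (mkD (2 * n + 3) u.1.2 (by omega) hum.2) rfl (by omega)]
    exact hcol _ _ rfl (Or.inl (by simp))

theorem primal_const_outside {n m : ℕ} {X : Type*} (g : Primal → X)
    (hg : ∀ t, t ∉ E n m → ∀ u ∈ edgeEnds t, ∀ v ∈ edgeEnds t, g u = g v) {u v : Primal}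
    (hu : u ∉ B n m) (hv : v ∉ B n m) : g u = g v := by
  have hcol : ∀ u v : Primal, u.1.1 = v.1.1 → (2 * n + 2 ≤ u.1.1 ∨ u.1.1 ≤ -(2 * n + 2)) → g u = g v := by
    intro u v h1 h2
    rcases le_total u.1.2 v.1.2 with h | h
    · exact primal_col_const g h1 h fun t h3 _ _ => hg t (by rw [mem_E]; omega)
    · exact (primal_col_const g h1.symm h fun t h3 _ _ => hg t (by rw [mem_E]; omega)).symm
  have hrow : ∀ u v : Primal, u.1.2 = v.1.2 → (2 * m + 2 ≤ u.1.2 ∨ u.1.2 ≤ -(2 * m + 2)) → g u = g v := by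
    intro u v h1 h2
    rcases le_total u.1.1 v.1.1 with h | h
    · exact primal_row_const g h1 h fun t h3 _ _ => hg t (by rw [mem_E]; omega)
    · exact (primal_row_const g h1.symm h fun t h3 _ _ => hg t (by rw [mem_E]; omega)).symm
  let c : Primal := mkP (2 * n + 2) (2 * m + 2) (by omega) (by omega)
  suffices key : ∀ u, u ∉ B n m → g u = g c by rw [key u hu, key v hv]
  intro u hu
  have hum := u.mod
  rw [mem_B] at hu
  by_cases h : 2 * n + 2 ≤ u.1.1 ∨ u.1.1 ≤ -(2 * n + 2)
  · rw [hcol u (mkP u.1.1 (2 * m + 2) hum.1 (by omega)) rfl h]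
    exact hrow _ _ rfl (Or.inl (by simp))
  · rw [hrow u (mkP (2 * n + 2) u.1.2 (by omega) hum.2) rfl (by omega)]
    exact hcol _ _ rfl (Or.inl (by simp))

theorem bs_eq_iff (z w : Pt) : bs z = bs w ↔ (0 ≤ z.2 ↔ 0 ≤ w.2) := by
  by_cases h : 0 ≤ z.2 <;> by_cases h' : 0 ≤ w.2 <;> simp only [bs, h, h', if_true, if_false] <;>
    decide

/-- The boundary sign of dual spins changes across row 0. For primal spins it changes across row -1
(`row_of_primal`). This is why the two crossings are anchored in these rows. -/
theorem row_of_dual {t : Tile} {u v : Dual} (hu : u ∈ dualEnds t) (hv : v ∈ dualEnds t) (huv : u ≠ v) :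
    (bs u.1 = bs v.1) ↔ t.1.2 ≠ 0 := by
  rw [mem_dualEnds, isCorner_iff] at hu hv
  have hum := u.mod; have hvm := v.mod; have htm := t.mod
  have hne : ¬ (u.1.1 = v.1.1 ∧ u.1.2 = v.1.2) := fun h => huv (Dual.ext' h.1 h.2)
  rw [bs_eq_iff]; omega

theorem row_of_primal {t : Tile} {u v : Primal} (hu : u ∈ edgeEnds t) (hv : v ∈ edgeEnds t)
    (huv : u ≠ v) : (bs u.1 = bs v.1) ↔ t.1.2 ≠ -1 := by
  rw [mem_edgeEnds, isCorner_iff] at hu hv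
  have hum := u.mod; have hvm := v.mod; have htm := t.mod
  have hne : ¬ (u.1.1 = v.1.1 ∧ u.1.2 = v.1.2) := fun h => huv (Primal.ext' h.1 h.2)
  rw [bs_eq_iff]; omega

/-- Comparison of spins with the boundary condition. -/
def spinDiff (x y : ℤˣ) : ZMod 2 := if x = y then 0 else 1

theorem spinDiff_add (a b c d : ℤˣ) (h : a = b) : spinDiff a c + spinDiff b d = spinDiff c d := by
  revert a b c d; decide

theorem mul_sgn_add (a b : ℤˣ) (x y : ZMod 2) (h : x + y = spinDiff a b) :
    a * sgn x = b * sgn y := by revert a b x y; decide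

/-- Inside the box, the straight segment is the set of edges across which the boundary condition
changes sign. -/
theorem rowChain_eq {r c : ℤ} {t : Tile} (h : t.1.2 = r → -c < t.1.1 ∧ t.1.1 < c) {a b : ℤˣ}
    (hab : a = b ↔ t.1.2 ≠ r) : rowChain r c t = spinDiff a b := by
  rw [rowChain, spinDiff]
  by_cases hr : t.1.2 = r
  · rw [if_pos ⟨hr, h hr⟩, if_neg (by tauto)]
  · rw [if_neg (by tauto), if_pos (by tauto)]

/-- The interface of dual spins with this boundary condition is the straight segment from `vL` to
`vR` plus the coboundary of the difference between the spins and the boundary sign. It has boundary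
`vL` + `vR` and lies in `F`, so it connects the two points. Conversely, a connecting chain in `F`
plus the segment is a cycle, and `cobD_ray` turns it into the difference function. -/
theorem spinsD_nonempty_iff {n m : ℕ} {F : Set Tile} (hF : F ⊆ Ebar n m) :
    (SpinsD n m (Ebar n m \ F)).Nonempty ↔ (primalGraph F).Reachable (vL n) (vR n) := by
  rw [primal_reachable_iff ((finite_Ebar n m).subset hF)]
  have hbd : ∀ i : Primal, bdry (rowChain 0 (2 * n + 2)) i.1 =
      (if i = vL n then 1 else 0) + if i = vR n then 1 else 0 := by
    intro i
    have him := i.mod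
    rw [bdry_rowChain (by omega) (by omega) (by omega) (by omega)]
    congr 1 <;> refine if_congr ?_ rfl rfl <;> rw [Subtype.ext_iff]
    · simp only [vL]; rw [show -(2 * (n : ℤ) + 2) = -2 * n - 2 by ring]
    · rfl
  have hbox : ∀ t ∈ Ebar n m, t.1.2 = 0 → -(2 * (n : ℤ) + 2) < t.1.1 ∧ t.1.1 < 2 * (n : ℤ) + 2 := by
    intro t ht h0
    have := t.mod
    rw [mem_Ebar] at ht; omega
  constructor
  · rintro ⟨σ, hσ, hσF⟩
    refine ⟨cobD (fun u => spinDiff (σ u) (bs u.1)) + rowChain 0 (2 * n + 2), fun t ht => ?_, fun i => ?_⟩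
    · obtain ⟨u, v, hu, hv, huv, -⟩ := exists_dualEnds t
      rw [Pi.add_apply, cobD_eq _ hu hv huv]
      by_cases hE : t ∈ Ebar n m
      · rw [rowChain_eq (hbox t hE) (row_of_dual hu hv huv),
          spinDiff_add _ _ _ _ (hσF t ⟨hE, ht⟩ u hu v hv), zmod2_add_self]
      · have h1 : ∀ u ∈ dualEnds t, σ u = bs u.1 := fun u hu =>
          hσ u ((not_mem_B_of_tile hE (i := mkP 0 0 rfl rfl)).2 hu)
        have h2 : rowChain 0 (2 * n + 2) t = 0 := by
          rw [mem_Ebar] at hE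
          exact if_neg (by omega)
        simp only [h1 u hu, h1 v hv, h2, spinDiff, if_true, add_zero]
    · rw [bdry_add, bdry_cobD, zero_add, hbd]
  · rintro ⟨c, hc, hcb⟩
    have hS : ∀ t, t ∉ (finite_Ebar n m).toFinset → (c + rowChain 0 (2 * n + 2)) t = 0 := by
      intro t ht
      rw [Set.Finite.mem_toFinset] at ht
      rw [Pi.add_apply, hc t (fun h => ht (hF h)), zero_add]
      rw [mem_Ebar] at ht
      exact if_neg (by omega)
    have hev : ∀ i : Primal, bdry (c + rowChain 0 (2 * n + 2)) i.1 = 0 := fun i => by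
      rw [bdry_add, hcb, hbd, zmod2_add_self]
    have hcob := cobD_ray hS hev
    set ψ : Dual → ZMod 2 := fun u => ray (finite_Ebar n m).toFinset (c + rowChain 0 (2 * n + 2)) u.1
    have hψ : ∀ u, u ∉ B' n m → ψ u = 0 := by
      intro u hu
      let w : Dual := mkD (2 * n + 3) 1 (by omega) rfl
      have hw : w ∉ B' n m := by rw [mem_B']; simp [w]
      rw [dual_const_outside ψ (fun t ht => (cobD_eq_zero ψ t).1 ?_) hu hw]
      · refine ray_far _ fun t ht => ?_
        rw [Set.Finite.mem_toFinset, mem_Ebar] at ht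
        simp [w]; omega
      · rw [hcob t, hS t (by rwa [Set.Finite.mem_toFinset])]
    refine ⟨fun u => bs u.1 * sgn (ψ u), fun u hu => by simp only [hψ u hu, sgn_zero, mul_one], ?_⟩
    rintro t ⟨hE, ht⟩ u hu v hv
    by_cases huv : u = v
    · rw [huv]
    · have h1 := hcob t
      rw [cobD_eq ψ hu hv huv, Pi.add_apply, hc t ht, zero_add,
        rowChain_eq (hbox t hE) (row_of_dual hu hv huv)] at h1
      exact mul_sgn_add _ _ _ _ h1

/-- As for dual spins, with row -1 and the roles of the lattices exchanged. The primal spins are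
also prescribed on the outer layer of `Vbar`, so the difference function must be constant along
boundary edges too. -/
theorem spinsP_nonempty_iff {n m : ℕ} {F : Set Tile} (hF : F ⊆ Ebar n m) :
    (SpinsP n m F).Nonempty ↔ (dualGraph (Ebar n m \ F)).Reachable (vL' n) (vR' n) := by
  rw [dual_reachable_iff ((finite_Ebar n m).subset Set.sdiff_subset)]
  have hbd : ∀ i : Dual, bdry (rowChain (-1) (2 * n + 3)) i.1 =
      (if i = vL' n then 1 else 0) + if i = vR' n then 1 else 0 := by
    intro i
    have him := i.mod
    rw [bdry_rowChain (by omega) (by omega) (by omega) (by omega)]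
    congr 1 <;> refine if_congr ?_ rfl rfl <;> rw [Subtype.ext_iff]
    · simp only [vL']; rw [show -(2 * (n : ℤ) + 3) = -2 * n - 3 by ring]
    · rfl
  have hbox : ∀ t ∈ Ebar n m, t.1.2 = -1 → -(2 * (n : ℤ) + 3) < t.1.1 ∧ t.1.1 < 2 * (n : ℤ) + 3 := by
    intro t ht h0
    rw [mem_Ebar] at ht; omega
  constructor
  · rintro ⟨σ, hσ, hσF⟩
    refine ⟨cobP (fun u => spinDiff (σ u) (bs u.1)) + rowChain (-1) (2 * n + 3), fun t ht => ?_,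
      fun i => ?_⟩
    · obtain ⟨u, v, hu, hv, huv, -⟩ := exists_edgeEnds t
      rw [Pi.add_apply, cobP_eq _ hu hv huv]
      by_cases hE : t ∈ Ebar n m
      · have htF : t ∈ F := by by_contra h; exact ht ⟨hE, h⟩
        rw [rowChain_eq (hbox t hE) (row_of_primal hu hv huv),
          spinDiff_add _ _ _ _ (hσF t htF u hu v hv), zmod2_add_self]
      · have h1 : ∀ u ∈ edgeEnds t, σ u = bs u.1 := fun u hu =>
          hσ u ((not_mem_B_of_tile hE (u := mkD 1 1 rfl rfl)).1 hu)
        have h2 : rowChain (-1) (2 * n + 3) t = 0 := by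
          rw [mem_Ebar] at hE
          exact if_neg (by omega)
        simp only [h1 u hu, h1 v hv, h2, spinDiff, if_true, add_zero]
    · rw [bdry_add, bdry_cobP, zero_add, hbd]
  · rintro ⟨c, hc, hcb⟩
    have hS : ∀ t, t ∉ (finite_Ebar n m).toFinset → (c + rowChain (-1) (2 * n + 3)) t = 0 := by
      intro t ht
      rw [Set.Finite.mem_toFinset] at ht
      rw [Pi.add_apply, hc t (fun h => ht h.1), zero_add]
      rw [mem_Ebar] at ht
      exact if_neg (by omega)
    have hev : ∀ i : Dual, bdry (c + rowChain (-1) (2 * n + 3)) i.1 = 0 := fun i => by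
      rw [bdry_add, hcb, hbd, zmod2_add_self]
    -- The outer end of the dual of a boundary edge meets no other tile of the box, so evenness
    -- there forces the cycle to vanish on that tile.
    have hleaf : ∀ t, t ∉ E n m → (c + rowChain (-1) (2 * n + 3)) t = 0 := by
      intro t htE
      by_cases htA : t ∈ Ebar n m
      · have htm := t.mod
        rw [mem_E] at htE
        rw [mem_Ebar] at htA
        obtain ⟨u, hut, hu⟩ : ∃ u : Dual, IsCorner t u.1 ∧ ∀ s, IsCorner s u.1 → s ≠ t →
            s ∉ (finite_Ebar n m).toFinset := by
          have : ∃ u : Dual, IsCorner t u.1 ∧ (u.1.1 = 2 * n + 3 ∨ u.1.1 = -(2 * n + 3) ∨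
              u.1.2 = 2 * m + 3 ∨ u.1.2 = -(2 * m + 3)) := by
            by_cases h1 : t.1.1 = 2 * n + 2
            · exact ⟨mkD (t.1.1 + 1) t.1.2 (by omega) (by omega), by rw [isCorner_iff]; simp,
                by simp; omega⟩
            by_cases h2 : t.1.1 = -(2 * n + 2)
            · exact ⟨mkD (t.1.1 - 1) t.1.2 (by omega) (by omega), by rw [isCorner_iff]; simp,
                by simp; omega⟩
            by_cases h3 : t.1.2 = 2 * m + 2
            · exact ⟨mkD t.1.1 (t.1.2 + 1) (by omega) (by omega), by rw [isCorner_iff]; simp,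
                by simp; omega⟩
            · exact ⟨mkD t.1.1 (t.1.2 - 1) (by omega) (by omega), by rw [isCorner_iff]; simp,
                by simp; omega⟩
          obtain ⟨u, h1, h2⟩ := this
          refine ⟨u, h1, fun s hs hst => ?_⟩
          have hum := u.mod; have hsm := s.mod
          have hne : ¬ (s.1.1 = t.1.1 ∧ s.1.2 = t.1.2) := fun h => hst (Tile.ext' h.1 h.2)
          rw [isCorner_iff] at h1 hs
          rw [Set.Finite.mem_toFinset, mem_Ebar]
          omega
        have h0 := hev u
        rw [bdry_eq hS (by have := u.mod; omega), Finset.sum_eq_single t, if_pos hut] at h0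
        · exact h0
        · intro s hs hst
          exact if_neg fun hc => hu s hc hst hs
        · intro h; exact absurd (by rwa [Set.Finite.mem_toFinset, mem_Ebar]) h
      · exact hS t (by rwa [Set.Finite.mem_toFinset])
    have hcob := cobP_ray hS hev
    set ψ : Primal → ZMod 2 := fun u => ray (finite_Ebar n m).toFinset (c + rowChain (-1) (2 * n + 3)) u.1
    have hψ : ∀ u, u ∉ B n m → ψ u = 0 := by
      intro u hu
      let w : Primal := mkP (2 * n + 2) 0 (by omega) rfl
      have hw : w ∉ B n m := by rw [mem_B]; simp [w]
      rw [primal_const_outside ψ (fun t ht => (cobP_eq_zero ψ t).1 ?_) hu hw]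
      · refine ray_far _ fun t ht => ?_
        rw [Set.Finite.mem_toFinset, mem_Ebar] at ht
        simp [w]; omega
      · rw [hcob t, hleaf t ht]
    refine ⟨fun u => bs u.1 * sgn (ψ u), fun u hu => by simp only [hψ u hu, sgn_zero, mul_one], ?_⟩
    rintro t ht u hu v hv
    by_cases huv : u = v
    · rw [huv]
    · have h1 := hcob t
      rw [cobP_eq ψ hu hv huv, Pi.add_apply, hc t (fun h => h.2 ht), zero_add,
        rowChain_eq (hbox t (hF ht)) (row_of_primal hu hv huv)] at h1
      exact mul_sgn_add _ _ _ _ h1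


/-! ### Counting spins and clusters -/

/-- Functions that vanish outside and are constant along the edges in `F`. -/
def CocP (n m : ℕ) (F : Set Tile) : Set (Primal → ZMod 2) :=
  {φ | (∀ i, i ∉ B n m → φ i = 0) ∧ ∀ t ∈ F, ∀ i ∈ edgeEnds t, ∀ j ∈ edgeEnds t, φ i = φ j}

/-- Functions that vanish outside and are constant along the dual edges in `F`. -/
def CocD (n m : ℕ) (F : Set Tile) : Set (Dual → ZMod 2) :=
  {φ | (∀ u, u ∉ B' n m → φ u = 0) ∧ ∀ t ∈ F, ∀ u ∈ dualEnds t, ∀ v ∈ dualEnds t, φ u = φ v}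

/-- Functions that are constant on the two parts of the outside and along the edges in `F`. -/
def SemiP (n m : ℕ) (F : Set Tile) : Set (Primal → ZMod 2) :=
  {φ | (∀ i j, i ∉ B n m → j ∉ B n m → (Upper i.1 ↔ Upper j.1) → φ i = φ j) ∧
    ∀ t ∈ F, ∀ i ∈ edgeEnds t, ∀ j ∈ edgeEnds t, φ i = φ j}

theorem sgn_spinDiff (a b : ℤˣ) : a * sgn (spinDiff b a) = b := by revert a b; decide

theorem spinDiff_mul_sgn (a : ℤˣ) (x : ZMod 2) : spinDiff (a * sgn x) a = x := by
  revert a x; decide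

theorem spinDiff_self (a : ℤˣ) : spinDiff a a = 0 := if_pos rfl

/-- Once nonempty, the set of spins is a torsor under the functions to ℤ/2 that vanish outside and
are constant along `F`. -/
theorem card_spinsP {n m : ℕ} {F : Set Tile} (h : (SpinsP n m F).Nonempty) :
    Nat.card (SpinsP n m F) = Nat.card (CocP n m F) := by
  obtain ⟨σ₀, h0, h0'⟩ := h
  refine Nat.card_congr ⟨fun σ => ⟨fun i => spinDiff (σ.1 i) (σ₀ i), fun i hi => ?_,
    fun t ht i hi j hj => ?_⟩, fun φ => ⟨fun i => σ₀ i * sgn (φ.1 i), fun i hi => ?_,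
    fun t ht i hi j hj => ?_⟩, fun σ => ?_, fun φ => ?_⟩
  · dsimp only; rw [σ.2.1 i hi, h0 i hi, spinDiff_self]
  · dsimp only; rw [σ.2.2 t ht i hi j hj, h0' t ht i hi j hj]
  · dsimp only; rw [φ.2.1 i hi, h0 i hi, sgn_zero, mul_one]
  · dsimp only; rw [φ.2.2 t ht i hi j hj, h0' t ht i hi j hj]
  · exact Subtype.ext (funext fun i => sgn_spinDiff _ _)
  · exact Subtype.ext (funext fun i => spinDiff_mul_sgn _ _)

theorem card_spinsD {n m : ℕ} {F : Set Tile} (h : (SpinsD n m F).Nonempty) :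
    Nat.card (SpinsD n m F) = Nat.card (CocD n m F) := by
  obtain ⟨σ₀, h0, h0'⟩ := h
  refine Nat.card_congr ⟨fun σ => ⟨fun i => spinDiff (σ.1 i) (σ₀ i), fun i hi => ?_,
    fun t ht i hi j hj => ?_⟩, fun φ => ⟨fun i => σ₀ i * sgn (φ.1 i), fun i hi => ?_,
    fun t ht i hi j hj => ?_⟩, fun σ => ?_, fun φ => ?_⟩
  · dsimp only; rw [σ.2.1 i hi, h0 i hi, spinDiff_self]
  · dsimp only; rw [σ.2.2 t ht i hi j hj, h0' t ht i hi j hj]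
  · dsimp only; rw [φ.2.1 i hi, h0 i hi, sgn_zero, mul_one]
  · dsimp only; rw [φ.2.2 t ht i hi j hj, h0' t ht i hi j hj]
  · exact Subtype.ext (funext fun i => sgn_spinDiff _ _)
  · exact Subtype.ext (funext fun i => spinDiff_mul_sgn _ _)

theorem midVertex_not_mem (n : ℕ) {m : ℕ} (up : Prop) [Decidable up] : midVertex m up ∉ B n m := by
  have h2 : (midVertex m up).1.2 = if up then 2 * (m : ℤ) + 2 else -(2 * m + 2) := rfl
  rw [mem_B]; split_ifs at h2 <;> omega

theorem upper_midVertex (m : ℕ) (up : Prop) [Decidable up] : Upper (midVertex m up).1 ↔ up := by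
  have h2 : (midVertex m up).1.2 = if up then 2 * (m : ℤ) + 2 else -(2 * m + 2) := rfl
  unfold Upper
  by_cases h : up
  · rw [if_pos h] at h2; exact ⟨fun _ => h, fun _ => by omega⟩
  · rw [if_neg h] at h2; exact ⟨fun _ => by omega, fun h' => absurd h' h⟩

theorem bs_eq_one (z : Pt) : bs z = 1 ↔ Upper z := by
  by_cases h : 0 ≤ z.2 <;> simp [bs, Upper, h]

/-- A spin configuration separates the two parts of the outside. Subtracting one constant where it
is plus and another where it is minus makes the function vanish outside; the two constants give the
factor 4. -/
theorem card_semiP {n m : ℕ} {F : Set Tile} (h : (SpinsP n m F).Nonempty) :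
    Nat.card (SemiP n m F) = 4 * Nat.card (CocP n m F) := by
  obtain ⟨σ₀, h0, h0'⟩ := h
  have hT : σ₀ (midVertex m True) = 1 := by
    rw [h0 _ (midVertex_not_mem n _), bs_eq_one, upper_midVertex]; trivial
  have hB : σ₀ (midVertex m False) ≠ 1 := by
    rw [h0 _ (midVertex_not_mem n _), Ne, bs_eq_one, upper_midVertex]; exact not_false
  have hcard : Nat.card (ZMod 2 × ZMod 2 × CocP n m F) = 4 * Nat.card (CocP n m F) := by
    rw [Nat.card_prod, Nat.card_prod, Nat.card_zmod]; ring
  rw [← hcard]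
  have hu : ∀ i, i ∉ B n m → (σ₀ i = 1 ↔ Upper i.1) := fun i hi => by rw [h0 i hi, bs_eq_one]
  refine Nat.card_congr ⟨fun φ => (φ.1 (midVertex m True), φ.1 (midVertex m False),
      ⟨fun i => φ.1 i + if σ₀ i = 1 then φ.1 (midVertex m True) else φ.1 (midVertex m False),
        fun i hi => ?_, fun t ht i hi j hj => ?_⟩),
    fun x => ⟨fun i => x.2.2.1 i + if σ₀ i = 1 then x.1 else x.2.1,
      fun i j hi hj hij => ?_, fun t ht i hi j hj => ?_⟩, fun φ => ?_, fun x => ?_⟩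
  · dsimp only
    by_cases h1 : σ₀ i = 1
    · rw [if_pos h1, φ.2.1 i (midVertex m True) hi (midVertex_not_mem n _), zmod2_add_self]
      rw [upper_midVertex, ← hu i hi]; simp [h1]
    · rw [if_neg h1, φ.2.1 i (midVertex m False) hi (midVertex_not_mem n _), zmod2_add_self]
      rw [upper_midVertex, ← hu i hi]; simp [h1]
  · dsimp only; rw [φ.2.2 t ht i hi j hj, h0' t ht i hi j hj]
  · dsimp only; rw [x.2.2.2.1 i hi, x.2.2.2.1 j hj]
    exact congrArg _ (if_congr (by rw [hu i hi, hu j hj, hij]) rfl rfl)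
  · dsimp only; rw [x.2.2.2.2 t ht i hi j hj, h0' t ht i hi j hj]
  · refine Subtype.ext (funext fun i => ?_)
    dsimp only
    rw [add_assoc, zmod2_add_self, add_zero]
  · have e1 := x.2.2.2.1 (midVertex m True) (midVertex_not_mem n _)
    have e2 := x.2.2.2.1 (midVertex m False) (midVertex_not_mem n _)
    dsimp only
    simp only [e1, e2, if_pos hT, if_neg hB, zero_add]
    refine Prod.ext rfl (Prod.ext rfl (Subtype.ext (funext fun i => ?_)))
    dsimp only
    rw [add_assoc, zmod2_add_self, add_zero]

/-- The dual vertices outside the box form one dual cluster, and the value on it accounts for the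
factor 2. -/
theorem card_dualFns_box {n m : ℕ} {F : Finset Tile} (hF : (F : Set Tile) ⊆ Ebar n m) :
    Nat.card (DualFns F) = 2 * Nat.card (CocD n m (Ebar n m \ F)) := by
  let w : Dual := mkD (2 * n + 3) 1 (by omega) rfl
  have hw : w ∉ B' n m := by rw [mem_B']; simp [w]
  have hcard : Nat.card (ZMod 2 × CocD n m (Ebar n m \ F)) =
      2 * Nat.card (CocD n m (Ebar n m \ F)) := by
    rw [Nat.card_prod, Nat.card_zmod]
  rw [← hcard]
  have hout : ∀ g : DualFns F, ∀ t, t ∉ Ebar n m → ∀ u ∈ dualEnds t, ∀ v ∈ dualEnds t, g.1 u = g.1 v :=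
    fun g t ht => g.2 t fun h => ht (hF h)
  refine Nat.card_congr ⟨fun g => (g.1 w, ⟨fun u => g.1 u + g.1 w, fun u hu => ?_,
    fun t ht u hu v hv => ?_⟩), fun x => ⟨fun u => x.2.1 u + x.1, fun t ht u hu v hv => ?_⟩,
    fun g => ?_, fun x => ?_⟩
  · dsimp only; rw [dual_const_outside g.1 (hout g) hu hw, zmod2_add_self]
  · dsimp only; rw [g.2 t ht.2 u hu v hv]
  · by_cases hE : t ∈ Ebar n m
    · dsimp only; rw [x.2.2.2 t ⟨hE, ht⟩ u hu v hv]
    · have h1 : ∀ u ∈ dualEnds t, x.2.1 u = 0 := fun u hu =>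
        x.2.2.1 u ((not_mem_B_of_tile hE (i := mkP 0 0 rfl rfl)).2 hu)
      dsimp only; rw [h1 u hu, h1 v hv]
  · refine Subtype.ext (funext fun i => ?_)
    dsimp only
    rw [add_assoc, zmod2_add_self, add_zero]
  · have e1 := x.2.2.1 w hw
    dsimp only
    simp only [e1, zero_add]
    refine Prod.ext rfl (Subtype.ext (funext fun i => ?_))
    dsimp only
    rw [add_assoc, zmod2_add_self, add_zero]

/-- Functions on the vertices of the box that are constant along the edges in `F`. -/
def BoxFns (n m : ℕ) (F : Set Tile) : Set (Vbar n m → ZMod 2) :=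
  {φ | ∀ t ∈ F, ∀ i j : Vbar n m, i.1 ∈ edgeEnds t → j.1 ∈ edgeEnds t → φ i = φ j}

/-- Euler's formula on the box. The factor 2 for the outer face cancels. -/
theorem card_boxFns {n m : ℕ} {F : Set Tile} (hF : F ⊆ Ebar n m) :
    Nat.card (BoxFns n m F) * 2 ^ F.ncard =
      Nat.card (CocD n m (Ebar n m \ F)) * 2 ^ (Vbar n m).ncard := by
  obtain ⟨F, rfl⟩ := ((finite_Ebar n m).subset hF).exists_finset_coe
  have h1 := euler (P := (finite_Vbar n m).toFinset) (F := F) fun t ht i hi => by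
    rw [Set.Finite.mem_toFinset]; exact ⟨t, hF ht, hi⟩
  rw [card_dualFns_box hF] at h1
  have h2 : Nat.card (PrimalFns (finite_Vbar n m).toFinset F) = Nat.card (BoxFns n m F) := by
    let e : (finite_Vbar n m).toFinset ≃ Vbar n m :=
      Equiv.subtypeEquivRight fun i => Set.Finite.mem_toFinset _
    refine Nat.card_congr ⟨fun φ => ⟨fun i => φ.1 (e.symm i), fun t ht i j hi hj =>
      φ.2 t ht _ _ hi hj⟩, fun φ => ⟨fun i => φ.1 (e i), fun t ht i j hi hj =>
      φ.2 t ht _ _ hi hj⟩, fun φ => rfl, fun φ => rfl⟩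
  rw [h2] at h1
  rw [Set.ncard_coe_finset, Set.ncard_eq_toFinset_card _ (finite_Vbar n m)]
  nlinarith

/-- Turns cluster counts into cardinalities of function spaces, so that clusters, loops and spins
can be compared by bijections. -/
theorem card_const_fns {V : Type*} (G : SimpleGraph V) [Finite G.ConnectedComponent] :
    Nat.card {f : V → ZMod 2 // ∀ x y, G.Adj x y → f x = f y} = 2 ^ Nat.card G.ConnectedComponent := by
  have hr : ∀ f : {f : V → ZMod 2 // ∀ x y, G.Adj x y → f x = f y}, ∀ x y, G.Reachable x y →
      f.1 x = f.1 y := fun f x y h =>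
    reachable_induction (P := fun y => f.1 x = f.1 y) h rfl fun y z hyz hy => hy.trans (f.2 y z hyz)
  have : Nat.card (G.ConnectedComponent → ZMod 2) = 2 ^ Nat.card G.ConnectedComponent := by
    rw [Nat.card_fun, Nat.card_zmod]
  rw [← this]
  refine Nat.card_congr ⟨fun f => SimpleGraph.ConnectedComponent.lift f.1
    fun v w p _ => hr f v w ⟨p⟩, fun g => ⟨fun v => g (G.connectedComponentMk v), fun x y h => ?_⟩,
    fun f => ?_, fun g => ?_⟩
  · exact congrArg g (SimpleGraph.ConnectedComponent.eq.2 h.reachable)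
  · rfl
  · funext C
    induction C using SimpleGraph.ConnectedComponent.ind with
    | h v => rfl

theorem openSet_subset {n m : ℕ} (a : BoxConfig n m) : openSet a ⊆ Ebar n m := fun _ ⟨h, _⟩ => h

theorem closedSet_eq {n m : ℕ} (a : BoxConfig n m) : closedSet a = Ebar n m \ openSet a := by
  ext t
  constructor
  · rintro ⟨h, h'⟩
    refine ⟨h, fun ⟨_, h''⟩ => ?_⟩
    rw [h'] at h''; simp at h''
  · rintro ⟨h, h'⟩
    refine ⟨h, ?_⟩
    by_contra hn
    exact h' ⟨h, by simpa using hn⟩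

theorem graphK_adj {n m : ℕ} (a : BoxConfig n m) (i j : Vbar n m) :
    (graphK a).Adj i j ↔ i ≠ j ∧ ∃ t ∈ openSet a, i.1 ∈ edgeEnds t ∧ j.1 ∈ edgeEnds t := by
  rw [graphK, SimpleGraph.comap_adj]
  refine exists_tile_of_adj.trans ?_
  exact and_congr_left fun _ => not_congr Subtype.ext_iff.symm

instance finite_Vbar_coe (n m : ℕ) : Finite (Vbar n m) := (finite_Vbar n m).to_subtype

theorem pow_card_graphK {n m : ℕ} (a : BoxConfig n m) :
    2 ^ Nat.card (graphK a).ConnectedComponent = Nat.card (BoxFns n m (openSet a)) := by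
  rw [← card_const_fns]
  refine Nat.card_congr (Equiv.subtypeEquivRight fun f => ?_)
  constructor
  · intro h t ht i j hi hj
    by_cases hij : i = j
    · rw [hij]
    · exact h i j ((graphK_adj a i j).2 ⟨hij, t, ht, hi, hj⟩)
  · intro h i j hij
    obtain ⟨-, t, ht, hi, hj⟩ := (graphK_adj a i j).1 hij
    exact h t ht i j hi hj

/-- The number of clusters in `K` for the configuration `a`. -/
theorem pow_card_graphK_mul {n m : ℕ} (a : BoxConfig n m) :
    2 ^ (Nat.card (graphK a).ConnectedComponent + (openSet a).ncard) =
      Nat.card (CocD n m (closedSet a)) * 2 ^ (Vbar n m).ncard := by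
  rw [pow_add, pow_card_graphK, card_boxFns (openSet_subset a), closedSet_eq]

theorem mem_inBoundary_iff {n m : ℕ} {i : Primal} (hi : i ∈ Vbar n m) :
    i ∈ inBoundary (Vbar n m) ↔ i ∉ B n m := by
  have := i.mod
  rw [mem_inBoundary_Vbar, mem_B]
  rw [mem_Vbar] at hi ⊢; omega

theorem midVertex_mem_Vbar (n : ℕ) {m : ℕ} (up : Prop) [Decidable up] : midVertex m up ∈ Vbar n m := by
  have h1 : (midVertex m up).1.1 = 0 := rfl
  have h2 : (midVertex m up).1.2 = if up then 2 * (m : ℤ) + 2 else -(2 * m + 2) := rfl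
  rw [mem_Vbar]; split_ifs at h2 <;> omega

open Classical in
-- A function on `Vbar` of this kind extends to the plane by its value at the mid vertex of the same
-- half plane, and the extension is forced.
theorem card_semi_restrict {n m : ℕ} {F : Set Tile} (hF : F ⊆ Ebar n m) :
    Nat.card {φ : Vbar n m → ZMod 2 // φ ∈ BoxFns n m F ∧ ∀ i j : Vbar n m, i.1 ∉ B n m →
      j.1 ∉ B n m → (Upper i.1.1 ↔ Upper j.1.1) → φ i = φ j} = Nat.card (SemiP n m F) := by
  have hVB : ∀ i, i ∉ Vbar n m → i ∉ B n m := fun i hi hB => hi (by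
    rw [mem_B] at hB; rw [mem_Vbar]; omega)
  let ext : (Vbar n m → ZMod 2) → Primal → ZMod 2 := fun φ i =>
    if h : i ∈ Vbar n m then φ ⟨i, h⟩ else φ ⟨midVertex m (Upper i.1), midVertex_mem_Vbar n _⟩
  have hext : ∀ φ : {φ : Vbar n m → ZMod 2 // φ ∈ BoxFns n m F ∧ ∀ i j : Vbar n m, i.1 ∉ B n m →
      j.1 ∉ B n m → (Upper i.1.1 ↔ Upper j.1.1) → φ i = φ j}, ∀ i, i ∉ B n m →
      ext φ.1 i = φ.1 ⟨midVertex m (Upper i.1), midVertex_mem_Vbar n _⟩ := by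
    intro φ i hi
    by_cases h : i ∈ Vbar n m
    · simp only [ext, dif_pos h]
      exact φ.2.2 ⟨i, h⟩ _ hi (midVertex_not_mem n _) (upper_midVertex m _).symm
    · simp only [ext, dif_neg h]
  refine Nat.card_congr ⟨fun φ => ⟨ext φ.1, fun i j hi hj hij => ?_, fun t ht i hi j hj => ?_⟩,
    fun φ => ⟨fun i => φ.1 i.1, fun t ht i j hi hj => φ.2.2 t ht i.1 hi j.1 hj,
      fun i j hi hj hij => φ.2.1 i.1 j.1 hi hj hij⟩, fun φ => ?_, fun φ => ?_⟩
  · rw [hext φ i hi, hext φ j hj]; simp only [hij]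
  · have hiV : i ∈ Vbar n m := ⟨t, hF ht, hi⟩
    have hjV : j ∈ Vbar n m := ⟨t, hF ht, hj⟩
    simp only [ext, dif_pos hiV, dif_pos hjV]
    exact φ.2.1 t ht _ _ hi hj
  · exact Subtype.ext (funext fun i => dif_pos i.2)
  · refine Subtype.ext (funext fun i => ?_)
    by_cases h : i ∈ Vbar n m
    · exact dif_pos h
    · refine (dif_neg h).trans ?_
      exact φ.2.1 _ _ (midVertex_not_mem n _) (hVB i h) (upper_midVertex m _)

/-- The number of clusters in `K¹`, if the two boundary vertices are not connected. -/
theorem pow_card_graphK1 {n m : ℕ} (b : BoxConfig n m) (h : (SpinsP n m (openSet b)).Nonempty) :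
    2 ^ Nat.card (graphK1 b).ConnectedComponent = 4 * Nat.card (CocP n m (openSet b)) := by
  rw [← card_semiP h, ← card_semi_restrict (openSet_subset b), ← card_const_fns]
  refine Nat.card_congr ⟨fun f => ⟨fun i => f.1 (Quot.mk _ i), fun t ht i j hi hj => ?_,
    fun i j hi hj hij => ?_⟩, fun φ => ⟨Quot.lift φ.1 fun i j hij => ?_, ?_⟩, fun f => ?_, fun φ => ?_⟩
  · by_cases hq : (Quot.mk (Identified n m) i) = Quot.mk (Identified n m) j
    · simp only [hq]
    · have hij : i ≠ j := fun h => hq (h ▸ rfl)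
      exact f.2 _ _ ((SimpleGraph.map_adj' _ _ _ _).2
        ⟨hq, i, j, (graphK_adj b i j).2 ⟨hij, t, ht, hi, hj⟩, rfl, rfl⟩)
  · exact congrArg f.1 (Quot.sound ⟨(mem_inBoundary_iff i.2).2 hi, (mem_inBoundary_iff j.2).2 hj, hij⟩)
  · exact φ.2.2 i j ((mem_inBoundary_iff i.2).1 hij.1) ((mem_inBoundary_iff j.2).1 hij.2.1) hij.2.2
  · intro x y hxy
    obtain ⟨-, i, j, hij, rfl, rfl⟩ := (SimpleGraph.map_adj' _ _ _ _).1 hxy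
    obtain ⟨-, t, ht, hi, hj⟩ := (graphK_adj b i j).1 hij
    exact φ.2.1 t ht i j hi hj
  · refine Subtype.ext (funext fun x => ?_)
    induction x using Quot.ind with
    | mk i => rfl
  · rfl

/-! ### The number of loops -/

/-- The open edges in the box. -/
def boxOpen (n m : ℕ) (ω : Config) : Set Tile := {t | t ∈ Ebar n m ∧ ω t = true}

/-- Edges off the box have both ends outside, where the functions vanish, so they impose no
condition. -/
theorem cocP_boxOpen (n m : ℕ) (ω : Config) : CocP n m (openEdges ω) = CocP n m (boxOpen n m ω) := by
  ext φ
  refine and_congr_right fun h0 => ⟨fun h t ht => h t ht.2, fun h t ht i hi j hj => ?_⟩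
  by_cases hE : t ∈ Ebar n m
  · exact h t ⟨hE, ht⟩ i hi j hj
  · have h1 : ∀ i ∈ edgeEnds t, φ i = 0 := fun i hi =>
      h0 i ((not_mem_B_of_tile hE (u := mkD 1 1 rfl rfl)).1 hi)
    rw [h1 i hi, h1 j hj]

theorem cocD_boxOpen (n m : ℕ) (ω : Config) :
    CocD n m {t | ω t = false} = CocD n m (Ebar n m \ boxOpen n m ω) := by
  ext φ
  refine and_congr_right fun h0 => ⟨fun h t ht => h t ?_, fun h t ht i hi j hj => ?_⟩
  · have := ht.2
    by_contra hn
    exact this ⟨ht.1, by simpa using hn⟩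
  · by_cases hE : t ∈ Ebar n m
    · refine h t ⟨hE, fun h' => ?_⟩ i hi j hj
      rw [Set.mem_ofPred_eq] at ht
      rw [boxOpen, Set.mem_ofPred_eq, ht] at h'; simp at h'
    · have h1 : ∀ i ∈ dualEnds t, φ i = 0 := fun i hi =>
        h0 i ((not_mem_B_of_tile hE (i := mkP 0 0 rfl rfl)).2 hi)
      rw [h1 i hi, h1 j hj]

theorem comp_iff {n m : ℕ} {ω : Config} {σ : Spins} : Comp n m ω σ ↔
    σ.1 ∈ SpinsP n m (openEdges ω) ∧ σ.2 ∈ SpinsD n m {t | ω t = false} :=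
  ⟨fun h => ⟨⟨h.1.1, h.2.1⟩, h.1.2, h.2.2⟩, fun h => ⟨⟨h.1.1, h.2.1⟩, h.1.2, h.2.2⟩⟩

/-- Both sides count the compatible pairs of spins: through the independent orientations of the
inner loops, and as independent choices of primal and dual spins. -/
theorem Dob.card_inner {n m : ℕ} {ω : Config} (hω : Dob n m ω) {σ₀ : Spins} (h₀ : Comp n m ω σ₀) :
    2 ^ {l | InnerLoop n m ω l}.ncard =
      Nat.card (CocP n m (openEdges ω)) * Nat.card (CocD n m {t | ω t = false}) := by
  classical
  rw [← card_spinsP ⟨_, (comp_iff.1 h₀).1⟩, ← card_spinsD ⟨_, (comp_iff.1 h₀).2⟩, ← Nat.card_prod]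
  have : Finite {l | InnerLoop n m ω l} := hω.finite_inner.to_subtype
  have h1 : Nat.card ({l | InnerLoop n m ω l} → Bool) = 2 ^ {l | InnerLoop n m ω l}.ncard := by
    rw [Nat.card_fun, Nat.card_eq_fintype_card, Fintype.card_bool]; rfl
  have h2 : Nat.card {σ // Comp n m ω σ} = Nat.card ({l | InnerLoop n m ω l} → Bool) := by
    refine Nat.card_congr (Equiv.ofBijective
      (fun σ : {σ // Comp n m ω σ} => fun l => decide (CwSpins σ.1 l.1)) ⟨?_, ?_⟩)
    · intro σ σ' h
      refine Subtype.ext (hω.comp_ext σ.2 σ'.2 fun l hl => ?_)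
      have := congrFun h ⟨l, hl⟩
      simpa using this
    · intro c
      obtain ⟨σ, hσ, hc⟩ := hω.exists_comp h₀
        (fun l => ∃ h : InnerLoop n m ω l, c ⟨l, h⟩ = true)
      refine ⟨⟨σ, hσ⟩, funext fun l => ?_⟩
      have := hc l.1 l.2
      rw [Bool.eq_iff_iff, decide_eq_true_iff, this]
      exact ⟨fun ⟨_, h⟩ => h, fun h => ⟨l.2, h⟩⟩
  rw [← h1, ← h2]
  refine Nat.card_congr ⟨fun σ => (⟨σ.1.1, (comp_iff.1 σ.2).1⟩, ⟨σ.1.2, (comp_iff.1 σ.2).2⟩),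
    fun x => ⟨(x.1.1, x.2.1), comp_iff.2 ⟨x.1.2, x.2.2⟩⟩, fun σ => rfl, fun x => rfl⟩

/-- Every cluster meets V, because all outer vertices of one half plane are joined to its mid
vertex. Functions that are constant on clusters are then those of `SemiP`. -/
theorem Dob.pow_kappaV {n m : ℕ} {ω : Config} (hω : Dob n m ω) {σ₀ : Spins} (h₀ : Comp n m ω σ₀) :
    2 ^ kappaV n m ω = 4 * Nat.card (CocP n m (openEdges ω)) := by
  classical
  have huniv : {C : (primalGraph (openEdges ω)).ConnectedComponent | ∃ i ∈ V n m,
      (primalGraph (openEdges ω)).connectedComponentMk i = C} = Set.univ := by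
    refine Set.eq_univ_of_forall fun C => ?_
    induction C using SimpleGraph.ConnectedComponent.ind with
    | h v =>
      by_cases hv : v ∈ B n m
      · exact ⟨v, Or.inl hv, rfl⟩
      · exact ⟨_, Or.inr (midVertex_mem n _).1,
          SimpleGraph.ConnectedComponent.eq.2 (hω.reachable_mid hv)⟩
  have hVfin : (V n m).Finite := by
    refine finite_primal (2 * n + 2) (2 * m + 2) ?_
    rintro i (hi | hi)
    · rw [mem_B] at hi; omega
    · rw [mem_exBoundary_B] at hi; omega
  have hfin : Finite (primalGraph (openEdges ω)).ConnectedComponent := by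
    rw [← Set.finite_univ_iff, ← huniv]
    exact hVfin.image _
  rw [kappaV, huniv, Set.ncard_univ, ← card_const_fns, ← card_semiP ⟨_, (comp_iff.1 h₀).1⟩]
  refine Nat.card_congr (Equiv.subtypeEquivRight fun f => ?_)
  constructor
  · intro h
    have hr : ∀ x y, (primalGraph (openEdges ω)).Reachable x y → f x = f y := fun x y hxy =>
      reachable_induction (P := fun y => f x = f y) hxy rfl fun y z hyz hy => hy.trans (h y z hyz)
    refine ⟨fun i j hi hj hij => ?_, fun t ht i hi j hj => hr i j (reachable_open ht hi hj)⟩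
    rw [← hr _ _ (hω.reachable_mid hi), ← hr _ _ (hω.reachable_mid hj)]
    simp only [hij]
  · intro h i j hij
    obtain ⟨-, t, ht, hi, hj⟩ := exists_tile_of_adj.1 hij
    exact h.2 t ht i hi j hj

/-- The open boundary edges already connect the outer layer of `Vbar` within each half plane, so
constancy on its two parts holds without any edges outside the box. -/
theorem Dob.boxFns_eq {n m : ℕ} {ω : Config} (hω : Dob n m ω) {σ₀ : Spins} (h₀ : Comp n m ω σ₀) :
    Nat.card (BoxFns n m (boxOpen n m ω)) = 4 * Nat.card (CocP n m (openEdges ω)) := by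
  have hne : (SpinsP n m (boxOpen n m ω)).Nonempty :=
    ⟨σ₀.1, (comp_iff.1 h₀).1.1, fun t ht => (comp_iff.1 h₀).1.2 t ht.2⟩
  rw [cocP_boxOpen, ← card_semiP hne, ← card_semi_restrict fun t ht => ht.1]
  refine Nat.card_congr (Equiv.subtypeEquivRight fun φ => ?_)
  refine ⟨fun h => ⟨h, ?_⟩, fun h => h.1⟩
  classical
  let ψ : Primal → ZMod 2 := fun i => if h : i ∈ Vbar n m then φ ⟨i, h⟩ else 0
  have hEq : ∀ t ∈ Ebar n m, t ∉ E n m → t.1.2 ≠ -1 → ∀ a ∈ edgeEnds t, ∀ b ∈ edgeEnds t,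
      ψ a = ψ b := by
    intro t ht hE h1 a ha b hb
    have haV : a ∈ Vbar n m := ⟨t, ht, ha⟩
    have hbV : b ∈ Vbar n m := ⟨t, ht, hb⟩
    simp only [ψ, dif_pos haV, dif_pos hbV]
    exact h t ⟨ht, (hω t hE).2 h1⟩ _ _ ha hb
  have key : ∀ j : Vbar n m, j.1 ∉ B n m → φ j = ψ (midVertex m (Upper j.1.1)) := by
    rintro ⟨j, hjV⟩ hj
    have hjm := j.mod
    have hψ : φ ⟨j, hjV⟩ = ψ j := by simp only [ψ, dif_pos hjV]
    rw [hψ]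
    rw [mem_B] at hj
    rw [mem_Vbar] at hjV
    dsimp only at hj ⊢
    let j' : Primal := mkP j.1.1 (if Upper j.1 then 2 * m + 2 else -(2 * m + 2))
      hjm.1 (by split_ifs <;> omega)
    have hj1 : j'.1.1 = j.1.1 := rfl
    have hj2 : j'.1.2 = if 0 ≤ j.1.2 then 2 * (m : ℤ) + 2 else -(2 * m + 2) :=
      if_congr Iff.rfl rfl rfl
    have hk2 : (midVertex m (Upper j.1)).1.2 = if 0 ≤ j.1.2 then 2 * (m : ℤ) + 2 else -(2 * m + 2) :=
      if_congr Iff.rfl rfl rfl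
    have hk1 : (midVertex m (Upper j.1)).1.1 = 0 := rfl
    have h1 : ψ j = ψ j' := by
      rcases le_total j.1.2 j'.1.2 with hle | hle
      · refine primal_col_const ψ rfl hle fun t h1 h2 h3 a ha b hb => hEq t ?_ ?_ ?_ a ha b hb
        · rw [mem_Ebar]; split_ifs at hj2 <;> omega
        · rw [mem_E]; split_ifs at hj2 <;> omega
        · split_ifs at hj2 <;> omega
      · refine (primal_col_const ψ (i := j') (j := j) rfl hle
          fun t h1 h2 h3 a ha b hb => hEq t ?_ ?_ ?_ a ha b hb).symm
        · rw [mem_Ebar]; split_ifs at hj2 <;> omega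
        · rw [mem_E]; split_ifs at hj2 <;> omega
        · split_ifs at hj2 <;> omega
    rw [h1]
    generalize midVertex m (Upper j.1) = k at *
    have hrow : j'.1.2 = k.1.2 := hj2.trans hk2.symm
    rcases le_total j'.1.1 k.1.1 with hle | hle
    · refine primal_row_const ψ (i := j') (j := k)
        hrow hle fun t h1 h2 h3 a ha b hb => hEq t ?_ ?_ ?_ a ha b hb
      · rw [mem_Ebar]; split_ifs at hj2 <;> omega
      · rw [mem_E]; split_ifs at hj2 <;> omega
      · split_ifs at hj2 <;> omega
    · refine (primal_row_const ψ (i := k) (j := j')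
        hrow.symm hle fun t h1 h2 h3 a ha b hb => hEq t ?_ ?_ ?_ a ha b hb).symm
      · rw [mem_Ebar]; split_ifs at hj2 <;> omega
      · rw [mem_E]; split_ifs at hj2 <;> omega
      · split_ifs at hj2 <;> omega
  intro i j hi hj hij
  rw [key i hi, key j hj]
  simp only [hij]

/-- The open tiles of `Ē` that are determined by the boundary condition. -/
def frame (n m : ℕ) : Set Tile := {t | t ∈ Ebar n m ∧ t ∉ E n m ∧ t.1.2 ≠ -1}

/-- The exponent of `√q` in the weight of FK-percolation is the number of inner loops, up to a
constant. -/
theorem Dob.kappaV_eq {n m : ℕ} {ω : Config} (hω : Dob n m ω) {σ₀ : Spins} (h₀ : Comp n m ω σ₀) :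
    2 * kappaV n m ω + {t ∈ E n m | ω t = true}.ncard + (frame n m).ncard =
      {l | InnerLoop n m ω l}.ncard + (Vbar n m).ncard + 2 := by
  have h1 := hω.pow_kappaV h₀
  have h2 := hω.card_inner h₀
  have h3 := card_boxFns (F := boxOpen n m ω) fun t ht => ht.1
  have h4 := hω.boxFns_eq h₀
  rw [h4, ← cocD_boxOpen] at h3
  have hsplit : boxOpen n m ω = {t ∈ E n m | ω t = true} ∪ frame n m := by
    ext t
    have hEE : t ∈ E n m → t ∈ Ebar n m := Or.inl
    by_cases hE : t ∈ E n m
    · exact ⟨fun h => Or.inl ⟨hE, h.2⟩, fun h => ⟨hEE hE, h.elim (fun h => h.2) fun h => absurd hE h.2.1⟩⟩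
    · exact ⟨fun h => Or.inr ⟨h.1, hE, (hω t hE).1 h.2⟩,
        fun h => h.elim (fun h => absurd h.1 hE) fun h => ⟨h.1, (hω t hE).2 h.2.2⟩⟩
  have hcard : (boxOpen n m ω).ncard = {t ∈ E n m | ω t = true}.ncard + (frame n m).ncard := by
    rw [hsplit]
    refine Set.ncard_union_eq ?_ ((finite_E n m).subset fun t ht => ht.1)
      ((finite_Ebar n m).subset fun t ht => ht.1)
    exact Set.disjoint_left.2 fun t h h' => h'.2.1 h.1
  refine Nat.pow_right_injective le_rfl ?_
  dsimp only
  rw [add_assoc, ← hcard, pow_add, pow_add, pow_add, mul_comm 2, pow_mul, h1, h2]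
  -- One factor 4·|`CocP`| is kept, and the other one is exchanged for |`CocD`| by Euler's formula
  -- in the box; the product |`CocP`|·|`CocD`| counts loop orientations.
  calc _ = (4 * Nat.card (CocP n m (openEdges ω))) *
      ((4 * Nat.card (CocP n m (openEdges ω))) * 2 ^ (boxOpen n m ω).ncard) := by ring
    _ = _ := by rw [h3]; ring


/-! ### Local weights -/

theorem crosses_mkArc_primal {t : Tile} {i : Primal} {u : Dual} (hi : IsCorner t i.1)
    (hu : IsCorner t u.1) : Crosses (mkArc t i.1 hi) i u := ⟨hi, hu, Or.inl rfl⟩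

theorem crosses_mkArc_dual {t : Tile} {i : Primal} {u : Dual} (hi : IsCorner t i.1)
    (hu : IsCorner t u.1) : Crosses (mkArc t u.1 hu) i u := ⟨hi, hu, Or.inr rfl⟩

theorem mkArc_mem_primal {ω : Config} {t : Tile} {i : Primal} (hi : IsCorner t i.1) :
    mkArc t i.1 hi ∈ arcs ω ↔ ω t = false :=
  mem_arcs_primal (a := mkArc t i.1 hi) (i := i) rfl

theorem mkArc_mem_dual {ω : Config} {t : Tile} {u : Dual} (hu : IsCorner t u.1) :
    mkArc t u.1 hu ∈ arcs ω ↔ ω t = true :=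
  mem_arcs_dual (a := mkArc t u.1 hu) (u := u) rfl

theorem Compat.turn_primal {ω : Config} {σ : Spins} (hσ : Compat ω σ) {t : Tile} (ht : ω t = false)
    {i : Primal} {u : Dual} (hi : IsCorner t i.1) (hu : IsCorner t u.1) :
    turn σ (mkArc t i.1 hi) = if σ.1 i = σ.2 u then -1 else 1 := by
  rw [turn, if_congr (hσ.spinOrient_iff ((mkArc_mem_primal hi).2 ht) (crosses_mkArc_primal hi hu))
    rfl rfl]
  have : ¬ (mkArc t i.1 hi).corner = u.1 := Primal.ne_dual i u
  by_cases h : σ.1 i = σ.2 u <;> simp [this, h]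

theorem Compat.turn_dual {ω : Config} {σ : Spins} (hσ : Compat ω σ) {t : Tile} (ht : ω t = true)
    {i : Primal} {u : Dual} (hi : IsCorner t i.1) (hu : IsCorner t u.1) :
    turn σ (mkArc t u.1 hu) = if σ.1 i = σ.2 u then 1 else -1 := by
  rw [turn, if_congr (hσ.spinOrient_iff ((mkArc_mem_dual hu).2 ht) (crosses_mkArc_dual hi hu))
    rfl rfl]
  have : (mkArc t u.1 hu).corner = u.1 := rfl
  by_cases h : σ.1 i = σ.2 u <;> simp [this, h]

theorem mkArc_mem_boxArcs_primal {n m : ℕ} {ω : Config} {t : Tile} (ht : t ∈ Ebar n m) {i : Primal}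
    (hi : IsCorner t i.1) : mkArc t i.1 hi ∈ boxArcs n m ω ↔ ω t = false := by
  rw [← mkArc_mem_primal hi]
  exact ⟨fun h => h.1, fun h => ⟨h, ht, fun u hu => absurd hu (Primal.ne_dual i u)⟩⟩

theorem mkArc_mem_boxArcs_dual {n m : ℕ} {ω : Config} {t : Tile} (ht : t ∈ Ebar n m) {u : Dual}
    (hu : IsCorner t u.1) : mkArc t u.1 hu ∈ boxArcs n m ω ↔ ω t = true ∧ u ∈ B' n m := by
  rw [← mkArc_mem_dual hu]
  exact ⟨fun h => ⟨h.1, h.2.2 u rfl⟩, fun h => ⟨h.1, ht, fun v hv => by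
    rw [← show u = v from Subtype.ext hv]; exact h.2⟩⟩

theorem agreePrimal_iff {σ : Primal → ℤˣ} {t : Tile} {i j : Primal} (hi : i ∈ edgeEnds t)
    (hj : j ∈ edgeEnds t) (hall : ∀ k ∈ edgeEnds t, k = i ∨ k = j) :
    AgreePrimal σ {t} ↔ σ i = σ j := by
  refine ⟨fun h => h t rfl i hi j hj, ?_⟩
  rintro h _ rfl k hk l hl
  rcases hall k hk with rfl | rfl <;> rcases hall l hl with rfl | rfl <;> first | rfl | exact h | exact h.symm

theorem agreeDual_iff {σ : Dual → ℤˣ} {t : Tile} {i j : Dual} (hi : i ∈ dualEnds t)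
    (hj : j ∈ dualEnds t) (hall : ∀ k ∈ dualEnds t, k = i ∨ k = j) :
    AgreeDual σ {t} ↔ σ i = σ j := by
  refine ⟨fun h => h t rfl i hi j hj, ?_⟩
  rintro h _ rfl k hk l hl
  rcases hall k hk with rfl | rfl <;> rcases hall l hl with rfl | rfl <;> first | rfl | exact h | exact h.symm

/-- A primal and a dual corner of the tile have the same spin. -/
def Aligned (σ : Spins) (t : Tile) : Prop := ∃ i ∈ edgeEnds t, ∃ u ∈ dualEnds t, σ.1 i = σ.2 u

open Classical in
/-- The sum of the turns in a tile in the bulk. -/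
def tileTurn (σ : Spins) (t : Tile) (b : Bool) : ℤ :=
  if AgreePrimal σ.1 {t} ∧ AgreeDual σ.2 {t} then (if Aligned σ t ↔ b = true then 2 else -2) else 0

theorem units_eq_or (a b c : ℤˣ) (h : b ≠ c) : (a = b ∧ a ≠ c) ∨ (a ≠ b ∧ a = c) := by
  revert a b c; decide

open Classical in
-- If both pairs of spins agree, the two arcs of the tile turn the same way, to a side given by the
-- alignment and the state of the edge. If one pair disagrees, they turn opposite ways and cancel.
theorem Compat.sum_turn_bulk {n m : ℕ} {ω : Config} {σ : Spins} (hσ : Compat ω σ) {t : Tile}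
    (ht : t ∈ E n m) {L : Finset Arc} (hL : ∀ a, a ∈ L ↔ a ∈ boxArcs n m ω) :
    ∑ a ∈ L with a.tile = t, turn σ a = tileTurn σ t (ω t) := by
  obtain ⟨i, j, hi, hj, hij, hP, -⟩ := exists_edgeEnds t
  obtain ⟨u, v, hu, hv, huv, hD, -⟩ := exists_dualEnds t
  have hE : t ∈ Ebar n m := Or.inl ht
  rw [sum_arcs_of_tile _ hi hj hij hu hv huv hP hD]
  simp only [hL]
  rw [if_congr (mkArc_mem_boxArcs_primal hE hi) rfl rfl,
    if_congr (mkArc_mem_boxArcs_primal hE hj) rfl rfl,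
    if_congr (mkArc_mem_boxArcs_dual hE hu) rfl rfl,
    if_congr (mkArc_mem_boxArcs_dual hE hv) rfl rfl]
  have hpa := agreePrimal_iff (σ := σ.1) hi hj hP
  have hda := agreeDual_iff (σ := σ.2) hu hv hD
  have hal : σ.1 i = σ.1 j → σ.2 u = σ.2 v → (Aligned σ t ↔ σ.1 i = σ.2 u) := by
    intro h1 h2
    refine ⟨?_, fun h => ⟨i, hi, u, hu, h⟩⟩
    rintro ⟨k, hk, l, hl, h⟩
    rcases hP k hk with rfl | rfl <;> rcases hD l hl with rfl | rfl <;> simp_all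
  rw [tileTurn]
  cases hb : ω t
  · have h2 : σ.2 u = σ.2 v := hσ.2 t hb u hu v hv
    rw [hσ.turn_primal hb hi hu, hσ.turn_primal hb hj hu]
    by_cases h1 : σ.1 i = σ.1 j
    · rw [if_pos (c := _ ∧ _) ⟨hpa.2 h1, hda.2 h2⟩, hal h1 h2, ← h1]
      by_cases h3 : σ.1 i = σ.2 u <;> simp [h3]
    · rw [if_neg (c := _ ∧ _) fun h => h1 (hpa.1 h.1)]
      rcases units_eq_or (σ.2 u) _ _ h1 with h | h
      · simp [h.1.symm, Ne.symm h.2]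
      · simp [h.2.symm, Ne.symm h.1]
  · have h1 : σ.1 i = σ.1 j := hσ.1 t hb i hi j hj
    rw [hσ.turn_dual hb hi hu, hσ.turn_dual hb hi hv]
    have hu' := mem_B'_of_E ht hu
    have hv' := mem_B'_of_E ht hv
    by_cases h2 : σ.2 u = σ.2 v
    · rw [if_pos (c := AgreePrimal _ _ ∧ _) ⟨hpa.2 h1, hda.2 h2⟩, hal h1 h2, ← h2]
      by_cases h3 : σ.1 i = σ.2 u <;> simp [h3, hu', hv']
    · rw [if_neg (c := AgreePrimal _ _ ∧ _) fun h => h2 (hda.1 h.2)]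
      rcases units_eq_or (σ.1 i) _ _ h2 with h | h
      · simp [h.1, h2, hu', hv']
      · simp [h.2, Ne.symm h2, hu', hv']

/-- At a boundary tile, exactly one corner is in the domain. -/
theorem bdry_tile {n m : ℕ} {t : Tile} (ht : t ∈ Eb n m) : (∀ i ∈ edgeEnds t, i ∉ B n m) ∧
    ∃ u v : Dual, u ∈ dualEnds t ∧ v ∈ dualEnds t ∧ u ≠ v ∧ (∀ k ∈ dualEnds t, k = u ∨ k = v) ∧
      u ∈ B' n m ∧ v ∉ B' n m ∧ (t.1.2 ≠ -1 → ∀ i ∈ edgeEnds t, bs i.1 = bs v.1) := by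
  rw [mem_Eb] at ht
  refine ⟨fun i hi hB => ht.2 ⟨i, hi, hB⟩, ?_⟩
  obtain ⟨h1, h2⟩ := ht
  rw [mem_Ebar] at h1
  rw [mem_E] at h2
  have htm := t.mod
  have hbs : ∀ v ∈ dualEnds t, v ∉ B' n m → (t.1.2 ≠ -1 → ∀ i ∈ edgeEnds t, bs i.1 = bs v.1) := by
    intro v hv hv' h3 i hi
    have := i.mod; have := v.mod
    rw [mem_edgeEnds, isCorner_iff] at hi
    rw [mem_dualEnds, isCorner_iff] at hv
    rw [mem_B'] at hv'
    rw [bs_eq_iff]; omega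
  obtain ⟨u, v, hu, hv, huv, hD, hc⟩ := exists_dualEnds t
  by_cases hB : u ∈ B' n m
  · have hv' : v ∉ B' n m := by rw [mem_B'] at hB ⊢; omega
    exact ⟨u, v, hu, hv, huv, hD, hB, hv', hbs v hv hv'⟩
  · have hv' : v ∈ B' n m := by rw [mem_B'] at hB ⊢; omega
    exact ⟨v, u, hv, hu, huv.symm, fun k hk => (hD k hk).symm, hv', hB, hbs u hu hB⟩

theorem bdry_agreePrimal {n m : ℕ} {σ : Spins} (hσ : BdSpins n m σ) {t : Tile} (ht : t ∈ Eb n m) :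
    AgreePrimal σ.1 {t} ↔ t.1.2 ≠ -1 := by
  obtain ⟨i, j, hi, hj, hij, hP, -⟩ := exists_edgeEnds t
  rw [agreePrimal_iff hi hj hP, ← row_of_primal hi hj hij,
    hσ.1 i ((bdry_tile ht).1 i hi), hσ.1 j ((bdry_tile ht).1 j hj)]

open Classical in
-- In row -1 the tile is closed with different primal spins, and its two arcs cancel. Elsewhere it
-- is open, and only the arc around the dual corner in `B'` is counted; it turns right exactly if
-- this corner has the boundary sign.
theorem Dob.sum_turn_bdry {n m : ℕ} {ω : Config} (hω : Dob n m ω) {σ : Spins} (hσ : Comp n m ω σ)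
    {t : Tile} (ht : t ∈ Eb n m) {L : Finset Arc} (hL : ∀ a, a ∈ L ↔ a ∈ boxArcs n m ω) :
    ∑ a ∈ L with a.tile = t, turn σ a =
      if t.1.2 = -1 then 0 else if AgreeDual σ.2 {t} then 1 else -1 := by
  obtain ⟨i, j, hi, hj, hij, hP, -⟩ := exists_edgeEnds t
  obtain ⟨hB, u, v, hu, hv, huv, hD, hu', hv', hbs⟩ := bdry_tile ht
  have hE : t ∈ Ebar n m := Or.inr ht
  have hb := hω t ((mem_Eb n m t).1 ht).2
  rw [sum_arcs_of_tile _ hi hj hij hu hv huv hP hD]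
  simp only [hL]
  rw [if_congr (mkArc_mem_boxArcs_primal hE hi) rfl rfl,
    if_congr (mkArc_mem_boxArcs_primal hE hj) rfl rfl,
    if_congr (mkArc_mem_boxArcs_dual hE hu) rfl rfl,
    if_congr (mkArc_mem_boxArcs_dual hE hv) rfl rfl]
  have hda := agreeDual_iff (σ := σ.2) hu hv hD
  by_cases h : t.1.2 = -1
  · have hb' : ω t = false := by simpa [h] using hb
    have h1 : ¬ σ.1 i = σ.1 j := fun h' =>
      ((bdry_agreePrimal hσ.1 ht).1 ((agreePrimal_iff hi hj hP).2 h')) h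
    rw [hσ.2.turn_primal hb' hi hu, hσ.2.turn_primal hb' hj hu, if_pos h]
    rcases units_eq_or (σ.2 u) _ _ h1 with h | h
    · simp [h.1.symm, Ne.symm h.2, hb']
    · simp [h.2.symm, Ne.symm h.1, hb']
  · have hb' : ω t = true := hb.2 h
    rw [hσ.2.turn_dual hb' hi hu, if_neg h, if_congr hda rfl rfl, hσ.1.1 i (hB i hi), hbs h i hi,
      ← hσ.1.2 v hv']
    simp only [hb', hu', hv', eq_comm (a := σ.2 v)]
    simp

open Classical in
/-- The weight of the state `b` of an edge in the bulk. -/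
def bulkFactor (lam : ℝ) (σ : Spins) (t : Tile) (b : Bool) : ℝ :=
  if (b = true → AgreePrimal σ.1 {t}) ∧ (b = false → AgreeDual σ.2 {t}) then
    Real.exp (lam / 4 * (tileTurn σ t b : ℤ)) else 0

open Classical in
/-- The weight of a boundary edge. -/
def bdryFactor (lam : ℝ) (σ : Spins) (t : Tile) : ℝ :=
  if t.1.2 = -1 then (if AgreeDual σ.2 {t} then 1 else 0)
  else Real.exp (lam / 4 * (if AgreeDual σ.2 {t} then 1 else -1))

/-- The edges of `E` as a finite set. -/
def bulkTiles (n m : ℕ) : Finset Tile := (finite_E n m).toFinset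

theorem finite_Eb (n m : ℕ) : (Eb n m).Finite := (finite_Ebar n m).subset fun _ => Or.inr

/-- The boundary edges as a finite set. -/
def bdryTiles (n m : ℕ) : Finset Tile := (finite_Eb n m).toFinset

theorem mem_bulkTiles {n m : ℕ} {t : Tile} : t ∈ bulkTiles n m ↔ t ∈ E n m := Set.Finite.mem_toFinset _

theorem mem_bdryTiles {n m : ℕ} {t : Tile} : t ∈ bdryTiles n m ↔ t ∈ Eb n m := Set.Finite.mem_toFinset _

theorem disjoint_tiles (n m : ℕ) : Disjoint (bulkTiles n m) (bdryTiles n m) := by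
  rw [Finset.disjoint_left]
  intro t h h'
  rw [mem_bulkTiles] at h
  rw [mem_bdryTiles, mem_Eb] at h'
  exact h'.2 h

open Classical in
/-- The joint weight of the configuration and the spins is a product of local weights. -/
theorem Dob.prod_factors {n m : ℕ} {ω : Config} (hω : Dob n m ω) {σ : Spins} (hσ : BdSpins n m σ)
    (lam : ℝ) :
    (if Comp n m ω σ then Real.exp (lam / 4 * (∑ᶠ a ∈ boxArcs n m ω, turn σ a : ℤ)) else 0) =
      (∏ t ∈ bulkTiles n m, bulkFactor lam σ t (ω t)) * ∏ t ∈ bdryTiles n m, bdryFactor lam σ t := by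
  by_cases hc : Comp n m ω σ
  · rw [if_pos hc]
    set L := (finite_boxArcs n m ω).toFinset with hLdef
    have hL : ∀ a, a ∈ L ↔ a ∈ boxArcs n m ω := fun a => Set.Finite.mem_toFinset _
    have h1 : ∑ᶠ a ∈ boxArcs n m ω, turn σ a = ∑ t ∈ bulkTiles n m, tileTurn σ t (ω t) +
        ∑ t ∈ bdryTiles n m,
          (if t.1.2 = -1 then 0 else if AgreeDual σ.2 {t} then 1 else -1 : ℤ) := by
      rw [finsum_mem_eq_finite_toFinset_sum _ (finite_boxArcs n m ω), ← hLdef,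
        ← Finset.sum_fiberwise_of_maps_to (t := bulkTiles n m ∪ bdryTiles n m) (g := Arc.tile),
        Finset.sum_union (disjoint_tiles n m)]
      · congr 1
        · exact Finset.sum_congr rfl fun t ht => hc.2.sum_turn_bulk (mem_bulkTiles.1 ht) hL
        · exact Finset.sum_congr rfl fun t ht => hω.sum_turn_bdry hc (mem_bdryTiles.1 ht) hL
      · intro a ha
        rw [Finset.mem_union, mem_bulkTiles, mem_bdryTiles]
        exact ((hL a).1 ha).2.1
    rw [h1]
    push_cast
    rw [mul_add, Real.exp_add, Finset.mul_sum, Finset.mul_sum, Real.exp_sum, Real.exp_sum]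
    congr 1
    · refine Finset.prod_congr rfl fun t ht => ?_
      rw [bulkFactor, if_pos]
      exact ⟨fun hb s hs => by rw [hs]; exact hc.2.1 t hb, fun hb s hs => by rw [hs]; exact hc.2.2 t hb⟩
    · refine Finset.prod_congr rfl fun t ht => ?_
      rw [bdryFactor]
      by_cases h : t.1.2 = -1
      · have hb : ω t = false := by
          have := hω t ((mem_Eb n m t).1 (mem_bdryTiles.1 ht)).2
          simpa [h] using this
        have hd : AgreeDual σ.2 {t} := fun s hs => by rw [hs]; exact hc.2.2 t hb
        rw [if_pos h, if_pos h, if_pos hd, mul_zero, Real.exp_zero]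
      · rw [if_neg h, if_neg h]
  · rw [if_neg hc]
    -- If the spins are not compatible with `ω`, some local factor must vanish; for tiles off the
    -- box compatibility follows from the boundary condition alone.
    symm
    by_contra hne
    have hne' := mul_ne_zero_iff.1 hne
    rw [Finset.prod_ne_zero_iff, Finset.prod_ne_zero_iff] at hne'
    refine hc ⟨hσ, ?_, ?_⟩
    · intro t ht i hi j hj
      by_cases hE : t ∈ E n m
      · have := hne'.1 t (mem_bulkTiles.2 hE)
        rw [bulkFactor] at this
        by_contra hx
        rw [if_neg (fun h => hx (h.1 ht t rfl i hi j hj))] at this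
        exact this rfl
      · by_cases hij : i = j
        · rw [hij]
        · rw [hσ.1 i fun h => hE ⟨i, hi, h⟩, hσ.1 j fun h => hE ⟨j, hj, h⟩, row_of_primal hi hj hij]
          exact (hω t hE).1 ht
    · intro t ht u hu v hv
      by_cases hE : t ∈ E n m
      · have := hne'.1 t (mem_bulkTiles.2 hE)
        rw [bulkFactor] at this
        by_contra hx
        rw [if_neg (fun h => hx (h.2 ht t rfl u hu v hv))] at this
        exact this rfl
      · have hrow : t.1.2 = -1 := by
          have := hω t hE
          rw [ht] at this
          simpa using this
        by_cases hb : t ∈ Eb n m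
        · have := hne'.2 t (mem_bdryTiles.2 hb)
          rw [bdryFactor, if_pos hrow] at this
          by_contra hx
          rw [if_neg (fun h => hx (h t rfl u hu v hv))] at this
          exact this rfl
        · have hE' : t ∉ Ebar n m := fun h => h.elim hE hb
          by_cases huv : u = v
          · rw [huv]
          · rw [hσ.2 u ((not_mem_B_of_tile hE' (i := mkP 0 0 rfl rfl)).2 hu),
              hσ.2 v ((not_mem_B_of_tile hE' (i := mkP 0 0 rfl rfl)).2 hv),
              row_of_dual hu hv huv]
            omega


/-! ### The local sampling rule -/

/-- Puts the thresholds 1/c and 2/c of the local rule into [0, 1] and makes c - 2 positive. -/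
theorem cBulk_gt {lam : ℝ} (hlam : 0 < lam) : 2 < cBulk lam := by
  have h1 : Real.exp (lam / 2) * Real.exp (-lam / 2) = 1 := by
    rw [← Real.exp_add]; simp [neg_div]
  have h2 : 1 < Real.exp (lam / 2) := Real.one_lt_exp_iff.2 (by linarith)
  have h3 := Real.exp_pos (-lam / 2)
  rw [cBulk]
  nlinarith [mul_pos (sub_pos.2 h2) (sub_pos.2 h2)]

theorem cBdry_gt {lam : ℝ} (hlam : 0 < lam) : 1 < cBdry lam :=
  Real.one_lt_exp_iff.2 (by linarith)

open Classical in
/-- The distribution of the states of an edge under the local sampling rule. -/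
def ruleProb (n m : ℕ) (lam : ℝ) (σ : Spins) (t : Tile) (w : Bool × Bool) : ℝ :=
  if ¬ AgreeDual σ.2 {t} then (if w = (true, true) then 1 else 0)
  else if ¬ AgreePrimal σ.1 {t} then (if w = (false, false) then 1 else 0)
  else if t ∈ E n m then
    if w = (true, true) then 1 / cBulk lam else if w = (false, false) then 1 / cBulk lam
    else if w = (false, true) then 1 - 2 / cBulk lam else 0
  else
    if w = (true, true) then 1 / cBdry lam else if w = (false, false) then 1 - 1 / cBdry lam else 0

theorem volume_setOf_lt {a : ℝ} (h0 : 0 ≤ a) (h1 : a ≤ 1) :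
    volume {x : unitInterval | (x : ℝ) < a} = ENNReal.ofReal a := by
  exact unitInterval.volume_Iio ⟨a, h0, h1⟩

theorem volume_setOf_ge {a : ℝ} (h0 : 0 ≤ a) (h1 : a ≤ 1) :
    volume {x : unitInterval | ¬ (x : ℝ) < a} = ENNReal.ofReal (1 - a) := by
  simp only [not_lt]
  exact unitInterval.volume_Ici ⟨a, h0, h1⟩

theorem volume_setOf_between {a b : ℝ} (h0 : 0 ≤ a) (hab : a ≤ b) (h1 : b ≤ 1) :
    volume {x : unitInterval | ¬ (x : ℝ) < a ∧ (x : ℝ) < b} = ENNReal.ofReal (b - a) := by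
  simp only [not_lt]
  exact unitInterval.volume_Ico ⟨a, h0, hab.trans h1⟩ ⟨b, h0.trans hab, h1⟩

theorem measurableSet_localRule (n m : ℕ) (lam : ℝ) (σ : Spins) (t : Tile) (w : Bool × Bool) :
    MeasurableSet {x | localRule n m lam σ t x = w} := by
  have hm : Measurable (localRule n m lam σ t) := by
    unfold localRule
    have h : ∀ a : ℝ, MeasurableSet {x : unitInterval | (x : ℝ) < a} := fun a =>
      measurableSet_lt measurable_subtype_coe measurable_const
    refine Measurable.ite (.const _) measurable_const (Measurable.ite (.const _) measurable_const
      (Measurable.ite (.const _) (Measurable.ite (h _) measurable_const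
        (Measurable.ite (h _) measurable_const measurable_const))
        (Measurable.ite (h _) measurable_const measurable_const)))
  exact hm (measurableSet_singleton w)

theorem volume_localRule {n m : ℕ} {lam : ℝ} (hlam : 0 < lam) (σ : Spins) (t : Tile)
    (w : Bool × Bool) :
    volume {x | localRule n m lam σ t x = w} = ENNReal.ofReal (ruleProb n m lam σ t w) := by
  classical
  have hc := cBulk_gt hlam
  have hb := cBdry_gt hlam
  have hconst : ∀ v : Bool × Bool, volume {x : unitInterval | v = w} =
      ENNReal.ofReal (if w = v then 1 else 0) := by
    intro v
    by_cases h : w = v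
    · simp [h]
    · simp [h, Ne.symm h]
  unfold localRule ruleProb
  by_cases hd : AgreeDual σ.2 {t}
  swap
  · simp only [hd, not_false_eq_true, if_true]; exact hconst _
  by_cases hp : AgreePrimal σ.1 {t}
  swap
  · simp only [hd, hp, not_true_eq_false, not_false_eq_true, if_true, if_false]; exact hconst _
  simp only [hd, hp, not_true_eq_false, if_false, innerA_eq]
  have c1 : 1 / cBulk lam ≤ 2 / cBulk lam := by gcongr; norm_num
  have c2 : 2 / cBulk lam ≤ 1 := by rw [div_le_one (by linarith)]; linarith
  have c0 : 0 ≤ 1 / cBulk lam := by positivity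
  have b0 : 0 ≤ 1 / cBdry lam := by positivity
  have b1 : 1 / cBdry lam ≤ 1 := by rw [div_le_one (by linarith)]; linarith
  by_cases hE : t ∈ E n m
  · simp only [hE, if_true]
    have key : ∀ x : unitInterval, (if (x : ℝ) < 1 / cBulk lam then (true, true)
        else if (x : ℝ) < 2 / cBulk lam then (false, false) else (false, true)) = w ↔
        (w = (true, true) ∧ (x : ℝ) < 1 / cBulk lam) ∨
        (w = (false, false) ∧ (¬ (x : ℝ) < 1 / cBulk lam ∧ (x : ℝ) < 2 / cBulk lam)) ∨
        (w = (false, true) ∧ ¬ (x : ℝ) < 2 / cBulk lam) := by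
      intro x
      by_cases h1 : (x : ℝ) < 1 / cBulk lam
      · have h2 : (x : ℝ) < 2 / cBulk lam := h1.trans_le c1
        simp only [h1, h2, if_true]; simp [eq_comm]
      · by_cases h2 : (x : ℝ) < 2 / cBulk lam
        · simp only [h1, h2, if_true, if_false]; simp [eq_comm]
        · simp only [h1, h2, if_false]; simp [eq_comm]
    simp only [key]
    rcases w with ⟨_ | _, _ | _⟩
    · simp only [Prod.mk.injEq, Bool.false_eq_true, and_self, and_false, false_and, true_and,
        false_or, or_false, if_false, if_true]
      rw [volume_setOf_between c0 c1 c2]; congr 1; ring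
    · simp only [Prod.mk.injEq, Bool.false_eq_true, and_false, false_and, true_and,
        false_or, if_false, if_true, reduceCtorEq, and_true]
      exact volume_setOf_ge (c0.trans c1) c2
    · simp
    · simp only [Prod.mk.injEq, and_self, false_and, true_and,
        or_false, if_true, reduceCtorEq]
      exact volume_setOf_lt c0 (c1.trans c2)
  · simp only [hE, if_false]
    have key : ∀ x : unitInterval, (if (x : ℝ) < 1 / cBdry lam then (true, true)
        else (false, false)) = w ↔
        (w = (true, true) ∧ (x : ℝ) < 1 / cBdry lam) ∨
        (w = (false, false) ∧ ¬ (x : ℝ) < 1 / cBdry lam) := by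
      intro x
      by_cases h1 : (x : ℝ) < 1 / cBdry lam
      · simp only [h1, if_true]; simp [eq_comm]
      · simp only [h1, if_false]; simp [eq_comm]
    simp only [key]
    rcases w with ⟨_ | _, _ | _⟩
    · simp only [Prod.mk.injEq, Bool.false_eq_true, and_self, false_and, true_and,
        false_or, if_false, if_true]
      exact volume_setOf_ge b0 b1
    · simp
    · simp
    · simp only [Prod.mk.injEq, and_self, false_and, true_and,
        or_false, if_true, reduceCtorEq]
      exact volume_setOf_lt b0 b1

theorem ruleProb_nonneg {lam : ℝ} (hlam : 0 < lam) (n m : ℕ) (σ : Spins) (t : Tile)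
    (w : Bool × Bool) : 0 ≤ ruleProb n m lam σ t w := by
  have hc := cBulk_gt hlam
  have hb := cBdry_gt hlam
  have c2 : 2 / cBulk lam ≤ 1 := by rw [div_le_one (by linarith)]; linarith
  have b1 : 1 / cBdry lam ≤ 1 := by rw [div_le_one (by linarith)]; linarith
  have c0 : 0 ≤ 1 / cBulk lam := by positivity
  have b0 : 0 ≤ 1 / cBdry lam := by positivity
  unfold ruleProb
  split_ifs <;> linarith

/-- The weight in the modified ATRC measure of a state of an edge in the bulk. -/
def bulkWeight (lam : ℝ) (w : Bool × Bool) : ℝ :=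
  if w.1 = w.2 then 1 else if w = (false, true) then cBulk lam - 2 else 0

/-- The weight in the modified ATRC measure of a state of a boundary edge. -/
def bdryWeight (lam : ℝ) (w : Bool × Bool) : ℝ :=
  if w = (true, true) then 1 else if w = (false, false) then cBdry lam - 1 else 0

/-- The normalisation at a boundary edge. -/
def bdryConst (lam : ℝ) (t : Tile) : ℝ :=
  if t.1.2 = -1 then 1 / (cBdry lam - 1) else Real.exp (lam / 4) / cBdry lam

/-- The spins are constant along open edges and along the duals of closed edges. -/
def TileOK (σ : Spins) (t : Tile) (w : Bool × Bool) : Prop :=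
  (w.2 = true → AgreePrimal σ.1 {t}) ∧ (w.1 = false → AgreeDual σ.2 {t})

/-- The two states weigh e^{λ/2} and e^{-λ/2}, in an order that depends on the alignment; the sum
does not. -/
theorem bulkFactor_sum (lam : ℝ) (σ : Spins) (t : Tile)
    (hp : AgreePrimal σ.1 {t}) (hd : AgreeDual σ.2 {t}) :
    bulkFactor lam σ t true + bulkFactor lam σ t false = cBulk lam := by
  classical
  simp only [bulkFactor, hp, hd, tileTurn, cBulk]
  by_cases h : Aligned σ t
  · simp [h]
    congr 2 <;> ring
  · simp [h]
    rw [add_comm]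
    congr 2 <;> ring

open Classical in
-- Summing out the edge of `ω` leaves the six-vertex weight c, 1 or 0, and the local rule splits it
-- into the ATRC weights 1, 1 and c - 2. If just one pair of spins disagrees, a single state is
-- left.
theorem bulk_mul_ruleProb {n m : ℕ} {lam : ℝ} (hlam : 0 < lam) (σ : Spins) {t : Tile}
    (ht : t ∈ E n m) (w : Bool × Bool) :
    (bulkFactor lam σ t true + bulkFactor lam σ t false) * ruleProb n m lam σ t w =
      bulkWeight lam w * if TileOK σ t w then 1 else 0 := by
  have hc : cBulk lam ≠ 0 := by linarith [cBulk_gt hlam]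
  by_cases hp : AgreePrimal σ.1 {t} <;> by_cases hd : AgreeDual σ.2 {t}
  · rw [bulkFactor_sum lam σ t hp hd]
    rcases w with ⟨_ | _, _ | _⟩ <;> simp [ruleProb, bulkWeight, TileOK, hp, hd, ht] <;> field_simp
  · rcases w with ⟨_ | _, _ | _⟩ <;>
      simp [ruleProb, bulkWeight, TileOK, hp, hd, bulkFactor, tileTurn]
  · rcases w with ⟨_ | _, _ | _⟩ <;>
      simp [ruleProb, bulkWeight, TileOK, hp, hd, bulkFactor, tileTurn]
  · rcases w with ⟨_ | _, _ | _⟩ <;>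
      simp [ruleProb, bulkWeight, TileOK, hp, hd, bulkFactor]

open Classical in
-- Off row -1 the constant is e^{λ/4}/c_b, common to all spins. In row -1 the primal spins differ,
-- the state is forced to be (0,0), and the constant only cancels its weight c_b - 1.
theorem bdry_mul_ruleProb {n m : ℕ} {lam : ℝ} (hlam : 0 < lam) {σ : Spins} (hσ : BdSpins n m σ)
    {t : Tile} (ht : t ∈ Eb n m) (w : Bool × Bool) :
    bdryFactor lam σ t * ruleProb n m lam σ t w =
      bdryConst lam t * bdryWeight lam w * if TileOK σ t w then 1 else 0 := by
  have hb := cBdry_gt hlam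
  have hb0 : cBdry lam ≠ 0 := by linarith
  have hb1 : cBdry lam - 1 ≠ 0 := by linarith
  have hpi := bdry_agreePrimal hσ ht
  have hE := ((mem_Eb n m t).1 ht).2
  by_cases hr : t.1.2 = -1
  · have hp : ¬ AgreePrimal σ.1 {t} := fun h => hpi.1 h hr
    by_cases hd : AgreeDual σ.2 {t} <;> rcases w with ⟨_ | _, _ | _⟩ <;>
      simp [ruleProb, bdryWeight, bdryConst, TileOK, hp, hd, bdryFactor, hr, hb1]
  · have hp : AgreePrimal σ.1 {t} := hpi.2 hr
    -- The choice c_b = e^{λ/2} is made for this identity: disagreeing dual spins weigh as much as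
    -- agreeing ones followed by the state (1,1).
    have he : Real.exp (-(lam / 4)) = Real.exp (lam / 4) / cBdry lam := by
      rw [cBdry, ← Real.exp_sub]; congr 1; ring
    by_cases hd : AgreeDual σ.2 {t}
    · rcases w with ⟨_ | _, _ | _⟩ <;>
        simp [ruleProb, bdryWeight, bdryConst, TileOK, hp, hd, bdryFactor, hr, hE] <;> field_simp
    · rcases w with ⟨_ | _, _ | _⟩ <;>
        simp [ruleProb, bdryWeight, bdryConst, TileOK, hp, hd, bdryFactor, hr, he]


/-! ### Summation over the configurations and the spins -/

/-- The configurations that satisfy the boundary conditions. -/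
abbrev DobConfig (n m : ℕ) : Type := {ω : Config // Dob n m ω}

/-- The spins that satisfy the boundary conditions. -/
abbrev BoxSpins (n m : ℕ) : Type := {σ : Spins // BdSpins n m σ}

open Classical in
/-- A configuration is given by its restriction to `E`. -/
def dobEquiv (n m : ℕ) : DobConfig n m ≃ (bulkTiles n m → Bool) where
  toFun ω t := ω.1 t.1
  invFun η := ⟨fun t => if h : t ∈ bulkTiles n m then η ⟨t, h⟩ else decide (t.1.2 ≠ -1),
    fun t ht => by
      dsimp only; rw [dif_neg (mt mem_bulkTiles.1 ht), decide_eq_true_iff]⟩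
  left_inv ω := by
    refine Subtype.ext (funext fun t => ?_)
    dsimp only
    split_ifs with h
    · rfl
    · rw [Bool.eq_iff_iff, decide_eq_true_iff]
      exact (ω.2 t (mt mem_bulkTiles.2 h)).symm
  right_inv η := funext fun t => dif_pos t.2

instance (n m : ℕ) : Finite (DobConfig n m) := Finite.of_equiv _ (dobEquiv n m).symm

instance (n m : ℕ) : Finite (BoxSpins n m) := by
  have h1 : Finite (B n m) := (finite_B n m).to_subtype
  have h2 : Finite (B' n m) := (finite_B' n m).to_subtype
  refine Finite.of_injective (β := (B n m → ℤˣ) × (B' n m → ℤˣ))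
    (fun σ => (fun i => σ.1.1 i, fun u => σ.1.2 u)) fun σ τ h => ?_
  rw [Prod.mk.injEq] at h
  refine Subtype.ext (Prod.ext (funext fun i => ?_) (funext fun u => ?_))
  · by_cases hi : i ∈ B n m
    · exact congrFun h.1 ⟨i, hi⟩
    · rw [σ.2.1 i hi, τ.2.1 i hi]
  · by_cases hu : u ∈ B' n m
    · exact congrFun h.2 ⟨u, hu⟩
    · rw [σ.2.2 u hu, τ.2.2 u hu]

instance (n m : ℕ) : Fintype (DobConfig n m) := Fintype.ofFinite _

instance (n m : ℕ) : Fintype (BoxSpins n m) := Fintype.ofFinite _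

instance finite_Ebar_coe (n m : ℕ) : Finite (Ebar n m) := (finite_Ebar n m).to_subtype

theorem sum_dobConfig (n m : ℕ) (f : Tile → Bool → ℝ) :
    ∑ ω : DobConfig n m, ∏ t ∈ bulkTiles n m, f t (ω.1 t) =
      ∏ t ∈ bulkTiles n m, (f t true + f t false) := by
  classical
  rw [← Finset.prod_coe_sort]
  have h1 : ∀ t : bulkTiles n m, f t.1 true + f t.1 false = ∑ b : Bool, f t.1 b := fun t => by simp
  rw [Finset.prod_congr rfl fun t _ => h1 t, Finset.prod_univ_sum, Fintype.piFinset_univ]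
  refine Fintype.sum_equiv (dobEquiv n m) _ _ fun ω => ?_
  rw [← Finset.prod_coe_sort]
  rfl

open Classical in
/-- The state of an edge. -/
def stateAt {n m : ℕ} (w : BoxConfig n m × BoxConfig n m) (t : Tile) : Bool × Bool :=
  (decide (t ∈ openSet w.1), decide (t ∈ openSet w.2))

theorem forall_tileOK {n m : ℕ} {w : BoxConfig n m × BoxConfig n m} {σ : Spins} (hσ : BdSpins n m σ) :
    ((∀ t ∈ bulkTiles n m, TileOK σ t (stateAt w t)) ∧ ∀ t ∈ bdryTiles n m, TileOK σ t (stateAt w t)) ↔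
      σ.1 ∈ SpinsP n m (openSet w.2) ∧ σ.2 ∈ SpinsD n m (closedSet w.1) := by
  have h1 : ((∀ t ∈ bulkTiles n m, TileOK σ t (stateAt w t)) ∧
      ∀ t ∈ bdryTiles n m, TileOK σ t (stateAt w t)) ↔ ∀ t ∈ Ebar n m, TileOK σ t (stateAt w t) := by
    constructor
    · rintro ⟨h, h'⟩ t (ht | ht)
      · exact h t (mem_bulkTiles.2 ht)
      · exact h' t (mem_bdryTiles.2 ht)
    · exact fun h => ⟨fun t ht => h t (Or.inl (mem_bulkTiles.1 ht)),
        fun t ht => h t (Or.inr (mem_bdryTiles.1 ht))⟩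
  rw [h1]
  constructor
  · intro h
    refine ⟨⟨hσ.1, fun t ht => (h t (openSet_subset _ ht)).1 (by simp [stateAt, ht]) t rfl⟩,
      hσ.2, fun t ht => ?_⟩
    rw [closedSet_eq] at ht
    exact (h t ht.1).2 (by simp [stateAt, ht.2]) t rfl
  · intro h t ht
    refine ⟨fun hw s hs => ?_, fun hw s hs => ?_⟩
    · rw [hs]; exact h.1.2 t (by simpa [stateAt] using hw)
    · rw [hs]; exact h.2.2 t (by rw [closedSet_eq]; exact ⟨ht, by simpa [stateAt] using hw⟩)

open Classical in
theorem card_boxSpins {n m : ℕ} (F F' : Set Tile) :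
    ∑ σ : BoxSpins n m, (if σ.1.1 ∈ SpinsP n m F ∧ σ.1.2 ∈ SpinsD n m F' then (1 : ℝ) else 0) =
      Nat.card (SpinsP n m F) * Nat.card (SpinsD n m F') := by
  rw [Finset.sum_boole, ← Nat.cast_mul, ← Nat.card_prod, ← Fintype.card_subtype, ← Nat.card_eq_fintype_card]
  congr 1
  exact Nat.card_congr ⟨fun σ => (⟨σ.1.1.1, σ.2.1⟩, ⟨σ.1.1.2, σ.2.2⟩),
    fun x => ⟨⟨(x.1.1, x.2.1), x.1.2.1, x.2.2.1⟩, x.1.2, x.2.2⟩, fun σ => rfl, fun x => rfl⟩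

/-- The product of the local weights of the modified ATRC measure. -/
def stateWeight {n m : ℕ} (lam : ℝ) (w : BoxConfig n m × BoxConfig n m) : ℝ :=
  (∏ t ∈ bulkTiles n m, bulkWeight lam (stateAt w t)) *
    ∏ t ∈ bdryTiles n m, bdryWeight lam (stateAt w t)

/-- The distribution of the states under the local sampling rule. -/
def sampleProb {n m : ℕ} (lam : ℝ) (σ : Spins) (w : BoxConfig n m × BoxConfig n m) : ℝ :=
  (∏ t ∈ bulkTiles n m, ruleProb n m lam σ t (stateAt w t)) *
    ∏ t ∈ bdryTiles n m, ruleProb n m lam σ t (stateAt w t)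

open Classical in
-- For fixed spins the sum over ω factorises over tiles. Multiplied by the sampling probabilities it
-- gives the ATRC factors times a consistency indicator, and the sum over spins counts the
-- consistent ones.
theorem sum_joint_weight {n m : ℕ} {lam : ℝ} (hlam : 0 < lam) (w : BoxConfig n m × BoxConfig n m) :
    ∑ ω : DobConfig n m, ∑ σ : BoxSpins n m,
      (if Comp n m ω.1 σ.1 then Real.exp (lam / 4 * (∑ᶠ a ∈ boxArcs n m ω.1, turn σ.1 a : ℤ)) else 0) *
        sampleProb lam σ.1 w =
      (∏ t ∈ bdryTiles n m, bdryConst lam t) * (stateWeight lam w *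
        (Nat.card (SpinsP n m (openSet w.2)) * Nat.card (SpinsD n m (closedSet w.1)))) := by
  rw [Finset.sum_comm, ← card_boxSpins, Finset.mul_sum, Finset.mul_sum]
  refine Finset.sum_congr rfl fun σ _ => ?_
  rw [← Finset.sum_mul, Finset.sum_congr rfl fun ω _ => ω.2.prod_factors σ.2 lam, ← Finset.sum_mul,
    sum_dobConfig n m fun t b => bulkFactor lam σ.1 t b, sampleProb, stateWeight]
  calc _ = (∏ t ∈ bulkTiles n m, (bulkFactor lam σ.1 t true + bulkFactor lam σ.1 t false) *
          ruleProb n m lam σ.1 t (stateAt w t)) *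
        ∏ t ∈ bdryTiles n m, bdryFactor lam σ.1 t * ruleProb n m lam σ.1 t (stateAt w t) := by
          rw [Finset.prod_mul_distrib, Finset.prod_mul_distrib]; ring
    _ = ((∏ t ∈ bulkTiles n m, bulkWeight lam (stateAt w t)) *
          ∏ t ∈ bulkTiles n m, if TileOK σ.1 t (stateAt w t) then (1 : ℝ) else 0) *
        ((∏ t ∈ bdryTiles n m, bdryConst lam t) *
          (∏ t ∈ bdryTiles n m, bdryWeight lam (stateAt w t)) *
          ∏ t ∈ bdryTiles n m, if TileOK σ.1 t (stateAt w t) then (1 : ℝ) else 0) := by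
      rw [← Finset.prod_mul_distrib, ← Finset.prod_mul_distrib, ← Finset.prod_mul_distrib]
      congr 1
      · exact Finset.prod_congr rfl fun t ht => bulk_mul_ruleProb hlam σ.1 (mem_bulkTiles.1 ht) _
      · exact Finset.prod_congr rfl fun t ht => bdry_mul_ruleProb hlam σ.2 (mem_bdryTiles.1 ht) _
    _ = _ := by
      rw [Finset.prod_boole, Finset.prod_boole, ← if_congr (forall_tileOK σ.2) rfl rfl]
      by_cases h1 : ∀ t ∈ bulkTiles n m, TileOK σ.1 t (stateAt w t)
      · by_cases h2 : ∀ t ∈ bdryTiles n m, TileOK σ.1 t (stateAt w t)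
        · rw [if_pos h1, if_pos h2, if_pos ⟨h1, h2⟩]; ring
        · rw [if_neg h2, if_neg (c := _ ∧ _) fun h => h2 h.2]; ring
      · rw [if_neg h1, if_neg (c := _ ∧ _) fun h => h1 h.1]; ring

theorem stateWeight_eq_zero {n m : ℕ} (lam : ℝ) {w : BoxConfig n m × BoxConfig n m}
    (h : ¬ (openSet w.1 ⊆ openSet w.2 ∧ openSet w.2 \ openSet w.1 ⊆ E n m)) :
    stateWeight lam w = 0 := by
  by_contra hne
  rw [stateWeight] at hne
  have hne' := mul_ne_zero_iff.1 hne
  rw [Finset.prod_ne_zero_iff, Finset.prod_ne_zero_iff] at hne'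
  refine h ⟨fun t ht => ?_, fun t ht => ?_⟩
  · by_contra h2
    have hs : stateAt w t = (true, false) := by simp [stateAt, ht, h2]
    rcases openSet_subset _ ht with hE | hE
    · exact hne'.1 t (mem_bulkTiles.2 hE) (by simp [hs, bulkWeight])
    · exact hne'.2 t (mem_bdryTiles.2 hE) (by simp [hs, bdryWeight])
  · have hs : stateAt w t = (false, true) := by simp [stateAt, ht.1, ht.2]
    rcases openSet_subset _ ht.1 with hE | hE
    · exact hE
    · exact absurd (by simp [hs, bdryWeight]) (hne'.2 t (mem_bdryTiles.2 hE))

theorem prod_ite_ncard {T : Finset Tile} {S : Set Tile} (hS : S ⊆ T) (c : ℝ) (f : Tile → ℝ)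
    (h1 : ∀ t ∈ T, t ∈ S → f t = c) (h2 : ∀ t ∈ T, t ∉ S → f t = 1) :
    ∏ t ∈ T, f t = c ^ S.ncard := by
  classical
  have : ∏ t ∈ T, f t = ∏ t ∈ T, if t ∈ S then c else 1 := Finset.prod_congr rfl fun t ht => by
    by_cases h : t ∈ S
    · rw [if_pos h, h1 t ht h]
    · rw [if_neg h, h2 t ht h]
  rw [this, Finset.prod_ite, Finset.prod_const, Finset.prod_const_one, mul_one]
  congr 1
  rw [← Set.ncard_coe_finset]
  congr 1
  ext t
  simp only [Finset.coe_filter, Set.mem_ofPred_eq]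
  exact ⟨fun h => h.2, fun h => ⟨hS h, h⟩⟩

/-- States (1,1) and bulk states (0,0) have weight 1, so only the edges of the difference and the
boundary edges that are closed in `w.1` are visible. -/
theorem stateWeight_eq {n m : ℕ} (lam : ℝ) {w : BoxConfig n m × BoxConfig n m}
    (h : openSet w.1 ⊆ openSet w.2) (h' : openSet w.2 \ openSet w.1 ⊆ E n m) :
    stateWeight lam w = (cBulk lam - 2) ^ (openSet w.2 \ openSet w.1).ncard *
      (cBdry lam - 1) ^ (Eb n m \ openSet w.1).ncard := by
  rw [stateWeight]
  congr 1
  · refine prod_ite_ncard (fun t ht => mem_bulkTiles.2 (h' ht)) _ _ (fun t _ ht => ?_) fun t _ ht => ?_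
    · simp [bulkWeight, stateAt, ht.1, ht.2]
    · have : t ∈ openSet w.1 ↔ t ∈ openSet w.2 :=
        ⟨fun h1 => h h1, fun h1 => by by_contra h2; exact ht ⟨h1, h2⟩⟩
      simp [bulkWeight, stateAt, this]
  · refine prod_ite_ncard (fun t ht => mem_bdryTiles.2 ht.1) _ _ (fun t hT ht => ?_) fun t hT ht => ?_
    · have : t ∉ openSet w.2 := fun h1 =>
        ((mem_Eb n m t).1 ht.1).2 (h' ⟨h1, ht.2⟩)
      simp [bdryWeight, stateAt, ht.2, this]
    · have h1 : t ∈ openSet w.1 := by by_contra h2; exact ht ⟨mem_bdryTiles.1 hT, h2⟩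
      simp [bdryWeight, stateAt, h1, h h1]

theorem nonempty_of_card {X : Type*} {S : Set X} (h : (Nat.card S : ℝ) ≠ 0) : S.Nonempty := by
  by_contra h'
  rw [Set.not_nonempty_iff_eq_empty] at h'
  subst h'
  simp at h

/-- The constant that relates the weights. -/
def atrcConst (n m : ℕ) (lam : ℝ) : ℝ := 4 * 2 ^ (Vbar n m).ncard / (cBdry lam - 1) ^ (Eb n m).ncard

open Classical in
/-- The weights of the modified ATRC measure, on the event that both crossings exist. -/
theorem indicator_mATRCWeight {n m : ℕ} {lam : ℝ} (hlam : 0 < lam)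
    (w : BoxConfig n m × BoxConfig n m) :
    (Crossings n m).indicator (mATRCWeight n m lam) w =
      ENNReal.ofReal (atrcConst n m lam * (stateWeight lam w *
        (Nat.card (SpinsP n m (openSet w.2)) * Nat.card (SpinsD n m (closedSet w.1))))) := by
  have hD := spinsD_nonempty_iff (openSet_subset w.1)
  have hP := spinsP_nonempty_iff (openSet_subset w.2)
  rw [← closedSet_eq] at hD hP
  by_cases hC : w ∈ Crossings n m
  swap
  · rw [Set.indicator_of_notMem hC]
    -- Off the crossing event one of the two sets of spins is empty, so the right-hand side vanishes
    -- as the indicator does.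
    have : (Nat.card (SpinsP n m (openSet w.2)) * Nat.card (SpinsD n m (closedSet w.1)) : ℝ) = 0 := by
      by_contra hne
      have := mul_ne_zero_iff.1 hne
      exact hC ⟨hD.1 (nonempty_of_card this.2), hP.1 (nonempty_of_card this.1)⟩
    rw [this]; simp
  rw [Set.indicator_of_mem hC]
  rw [mATRCWeight]
  by_cases hs : openSet w.1 ⊆ openSet w.2 ∧ openSet w.2 \ openSet w.1 ⊆ E n m
  swap
  · rw [if_neg hs, stateWeight_eq_zero lam hs]; simp
  rw [if_pos hs, stateWeight_eq lam hs.1 hs.2]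
  congr 1
  have hb : cBdry lam - 1 ≠ 0 := by linarith [cBdry_gt hlam]
  have hPn := hP.2 hC.2
  have hDn := hD.2 hC.1
  have e1 := pow_card_graphK_mul w.1
  have e2 := pow_card_graphK1 w.2 hPn
  rw [← card_spinsD hDn] at e1
  rw [← card_spinsP hPn] at e2
  have e1' : (2 : ℝ) ^ Nat.card (graphK w.1).ConnectedComponent * 2 ^ (openSet w.1).ncard =
      Nat.card (SpinsD n m (closedSet w.1)) * 2 ^ (Vbar n m).ncard := by
    rw [← pow_add]; exact_mod_cast e1
  have e2' : (2 : ℝ) ^ Nat.card (graphK1 w.2).ConnectedComponent =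
      4 * Nat.card (SpinsP n m (openSet w.2)) := by exact_mod_cast e2
  have hfin : (openSet w.1).Finite := (finite_Ebar n m).subset (openSet_subset _)
  have e3 : (openSet w.1 ∩ E n m).ncard + (openSet w.1 ∩ Eb n m).ncard = (openSet w.1).ncard := by
    rw [← Set.ncard_union_eq _ (hfin.inter_of_left _) (hfin.inter_of_left _),
      ← Set.inter_union_distrib_left]
    · congr 1; exact Set.inter_eq_left.2 (openSet_subset w.1)
    · rw [Set.disjoint_left]
      exact fun t ht ht' => ((mem_Eb n m t).1 ht'.2).2 ht.2
  have e4 : (openSet w.1 ∩ Eb n m).ncard + (Eb n m \ openSet w.1).ncard = (Eb n m).ncard := by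
    rw [Set.inter_comm]; exact Set.ncard_inter_add_ncard_sdiff_eq_ncard _ _ (finite_Eb n m)
  -- The powers of 2 attached to open edges combine with the clusters of K to the number of dual
  -- spins, and 1/(c_b - 1) per open boundary edge becomes c_b - 1 per closed one after division by
  -- a constant.
  rw [atrcConst, ← e4, pow_add (cBdry lam - 1), pow_add, e2', div_pow]
  rw [← e3, pow_add] at e1'
  field_simp
  linear_combination Nat.card (SpinsP n m (openSet w.2)) *
    (cBulk lam - 2) ^ (openSet w.2 \ openSet w.1).ncard * e1'


/-! ### Discrete measures -/

/-- Reduces the sum over all of `α`, which is uncountable for configurations on the plane, to a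
countable index set that carries the weight. -/
theorem gibbs_of_range {α ι : Type*} [MeasurableSpace α] [Countable ι] {e : ι → α}
    (he : Function.Injective e) {w : α → ℝ≥0∞} (hw : ∀ a, a ∉ Set.range e → w a = 0) :
    gibbs w = (∑' i, w (e i))⁻¹ • Measure.sum fun i => w (e i) • Measure.dirac (e i) := by
  rw [gibbs]
  congr 1
  · congr 1
    refine (he.tsum_eq ?_).symm
    intro a ha
    by_contra h
    exact ha (hw a h)
  · ext s hs
    rw [Measure.sum_apply _ hs, Measure.sum_apply _ hs]
    refine (he.tsum_eq (f := fun a => (w a • Measure.dirac a) s) ?_).symm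
    intro a ha
    by_contra h
    exact ha (by simp [hw a h])

/-- The constant absorbs both the partition function and the probability of the event; neither is
ever computed. -/
theorem cond_gibbs_of_range {α ι : Type*} [MeasurableSpace α] [MeasurableSingletonClass α]
    [Countable ι] {e : ι → α} (he : Function.Injective e) {w : α → ℝ≥0∞}
    (hw : ∀ a, a ∉ Set.range e → w a = 0) (s : Set α) :
    ∃ c : ℝ≥0∞, ProbabilityTheory.cond (gibbs w) s =
      c • Measure.sum fun i => s.indicator w (e i) • Measure.dirac (e i) := by
  classical
  refine ⟨(gibbs w s)⁻¹ * (∑' i, w (e i))⁻¹, ?_⟩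
  rw [ProbabilityTheory.cond, mul_smul]
  congr 1
  rw [gibbs_of_range he hw, Measure.restrict_smul, Measure.restrict_sum_of_countable]
  congr 2
  funext i
  rw [Measure.restrict_smul, restrict_dirac]
  by_cases h : e i ∈ s
  · rw [if_pos h, Set.indicator_of_mem h]
  · rw [if_neg h, Set.indicator_of_notMem h, smul_zero, zero_smul]

theorem isProbabilityMeasure_cond_gibbs {α ι : Type*} [MeasurableSpace α]
    [MeasurableSingletonClass α] [Finite ι] {e : ι → α} (he : Function.Injective e) {w : α → ℝ≥0∞}
    (hw : ∀ a, a ∉ Set.range e → w a = 0) (htop : ∀ i, w (e i) ≠ ⊤) {s : Set α} {i : ι}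
    (hi : e i ∈ s) (h0 : w (e i) ≠ 0) :
    IsProbabilityMeasure (ProbabilityTheory.cond (gibbs w) s) := by
  have := Fintype.ofFinite ι
  have hsum : ∑' i, w (e i) ≠ ⊤ := by
    rw [tsum_fintype]; exact ENNReal.sum_ne_top.2 fun i _ => htop i
  have hle : w (e i) ≤ ∑' i, w (e i) := ENNReal.le_tsum i
  have hsum0 : ∑' i, w (e i) ≠ 0 := fun h => h0 (nonpos_iff_eq_zero.1 (h ▸ hle))
  refine cond_isProbabilityMeasure_of_finite ?_ ?_
  · intro hz
    have hz' := measure_mono_null (Set.singleton_subset_iff.2 hi) hz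
    rw [gibbs_of_range he hw, Measure.smul_apply, smul_eq_mul, mul_eq_zero,
      Measure.sum_apply _ (measurableSet_singleton _), ENNReal.tsum_eq_zero] at hz'
    rcases hz' with h | h
    · exact ENNReal.inv_ne_zero.2 hsum h
    · have := h i
      simp [h0] at this
  · refine ne_top_of_le_ne_top ?_ (measure_mono (Set.subset_univ s))
    rw [gibbs_of_range he hw, Measure.smul_apply, Measure.sum_apply _ MeasurableSet.univ]
    simp only [Measure.smul_apply, measure_univ, smul_eq_mul, mul_one]
    exact ENNReal.mul_ne_top (ENNReal.inv_ne_top.2 hsum0) hsum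

/-- Allows all normalising constants to be left unspecified up to the final comparison of laws. -/
theorem eq_of_proportional {α : Type*} [MeasurableSpace α] {μ μ₁ μ₂ : Measure α}
    [IsProbabilityMeasure μ₁] [IsProbabilityMeasure μ₂] {a b : ℝ≥0∞} (h₁ : μ₁ = a • μ)
    (h₂ : μ₂ = b • μ) : μ₁ = μ₂ := by
  have e1 : a * μ Set.univ = 1 := by
    rw [← measure_univ (μ := μ₁), h₁]; rfl
  have e2 : b * μ Set.univ = 1 := by
    rw [← measure_univ (μ := μ₂), h₂]; rfl
  rw [h₁, h₂, ENNReal.eq_inv_of_mul_eq_one_left e1, ENNReal.eq_inv_of_mul_eq_one_left e2]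

/-! ### The law of the configuration -/

theorem fkWeight_eq_zero {n m : ℕ} (p q : ℝ) {ω : Config} (h : ¬ Dob n m ω) :
    fkWeight n m p q ω = 0 := by
  rw [fkWeight, if_neg]
  exact fun h' => h fun t ht => (h' t ht).trans (xi_iff t)

/-- At the self-dual point p/(1-p) = √q, and q = √q², so edges and clusters are counted in powers of
the same number. -/
theorem fkWeight_eq {n m : ℕ} {q : ℝ} (hq : 0 < q) {ω : Config} (h : Dob n m ω) :
    fkWeight n m (pc q) q ω = ENNReal.ofReal ((1 / (1 + √q)) ^ (E n m).ncard *
      √q ^ (2 * kappaV n m ω + {t ∈ E n m | ω t = true}.ncard)) := by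
  rw [fkWeight, if_pos fun t ht => (h t ht).trans (xi_iff t).symm]
  congr 1
  have hs : 0 < √q := Real.sqrt_pos.2 hq
  have hcard : (E n m).ncard = {t ∈ E n m | ω t = true}.ncard + {t ∈ E n m | ω t = false}.ncard := by
    rw [← Set.ncard_union_eq _ ((finite_E n m).subset fun t ht => ht.1)
      ((finite_E n m).subset fun t ht => ht.1)]
    · congr 1
      ext t
      cases hb : ω t <;> simp [hb]
    · rw [Set.disjoint_left]
      rintro t ⟨-, h1⟩ ⟨-, h2⟩
      rw [h1] at h2; simp at h2
  have h1 : 1 - pc q = 1 / (1 + √q) := by rw [pc]; field_simp; ring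
  have h2 : pc q = √q * (1 / (1 + √q)) := by rw [pc]; ring
  have h3 : q = √q ^ 2 := (Real.sq_sqrt hq.le).symm
  rw [h1, h2, hcard, mul_pow]
  nth_rw 4 [h3]
  ring

theorem fkWeight_ne_zero {n m : ℕ} {q : ℝ} (hq : 0 < q) {ω : Config} (h : Dob n m ω) :
    fkWeight n m (pc q) q ω ≠ 0 := by
  rw [fkWeight_eq hq h, Ne, ENNReal.ofReal_eq_zero, not_le]
  have hs : 0 < √q := Real.sqrt_pos.2 hq
  positivity

/-- Converse of `Dob.exists_base`: an open path between the two arcs would force equal spins on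
both. -/
theorem Comp.notCrossed {n m : ℕ} {ω : Config} {σ : Spins} (h : Comp n m ω σ) :
    ω ∈ NotCrossed n m := by
  intro i hi j hj hiu hju hr
  have h1 : σ.1 i = σ.1 j := reachable_induction (P := fun j => σ.1 i = σ.1 j) hr rfl
    fun y z hyz hy => by
      obtain ⟨-, t, ht, h1, h2⟩ := exists_tile_of_adj.1 hyz
      exact hy.trans (h.2.1 t ht y h1 z h2)
  rw [h.1.1 i hi.1, h.1.1 j hj.1, bs_eq_iff] at h1
  exact hju (h1.1 hiu)

/-- Closing all of E separates the half planes; this gives the conditioning event positive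
probability. -/
theorem exists_notCrossed (n m : ℕ) : ∃ ω, Dob n m ω ∧ ω ∈ NotCrossed n m := by
  classical
  refine ⟨fun t => decide (t ∉ E n m ∧ t.1.2 ≠ -1), fun t ht => by simp [ht], ?_⟩
  intro i _ j _ hiu hju hr
  refine hju (reachable_induction (P := fun j => Upper j.1) hr hiu fun y z hyz hy => ?_)
  obtain ⟨-, t, ht, h1, h2⟩ := exists_tile_of_adj.1 hyz
  have h3 : t.1.2 ≠ -1 := by
    simp only [openEdges, Set.mem_ofPred_eq, decide_eq_true_eq] at ht
    exact ht.2
  rw [mem_edgeEnds, isCorner_iff] at h1 h2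
  have := y.mod; have := z.mod
  unfold Upper at hy ⊢
  omega

theorem dob_range (n m : ℕ) (p q : ℝ) (ω : Config)
    (h : ω ∉ Set.range (Subtype.val : DobConfig n m → Config)) : fkWeight n m p q ω = 0 :=
  fkWeight_eq_zero p q fun h' => h ⟨⟨ω, h'⟩, rfl⟩

instance : Countable Tile := Subtype.countable

/-- The law of the uniform random variables. -/
def uniforms : Measure ((Loop → unitInterval) × (Tile → unitInterval)) :=
  (Measure.infinitePi fun _ : Loop => (volume : Measure unitInterval)).prod
    (Measure.infinitePi fun _ : Tile => (volume : Measure unitInterval))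

theorem isProbabilityMeasure_coupling {n m : ℕ} {q : ℝ} (hq : 0 < q) :
    IsProbabilityMeasure (coupling n m q) := by
  obtain ⟨ω, hω, hnc⟩ := exists_notCrossed n m
  have : IsProbabilityMeasure (ProbabilityTheory.cond (fk n m (pc q) q) (NotCrossed n m)) := by
    refine isProbabilityMeasure_cond_gibbs (e := (Subtype.val : DobConfig n m → Config))
      Subtype.val_injective (dob_range n m _ _) (fun ω => ?_) (i := ⟨ω, hω⟩) hnc
      (fkWeight_ne_zero hq hω)
    rw [fkWeight_eq hq ω.2]; exact ENNReal.ofReal_ne_top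
  unfold coupling; infer_instance

/-- The coupling is a finite mixture over the configurations with the right boundary condition, so
measurability and probabilities are treated for each fixed ω. -/
theorem coupling_eq (n m : ℕ) (q : ℝ) : ∃ c : ℝ≥0∞, coupling n m q =
    c • Measure.sum fun ω : DobConfig n m => (NotCrossed n m).indicator (fkWeight n m (pc q) q) ω.1 •
      Measure.map (Prod.mk ω.1) uniforms := by
  obtain ⟨c, hc⟩ := cond_gibbs_of_range (e := (Subtype.val : DobConfig n m → Config))
    Subtype.val_injective (dob_range n m (pc q) q) (NotCrossed n m)
  refine ⟨c, ?_⟩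
  rw [coupling, fk, hc, Measure.prod_smul_left, Measure.prod_sum_left]
  congr 2
  funext ω
  rw [Measure.prod_smul_left, Measure.dirac_prod]
  rfl

theorem coupling_ae (n m : ℕ) (q : ℝ) : ∀ᵐ x ∂coupling n m q, Dob n m x.1 ∧ x.1 ∈ NotCrossed n m := by
  obtain ⟨c, hc⟩ := coupling_eq n m q
  rw [ae_iff, hc, Measure.smul_apply, Measure.sum_apply_of_countable, ENNReal.tsum_eq_zero.2, smul_zero]
  intro ω
  by_cases h : ω.1 ∈ NotCrossed n m
  · rw [Measure.smul_apply, (measurableEmbedding_prodMk_left ω.1).map_apply]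
    have : Prod.mk ω.1 ⁻¹' {x : CouplingSpace | ¬ (Dob n m x.1 ∧ x.1 ∈ NotCrossed n m)} = ∅ := by
      ext y; simp [ω.2, h]
    rw [this, measure_empty, smul_zero]
  · rw [Set.indicator_of_notMem h, zero_smul]; rfl


/-! ### The law of the sample -/

theorem sampleATRC_eq_iff {n m : ℕ} {lam : ℝ} {σ : Spins} {U' : Tile → unitInterval}
    {w : BoxConfig n m × BoxConfig n m} : sampleATRC n m lam σ U' = w ↔
      ∀ t ∈ bulkTiles n m ∪ bdryTiles n m, localRule n m lam σ t (U' t) = stateAt w t := by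
  have hst : ∀ t (h : t ∈ Ebar n m), stateAt w t = (w.1 ⟨t, h⟩, w.2 ⟨t, h⟩) := by
    intro t h
    simp only [stateAt, openSet, Set.mem_ofPred_eq, h, exists_true_left, Bool.decide_eq_true]
  have hmem : ∀ t, t ∈ bulkTiles n m ∪ bdryTiles n m ↔ t ∈ Ebar n m := fun t => by
    rw [Finset.mem_union, mem_bulkTiles, mem_bdryTiles]; rfl
  constructor
  · rintro rfl t ht
    rw [hst t ((hmem t).1 ht)]; rfl
  · intro h
    refine Prod.ext (funext fun t => ?_) (funext fun t => ?_)
    · have := h t.1 ((hmem _).2 t.2)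
      rw [hst t.1 t.2] at this
      exact congrArg Prod.fst this
    · have := h t.1 ((hmem _).2 t.2)
      rw [hst t.1 t.2] at this
      exact congrArg Prod.snd this

/-- For given spins the event is a cylinder set over the finitely many tiles of the box. -/
theorem sample_event {n m : ℕ} (lam : ℝ) (σ : Spins) (w : BoxConfig n m × BoxConfig n m) :
    {U' | sampleATRC n m lam σ U' = w} = Set.pi (bulkTiles n m ∪ bdryTiles n m : Finset Tile)
      fun t => {x | localRule n m lam σ t x = stateAt w t} := by
  ext U'
  exact sampleATRC_eq_iff

theorem measurableSet_sample {n m : ℕ} (lam : ℝ) (σ : Spins) (w : BoxConfig n m × BoxConfig n m) :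
    MeasurableSet {U' | sampleATRC n m lam σ U' = w} := by
  rw [sample_event]
  exact MeasurableSet.pi (Finset.countable_toSet _) fun t _ => measurableSet_localRule n m lam σ t _

/-- The law of the sample for given spins. -/
theorem measure_sample {n m : ℕ} {lam : ℝ} (hlam : 0 < lam) (σ : Spins)
    (w : BoxConfig n m × BoxConfig n m) :
    (Measure.infinitePi fun _ : Tile => (volume : Measure unitInterval))
      {U' | sampleATRC n m lam σ U' = w} = ENNReal.ofReal (sampleProb lam σ w) := by
  rw [sample_event, Measure.infinitePi_pi _ fun t _ => measurableSet_localRule n m lam σ t _,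
    Finset.prod_congr rfl fun t _ => volume_localRule hlam σ t _,
    ← ENNReal.ofReal_prod_of_nonneg fun t _ => ruleProb_nonneg hlam n m σ t _,
    Finset.prod_union (disjoint_tiles n m), sampleProb]

theorem sampleProb_nonneg {n m : ℕ} {lam : ℝ} (hlam : 0 < lam) (σ : Spins)
    (w : BoxConfig n m × BoxConfig n m) : 0 ≤ sampleProb lam σ w :=
  mul_nonneg (Finset.prod_nonneg fun t _ => ruleProb_nonneg hlam n m σ t _)
    (Finset.prod_nonneg fun t _ => ruleProb_nonneg hlam n m σ t _)

/-- The inner loops as a finite set of loops. -/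
def innerLoops {n m : ℕ} (ω : DobConfig n m) : Finset Loop :=
  (ω.2.finite_inner.preimage (f := (Subtype.val : Loop → Set Arc))
    Subtype.val_injective.injOn).toFinset

theorem mem_innerLoops {n m : ℕ} {ω : DobConfig n m} {l : Loop} :
    l ∈ innerLoops ω ↔ InnerLoop n m ω.1 l.1 := by
  rw [innerLoops, Set.Finite.mem_toFinset]; rfl

theorem map_innerLoops {n m : ℕ} (ω : DobConfig n m) :
    ((innerLoops ω).map ⟨Subtype.val, Subtype.val_injective⟩ : Finset (Set Arc)) =
      ω.2.finite_inner.toFinset := by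
  ext l
  rw [Finset.mem_map, Set.Finite.mem_toFinset]
  constructor
  · rintro ⟨l, hl, rfl⟩; exact mem_innerLoops.1 hl
  · intro hl; exact ⟨⟨l, ω.1, hl.1⟩, mem_innerLoops.2 hl, rfl⟩

open Classical in
/-- The orientations of the inner loops are those given by the spins. -/
def loopEvent {n m : ℕ} (q lam : ℝ) (ω : DobConfig n m) (σ : Spins) : Set (Loop → unitInterval) :=
  Set.pi (innerLoops ω) fun l => {x | (x : ℝ) < Real.exp lam / √q ↔ CwSpins σ l.1}

theorem measurableSet_loopFactor (a : ℝ) (p : Prop) :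
    MeasurableSet {x : unitInterval | (x : ℝ) < a ↔ p} := by
  have h : MeasurableSet {x : unitInterval | (x : ℝ) < a} :=
    measurableSet_lt measurable_subtype_coe measurable_const
  by_cases hp : p
  · simpa [hp] using h
  · simp only [hp, iff_false]; exact h.compl

theorem measurableSet_loopEvent {n m : ℕ} (q lam : ℝ) (ω : DobConfig n m) (σ : Spins) :
    MeasurableSet (loopEvent q lam ω σ) :=
  MeasurableSet.pi (Finset.countable_toSet _) fun _ _ => measurableSet_loopFactor _ _

/-- The contribution of the surroundings to the sum of the turns. -/
def fringeTurn (n m : ℕ) : ℤ := ∑ᶠ a ∈ fringe n m, turn outSpins a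

/-- The probability of the orientations of the inner loops. -/
theorem measure_loopEvent {n m : ℕ} {q lam : ℝ}
    (hqlam : √q = Real.exp lam + Real.exp (-lam)) (ω : DobConfig n m) {σ : Spins}
    (hσ : Comp n m ω.1 σ) :
    (Measure.infinitePi fun _ : Loop => (volume : Measure unitInterval)) (loopEvent q lam ω σ) =
      ENNReal.ofReal (Real.exp (lam / 4 * (∑ᶠ a ∈ boxArcs n m ω.1, turn σ a : ℤ)) *
        (Real.exp (lam / 4 * (fringeTurn n m : ℤ)) / √q ^ {l | InnerLoop n m ω.1 l}.ncard)) := by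
  classical
  have e1 := Real.exp_pos lam
  have e2 := Real.exp_pos (-lam)
  have hs : 0 < √q := by rw [hqlam]; positivity
  have hp : Real.exp lam / √q ≤ 1 := by rw [div_le_one hs, hqlam]; linarith
  have hfac : ∀ l : Loop, volume {x : unitInterval | (x : ℝ) < Real.exp lam / √q ↔ CwSpins σ l.1} =
      ENNReal.ofReal (Real.exp (lam / 4 * ((if CwSpins σ l.1 then 4 else -4 : ℤ) : ℝ)) / √q) := by
    intro l
    by_cases h : CwSpins σ l.1
    · simp only [h, iff_true, if_true]
      rw [volume_setOf_lt (by positivity) hp]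
      congr 3; push_cast; ring
    · simp only [h, iff_false, if_false]
      rw [volume_setOf_ge (by positivity) hp]
      congr 1
      -- The complementary probability is 1 - e^λ/√q = e^{-λ}/√q; this is where the relation between
      -- q and λ enters.
      rw [show lam / 4 * ((-4 : ℤ) : ℝ) = -lam by push_cast; ring, eq_div_iff hs.ne', sub_mul,
        div_mul_cancel₀ _ hs.ne', hqlam]
      ring
  rw [loopEvent, Measure.infinitePi_pi _ fun _ _ => measurableSet_loopFactor _ _,
    Finset.prod_congr rfl fun l _ => hfac l,
    ← ENNReal.ofReal_prod_of_nonneg fun l _ => by positivity]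
  congr 1
  rw [Finset.prod_div_distrib, Finset.prod_const, ← Real.exp_sum, ← Finset.mul_sum, ← mul_div_assoc,
    ← Real.exp_add, ← mul_add, ← Int.cast_add, fringeTurn, ω.2.sum_turn hσ]
  have hcard : (innerLoops ω).card = {l | InnerLoop n m ω.1 l}.ncard := by
    rw [Set.ncard_eq_toFinset_card _ ω.2.finite_inner, ← map_innerLoops, Finset.card_map]
  have hsum : ∑ l ∈ innerLoops ω, (((if CwSpins σ l.1 then 4 else -4 : ℤ) : ℤ) : ℝ) =
      ((∑ᶠ l ∈ {l | InnerLoop n m ω.1 l}, (if CwSpins σ l then 4 else -4 : ℤ) : ℤ) : ℝ) := by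
    rw [finsum_mem_eq_finite_toFinset_sum _ ω.2.finite_inner, ← map_innerLoops, Finset.sum_map]
    push_cast
    rfl
  rw [hcard, hsum]

/-- The map from `(ω, U, U')` to the pair of configurations. -/
def sampleMap (n m : ℕ) (q lam : ℝ) (x : CouplingSpace) : BoxConfig n m × BoxConfig n m :=
  sampleATRC n m lam (bkwSpins n m q lam x.1 x.2.1) x.2.2

theorem Dob.bkwSpins_eq {n m : ℕ} {ω : Config} (hω : Dob n m ω) (hnc : ω ∈ NotCrossed n m)
    {q lam : ℝ} {U : Loop → unitInterval} :
    IsBKWSpins n m q lam ω U (BKW.bkwSpins n m q lam ω U) ∧ Comp n m ω (BKW.bkwSpins n m q lam ω U) ∧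
      ∃! σ, IsBKWSpins n m q lam ω U σ := by
  obtain ⟨σ, h1, -, h3⟩ := hω.bkwSpins hnc q lam U
  have h4 : IsBKWSpins n m q lam ω U (BKW.bkwSpins n m q lam ω U) :=
    Classical.epsilon_spec ⟨σ, (h3 σ).2 rfl⟩
  exact ⟨h4, by rw [(h3 _).1 h4]; exact h1, σ, (h3 σ).2 rfl, fun τ hτ => (h3 τ).1 hτ⟩

/-- Compatible spins are determined by the orientations of the inner loops, so the event only
constrains the variables of finitely many loops. -/
theorem bkwSpins_eq_iff {n m : ℕ} {q lam : ℝ} (ω : DobConfig n m) {σ : Spins} (hσ : Comp n m ω.1 σ)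
    (U : Loop → unitInterval) : bkwSpins n m q lam ω.1 U = σ ↔ U ∈ loopEvent q lam ω σ := by
  obtain ⟨τ, h1, h2, h3⟩ := ω.2.bkwSpins hσ.notCrossed q lam U
  have h4 := (h3 _).1 (ω.2.bkwSpins_eq hσ.notCrossed (q := q) (lam := lam) (U := U)).1
  rw [h4]
  constructor
  · rintro rfl l hl
    exact h2 l.1 (mem_innerLoops.1 hl)
  · intro hU
    refine ω.2.comp_ext h1 hσ fun l hl => ?_
    rw [← h2 l hl]
    exact hU ⟨l, ω.1, hl.1⟩ (mem_innerLoops.2 hl)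

open Classical in
-- A finite union of rectangles indexed by the compatible spins; measurability of the sample, whose
-- spins are defined by choice, is read off from it.
theorem sampleMap_event {n m : ℕ} (q lam : ℝ) (ω : DobConfig n m) (hnc : ω.1 ∈ NotCrossed n m)
    (w : BoxConfig n m × BoxConfig n m) :
    {y | sampleMap n m q lam (ω.1, y) = w} = ⋃ σ ∈ (Finset.univ.filter fun σ : BoxSpins n m =>
      Comp n m ω.1 σ.1), loopEvent q lam ω σ.1 ×ˢ {U' | sampleATRC n m lam σ.1 U' = w} := by
  ext y
  simp only [Set.mem_ofPred_eq, Set.mem_iUnion, Finset.mem_filter, Finset.mem_univ, true_and,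
    Set.mem_prod, exists_prop]
  constructor
  · intro h
    have hc := (ω.2.bkwSpins_eq hnc (q := q) (lam := lam) (U := y.1)).2.1
    exact ⟨⟨_, hc.1⟩, hc, (bkwSpins_eq_iff ω hc y.1).1 rfl, h⟩
  · rintro ⟨σ, hc, h1, h2⟩
    rw [sampleMap, (bkwSpins_eq_iff ω hc y.1).2 h1]
    exact h2

theorem measurable_sampleMap {n m : ℕ} (q lam : ℝ) (ω : DobConfig n m) (hnc : ω.1 ∈ NotCrossed n m) :
    Measurable fun y => sampleMap n m q lam (ω.1, y) := by
  classical
  refine measurable_to_countable' fun w => ?_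
  have := sampleMap_event q lam ω hnc w
  change MeasurableSet {y | sampleMap n m q lam (ω.1, y) = w}
  rw [this]
  exact Finset.measurableSet_biUnion _ fun σ _ =>
    (measurableSet_loopEvent q lam ω σ.1).prod (measurableSet_sample lam σ.1 w)

open Classical in
theorem measure_sampleMap {n m : ℕ} {q lam : ℝ} (hlam : 0 < lam)
    (hqlam : √q = Real.exp lam + Real.exp (-lam)) (ω : DobConfig n m)
    (hnc : ω.1 ∈ NotCrossed n m) (w : BoxConfig n m × BoxConfig n m) :
    uniforms {y | sampleMap n m q lam (ω.1, y) = w} =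
      ENNReal.ofReal (∑ σ : BoxSpins n m, (if Comp n m ω.1 σ.1 then
        Real.exp (lam / 4 * (∑ᶠ a ∈ boxArcs n m ω.1, turn σ.1 a : ℤ)) else 0) *
        sampleProb lam σ.1 w *
        (Real.exp (lam / 4 * (fringeTurn n m : ℤ)) / √q ^ {l | InnerLoop n m ω.1 l}.ncard)) := by
  rw [sampleMap_event q lam ω hnc w, measure_biUnion_finset, Finset.sum_filter,
    ENNReal.ofReal_sum_of_nonneg]
  · refine Finset.sum_congr rfl fun σ _ => ?_
    by_cases h : Comp n m ω.1 σ.1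
    · rw [if_pos h, if_pos h, uniforms, Measure.prod_prod, measure_loopEvent hqlam ω h,
        measure_sample hlam, ← ENNReal.ofReal_mul (by positivity)]
      congr 1; ring
    · rw [if_neg h, if_neg h]; simp
  · intro σ _
    have := sampleProb_nonneg hlam σ.1 w
    split_ifs <;> positivity
  · intro σ hσ τ hτ hne
    rw [Function.onFun, Set.disjoint_left]
    rintro y ⟨h1, -⟩ ⟨h2, -⟩
    have hσ' := (Finset.mem_filter.1 (Finset.mem_coe.1 hσ)).2
    have hτ' := (Finset.mem_filter.1 (Finset.mem_coe.1 hτ)).2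
    exact hne (Subtype.ext (((bkwSpins_eq_iff ω hσ' y.1).2 h1).symm.trans
      ((bkwSpins_eq_iff ω hτ' y.1).2 h2)))
  · exact fun σ _ => (measurableSet_loopEvent q lam ω σ.1).prod (measurableSet_sample lam σ.1 w)

/-- The normalisation of the joint weight. -/
def jointConst (n m : ℕ) (q lam : ℝ) : ℝ := (1 / (1 + √q)) ^ (E n m).ncard *
  (√q ^ ((Vbar n m).ncard + 2) / √q ^ (frame n m).ncard) * Real.exp (lam / 4 * (fringeTurn n m : ℤ))

open Classical in
-- By `Dob.kappaV_eq` the FK weight contains one √q per inner loop, and these cancel the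
-- denominators of the orientation probabilities.
theorem fkWeight_mul_measure {n m : ℕ} {q lam : ℝ} (hlam : 0 < lam)
    (hqlam : √q = Real.exp lam + Real.exp (-lam)) (ω : DobConfig n m)
    (w : BoxConfig n m × BoxConfig n m) :
    (NotCrossed n m).indicator (fkWeight n m (pc q) q) ω.1 *
        uniforms {y | sampleMap n m q lam (ω.1, y) = w} =
      ENNReal.ofReal (jointConst n m q lam * ∑ σ : BoxSpins n m, (if Comp n m ω.1 σ.1 then
        Real.exp (lam / 4 * (∑ᶠ a ∈ boxArcs n m ω.1, turn σ.1 a : ℤ)) else 0) *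
        sampleProb lam σ.1 w) := by
  have hs : 0 < √q := by rw [hqlam]; positivity
  have hq : 0 < q := Real.sqrt_pos.1 hs
  by_cases hnc : ω.1 ∈ NotCrossed n m
  · rw [Set.indicator_of_mem hnc, fkWeight_eq hq ω.2, measure_sampleMap hlam hqlam ω hnc,
      ← ENNReal.ofReal_mul (by positivity), ← Finset.sum_mul]
    congr 1
    obtain ⟨σ₀, h₀⟩ := ω.2.exists_base hnc
    have h := ω.2.kappaV_eq h₀
    have h' : √q ^ (2 * kappaV n m ω.1 + {t ∈ E n m | ω.1 t = true}.ncard) * √q ^ (frame n m).ncard =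
        √q ^ {l | InnerLoop n m ω.1 l}.ncard * √q ^ ((Vbar n m).ncard + 2) := by
      rw [← pow_add, ← pow_add, h, add_assoc]
    rw [← eq_div_iff (by positivity)] at h'
    rw [h', jointConst]
    field_simp
  · rw [Set.indicator_of_notMem hnc, zero_mul, eq_comm, ENNReal.ofReal_eq_zero]
    refine le_of_eq (mul_eq_zero_of_right _ (Finset.sum_eq_zero fun σ _ => ?_))
    rw [if_neg fun h : Comp n m ω.1 σ.1 => hnc h.notCrossed, zero_mul]

theorem aemeasurable_sampleMap (n m : ℕ) (q lam : ℝ) :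
    AEMeasurable (sampleMap n m q lam) (coupling n m q) := by
  obtain ⟨c, hc⟩ := coupling_eq n m q
  rw [hc]
  refine AEMeasurable.smul_measure (AEMeasurable.sum_measure fun ω => ?_) c
  by_cases hnc : ω.1 ∈ NotCrossed n m
  · refine AEMeasurable.smul_measure ?_ _
    rw [(measurableEmbedding_prodMk_left ω.1).aemeasurable_map_iff]
    exact (measurable_sampleMap q lam ω hnc).aemeasurable
  · rw [Set.indicator_of_notMem hnc, zero_smul]
    exact aemeasurable_zero_measure

/-- The measure that is proportional to the law of the sample. -/
def sampleMeasure (n m : ℕ) (lam : ℝ) : Measure (BoxConfig n m × BoxConfig n m) :=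
  Measure.sum fun w => ENNReal.ofReal (stateWeight lam w *
    (Nat.card (SpinsP n m (openSet w.2)) * Nat.card (SpinsD n m (closedSet w.1)))) • Measure.dirac w

/-- At a single pair of configurations the probability is the joint weight summed over ω and the
spins, which `sum_joint_weight` evaluates. -/
theorem map_sampleMap {n m : ℕ} {q lam : ℝ} (hlam : 0 < lam)
    (hqlam : √q = Real.exp lam + Real.exp (-lam)) :
    ∃ c : ℝ≥0∞, Measure.map (sampleMap n m q lam) (coupling n m q) = c • sampleMeasure n m lam := by
  classical
  obtain ⟨c, hc⟩ := coupling_eq n m q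
  have hs : 0 < √q := by rw [hqlam]; positivity
  have hb := cBdry_gt hlam
  have hK : 0 ≤ jointConst n m q lam := by unfold jointConst; positivity
  have hK' : 0 ≤ ∏ t ∈ bdryTiles n m, bdryConst lam t := by
    refine Finset.prod_nonneg fun t _ => ?_
    have : 0 ≤ cBdry lam - 1 := by linarith
    unfold bdryConst
    split_ifs <;> positivity
  refine ⟨c * (ENNReal.ofReal (jointConst n m q lam) *
    ENNReal.ofReal (∏ t ∈ bdryTiles n m, bdryConst lam t)), ?_⟩
  refine Measure.ext_of_singleton fun w => ?_
  rw [Measure.map_apply_of_aemeasurable (aemeasurable_sampleMap n m q lam) (measurableSet_singleton w),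
    Measure.smul_apply, sampleMeasure, Measure.sum_smul_dirac_singleton]
  nth_rw 1 [hc]
  rw [Measure.smul_apply, Measure.sum_apply_of_countable, tsum_fintype, smul_eq_mul, smul_eq_mul,
    mul_assoc]
  congr 1
  have h1 : ∀ ω : DobConfig n m, ((NotCrossed n m).indicator (fkWeight n m (pc q) q) ω.1 •
      Measure.map (Prod.mk ω.1) uniforms) (sampleMap n m q lam ⁻¹' {w}) =
      ENNReal.ofReal (jointConst n m q lam * ∑ σ : BoxSpins n m, (if Comp n m ω.1 σ.1 then
        Real.exp (lam / 4 * (∑ᶠ a ∈ boxArcs n m ω.1, turn σ.1 a : ℤ)) else 0) *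
        sampleProb lam σ.1 w) := by
    intro ω
    rw [Measure.smul_apply, (measurableEmbedding_prodMk_left ω.1).map_apply, smul_eq_mul]
    exact fkWeight_mul_measure hlam hqlam ω w
  rw [Finset.sum_congr rfl fun ω _ => h1 ω, ← ENNReal.ofReal_sum_of_nonneg, ← Finset.mul_sum,
    sum_joint_weight hlam, ENNReal.ofReal_mul hK, ENNReal.ofReal_mul hK', mul_assoc]
  intro ω _
  refine mul_nonneg hK (Finset.sum_nonneg fun σ _ => mul_nonneg ?_ (sampleProb_nonneg hlam _ _))
  split_ifs <;> positivity

theorem cond_mATRC {n m : ℕ} {lam : ℝ} (hlam : 0 < lam) :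
    ∃ c : ℝ≥0∞, ProbabilityTheory.cond (mATRC n m lam) (Crossings n m) = c • sampleMeasure n m lam := by
  obtain ⟨c, hc⟩ := cond_gibbs_of_range (e := (id : BoxConfig n m × BoxConfig n m → _))
    Function.injective_id (w := mATRCWeight n m lam) (fun a h => absurd ⟨a, rfl⟩ h) (Crossings n m)
  have hb : 0 < cBdry lam - 1 := by linarith [cBdry_gt hlam]
  have hK : 0 ≤ atrcConst n m lam := by unfold atrcConst; positivity
  refine ⟨c * ENNReal.ofReal (atrcConst n m lam), ?_⟩
  rw [mATRC, hc, mul_smul]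
  congr 1
  refine Measure.ext_of_singleton fun w => ?_
  simp only [id]
  rw [Measure.smul_apply, sampleMeasure, Measure.sum_smul_dirac_singleton,
    Measure.sum_smul_dirac_singleton, indicator_mATRCWeight hlam, ENNReal.ofReal_mul hK, smul_eq_mul]

/-- Both laws are multiples of `sampleMeasure`, so only their total masses have to be compared. -/
theorem hasLaw_sampleMap {n m : ℕ} {q lam : ℝ} (hlam : 0 < lam)
    (hqlam : √q = Real.exp lam + Real.exp (-lam)) :
    HasLaw (sampleMap n m q lam) (ProbabilityTheory.cond (mATRC n m lam) (Crossings n m))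
      (coupling n m q) := by
  have hs : 0 < √q := by rw [hqlam]; positivity
  have := isProbabilityMeasure_coupling (n := n) (m := m) (Real.sqrt_pos.1 hs)
  have hmeas := aemeasurable_sampleMap n m q lam
  have hprob := Measure.isProbabilityMeasure_map hmeas
  obtain ⟨c, hc⟩ := map_sampleMap (n := n) (m := m) hlam hqlam
  obtain ⟨c', hc'⟩ := cond_mATRC (n := n) (m := m) hlam
  refine ⟨hmeas, ?_⟩
  -- Positivity of the crossing event is not shown directly: the law of the sample has mass 1, so
  -- the common measure charges some `w`, and that `w` lies in the event with positive weight.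
  have hne : ∃ w, sampleMeasure n m lam {w} ≠ 0 := by
    by_contra! h
    have h0 : sampleMeasure n m lam = 0 := Measure.ext_of_singleton fun w => by rw [h w]; rfl
    rw [h0, smul_zero] at hc
    have := measure_univ (μ := Measure.map (sampleMap n m q lam) (coupling n m q))
    rw [hc] at this
    simp at this
  obtain ⟨w, hw⟩ := hne
  have hb : 0 < cBdry lam - 1 := by linarith [cBdry_gt hlam]
  have hK : 0 < atrcConst n m lam := by unfold atrcConst; positivity
  have hind : (Crossings n m).indicator (mATRCWeight n m lam) w ≠ 0 := by
    rw [indicator_mATRCWeight hlam, ENNReal.ofReal_mul hK.le]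
    refine mul_ne_zero ?_ ?_
    · rw [Ne, ENNReal.ofReal_eq_zero, not_le]; exact hK
    · rwa [sampleMeasure, Measure.sum_smul_dirac_singleton] at hw
  have hC : w ∈ Crossings n m := by
    by_contra h; exact hind (Set.indicator_of_notMem h _)
  rw [Set.indicator_of_mem hC] at hind
  have : IsProbabilityMeasure (ProbabilityTheory.cond (mATRC n m lam) (Crossings n m)) := by
    refine isProbabilityMeasure_cond_gibbs (e := (id : BoxConfig n m × BoxConfig n m → _))
      Function.injective_id (fun a h => absurd ⟨a, rfl⟩ h) (fun v => ?_) hC hind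
    rw [id, mATRCWeight]
    split_ifs
    · exact ENNReal.ofReal_ne_top
    · exact ENNReal.zero_ne_top
  exact eq_of_proportional hc hc'

/-- The deterministic properties of the sample. -/
theorem sample_properties (n m : ℕ) (lam : ℝ) {ω : Config} {σ : Spins}
    (hσ : Comp n m ω σ) (U' : Tile → unitInterval) {w : BoxConfig n m × BoxConfig n m}
    (hw : w = sampleATRC n m lam σ U') : openSet w.1 ⊆ openSet w.2 ∧
      openSet w.2 \ openSet w.1 ⊆ E n m ∧ AgreePrimal σ.1 (openSet w.2) ∧
      AgreeDual σ.2 (closedSet w.1) := by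
  -- Compatibility with one common configuration excludes that both pairs of spins of a tile
  -- disagree. Without it, the state (1,1) forced by differing dual spins might violate the primal
  -- condition.
  have hAB : ∀ t, AgreePrimal σ.1 {t} ∨ AgreeDual σ.2 {t} := by
    intro t
    cases hb : ω t
    · right; intro s hs; rw [hs]; exact hσ.2.2 t hb
    · left; intro s hs; rw [hs]; exact hσ.2.1 t hb
  have hv : ∀ t (h : t ∈ Ebar n m), (w.1 ⟨t, h⟩, w.2 ⟨t, h⟩) = localRule n m lam σ t (U' t) := by
    intro t h; rw [hw]; rfl
  have key : ∀ t x, ((localRule n m lam σ t x).1 = true → (localRule n m lam σ t x).2 = true) ∧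
      ((localRule n m lam σ t x).2 = true → (localRule n m lam σ t x).1 ≠ true → t ∈ E n m) ∧
      ((localRule n m lam σ t x).2 = true → AgreePrimal σ.1 {t}) ∧
      ((localRule n m lam σ t x).1 = false → AgreeDual σ.2 {t}) := by
    intro t x
    have := hAB t
    rw [localRule, innerA_eq]
    split_ifs <;> simp_all
  refine ⟨?_, ?_, ?_, ?_⟩
  · rintro t ⟨h, h1⟩
    have := (key t (U' t)).1
    rw [← hv t h] at this
    exact ⟨h, this h1⟩
  · rintro t ⟨⟨h, h1⟩, h2⟩
    have := (key t (U' t)).2.1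
    rw [← hv t h] at this
    exact this h1 fun h3 => h2 ⟨h, h3⟩
  · rintro t ⟨h, h1⟩
    have := (key t (U' t)).2.2.1
    rw [← hv t h] at this
    exact this h1 t rfl
  · rintro t ⟨h, h1⟩
    have := (key t (U' t)).2.2.2
    rw [← hv t h] at this
    exact this h1 t rfl

end BKW

end

/-! ### Transfer from the canonical coupling space to an arbitrary probability space -/

theorem mainTheorem7 (n m : ℕ) (q lam : ℝ) (hq : 4 < q) (hlam : 0 < lam)
    (hqlam : Real.sqrt q = Real.exp lam + Real.exp (-lam))
    {Ω : Type*} [MeasurableSpace Ω] (P : Measure Ω)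
    (ω : Ω → BKW.Config) (U : Ω → BKW.Loop → unitInterval) (U' : Ω → BKW.Tile → unitInterval)
    (hlaw : HasLaw (fun x => (ω x, U x, U' x)) (BKW.coupling n m q) P)
    (σ : Ω → BKW.Spins) (hσ : ∀ x, σ x = BKW.bkwSpins n m q lam (ω x) (U x))
    (ωτ ωττ' : Ω → BKW.BoxConfig n m)
    (hω : ∀ x, (ωτ x, ωττ' x) = BKW.sampleATRC n m lam (σ x) (U' x)) :
    -- the six-vertex spins are almost surely well defined
    (∀ᵐ x ∂P, (∃! s, BKW.IsBKWSpins n m q lam (ω x) (U x) s) ∧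
      BKW.IsBKWSpins n m q lam (ω x) (U x) (σ x)) ∧
    -- the law of the pair is the conditioned modified ATRC measure
    HasLaw (fun x => (ωτ x, ωττ' x))
      (ProbabilityTheory.cond (BKW.mATRC n m lam) (BKW.Crossings n m)) P ∧
    -- consequences
    BKW.innerA n m = BKW.E n m ∧
    ∀ᵐ x ∂P, BKW.openSet (ωτ x) ⊆ BKW.openSet (ωττ' x) ∧
      BKW.openSet (ωττ' x) \ BKW.openSet (ωτ x) ⊆ BKW.E n m ∧
      BKW.AgreePrimal (σ x).1 (BKW.openSet (ωττ' x)) ∧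
      BKW.AgreeDual (σ x).2 (BKW.closedSet (ωτ x)) := by
  have hae := ae_of_ae_map hlaw.aemeasurable (hlaw.map_eq.symm ▸ BKW.coupling_ae n m q)
  refine ⟨?_, ?_, BKW.innerA_eq n m, ?_⟩
  · filter_upwards [hae] with x hx
    have h := hx.1.bkwSpins_eq hx.2 (q := q) (lam := lam) (U := U x)
    rw [hσ x]
    exact ⟨h.2.2, h.1⟩
  · have h := (BKW.hasLaw_sampleMap (n := n) (m := m) hlam hqlam).comp hlaw
    refine h.congr (Filter.Eventually.of_forall fun x => ?_)
    refine (hω x).trans ?_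
    rw [hσ x]
    rfl
  · filter_upwards [hae] with x hx
    have h := hx.1.bkwSpins_eq hx.2 (q := q) (lam := lam) (U := U x)
    exact BKW.sample_properties n m lam (hσ x ▸ h.2.1) (U' x) (hω x)
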